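/- Let $0<p<1$, $0<q<1$ with $q^2\notin\{p^m: m\in\mathbb{N}\}$. Let $M$ be the field of meromorphic functions on $\mathfrak{h}^*=\mathbb{C}$, $(T_\alpha f)(\lambda)=f(\lambda+\alpha)$, $\bar f(\lambda)=\overline{f(\bar\lambda)}$, and let $D$ be the algebra of difference operators $\sum_i f_iT_{\alpha_i}$ ($f_i\in M$), with $fT_{-\alpha}\in D_{\alpha\alpha}$, antipode $S^D(fT_\alpha)=T_{-\alpha}\circ f$ and $(fT_\alpha)^*=T_{-\bar\alpha}\circ\bar f$. Put $\theta(z)=\prod_{i\ge0}(1-zp^i)(1-p^{i+1}/z)$, $\theta(a_1,\dots,a_r)=\prod_i\theta(a_i)$, $F(\lambda)=q^\lambda\theta(q^{-2(\lambda+1)})$, $\omega(\pm1)=\pm1$, and let $R^{ab}_{xy}(\lambda,z)$ ($a,b,x,y\in\{1,-1\}$) be the elliptic $R$-matrix, whose non-zero entries are $R^{1,1}_{1,1}=R^{-1,-1}_{-1,-1}=1$ and $$R^{1,-1}_{1,-1}=\frac{\theta(z,q^{2(\lambda+2)})}{\theta(q^2z,q^{2(\lambda+1)})},\quad R^{-1,1}_{1,-1}=\frac{\theta(q^2,q^{-2(\lambda+1)}z)}{\theta(q^2z,q^{-2(\lambda+1)})},\quad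 R^{1,-1}_{-1,1}=\frac{\theta(q^2,q^{2(\lambda+1)}z)}{\theta(q^2z,q^{2(\lambda+1)})},\quad R^{-1,1}_{-1,1}=\frac{\theta(z,q^{-2\lambda})}{\theta(q^2z,q^{-2(\lambda+1)})}.$$ For a set $Z\subseteq\mathbb{C}\setminus\{0\}$ stable under $z\mapsto q^{\pm2}z$ and $z\mapsto1/\bar z$ let $\mathcal{E}_Z$ be the elliptic $U(2)$ dynamical quantum group with spectral parameters in $Z$: the unital complex algebra generated by two commuting copies $f(\lambda)=\mu_l(f)$, $f(\mu)=\mu_r(f)$ of $M$, by $\alpha(z)=L_{1,1}(z)$, $\beta(z)=L_{1,-1}(z)$, $\gamma(z)=L_{-1,1}(z)$, $\delta(z)=L_{-1,-1}(z)$ and by $\det^{-1}(z)$ ($z\in Z$), with relations $f(\lambda)L_{xy}(z)=L_{xy}(z)f(\lambda+\omega(x))$, $f(\mu)L_{xy}(z)=L_{xy}(z)f(\mu+\omega(y))$, $$\sum_{x,y}R^{xy}_{ac}(\lambda,\tfrac{z_1}{z_2})L_{xb}(z_1)L_{yd}(z_2)=\sum_{x,y}R^{bd}_{xy}(\mu,\tfrac{z_1}{z_2})L_{cy}(z_2)L_{ax}(z_1)$$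 (both sides multiplied by $\theta(q^2z_1/z_2)$, so that the relation makes sense for all $z_1,z_2\in Z$), and such that $\det^{-1}(z)$ is central and inverse to $\det(z)=\mu_r(F)\mu_l(F^{-1})[\alpha(z)\delta(q^2z)-\gamma(z)\beta(q^2z)]$. It is bigraded by $L_{xy}(z)\in(\mathcal{E}_Z)_{\omega(x),\omega(y)}$, all other generators having bidegree $(0,0)$. Let $W,Z$ be two such sets with $w/z\notin p^{\mathbb{Z}}q^{2\mathbb{Z}}$ for all $w\in W$, $z\in Z$. Then $\mathcal{E}_W$ and $\mathcal{E}_Z$ are $\mathfrak{h}$-Hopf $*$-algebroids with invertible antipode with the following structure on the generators: $\Delta(L_{ab}(z))=\sum_xL_{ax}(z)\otimes L_{xb}(z)$, $\varepsilon(L_{ab}(z))=\delta_{ab}T_{-\omega(a)}$, $\Delta(\det^{-1}(z))=\det^{-1}(z)\otimes\det^{-1}(z)$, $\varepsilon(\det^{-1}(z))=1$; with $G=\mu_r(F)\mu_l(F^{-1})$, $S(\alpha(z))=G\det^{-1}(q^{-2}z)\delta(q^{-2}z)$, $S(\beta(z))=-G\det^{-1}(q^{-2}z)\beta(q^{-2}z)$,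 $S(\gamma(z))=-G\det^{-1}(q^{-2}z)\gamma(q^{-2}z)$, $S(\delta(z))=G\det^{-1}(q^{-2}z)\alpha(q^{-2}z)$, $S(\det^{-1}(z))=\det(z)$; $\alpha(z)^*=\delta(1/\bar z)$, $\beta(z)^*=-\gamma(1/\bar z)$, $\gamma(z)^*=-\beta(1/\bar z)$, $\delta(z)^*=\alpha(1/\bar z)$, $\det^{-1}(z)^*=\det^{-1}(q^{-2}/\bar z)$. The co-opposite $\mathcal{E}_W^{\mathrm{cop}}$ (same algebra, counit and $*$; interchanged moment maps and bidegrees, flipped comultiplication, antipode $S^{-1}$) is an $\mathfrak{h}$-Hopf $*$-algebroid as well. Moreover there is exactly one pairing of $\mathfrak{h}$-bialgebroids $\langle\cdot,\cdot\rangle:\mathcal{E}_W^{\mathrm{cop}}\times\mathcal{E}_Z\to D$ with the values $$\langle L_{ij}(w),L_{kl}(z)\rangle=R^{jl}_{ik}(\lambda,w/z)\,T_{-\omega(i)-\omega(k)},$$ $$\langle L_{ij}(w),\textstyle\det^{-1}(z)\rangle=\delta_{ij}\,q^{-1}\frac{\theta(w/z)}{\theta(q^{-2}w/z)}T_{-\omega(i)},\qquad\langle\textstyle\det^{-1}(w),L_{ij}(z)\rangle=\delta_{ij}\,q^{-1}\frac{\theta(q^2w/z)}{\theta(w/z)}T_{-\omega(i)},$$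 and it makes $\mathcal{E}_W^{\mathrm{cop}}$ and $\mathcal{E}_Z$ paired $\mathfrak{h}$-Hopf $*$-algebroids. That is, writing $\mathcal{U}=\mathcal{E}_W^{\mathrm{cop}}$, $\mathcal{A}=\mathcal{E}_Z$, it is $\mathbb{C}$-bilinear and satisfies: $\langle\mathcal{U}_{\alpha\beta},\mathcal{A}_{\gamma\delta}\rangle\subseteq D_{\alpha+\delta,\beta+\gamma}$; $\langle\mu_l(f)X,a\rangle=\langle X,\mu_l(f)a\rangle=f\circ\langle X,a\rangle$; $\langle X\mu_r(f),a\rangle=\langle X,a\mu_r(f)\rangle=\langle X,a\rangle\circ f$; $\langle XY,a\rangle=\sum_{(a)}\langle X,a_{(1)}\rangle T_\rho\langle Y,a_{(2)}\rangle$ with $a_{(1)}\in\mathcal{A}_{\gamma\rho}$; $\langle X,ab\rangle=\sum_{(X)}\langle X_{(1)},a\rangle T_\rho\langle X_{(2)},b\rangle$ with $X_{(1)}\in\mathcal{U}_{\alpha\rho}$; $\langle X,1\rangle=\varepsilon(X)$, $\langle1,a\rangle=\varepsilon(a)$ (these are the axioms of a pairing of $\mathfrak{h}$-bialgebroids); $\langle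 S^{\mathcal{U}}(X),a\rangle=S^D(\langle X,S^{\mathcal{A}}(a)\rangle)$; and $$\langle X^*,a\rangle=T_{-\gamma}\circ\bigl(\langle X,S^{\mathcal{A}}(a)^*\rangle\bigr)^*\circ T_{-\delta},\qquad a\in\mathcal{A}_{\gamma\delta},\ X\in\mathcal{U}.$$ -/

import Mathlib

open scoped TensorProduct ComplexConjugate

noncomputable section

namespace EllipticU2

/-! ### Meromorphic functions on `𝔥* = ℂ` -/

/-- The algebra of (everywhere defined representatives of) meromorphic functions on `ℂ`. -/
def meroFun : Subalgebra ℂ (ℂ → ℂ) where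
  carrier := {f | Meromorphic f}
  mul_mem' := fun hf hg => hf.mul hg
  add_mem' := fun hf hg => hf.add hg
  algebraMap_mem' := fun c => Meromorphic.const c

/-- Representatives that vanish off a closed discrete set. -/
def meroNull : Ideal meroFun where
  carrier := {f | (f : ℂ → ℂ) =ᶠ[Filter.codiscrete ℂ] 0}
  add_mem' := by
    intro f g hf hg
    have hf' : (f : ℂ → ℂ) =ᶠ[Filter.codiscrete ℂ] 0 := hf
    have hg' : (g : ℂ → ℂ) =ᶠ[Filter.codiscrete ℂ] 0 := hg
    show (f : ℂ → ℂ) + (g : ℂ → ℂ) =ᶠ[Filter.codiscrete ℂ] 0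
    simpa using hf'.add hg'
  zero_mem' := by
    show (0 : ℂ → ℂ) =ᶠ[Filter.codiscrete ℂ] 0
    exact Filter.EventuallyEq.rfl
  smul_mem' := by
    intro c f hf
    have hf' : (f : ℂ → ℂ) =ᶠ[Filter.codiscrete ℂ] 0 := hf
    show (c : ℂ → ℂ) * (f : ℂ → ℂ) =ᶠ[Filter.codiscrete ℂ] 0
    filter_upwards [hf'] with x hx
    simp [hx]

/-- The field `M` of meromorphic functions on `ℂ`: two representatives define the same
meromorphic function if and only if they agree off a closed discrete set. -/
def Mero : Type := meroFun ⧸ meroNull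

instance : CommRing Mero := inferInstanceAs (CommRing (meroFun ⧸ meroNull))

instance : Algebra ℂ Mero := inferInstanceAs (Algebra ℂ (meroFun ⧸ meroNull))

/-- The meromorphic function defined by a representative. -/
def Mero.mk : meroFun →+* Mero := Ideal.Quotient.mk meroNull

theorem Mero.mk_surjective : Function.Surjective Mero.mk := Ideal.Quotient.mk_surjective

open Classical in
/-- The meromorphic function represented by `f` (only used for meromorphic `f`). -/
def Mero.of (f : ℂ → ℂ) : Mero :=
  if h : Meromorphic f then Mero.mk ⟨f, h⟩ else 0

theorem tendsto_codiscrete_of_homeomorph (e : ℂ ≃ₜ ℂ) :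
    Filter.Tendsto e (Filter.codiscrete ℂ) (Filter.codiscrete ℂ) := by
  intro s hs
  rw [Filter.mem_map, mem_codiscrete'] at *
  refine ⟨hs.1.preimage e.continuous, ?_⟩
  have : (e ⁻¹' s)ᶜ = e ⁻¹' sᶜ := rfl
  rw [this]
  exact hs.2.preimage e.continuous.continuousOn e.injective

theorem meromorphic_shift (α : ℂ) {f : ℂ → ℂ} (hf : Meromorphic f) :
    Meromorphic (fun x => f (x + α)) := by
  simpa using hf

theorem meromorphic_conj {f : ℂ → ℂ} (hf : Meromorphic f) :
    Meromorphic (fun x => conj (f (conj x))) := by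
  intro x
  obtain ⟨n, hn⟩ := hf (conj x)
  refine ⟨n, ?_⟩
  rw [Complex.analyticAt_iff_eventually_differentiableAt] at hn ⊢
  have hc : Filter.Tendsto (conj : ℂ → ℂ) (nhds x) (nhds (conj x)) :=
    Complex.continuous_conj.tendsto x
  filter_upwards [hc.eventually hn] with y hy
  have h := hy.conj_conj
  rw [Complex.conj_conj] at h
  have e : (fun t => (t - x) ^ n • conj (f (conj t))) =
      conj ∘ (fun t => (t - conj x) ^ n • f t) ∘ conj := by
    funext t
    simp
  rw [e]
  exact h

/-- `(T_α f)(λ) = f(λ + α)` on representatives. -/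
def shiftFun (α : ℂ) : meroFun →+* meroFun where
  toFun f := ⟨fun x => (f : ℂ → ℂ) (x + α), meromorphic_shift α f.2⟩
  map_one' := rfl
  map_mul' _ _ := rfl
  map_zero' := rfl
  map_add' _ _ := rfl

/-- `(f̄)(λ) = conj (f (conj λ))` on representatives. -/
def conjFun : meroFun →+* meroFun where
  toFun f := ⟨fun x => conj ((f : ℂ → ℂ) (conj x)), meromorphic_conj f.2⟩
  map_one' := by ext; simp
  map_mul' _ _ := by ext; simp
  map_zero' := by ext; simp
  map_add' _ _ := by ext; simp

theorem shiftFun_null (α : ℂ) : meroNull ≤ meroNull.comap (shiftFun α) := fun _ hf =>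
  (tendsto_codiscrete_of_homeomorph (Homeomorph.addRight α)).eventually hf

theorem conjFun_null : meroNull ≤ meroNull.comap conjFun := by
  intro f hf
  have h := (tendsto_codiscrete_of_homeomorph Complex.conjLIE.toHomeomorph).eventually hf
  show ∀ᶠ x in Filter.codiscrete ℂ, conj ((f : ℂ → ℂ) (conj x)) = 0
  filter_upwards [h] with x hx
  have hx' : (f : ℂ → ℂ) (conj x) = 0 := hx
  rw [hx', map_zero]

/-- The automorphism `T_α` of `M`, `(T_α f)(λ) = f(λ + α)`. -/
def Mero.shift (α : ℂ) : Mero →+* Mero :=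
  Ideal.quotientMap meroNull (shiftFun α) (shiftFun_null α)

/-- The conjugation `f ↦ f̄` of `M`, `f̄(λ) = conj (f (conj λ))`. -/
def Mero.bar : Mero →+* Mero :=
  Ideal.quotientMap meroNull conjFun conjFun_null

/-- The additive group `ℂ` acts on `M` by `α ↦ T_α`. -/
instance : MulSemiringAction (Multiplicative ℂ) Mero where
  smul g f := Mero.shift g.toAdd f
  one_smul f := by
    obtain ⟨f, rfl⟩ := Mero.mk_surjective f
    refine congrArg Mero.mk (Subtype.ext (funext fun x => ?_))
    exact congrArg (f : ℂ → ℂ) (add_zero x)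
  mul_smul g h f := by
    obtain ⟨f, rfl⟩ := Mero.mk_surjective f
    refine congrArg Mero.mk (Subtype.ext (funext fun x => ?_))
    exact congrArg (f : ℂ → ℂ) (add_assoc x g.toAdd h.toAdd).symm
  smul_zero g := map_zero (Mero.shift g.toAdd)
  smul_add g := map_add (Mero.shift g.toAdd)
  smul_one g := map_one (Mero.shift g.toAdd)
  smul_mul g := map_mul (Mero.shift g.toAdd)

instance : SMulCommClass (Multiplicative ℂ) ℂ Mero where
  smul_comm g c f := by
    obtain ⟨f, rfl⟩ := Mero.mk_surjective f
    rfl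

/-! ### Difference operators -/

/-- The algebra `D` of finite difference operators `∑ f_i T_{α_i}` on `M`, with product
`(f T_α)(g T_β) = f (T_α g) T_{α + β}`. -/
abbrev DiffOp : Type := SkewMonoidAlgebra Mero (Multiplicative ℂ)

/-- The difference operator `f T_α`. -/
def DiffOp.term (f : Mero) (α : ℂ) : DiffOp :=
  SkewMonoidAlgebra.single (Multiplicative.ofAdd α) f

/-- The difference operator `T_α`. -/
def DiffOp.T (α : ℂ) : DiffOp := DiffOp.term 1 α

/-- The multiplication operator by `f`. -/
def DiffOp.mulOp (f : Mero) : DiffOp := DiffOp.term f 0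

/-- `x` lies in `D_{αβ}`, i.e. `x = f T_{-α}` if `α = β`, and `x = 0` otherwise. -/
def DiffOp.HasDeg (α β : ℂ) (x : DiffOp) : Prop :=
  ∃ f : Mero, x = DiffOp.term f (-α) ∧ (α ≠ β → f = 0)

/-- The value of a difference operator at the constant function `1`:
`(∑ f_i T_{α_i}) 1 = ∑ f_i`. -/
def DiffOp.applyOne (x : DiffOp) : Mero := x.sum fun _ f => f

/-- The antipode of `D`: `f T_α ↦ T_{-α} ∘ f`. -/
def DiffOp.antipode (x : DiffOp) : DiffOp :=
  x.sum fun α f => DiffOp.T (-α.toAdd) * DiffOp.mulOp f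

/-- The `*`-operator of `D`: `(f T_α)^* = T_{-ᾱ} ∘ f̄`. -/
def DiffOp.star (x : DiffOp) : DiffOp :=
  x.sum fun α f => DiffOp.T (-conj α.toAdd) * DiffOp.mulOp (Mero.bar f)

/-! ### `𝔥`-Hopf `*`-algebroids for `𝔥* = ℂ` -/

section Algebroid

variable {A : Type*} [Ring A] [Algebra ℂ A]

/-- The subspace spanned by `μ_r(f)a ⊗ b - a ⊗ μ_l(f)b`. -/
def balRel (μl μr : Mero →ₐ[ℂ] A) : Submodule ℂ (A ⊗[ℂ] A) :=
  Submodule.span ℂ {t | ∃ (f : Mero) (a b : A), t = (μr f * a) ⊗ₜ b - a ⊗ₜ (μl f * b)}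

/-- The subspace of `A ⊗ A ⊗ A` spanned by the same relations in either pair of adjacent legs. -/
def balRel₃ (μl μr : Mero →ₐ[ℂ] A) : Submodule ℂ (A ⊗[ℂ] (A ⊗[ℂ] A)) :=
  Submodule.span ℂ {t | ∃ (f : Mero) (a b c : A),
    t = (μr f * a) ⊗ₜ (b ⊗ₜ c) - a ⊗ₜ ((μl f * b) ⊗ₜ c) ∨
    t = a ⊗ₜ ((μr f * b) ⊗ₜ c) - a ⊗ₜ (b ⊗ₜ (μl f * c))}

/-- The tensor product `A ⊗_M A`. The matrix tensor product `A ⊗̃ A` is its subspace spanned by the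
`a ⊗ b` with `a ∈ A_{αγ}`, `b ∈ A_{γβ}` for some `α, β, γ`. -/
abbrev BalTensor (μl μr : Mero →ₐ[ℂ] A) : Type _ := (A ⊗[ℂ] A) ⧸ balRel μl μr

/-- The class of `a ⊗ b` in `A ⊗_M A`. -/
def btmul (μl μr : Mero →ₐ[ℂ] A) (a b : A) : BalTensor μl μr :=
  (balRel μl μr).mkQ (a ⊗ₜ[ℂ] b)

/-- The class of `a ⊗ b ⊗ c` in `A ⊗_M A ⊗_M A`. -/
def btmul₃ (μl μr : Mero →ₐ[ℂ] A) (a b c : A) :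
    (A ⊗[ℂ] (A ⊗[ℂ] A)) ⧸ balRel₃ μl μr :=
  (balRel₃ μl μr).mkQ (a ⊗ₜ[ℂ] (b ⊗ₜ[ℂ] c))

/-- The flip `A ⊗_M A → A ⊗_M A` that interchanges the roles of the moment maps. -/
def flipTensor (μl μr : Mero →ₐ[ℂ] A) : BalTensor μl μr →ₗ[ℂ] BalTensor μr μl :=
  Submodule.mapQ (balRel μl μr) (balRel μr μl) (TensorProduct.comm ℂ A A).toLinearMap (by
    refine Submodule.span_le.2 ?_
    rintro _ ⟨f, a, b, rfl⟩
    show (TensorProduct.comm ℂ A A) _ ∈ balRel μr μl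
    rw [map_sub, TensorProduct.comm_tmul, TensorProduct.comm_tmul, ← neg_sub]
    exact Submodule.neg_mem _ (Submodule.subset_span ⟨f, b, a, rfl⟩))

variable (A) in
/-- The data (without axioms) of an `𝔥`-Hopf `*`-algebroid with invertible antipode on the
algebra `A`: bigrading, moment maps, comultiplication, counit, antipode, `*`-operator. -/
structure HopfStarData where
  gr : ℂ → ℂ → Submodule ℂ A
  μl : Mero →ₐ[ℂ] A
  μr : Mero →ₐ[ℂ] A
  Δ : A →ₗ[ℂ] BalTensor μl μr
  ε : A →ₗ[ℂ] DiffOp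
  S : A ≃ₗ[ℂ] A
  st : A → A

namespace HopfStarData

/-- The co-opposite: same algebra and `*`, interchanged moment maps and bidegrees, flipped
comultiplication, same counit, inverse antipode. -/
def cop (H : HopfStarData A) : HopfStarData A where
  gr α β := H.gr β α
  μl := H.μr
  μr := H.μl
  Δ := flipTensor H.μl H.μr ∘ₗ H.Δ
  ε := H.ε
  S := H.S.symm
  st := H.st

/-- `Δ(a) = ∑ a₁ ⊗ a₂` with `a₁ ∈ A_{γρ}`, `a₂ ∈ A_{ρδ}`; the sum is over the entries
`(ρ, a₁, a₂)` of the list `s`. -/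
def IsSweedler (H : HopfStarData A) (a : A) (s : List (ℂ × A × A)) : Prop :=
  (∀ t ∈ s, (∃ γ, t.2.1 ∈ H.gr γ t.1) ∧ ∃ δ, t.2.2 ∈ H.gr t.1 δ) ∧
    H.Δ a = (s.map fun t => btmul H.μl H.μr t.2.1 t.2.2).sum

/-- The axioms of an `𝔥`-algebra. -/
structure IsHAlgebra (H : HopfStarData A) : Prop where
  decomp : DirectSum.IsInternal fun i : ℂ × ℂ => H.gr i.1 i.2
  one_mem : (1 : A) ∈ H.gr 0 0
  mul_mem : ∀ {α β γ δ : ℂ} {a b : A}, a ∈ H.gr α β → b ∈ H.gr γ δ →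
    a * b ∈ H.gr (α + γ) (β + δ)
  μl_mem : ∀ f, H.μl f ∈ H.gr 0 0
  μr_mem : ∀ f, H.μr f ∈ H.gr 0 0
  μl_inj : Function.Injective H.μl
  μr_inj : Function.Injective H.μr
  μl_μr : ∀ f g, H.μl f * H.μr g = H.μr g * H.μl f
  μl_mul : ∀ {α β : ℂ} {a : A}, a ∈ H.gr α β → ∀ f, H.μl f * a = a * H.μl (Mero.shift α f)
  μr_mul : ∀ {α β : ℂ} {a : A}, a ∈ H.gr α β → ∀ f, H.μr f * a = a * H.μr (Mero.shift β f)

/-- The axioms of an `𝔥`-bialgebroid: `Δ` and `ε` are `𝔥`-algebra homomorphisms to `A ⊗̃ A` and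
`D`, and they satisfy coassociativity and the counit axiom. -/
structure IsBialgebroid (H : HopfStarData A) : Prop extends IsHAlgebra H where
  Δ_mem : ∀ {α β : ℂ} {a : A}, a ∈ H.gr α β →
    H.Δ a ∈ Submodule.span ℂ {t | ∃ (γ : ℂ) (b c : A),
      b ∈ H.gr α γ ∧ c ∈ H.gr γ β ∧ t = btmul H.μl H.μr b c}
  Δ_μl : ∀ f, H.Δ (H.μl f) = btmul H.μl H.μr (H.μl f) 1
  Δ_μr : ∀ f, H.Δ (H.μr f) = btmul H.μl H.μr 1 (H.μr f)
  Δ_one : H.Δ 1 = btmul H.μl H.μr 1 1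
  Δ_mul : ∀ (a b : A) (s t : List (ℂ × A × A)), H.IsSweedler a s → H.IsSweedler b t →
    H.Δ (a * b) = (s.map fun x => (t.map fun y =>
      btmul H.μl H.μr (x.2.1 * y.2.1) (x.2.2 * y.2.2)).sum).sum
  ε_mem : ∀ {α β : ℂ} {a : A}, a ∈ H.gr α β → DiffOp.HasDeg α β (H.ε a)
  ε_μl : ∀ f, H.ε (H.μl f) = DiffOp.mulOp f
  ε_μr : ∀ f, H.ε (H.μr f) = DiffOp.mulOp f
  ε_one : H.ε 1 = 1
  ε_mul : ∀ a b, H.ε (a * b) = H.ε a * H.ε b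
  coassoc : ∀ (a : A) (s : List (ℂ × A × A)) (u v : ℂ × A × A → List (ℂ × A × A)),
    H.IsSweedler a s → (∀ x ∈ s, H.IsSweedler x.2.1 (u x)) →
    (∀ x ∈ s, H.IsSweedler x.2.2 (v x)) →
    (s.map fun x => ((u x).map fun y => btmul₃ H.μl H.μr y.2.1 y.2.2 x.2.2).sum).sum =
      (s.map fun x => ((v x).map fun y => btmul₃ H.μl H.μr x.2.1 y.2.1 y.2.2).sum).sum
  counit_left : ∀ (a : A) (s : List (ℂ × A × A)), H.IsSweedler a s →
    (s.map fun x => H.μl (H.ε x.2.1).applyOne * x.2.2).sum = a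
  counit_right : ∀ (a : A) (s : List (ℂ × A × A)), H.IsSweedler a s →
    (s.map fun x => H.μr (H.ε x.2.2).applyOne * x.2.1).sum = a

/-- The axioms of an `𝔥`-Hopf algebroid. -/
structure IsHopfAlgebroid (H : HopfStarData A) : Prop extends IsBialgebroid H where
  S_μr : ∀ f a, H.S (H.μr f * a) = H.S a * H.μl f
  S_μl : ∀ f a, H.S (a * H.μl f) = H.μr f * H.S a
  S_right : ∀ (a : A) (s : List (ℂ × A × A)), H.IsSweedler a s →
    (s.map fun x => x.2.1 * H.S x.2.2).sum = H.μl (H.ε a).applyOne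
  S_left : ∀ {α β : ℂ} {a : A}, a ∈ H.gr α β → ∀ s : List (ℂ × A × A), H.IsSweedler a s →
    (s.map fun x => H.S x.2.1 * x.2.2).sum = H.μr (Mero.shift α (H.ε a).applyOne)

/-- The axioms of an `𝔥`-Hopf `*`-algebroid. -/
structure IsHopfStarAlgebroid (H : HopfStarData A) : Prop extends IsHopfAlgebroid H where
  st_add : ∀ a b, H.st (a + b) = H.st a + H.st b
  st_smul : ∀ (c : ℂ) (a : A), H.st (c • a) = conj c • H.st a
  st_mul : ∀ a b, H.st (a * b) = H.st b * H.st a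
  st_st : ∀ a, H.st (H.st a) = a
  st_μl : ∀ f, H.st (H.μl f) = H.μl (Mero.bar f)
  st_μr : ∀ f, H.st (H.μr f) = H.μr (Mero.bar f)
  Δ_st : ∀ (a : A) (s : List (ℂ × A × A)), H.IsSweedler a s →
    H.Δ (H.st a) = (s.map fun x => btmul H.μl H.μr (H.st x.2.1) (H.st x.2.2)).sum
  ε_st : ∀ a, H.ε (H.st a) = (H.ε a).star

end HopfStarData

variable {U : Type*} [Ring U] [Algebra ℂ U]

open DiffOp in
/-- A pairing of `𝔥`-bialgebroids. -/
structure IsPairing (K : HopfStarData U) (H : HopfStarData A)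
    (P : U →ₗ[ℂ] A →ₗ[ℂ] DiffOp) : Prop where
  target : ∀ {α β γ δ : ℂ} {X : U} {a : A}, X ∈ K.gr α β → a ∈ H.gr γ δ →
    HasDeg (α + δ) (β + γ) (P X a)
  μl_fst : ∀ f X a, P (K.μl f * X) a = mulOp f * P X a
  μl_snd : ∀ f X a, P X (H.μl f * a) = mulOp f * P X a
  μr_fst : ∀ f X a, P (X * K.μr f) a = P X a * mulOp f
  μr_snd : ∀ f X a, P X (a * H.μr f) = P X a * mulOp f
  mul_fst : ∀ (X Y : U) (a : A) (s : List (ℂ × A × A)), H.IsSweedler a s →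
    P (X * Y) a = (s.map fun t => P X t.2.1 * T t.1 * P Y t.2.2).sum
  mul_snd : ∀ (X : U) (a b : A) (s : List (ℂ × U × U)), K.IsSweedler X s →
    P X (a * b) = (s.map fun t => P t.2.1 a * T t.1 * P t.2.2 b).sum
  one_snd : ∀ X, P X 1 = K.ε X
  one_fst : ∀ a, P 1 a = H.ε a

/-- A pairing of `𝔥`-Hopf algebroids. -/
structure IsHopfPairing (K : HopfStarData U) (H : HopfStarData A)
    (P : U →ₗ[ℂ] A →ₗ[ℂ] DiffOp) : Prop extends IsPairing K H P where
  antipode : ∀ X a, P (K.S X) a = (P X (H.S a)).antipode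

open DiffOp in
/-- `U` and `A` are paired as `𝔥`-Hopf `*`-algebroids by `P`, with the compatibility
`⟨X^*, a⟩ = T_{-γ} ∘ ⟨X, S(a)^*⟩^* ∘ T_{-δ}` for `a ∈ A_{γδ}`. -/
structure IsHopfStarPairing (K : HopfStarData U) (H : HopfStarData A)
    (P : U →ₗ[ℂ] A →ₗ[ℂ] DiffOp) : Prop extends IsHopfPairing K H P where
  isHopfStar_fst : K.IsHopfStarAlgebroid
  isHopfStar_snd : H.IsHopfStarAlgebroid
  star_compat : ∀ {γ δ : ℂ} {a : A}, a ∈ H.gr γ δ → ∀ X : U,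
    P (K.st X) a = T (-γ) * (P X (H.st (H.S a))).star * T (-δ)

end Algebroid

/-! ### The elliptic R-matrix -/

/-- The normalised theta function `θ(z) = (z, p/z; p)_∞`. -/
def theta (p : ℝ) (z : ℂ) : ℂ :=
  (∏' i : ℕ, (1 - z * (p : ℂ) ^ i)) * ∏' i : ℕ, (1 - (p : ℂ) / z * (p : ℂ) ^ i)

/-- The weights `ω(1) = 1`, `ω(-1) = -1` of the basis `e_1, e_{-1}`; the index `1` is
represented by `0 : Fin 2` and the index `-1` by `1 : Fin 2`. -/
def wt : Fin 2 → ℂ := ![1, -1]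

/-- `θ(q² z) R^{ab}_{xy}(λ, z)`, the matrix element of the elliptic R-matrix with its denominator
in the spectral parameter `z` cleared. -/
def ellRnum (p q : ℝ) (l z : ℂ) (a b x y : Fin 2) : ℂ :=
  match a, b, x, y with
  | 0, 0, 0, 0 => theta p ((q : ℂ) ^ 2 * z)
  | 0, 1, 0, 1 => theta p z * theta p ((q : ℂ) ^ (2 * (l + 2))) /
      theta p ((q : ℂ) ^ (2 * (l + 1)))
  | 1, 0, 0, 1 => theta p ((q : ℂ) ^ 2) * theta p ((q : ℂ) ^ (-2 * (l + 1)) * z) /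
      theta p ((q : ℂ) ^ (-2 * (l + 1)))
  | 0, 1, 1, 0 => theta p ((q : ℂ) ^ 2) * theta p ((q : ℂ) ^ (2 * (l + 1)) * z) /
      theta p ((q : ℂ) ^ (2 * (l + 1)))
  | 1, 0, 1, 0 => theta p z * theta p ((q : ℂ) ^ (-2 * l)) /
      theta p ((q : ℂ) ^ (-2 * (l + 1)))
  | 1, 1, 1, 1 => theta p ((q : ℂ) ^ 2 * z)
  | _, _, _, _ => 0

/-- The matrix element `R^{ab}_{xy}(λ, z)` of the elliptic R-matrix,
`R(λ, z)(e_a ⊗ e_b) = ∑ R^{ab}_{xy}(λ, z) e_x ⊗ e_y`, for `θ(q² z) ≠ 0`. -/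
def ellR (p q : ℝ) (l z : ℂ) (a b x y : Fin 2) : ℂ :=
  ellRnum p q l z a b x y / theta p ((q : ℂ) ^ 2 * z)

/-- `F(λ) = q^λ θ(q^{-2(λ+1)})`. -/
def Ffun (p q : ℝ) (l : ℂ) : ℂ := (q : ℂ) ^ l * theta p ((q : ℂ) ^ (-2 * (l + 1)))

/-! ### The elliptic `U(2)` dynamical quantum group -/

/-- A set of admissible spectral parameters: a subset of `ℂ \ {0}` stable under `z ↦ q^{±2} z` and
`z ↦ 1 / z̄`. -/
structure SpectralSet (q : ℝ) where
  carrier : Set ℂ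
  zero_notMem : (0 : ℂ) ∉ carrier
  up_mem : ∀ z ∈ carrier, (q : ℂ) ^ 2 * z ∈ carrier
  down_mem : ∀ z ∈ carrier, ((q : ℂ) ^ 2)⁻¹ * z ∈ carrier
  refl_mem : ∀ z ∈ carrier, (conj z)⁻¹ ∈ carrier

namespace SpectralSet

variable {q : ℝ} (Z : SpectralSet q)

/-- `z ↦ q² z`. -/
def up (z : Z.carrier) : Z.carrier := ⟨(q : ℂ) ^ 2 * z, Z.up_mem z z.2⟩

/-- `z ↦ q⁻² z`. -/
def down (z : Z.carrier) : Z.carrier := ⟨((q : ℂ) ^ 2)⁻¹ * z, Z.down_mem z z.2⟩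

/-- `z ↦ 1 / z̄`. -/
def refl (z : Z.carrier) : Z.carrier := ⟨(conj (z : ℂ))⁻¹, Z.refl_mem z z.2⟩

end SpectralSet

/-- The generators: `f(λ) = μ_l(f)`, `f(μ) = μ_r(f)`, `L_{xy}(z)` and `det⁻¹(z)`. -/
inductive Gen {q : ℝ} (Z : SpectralSet q) : Type
  | ml (f : Mero)
  | mr (f : Mero)
  | L (x y : Fin 2) (z : Z.carrier)
  | detInv (z : Z.carrier)

/-- The bidegree of a generator. -/
def Gen.deg {q : ℝ} {Z : SpectralSet q} : Gen Z → ℂ × ℂ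
  | .ml _ => 0
  | .mr _ => 0
  | .L x y _ => (wt x, wt y)
  | .detInv _ => 0

section Free

variable (p q : ℝ) (Z : SpectralSet q)

/-- A generator as an element of the free algebra. -/
abbrev gen (g : Gen Z) : FreeAlgebra ℂ (Gen Z) := FreeAlgebra.ι ℂ g

/-- `det(z) = μ_r(F) μ_l(F⁻¹) [α(z) δ(q² z) - γ(z) β(q² z)]` in the free algebra. -/
def detFree (z : Z.carrier) : FreeAlgebra ℂ (Gen Z) :=
  gen q Z (.mr (Mero.of (Ffun p q))) * gen q Z (.ml (Mero.of fun l => (Ffun p q l)⁻¹)) *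
    (gen q Z (.L 0 0 z) * gen q Z (.L 1 1 (Z.up z)) -
      gen q Z (.L 1 0 z) * gen q Z (.L 0 1 (Z.up z)))

/-- The defining relations. The `RLL`-relations are multiplied by `θ(q² z₁/z₂)`, so that they make
sense for all spectral parameters. The element `det⁻¹(z)` is adjoined as a central inverse
of `det(z)`. -/
inductive Rel : FreeAlgebra ℂ (Gen Z) → FreeAlgebra ℂ (Gen Z) → Prop
  | ml_add (f g) : Rel (gen q Z (.ml (f + g))) (gen q Z (.ml f) + gen q Z (.ml g))
  | ml_mul (f g) : Rel (gen q Z (.ml (f * g))) (gen q Z (.ml f) * gen q Z (.ml g))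
  | ml_const (c : ℂ) : Rel (gen q Z (.ml (algebraMap ℂ Mero c))) (algebraMap ℂ _ c)
  | mr_add (f g) : Rel (gen q Z (.mr (f + g))) (gen q Z (.mr f) + gen q Z (.mr g))
  | mr_mul (f g) : Rel (gen q Z (.mr (f * g))) (gen q Z (.mr f) * gen q Z (.mr g))
  | mr_const (c : ℂ) : Rel (gen q Z (.mr (algebraMap ℂ Mero c))) (algebraMap ℂ _ c)
  | ml_mr (f g) : Rel (gen q Z (.ml f) * gen q Z (.mr g)) (gen q Z (.mr g) * gen q Z (.ml f))
  | ml_L (f x y z) : Rel (gen q Z (.ml f) * gen q Z (.L x y z))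
      (gen q Z (.L x y z) * gen q Z (.ml (Mero.shift (wt x) f)))
  | mr_L (f x y z) : Rel (gen q Z (.mr f) * gen q Z (.L x y z))
      (gen q Z (.L x y z) * gen q Z (.mr (Mero.shift (wt y) f)))
  | RLL (a b c d : Fin 2) (z₁ z₂ : Z.carrier) : Rel
      (∑ x, ∑ y, gen q Z (.ml (Mero.of fun l => ellRnum p q l (z₁ / z₂ : ℂ) x y a c)) *
        (gen q Z (.L x b z₁) * gen q Z (.L y d z₂)))
      (∑ x, ∑ y, gen q Z (.mr (Mero.of fun l => ellRnum p q l (z₁ / z₂ : ℂ) b d x y)) *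
        (gen q Z (.L c y z₂) * gen q Z (.L a x z₁)))
  | detInv_mul (z) : Rel (gen q Z (.detInv z) * detFree p q Z z) 1
  | mul_detInv (z) : Rel (detFree p q Z z * gen q Z (.detInv z)) 1
  | detInv_comm (z g) : Rel (gen q Z (.detInv z) * gen q Z g) (gen q Z g * gen q Z (.detInv z))

/-- The algebra underlying the elliptic `U(2)` dynamical quantum group `ℰ` with spectral parameters
in `Z`. -/
def Ell : Type := RingQuot (Rel p q Z)

instance : Ring (Ell p q Z) := inferInstanceAs (Ring (RingQuot (Rel p q Z)))

instance : Algebra ℂ (Ell p q Z) := inferInstanceAs (Algebra ℂ (RingQuot (Rel p q Z)))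

namespace Ell

/-- The quotient map from the free algebra. -/
def mk : FreeAlgebra ℂ (Gen Z) →ₐ[ℂ] Ell p q Z := RingQuot.mkAlgHom ℂ (Rel p q Z)

/-- The class of a generator. -/
def of (g : Gen Z) : Ell p q Z := mk p q Z (gen q Z g)

theorem mk_rel {x y : FreeAlgebra ℂ (Gen Z)} (h : Rel p q Z x y) :
    mk p q Z x = mk p q Z y :=
  RingQuot.mkAlgHom_rel ℂ h

/-- The left moment map `f ↦ f(λ)`. -/
def muL : Mero →ₐ[ℂ] Ell p q Z where
  toFun f := of p q Z (.ml f)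
  map_one' := by simpa [of] using mk_rel p q Z (Rel.ml_const 1)
  map_mul' f g := by simpa [of] using mk_rel p q Z (Rel.ml_mul f g)
  map_zero' := by simpa [of] using mk_rel p q Z (Rel.ml_const 0)
  map_add' f g := by simpa [of] using mk_rel p q Z (Rel.ml_add f g)
  commutes' c := by simpa [of] using mk_rel p q Z (Rel.ml_const c)

/-- The right moment map `f ↦ f(μ)`. -/
def muR : Mero →ₐ[ℂ] Ell p q Z where
  toFun f := of p q Z (.mr f)
  map_one' := by simpa [of] using mk_rel p q Z (Rel.mr_const 1)
  map_mul' f g := by simpa [of] using mk_rel p q Z (Rel.mr_mul f g)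
  map_zero' := by simpa [of] using mk_rel p q Z (Rel.mr_const 0)
  map_add' f g := by simpa [of] using mk_rel p q Z (Rel.mr_add f g)
  commutes' c := by simpa [of] using mk_rel p q Z (Rel.mr_const c)

/-- The generator `L_{xy}(z)`. -/
def L (x y : Fin 2) (z : Z.carrier) : Ell p q Z := of p q Z (.L x y z)

/-- `α(z) = L_{1,1}(z)`. -/
def al (z : Z.carrier) : Ell p q Z := L p q Z 0 0 z

/-- `β(z) = L_{1,-1}(z)`. -/
def be (z : Z.carrier) : Ell p q Z := L p q Z 0 1 z

/-- `γ(z) = L_{-1,1}(z)`. -/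
def ga (z : Z.carrier) : Ell p q Z := L p q Z 1 0 z

/-- `δ(z) = L_{-1,-1}(z)`. -/
def de (z : Z.carrier) : Ell p q Z := L p q Z 1 1 z

/-- The generator `det⁻¹(z)`. -/
def detInv (z : Z.carrier) : Ell p q Z := of p q Z (.detInv z)

/-- `μ_r(F) μ_l(F⁻¹)`. -/
def FF : Ell p q Z :=
  muR p q Z (Mero.of (Ffun p q)) * muL p q Z (Mero.of fun l => (Ffun p q l)⁻¹)

/-- The determinant `det(z)`. -/
def det (z : Z.carrier) : Ell p q Z :=
  FF p q Z * (al p q Z z * de p q Z (Z.up z) - ga p q Z z * be p q Z (Z.up z))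

/-- The bigrading: `ℰ_{αβ}` is spanned by the products of generators of total bidegree `(α, β)`. -/
def grading (α β : ℂ) : Submodule ℂ (Ell p q Z) :=
  Submodule.span ℂ {t | ∃ w : List (Gen Z),
    (w.map Gen.deg).sum = (α, β) ∧ t = (w.map (of p q Z)).prod}

/-- `H` is the structure on `ℰ` that is given on the generators by the formulas of the elliptic
`U(2)` dynamical quantum group. -/
structure IsStandard (H : HopfStarData (Ell p q Z)) : Prop where
  gr_eq : H.gr = grading p q Z
  μl_eq : H.μl = muL p q Z
  μr_eq : H.μr = muR p q Z
  Δ_L : ∀ a b z, H.Δ (L p q Z a b z) =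
    ∑ x, btmul H.μl H.μr (L p q Z a x z) (L p q Z x b z)
  Δ_detInv : ∀ z, H.Δ (detInv p q Z z) = btmul H.μl H.μr (detInv p q Z z) (detInv p q Z z)
  ε_L : ∀ a b z, H.ε (L p q Z a b z) = if a = b then DiffOp.T (-wt a) else 0
  ε_detInv : ∀ z, H.ε (detInv p q Z z) = 1
  S_al : ∀ z, H.S (al p q Z z) =
    FF p q Z * detInv p q Z (Z.down z) * de p q Z (Z.down z)
  S_be : ∀ z, H.S (be p q Z z) =
    -(FF p q Z * detInv p q Z (Z.down z) * be p q Z (Z.down z))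
  S_ga : ∀ z, H.S (ga p q Z z) =
    -(FF p q Z * detInv p q Z (Z.down z) * ga p q Z (Z.down z))
  S_de : ∀ z, H.S (de p q Z z) =
    FF p q Z * detInv p q Z (Z.down z) * al p q Z (Z.down z)
  S_detInv : ∀ z, H.S (detInv p q Z z) = det p q Z z
  st_al : ∀ z, H.st (al p q Z z) = de p q Z (Z.refl z)
  st_be : ∀ z, H.st (be p q Z z) = -ga p q Z (Z.refl z)
  st_ga : ∀ z, H.st (ga p q Z z) = -be p q Z (Z.refl z)
  st_de : ∀ z, H.st (de p q Z z) = al p q Z (Z.refl z)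
  st_detInv : ∀ z, H.st (detInv p q Z z) = detInv p q Z (Z.down (Z.refl z))

end Ell

end Free

/-- The prescribed values of the pairing on generators:
`⟨L_{ij}(w), L_{kl}(z)⟩ = R^{jl}_{ik}(λ, w/z) T_{-ω(i)-ω(k)}`, and the values on `det⁻¹`. -/
structure HasGeneratorValues (p q : ℝ) (W Z : SpectralSet q)
    (P : Ell p q W →ₗ[ℂ] Ell p q Z →ₗ[ℂ] DiffOp) : Prop where
  L_L : ∀ i j k l w z, P (Ell.L p q W i j w) (Ell.L p q Z k l z) =
    DiffOp.term (Mero.of fun t => ellR p q t (w / z : ℂ) j l i k) (-wt i - wt k)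
  L_detInv : ∀ i j w z, P (Ell.L p q W i j w) (Ell.detInv p q Z z) =
    if i = j then DiffOp.term (Mero.of fun _ => (q : ℂ)⁻¹ * theta p (w / z : ℂ) /
      theta p (((q : ℂ) ^ 2)⁻¹ * (w / z : ℂ))) (-wt i) else 0
  detInv_L : ∀ i j w z, P (Ell.detInv p q W w) (Ell.L p q Z i j z) =
    if i = j then DiffOp.term (Mero.of fun _ => (q : ℂ)⁻¹ * theta p ((q : ℂ) ^ 2 * (w / z : ℂ)) /
      theta p (w / z : ℂ)) (-wt i) else 0

end EllipticU2

end

open scoped TensorProduct ComplexConjugate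

noncomputable section

namespace EllipticU2

/-! ### The theta function -/

section Theta

open Filter Topology

variable {p : ℝ}

/-! Analysis enters through a single identity. In terms of the odd brackets [u] = q^{-u} θ(q^{2u})
the R-matrix is, up to a scalar, a matrix of products and quotients of brackets. The Jacobi triple
product shows that [x+y][x-y] has the form f(x)g(y) - g(x)f(y), and this rank-two form is
Weierstrass' three-term relation. The three-term relation yields the dynamical Yang–Baxter equation
(`brkR_yangBaxter`, `rM_yangBaxter`). The assumption on q² says that [1] ≠ 0, so no translate of the
bracket vanishes identically and all dynamical denominators are invertible in the field of
meromorphic functions. Inspection of the entries gives two reflection symmetries (`shift_FM_mul_rM`,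
`shift_rM`), the crossing symmetry (`crossing_rM`), and the degeneration to rank one at z = q^{-2}
(`bM_mul_rM`).

A homomorphism out of ℰ is the same as a family of operators satisfying the defining relations
(`EllRep.lift`), and every structure map comes from such a family in a suitable target: a group
algebra over ℰ for the bigrading, D for the counit, the opposite algebra for the antipode, and the
opposite algebra with conjugated scalars for the star. Since ℰ ⊗_M ℰ is not an algebra, the
comultiplication is obtained from an action of ℰ on this space: a generator acts as left
multiplication by its prescribed coproduct, and Δ(a) is the image of 1 ⊗ 1 under a. The rank-one
degeneration makes all 2×2 minors with parameters z, q²z proportional to the determinant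
(`LOps.rowMinor_eq`, `LOps.colMinor_eq`). Consequently det is group-like, and S(L) is inverse to L
on both sides. The remaining axioms are compared on generators. The antipode is bijective because
(S∘*)² = id, so S^{-1} = *∘S∘*, and this formula also reduces the antipode axioms of the co-opposite
to those of ℰ.

The pairing is read off from an action of ℰ_W on ℰ_Z, informally X·a = ∑ a_{(1)}⟨X, a_{(2)}⟩. For
fixed w the Yang–Baxter equation turns L_{kl}(z) into a 2×2 matrix over ℰ_Z compatible with all
relations (`coactRep`), and its entries are the operators of the L_{ij}(w). These operators satisfy
the relations of ℰ_W: the RLL relation passes to products of arguments and is the Yang–Baxter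
equation on generators (`exchange`), while det(w) acts by rescaling the generators (`actOps_det`).
The separation of W and Z keeps the scalars finite and non-zero. With ⟨X, a⟩ = ε(X·a) T_{-α}, where
α is the left degree of X in ℰ_W, the two product axioms say that Δ(X·a) = (1 ⊗ X)Δ(a) (`comul_act`)
and that ℰ_Z is a module algebra over the co-opposite (`act_mul`).

Pairings are rigid (`Ell.IsMulPairing.unique`): for X = L(w) or X = det^{-1}(w) the pairing with X
is an algebra homomorphism into matrices over D, hence determined by its values on the L(z), and the
values of det^{-1}(w) on L(z) are forced by inverting those of det(w). This gives uniqueness. It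
also gives both compatibilities: twisting the pairing by the antipodes, or by the stars, produces a
multiplicative pairing, which agrees with the original one on generators by `shift_FM_mul_rM` and by
`crossing_rM` respectively. -/

/-- The infinite product `(z; p)_∞`. -/
def qProd (p : ℝ) (z : ℂ) : ℂ := ∏' i : ℕ, (1 - z * (p : ℂ) ^ i)

theorem theta_eq (p : ℝ) (z : ℂ) : theta p z = qProd p z * qProd p (p / z) := rfl

theorem summable_norm_qProd (hp0 : 0 < p) (hp1 : p < 1) (z : ℂ) :
    Summable fun i : ℕ => ‖-(z * (p : ℂ) ^ i)‖ := by
  simp only [norm_neg, norm_mul, norm_pow, Complex.norm_real, Real.norm_eq_abs, abs_of_pos hp0]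
  exact (summable_geometric_of_lt_one hp0.le hp1).mul_left _

theorem multipliable_qProd (hp0 : 0 < p) (hp1 : p < 1) (z : ℂ) :
    Multipliable fun i : ℕ => 1 - z * (p : ℂ) ^ i := by
  simpa [sub_eq_add_neg] using multipliable_one_add_of_summable (summable_norm_qProd hp0 hp1 z)

theorem qProd_step (hp0 : 0 < p) (hp1 : p < 1) (z : ℂ) :
    qProd p z = (1 - z) * qProd p (z * p) := by
  have e : ∀ i : ℕ, 1 - z * (p : ℂ) * (p : ℂ) ^ i = 1 - z * (p : ℂ) ^ (i + 1) := fun i => by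
    rw [pow_succ]; ring
  have h := (multipliable_congr e).1 (multipliable_qProd hp0 hp1 (z * p))
  rw [qProd, tprod_eq_zero_mul' (f := fun i : ℕ => 1 - z * (p : ℂ) ^ i) h, qProd, tprod_congr e,
    pow_zero, mul_one]

theorem qProd_ne_zero (hp0 : 0 < p) (hp1 : p < 1) {z : ℂ} (hz : ∀ i : ℕ, z * (p : ℂ) ^ i ≠ 1) :
    qProd p z ≠ 0 := by
  have := tprod_one_add_ne_zero_of_summable (f := fun i : ℕ => -(z * (p : ℂ) ^ i))
    (fun i => by rw [← sub_eq_add_neg, sub_ne_zero]; exact (hz i).symm)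
    (summable_norm_qProd hp0 hp1 z)
  simpa [qProd, sub_eq_add_neg] using this

/-- On the ball of radius ‖z‖ + 1 the factors differ from 1 by at most a geometric series, so the
partial products converge locally uniformly. -/
theorem differentiable_qProd (hp0 : 0 < p) (hp1 : p < 1) : Differentiable ℂ (qProd p) := by
  intro z
  have hb : IsOpen (Metric.ball (0 : ℂ) (‖z‖ + 1)) := Metric.isOpen_ball
  have hm := Summable.hasProdLocallyUniformlyOn_nat_one_add (R := ℂ)
    (f := fun (i : ℕ) (z : ℂ) => -(z * (p : ℂ) ^ i)) hb
    (u := fun i => (‖z‖ + 1) * p ^ i) ((summable_geometric_of_lt_one hp0.le hp1).mul_left _)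
    (.of_forall fun n x hx => by
      have hx' : ‖x‖ ≤ ‖z‖ + 1 := by simpa using (mem_ball_zero_iff.1 hx).le
      simp only [norm_neg, norm_mul, norm_pow, Complex.norm_real, Real.norm_eq_abs, abs_of_pos hp0]
      gcongr)
    (fun _ => by fun_prop)
  have hd := hm.differentiableOn (.of_forall fun s => by
    simpa [Finset.prod_fn] using DifferentiableOn.finsetProd (fun _ _ => by fun_prop)) hb
  have := hd.differentiableAt (hb.mem_nhds (x := z) (by simp))
  have e : qProd p = fun x => ∏' i : ℕ, (1 + -(x * (p : ℂ) ^ i)) := by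
    funext x; simp only [qProd, sub_eq_add_neg]
  rw [e]
  exact this

/-- Inversion exchanges the two products except for one factor, which changes from 1 - z to 1 -
z^{-1} = -z^{-1}(1 - z). -/
theorem theta_inv (hp0 : 0 < p) (hp1 : p < 1) {z : ℂ} (hz : z ≠ 0) :
    theta p z⁻¹ = -z⁻¹ * theta p z := by
  rw [theta_eq, theta_eq, qProd_step hp0 hp1 z, qProd_step hp0 hp1 z⁻¹]
  have e1 : (p : ℂ) / z⁻¹ = z * p := by field_simp
  have e2 : z⁻¹ * (p : ℂ) = p / z := by field_simp
  rw [e1, e2]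
  field_simp
  ring

/-- A vanishing factor would put z at p^{-i} in the first product, or at p^{i+1} in the second one.
-/
theorem theta_ne_zero (hp0 : 0 < p) (hp1 : p < 1) {z : ℂ} (hz : z ≠ 0)
    (h : ∀ m : ℤ, z ≠ (p : ℂ) ^ m) : theta p z ≠ 0 := by
  have hp : (p : ℂ) ≠ 0 := by exact_mod_cast hp0.ne'
  refine mul_ne_zero (qProd_ne_zero hp0 hp1 fun i hi => h (-i) ?_)
    (qProd_ne_zero hp0 hp1 fun i hi => h (i + 1) ?_)
  · rw [zpow_neg, zpow_natCast]
    exact eq_inv_of_mul_eq_one_left hi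
  · rw [zpow_add_one₀ hp, zpow_natCast]
    field_simp at hi
    rw [← hi]; ring

theorem theta_conj (hp0 : 0 < p) (hp1 : p < 1) (z : ℂ) : theta p (conj z) = conj (theta p z) := by
  have h : ∀ w : ℂ, qProd p (conj w) = conj (qProd p w) := fun w => by
    have := (multipliable_qProd hp0 hp1 w).map_tprod (starRingEnd ℂ) Complex.continuous_conj
    rw [qProd, qProd, this]
    simp
  rw [theta_eq, theta_eq, map_mul, ← h, ← h]
  simp

/-! #### The triple product identity -/

/-- The theta series `∑ t^{k²} z^k`. -/
def thetaSeries (t : ℝ) (z : ℂ) : ℂ := ∑' k : ℤ, (t : ℂ) ^ (k ^ 2) * z ^ k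

/-- The terms are those of the two-variable Jacobi theta function at τ = -i log t / π and argument
log z / 2πi; the convergence condition Im τ > 0 is t < 1. -/
theorem summable_thetaSeries {t : ℝ} (ht0 : 0 < t) (ht1 : t < 1) {z : ℂ} (hz : z ≠ 0) :
    Summable fun k : ℤ => ‖(t : ℂ) ^ (k ^ 2) * z ^ k‖ := by
  have ht : (t : ℂ) ≠ 0 := by exact_mod_cast ht0.ne'
  rw [summable_norm_iff]
  have := (summable_jacobiTheta₂_term_iff (Complex.log z / (2 * Real.pi * Complex.I))
    (-Complex.I * (Real.log t / Real.pi : ℝ))).2 (by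
      simp only [neg_mul, Complex.neg_im, Complex.mul_im, Complex.I_re, Complex.I_im,
        Complex.ofReal_re, Complex.ofReal_im]
      have := div_neg_of_neg_of_pos (Real.log_neg ht0 ht1) Real.pi_pos
      linarith)
  refine this.congr fun k => ?_
  have hpi : (Real.pi : ℂ) ≠ 0 := by exact_mod_cast Real.pi_ne_zero
  rw [jacobiTheta₂_term, Complex.exp_add]
  have e1 : 2 * (Real.pi : ℂ) * Complex.I * k * (Complex.log z / (2 * Real.pi * Complex.I)) =
      k * Complex.log z := by field_simp
  have e2 : (Real.pi : ℂ) * Complex.I * k ^ 2 * (-Complex.I * (Real.log t / Real.pi : ℝ)) =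
      ((k ^ 2 : ℤ) : ℂ) * Complex.log t := by
    rw [← Complex.ofReal_log ht0.le]; push_cast; field_simp
    linear_combination (-(k : ℂ) ^ 2 * (Real.log t)) * Complex.I_sq
  rw [e1, e2, Complex.exp_int_mul, Complex.exp_int_mul, Complex.exp_log hz, Complex.exp_log ht,
    mul_comm]

theorem thetaSeries_shift {t : ℝ} (ht0 : 0 < t) {z : ℂ} (hz : z ≠ 0) :
    thetaSeries t z = t * z * thetaSeries t (t ^ 2 * z) := by
  have ht : (t : ℂ) ≠ 0 := by exact_mod_cast ht0.ne'
  rw [thetaSeries, thetaSeries, ← tsum_mul_left, ← (Equiv.addRight (1 : ℤ)).tsum_eq]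
  refine tsum_congr fun k => ?_
  simp only [Equiv.coe_addRight]
  rw [show (k + 1) ^ 2 = k ^ 2 + 2 * k + 1 by ring, zpow_add₀ ht, zpow_add₀ ht, zpow_add₀ hz,
    mul_zpow, zpow_mul]
  simp only [zpow_ofNat]
  ring

/-- The pairs of integers, split by the parity of the sum of their entries. -/
def intPairParity : (ℤ × ℤ) ⊕ (ℤ × ℤ) ≃ ℤ × ℤ where
  toFun := Sum.elim (fun x => (x.1 + x.2, x.1 - x.2)) (fun x => (x.1 + x.2 + 1, x.1 - x.2))
  invFun x := if (x.1 + x.2) % 2 = 0 then .inl ((x.1 + x.2) / 2, (x.1 - x.2) / 2)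
    else .inr ((x.1 + x.2) / 2, (x.1 - x.2) / 2)
  left_inv := by
    rintro (⟨a, b⟩ | ⟨a, b⟩)
    · have h : (a + b + (a - b)) % 2 = 0 := by omega
      refine (if_pos h).trans (congrArg Sum.inl (Prod.ext ?_ ?_)) <;> dsimp only [Sum.elim_inl] <;>
        omega
    · have h : ¬(a + b + 1 + (a - b)) % 2 = 0 := by omega
      refine (if_neg h).trans (congrArg Sum.inr (Prod.ext ?_ ?_)) <;> dsimp only [Sum.elim_inr] <;>
        omega
  right_inv := by
    rintro ⟨a, b⟩
    dsimp only
    split_ifs with h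
    · simp only [Sum.elim_inl, Prod.mk.injEq]; omega
    · simp only [Sum.elim_inr, Prod.mk.injEq]; omega

/-- Write the pair of summation indices as (s+d, s-d) or (s+d+1, s-d) according to the parity of its
sum. The sum of squares becomes 2s² + 2d², respectively 2s² + 2d² + 2s + 2d + 1, so each half of the
double series factorises into two series of nome h². -/
theorem thetaSeries_mul {h : ℝ} (h0 : 0 < h) (h1 : h < 1) {a b : ℂ} (ha : a ≠ 0) (hb : b ≠ 0) :
    thetaSeries h a * thetaSeries h b =
      thetaSeries (h ^ 2) (a * b) * thetaSeries (h ^ 2) (a / b) +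
        h * a * (thetaSeries (h ^ 2) (h ^ 2 * (a * b)) *
          thetaSeries (h ^ 2) (h ^ 2 * (a / b))) := by
  have hh : (h : ℂ) ≠ 0 := by exact_mod_cast h0.ne'
  have k0 : 0 < h ^ 2 := by positivity
  have k1 : h ^ 2 < 1 := by nlinarith
  have hab : a * b ≠ 0 := mul_ne_zero ha hb
  have hadb : a / b ≠ 0 := div_ne_zero ha hb
  have hab' : (h : ℂ) ^ 2 * (a * b) ≠ 0 := mul_ne_zero (pow_ne_zero _ hh) hab
  have hadb' : (h : ℂ) ^ 2 * (a / b) ≠ 0 := mul_ne_zero (pow_ne_zero _ hh) hadb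
  simp only [thetaSeries]
  rw [tsum_mul_tsum_of_summable_norm (summable_thetaSeries h0 h1 ha)
      (summable_thetaSeries h0 h1 hb),
    tsum_mul_tsum_of_summable_norm (summable_thetaSeries k0 k1 hab)
      (summable_thetaSeries k0 k1 hadb),
    tsum_mul_tsum_of_summable_norm (summable_thetaSeries k0 k1 hab')
      (summable_thetaSeries k0 k1 hadb'),
    ← tsum_mul_left, ← intPairParity.tsum_eq]
  have e1 : ∀ x : ℤ × ℤ,
      (h : ℂ) ^ ((x.1 + x.2) ^ 2) * a ^ (x.1 + x.2) * ((h : ℂ) ^ ((x.1 - x.2) ^ 2) * b ^ (x.1 - x.2)) =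
        ((h ^ 2 : ℝ) : ℂ) ^ (x.1 ^ 2) * (a * b) ^ x.1 *
          (((h ^ 2 : ℝ) : ℂ) ^ (x.2 ^ 2) * (a / b) ^ x.2) := by
    rintro ⟨s, d⟩
    dsimp only
    push_cast
    rw [zpow_add₀ ha, zpow_sub₀ hb, mul_zpow, div_zpow, ← zpow_natCast (h : ℂ) 2, ← zpow_mul,
      ← zpow_mul]
    have : (h : ℂ) ^ ((s + d) ^ 2) * (h : ℂ) ^ ((s - d) ^ 2) =
        (h : ℂ) ^ (((2 : ℕ) : ℤ) * s ^ 2) * (h : ℂ) ^ (((2 : ℕ) : ℤ) * d ^ 2) := by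
      rw [← zpow_add₀ hh, ← zpow_add₀ hh]; congr 1; push_cast; ring
    linear_combination (a ^ s * a ^ d * (b ^ s / b ^ d)) * this
  have e2 : ∀ x : ℤ × ℤ,
      (h : ℂ) ^ ((x.1 + x.2 + 1) ^ 2) * a ^ (x.1 + x.2 + 1) *
        ((h : ℂ) ^ ((x.1 - x.2) ^ 2) * b ^ (x.1 - x.2)) =
      h * a * (((h ^ 2 : ℝ) : ℂ) ^ (x.1 ^ 2) * ((h : ℂ) ^ 2 * (a * b)) ^ x.1 *
          (((h ^ 2 : ℝ) : ℂ) ^ (x.2 ^ 2) * ((h : ℂ) ^ 2 * (a / b)) ^ x.2)) := by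
    rintro ⟨s, d⟩
    dsimp only
    push_cast
    rw [zpow_add_one₀ ha, zpow_add₀ ha, zpow_sub₀ hb, mul_zpow, mul_zpow, mul_zpow, div_zpow,
      ← zpow_natCast (h : ℂ) 2, ← zpow_mul, ← zpow_mul, ← zpow_mul, ← zpow_mul]
    have : (h : ℂ) ^ ((s + d + 1) ^ 2) * (h : ℂ) ^ ((s - d) ^ 2) =
        h * ((h : ℂ) ^ (((2 : ℕ) : ℤ) * s ^ 2) * (h : ℂ) ^ (((2 : ℕ) : ℤ) * d ^ 2) *
          (h : ℂ) ^ (((2 : ℕ) : ℤ) * s) * (h : ℂ) ^ (((2 : ℕ) : ℤ) * d)) := by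
      rw [← zpow_add₀ hh, ← zpow_add₀ hh, ← zpow_add₀ hh, ← zpow_add₀ hh, ← zpow_one_add₀ hh]
      congr 1; push_cast; ring
    linear_combination (a ^ s * a ^ d * a * (b ^ s / b ^ d)) * this
  have s1 := summable_mul_of_summable_norm (summable_thetaSeries k0 k1 hab)
      (summable_thetaSeries k0 k1 hadb)
  have s2 := (summable_mul_of_summable_norm (summable_thetaSeries k0 k1 hab')
      (summable_thetaSeries k0 k1 hadb')).mul_left (h * a)
  rw [Summable.tsum_sum]
  · simp only [intPairParity, Equiv.coe_fn_mk, Sum.elim_inl, Sum.elim_inr]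
    rw [tsum_congr e1, tsum_congr e2]
  · exact s1.congr fun x => (e1 x).symm
  · exact s2.congr fun x => (e2 x).symm

/-! ### Gaussian binomials and the finite form of the triple product -/

/-- The Gaussian binomial coefficients. -/
def gaussBinom (p : ℂ) : ℕ → ℕ → ℂ
  | _, 0 => 1
  | 0, _ + 1 => 0
  | n + 1, k + 1 => gaussBinom p n k + p ^ (k + 1) * gaussBinom p n (k + 1)

theorem gaussBinom_zero_right (p : ℂ) (n : ℕ) : gaussBinom p n 0 = 1 := by cases n <;> rfl

theorem gaussBinom_eq_zero (p : ℂ) {n k : ℕ} (h : n < k) : gaussBinom p n k = 0 := by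
  induction n generalizing k with
  | zero => obtain ⟨k, rfl⟩ := Nat.exists_eq_succ_of_ne_zero (by omega : k ≠ 0); rfl
  | succ n ih =>
    obtain ⟨k, rfl⟩ := Nat.exists_eq_succ_of_ne_zero (by omega : k ≠ 0)
    rw [gaussBinom, ih (by omega), ih (by omega)]; simp

/-- The finite product `(p; p)_n`. -/
def qFact (p : ℂ) (n : ℕ) : ℂ := ∏ i ∈ Finset.range n, (1 - p ^ (i + 1))

theorem qFact_succ (p : ℂ) (n : ℕ) : qFact p (n + 1) = qFact p n * (1 - p ^ (n + 1)) :=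
  Finset.prod_range_succ _ _

/-- Pascal's rule, combined with 1 - p^{j+k} = (1 - p^j) + p^j (1 - p^k). -/
theorem gaussBinom_mul_qFact (p : ℂ) (j k : ℕ) :
    gaussBinom p (j + k) j * (qFact p j * qFact p k) = qFact p (j + k) := by
  obtain ⟨n, hn⟩ : ∃ n, j + k = n := ⟨_, rfl⟩
  induction n generalizing j k with
  | zero =>
    obtain ⟨rfl, rfl⟩ : j = 0 ∧ k = 0 := by omega
    simp [qFact, gaussBinom]
  | succ n ih =>
    rcases j with _ | j
    · simp [qFact, gaussBinom_zero_right]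
    rcases k with _ | k
    · have h1 := ih j 0 (by omega)
      simp only [add_zero] at h1 ⊢
      rw [gaussBinom, gaussBinom_eq_zero p (by omega : j < j + 1), qFact_succ]
      linear_combination (1 - p ^ (j + 1)) * h1
    · have h1 := ih j (k + 1) (by omega)
      have h2 := ih (j + 1) k (by omega)
      have e : j + 1 + (k + 1) = (j + (k + 1)) + 1 := by omega
      have e' : j + 1 + k = j + (k + 1) := by omega
      rw [e'] at h2
      rw [e, gaussBinom, qFact_succ p j, qFact_succ p k, qFact_succ p (j + (k + 1))]
      rw [qFact_succ p j] at h2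
      rw [qFact_succ p k] at h1
      have : p ^ (j + (k + 1) + 1) = p ^ (j + 1) * p ^ (k + 1) := by rw [← pow_add]; congr 1; omega
      rw [this]
      linear_combination (1 - p ^ (j + 1)) * h1 + p ^ (j + 1) * (1 - p ^ (k + 1)) * h2

/-- Cauchy's q-binomial theorem in the base h², so that the quadratic exponent j(j-1) needs no
halving. Splitting off the factor 1 + x replaces x by x h² in the rest. -/
theorem prod_one_add_mul_pow (h x : ℂ) (N : ℕ) :
    ∏ i ∈ Finset.range N, (1 + x * (h ^ 2) ^ i) =
      ∑ j ∈ Finset.range (N + 1), h ^ (j * (j - 1)) * gaussBinom (h ^ 2) N j * x ^ j := by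
  induction N generalizing x with
  | zero => simp [gaussBinom]
  | succ N ih =>
    have e : ∀ i ∈ Finset.range N, 1 + x * (h ^ 2) ^ (i + 1) = 1 + (x * h ^ 2) * (h ^ 2) ^ i :=
      fun i _ => by rw [pow_succ]; ring
    rw [Finset.prod_range_succ', Finset.prod_congr rfl e, ih, pow_zero, mul_one,
      Finset.sum_range_succ' _ (N + 1)]
    have e2 : ∀ j ∈ Finset.range (N + 1),
        h ^ ((j + 1) * (j + 1 - 1)) * gaussBinom (h ^ 2) (N + 1) (j + 1) * x ^ (j + 1) =
        x * (h ^ (j * (j - 1)) * gaussBinom (h ^ 2) N j * (x * h ^ 2) ^ j) +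
        h ^ ((j + 1) * (j + 1 - 1)) * gaussBinom (h ^ 2) N (j + 1) * (x * h ^ 2) ^ (j + 1) := by
      intro j _
      have : (j + 1) * (j + 1 - 1) = j * (j - 1) + 2 * j := by
        rcases j with _ | j
        · rfl
        · simp only [Nat.add_sub_cancel]; ring
      rw [gaussBinom, this, pow_add, pow_mul h 2 j]
      ring
    rw [Finset.sum_congr rfl e2, Finset.sum_add_distrib, ← Finset.mul_sum, mul_add, mul_one]
    have e3 := Finset.sum_range_succ'
      (fun j => h ^ (j * (j - 1)) * gaussBinom (h ^ 2) N j * (x * h ^ 2) ^ j) (N + 1)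
    rw [Finset.sum_range_succ, gaussBinom_eq_zero _ (by omega : N < N + 1)] at e3
    simp only [mul_zero, zero_mul, add_zero, pow_zero, mul_one, gaussBinom_zero_right] at e3 ⊢
    linear_combination e3

/-- This is the q-binomial theorem with 2n factors at x = -z h^{-2n}. The upper n factors are those
of the first product; the lower n, in reversed order, are those of the second one up to the
monomials -z h^{-2(i+1)}. -/
theorem finite_triple_product {h z : ℂ} (hh : h ≠ 0) (hz : z ≠ 0) (n : ℕ) :
    (∏ i ∈ Finset.range n, (1 - z * (h ^ 2) ^ i)) * ∏ i ∈ Finset.range n, (1 - h ^ 2 / z * (h ^ 2) ^ i) =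
      ∑ j ∈ Finset.range (2 * n + 1),
        h ^ (((j : ℤ) - n) ^ 2) * (-z / h) ^ ((j : ℤ) - n) * gaussBinom (h ^ 2) (2 * n) j := by
  have key := prod_one_add_mul_pow h (-z / (h ^ 2) ^ n) (2 * n)
  obtain ⟨w, hzw⟩ : ∃ w, -z = w * h := ⟨-z / h, by field_simp⟩
  have hw2 : w * h / h = w := by field_simp
  have e1 : ∀ i ∈ Finset.range n, 1 + -z / (h ^ 2) ^ n * (h ^ 2) ^ (n + i) = 1 - z * (h ^ 2) ^ i :=
    fun i _ => by rw [pow_add]; field_simp; ring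
  have e2 : ∀ i ∈ Finset.range n, 1 + -z / (h ^ 2) ^ n * (h ^ 2) ^ (n - 1 - i) =
      (-z / (h ^ 2) ^ (i + 1)) * (1 - h ^ 2 / z * (h ^ 2) ^ i) := fun i hi => by
    have hi' := Finset.mem_range.1 hi
    have : (h ^ 2) ^ n = (h ^ 2) ^ (n - 1 - i) * (h ^ 2) ^ (i + 1) := by
      rw [← pow_add]; congr 1; omega
    rw [this, pow_succ]; field_simp; ring
  have e3 : ∏ i ∈ Finset.range n, (-z / (h ^ 2) ^ (i + 1)) = h ^ (-(n : ℤ) ^ 2) * (-z / h) ^ n := by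
    clear key e1 e2
    rw [hzw, hw2]
    clear hzw hw2 hz
    induction n with
    | zero => simp
    | succ n ih =>
      rw [Finset.prod_range_succ, ih]
      push_cast
      rw [show (-((n : ℤ) + 1) ^ 2) = -(n : ℤ) ^ 2 - (2 * n : ℕ) - 1 by push_cast; ring,
        zpow_sub₀ hh, zpow_sub₀ hh, zpow_natCast, zpow_one, pow_succ, pow_succ, ← pow_mul]
      field_simp
      ring
  rw [two_mul, Finset.prod_range_add, Finset.prod_congr rfl e1, ← Finset.prod_range_reflect,
    Finset.prod_congr rfl e2, Finset.prod_mul_distrib, e3, ← two_mul] at key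
  have hz' : -z / h ≠ 0 := div_ne_zero (neg_ne_zero.2 hz) hh
  have hc : h ^ (-(n : ℤ) ^ 2) * (-z / h) ^ n ≠ 0 := mul_ne_zero (zpow_ne_zero _ hh) (pow_ne_zero _ hz')
  apply mul_left_cancel₀ hc
  rw [Finset.mul_sum]
  rw [show h ^ (-(n : ℤ) ^ 2) * (-z / h) ^ n * ((∏ i ∈ Finset.range n, (1 - z * (h ^ 2) ^ i)) *
      ∏ i ∈ Finset.range n, (1 - h ^ 2 / z * (h ^ 2) ^ i)) = _ from Eq.trans (by ring) key]
  refine Finset.sum_congr rfl fun j _ => ?_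
  have e4 : h ^ (j * (j - 1)) * (-z / (h ^ 2) ^ n) ^ j =
      h ^ (-(n : ℤ) ^ 2) * (-z / h) ^ n * (h ^ (((j : ℤ) - n) ^ 2) * (-z / h) ^ ((j : ℤ) - n)) := by
    rw [zpow_sub₀ hz', zpow_natCast, zpow_natCast]
    have e5 : h ^ (j * (j - 1)) = h ^ ((j : ℤ) ^ 2 - j) := by
      rw [← zpow_natCast]; congr 1
      rcases j with _ | j
      · rfl
      · push_cast [Nat.add_sub_cancel]; ring
    have e6 : h ^ (-(n : ℤ) ^ 2) * h ^ (((j : ℤ) - n) ^ 2) = h ^ ((j : ℤ) ^ 2 - (2 * n * j : ℕ)) := by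
      rw [← zpow_add₀ hh]; congr 1; push_cast; ring
    have e7 : (-z / (h ^ 2) ^ n) ^ j = (-z) ^ j / h ^ (2 * n * j) := by
      rw [div_pow, ← pow_mul, ← pow_mul]; congr 2; ring
    rw [zpow_sub₀ hh, zpow_natCast] at e5 e6
    rw [e5, e7, hzw, hw2, mul_pow]
    have hzn : w ^ n ≠ 0 := pow_ne_zero _ (by rwa [hzw, hw2] at hz')
    field_simp
    field_simp at e6
    linear_combination (-w ^ j) * e6
  linear_combination (gaussBinom (h ^ 2) (2 * n) j) * e4

theorem tendsto_qFact (hp0 : 0 < p) (hp1 : p < 1) :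
    Tendsto (qFact (p : ℂ)) atTop (𝓝 (qProd p p)) := by
  have h := (multipliable_qProd hp0 hp1 p).hasProd.tendsto_prod_nat
  refine h.congr fun n => Finset.prod_congr rfl fun i _ => ?_
  rw [pow_succ']

theorem pow_ne_one_of_pos_of_lt_one (hp0 : 0 < p) (hp1 : p < 1) (n : ℕ) : (p : ℂ) ^ (n + 1) ≠ 1 := by
  norm_cast
  exact (pow_lt_one₀ hp0.le hp1 (by omega)).ne

theorem qProd_self_ne_zero (hp0 : 0 < p) (hp1 : p < 1) : qProd p p ≠ 0 :=
  qProd_ne_zero hp0 hp1 fun i => by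
    rw [← pow_succ']; exact pow_ne_one_of_pos_of_lt_one hp0 hp1 i

theorem qFact_ne_zero (hp0 : 0 < p) (hp1 : p < 1) (n : ℕ) : qFact (p : ℂ) n ≠ 0 :=
  Finset.prod_ne_zero_iff.2 fun i _ =>
    sub_ne_zero.2 (pow_ne_one_of_pos_of_lt_one hp0 hp1 i).symm

theorem gaussBinom_eq_div (hp0 : 0 < p) (hp1 : p < 1) {n j : ℕ} (h : j ≤ n) :
    gaussBinom (p : ℂ) n j = qFact p n * ((qFact p j)⁻¹ * (qFact p (n - j))⁻¹) := by
  have := gaussBinom_mul_qFact (p : ℂ) j (n - j)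
  rw [Nat.add_sub_cancel' h] at this
  rw [← this]
  have h1 := qFact_ne_zero hp0 hp1 j
  have h2 := qFact_ne_zero hp0 hp1 (n - j)
  field_simp

/-- The central coefficients in the finite form of the triple product identity. -/
def centralBinom (p : ℂ) (n : ℕ) (k : ℤ) : ℂ :=
  if 0 ≤ n + k then gaussBinom p (2 * n) (n + k).toNat else 0

/-- For large n the coefficient is (p)_{2n} / ((p)_{n+k} (p)_{n-k}), and each of the three finite
products tends to the same non-zero limit. -/
theorem tendsto_centralBinom (hp0 : 0 < p) (hp1 : p < 1) (k : ℤ) :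
    Tendsto (fun n => centralBinom (p : ℂ) n k) atTop (𝓝 (qProd p p)⁻¹) := by
  have hQ := tendsto_qFact hp0 hp1
  have hQi := hQ.inv₀ (qProd_self_ne_zero hp0 hp1)
  have t1 : Tendsto (fun n : ℕ => 2 * n) atTop atTop :=
    tendsto_atTop_mono (fun n => show n ≤ 2 * n by omega) tendsto_id
  have t2 : ∀ k : ℤ, Tendsto (fun n : ℕ => ((n : ℤ) + k).toNat) atTop atTop := fun k =>
    tendsto_atTop.2 fun b => by
      filter_upwards [eventually_ge_atTop (b + k.natAbs)] with n hn
      omega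
  have key := (hQ.comp t1).mul ((hQi.comp (t2 k)).mul (hQi.comp (t2 (-k))))
  have e : qProd p p * ((qProd p p)⁻¹ * (qProd p p)⁻¹) = (qProd p p)⁻¹ := by
    have := qProd_self_ne_zero hp0 hp1
    field_simp
  rw [e] at key
  refine key.congr' ?_
  filter_upwards [eventually_ge_atTop k.natAbs] with n hn
  rw [centralBinom, if_pos (by omega), gaussBinom_eq_div hp0 hp1 (by omega)]
  simp only [Function.comp]
  congr 4
  omega

/-- The products (p)_n and their reciprocals converge, hence are bounded. Uniformity in n and k is
what dominated convergence needs. -/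
theorem exists_bound_centralBinom (hp0 : 0 < p) (hp1 : p < 1) :
    ∃ C : ℝ, ∀ n k, ‖centralBinom (p : ℂ) n k‖ ≤ C := by
  have hQ := tendsto_qFact hp0 hp1
  have hQi := hQ.inv₀ (qProd_self_ne_zero hp0 hp1)
  obtain ⟨C, hC⟩ := (Metric.isBounded_range_of_tendsto _ hQ).exists_norm_le
  obtain ⟨C', hC'⟩ := (Metric.isBounded_range_of_tendsto _ hQi).exists_norm_le
  have h0 : 0 ≤ C := (norm_nonneg _).trans (hC _ ⟨0, rfl⟩)
  have h0' : 0 ≤ C' := (norm_nonneg _).trans (hC' _ ⟨0, rfl⟩)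
  refine ⟨C * (C' * C'), fun n k => ?_⟩
  rw [centralBinom]
  split_ifs with h
  · rcases le_or_gt (n + k).toNat (2 * n) with h' | h'
    · rw [gaussBinom_eq_div hp0 hp1 h', norm_mul, norm_mul]
      gcongr
      · exact hC _ ⟨_, rfl⟩
      · exact hC' _ ⟨_, rfl⟩
      · exact hC' _ ⟨_, rfl⟩
    · rw [gaussBinom_eq_zero _ h', norm_zero]; positivity
  · rw [norm_zero]; positivity

/-- The Jacobi triple product, as the limit n → ∞ of its finite form; the limit passes through the
series by dominated convergence. -/
theorem theta_eq_thetaSeries {h : ℝ} (h0 : 0 < h) (h1 : h < 1) {z : ℂ} (hz : z ≠ 0) :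
    theta (h ^ 2) z =
      (qProd (h ^ 2) ((h ^ 2 : ℝ) : ℂ))⁻¹ * thetaSeries h (-z / h) := by
  have hh : (h : ℂ) ≠ 0 := by exact_mod_cast h0.ne'
  have k0 : 0 < h ^ 2 := by positivity
  have k1 : h ^ 2 < 1 := by nlinarith
  have hz' : -z / h ≠ 0 := div_ne_zero (neg_ne_zero.2 hz) hh
  obtain ⟨C, hC⟩ := exists_bound_centralBinom k0 k1
  have lim1 := tendsto_tsum_of_dominated_convergence (𝓕 := atTop)
    (f := fun (n : ℕ) (k : ℤ) => (h : ℂ) ^ (k ^ 2) * (-z / h) ^ k *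
      centralBinom ((h ^ 2 : ℝ) : ℂ) n k)
    ((summable_thetaSeries h0 h1 hz').mul_right C)
    (fun k => (tendsto_centralBinom k0 k1 k).const_mul ((h : ℂ) ^ (k ^ 2) * (-z / h) ^ k))
    (.of_forall fun n k => by
      rw [norm_mul]
      exact mul_le_mul_of_nonneg_left (hC n k) (norm_nonneg _))
  have lim2 := ((multipliable_qProd k0 k1 z).hasProd.tendsto_prod_nat).mul
    ((multipliable_qProd k0 k1 (((h ^ 2 : ℝ) : ℂ) / z)).hasProd.tendsto_prod_nat)
  have e : ∀ n : ℕ, (∏ i ∈ Finset.range n, (1 - z * ((h ^ 2 : ℝ) : ℂ) ^ i)) *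
      ∏ i ∈ Finset.range n, (1 - ((h ^ 2 : ℝ) : ℂ) / z * ((h ^ 2 : ℝ) : ℂ) ^ i) =
      ∑' k : ℤ, (h : ℂ) ^ (k ^ 2) * (-z / h) ^ k * centralBinom ((h ^ 2 : ℝ) : ℂ) n k := by
    intro n
    have := finite_triple_product hh hz n
    push_cast
    -- The finite sum is recentred at k = j - n and extended to all integers; `centralBinom`
    -- vanishes outside the range.
    rw [this, ← (Equiv.subRight (n : ℤ)).tsum_eq,
      tsum_eq_sum (s := (Finset.range (2 * n + 1)).map Nat.castEmbedding), Finset.sum_map]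
    · refine Finset.sum_congr rfl fun j _ => ?_
      simp [centralBinom]
    · intro k hk
      simp only [Equiv.subRight_apply, centralBinom, add_sub_cancel]
      split_ifs with hk0
      · rw [gaussBinom_eq_zero, mul_zero]
        by_contra hcon
        refine hk (Finset.mem_map.2 ⟨k.toNat, Finset.mem_range.2 (by omega), ?_⟩)
        simp only [Nat.castEmbedding_apply]; omega
      · simp
  have := tendsto_nhds_unique (lim2.congr e) lim1
  rw [tsum_mul_right] at this
  rw [theta_eq, qProd, qProd, this, thetaSeries, mul_comm]

end Theta

end EllipticU2

namespace EllipticU2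

/-! ### Brackets and the dynamical Yang–Baxter equation -/

section Bracket

/-- The bracket `[u] = q^{-u} θ(q^{2u})`. -/
def brk (p q : ℝ) (u : ℂ) : ℂ := (q : ℂ) ^ (-u) * theta p ((q : ℂ) ^ (2 * u))

variable {p q : ℝ}

theorem brk_neg (hp0 : 0 < p) (hp1 : p < 1) (hq0 : 0 < q) (u : ℂ) :
    brk p q (-u) = -brk p q u := by
  have hq : (q : ℂ) ≠ 0 := by exact_mod_cast hq0.ne'
  have h2 : (q : ℂ) ^ (2 * u) ≠ 0 := by simp [Complex.cpow_eq_zero_iff, hq]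
  have h1 : (q : ℂ) ^ u ≠ 0 := by simp [Complex.cpow_eq_zero_iff, hq]
  rw [brk, brk, neg_neg, mul_neg, Complex.cpow_neg, theta_inv hp0 hp1 h2, Complex.cpow_neg, two_mul,
    Complex.cpow_add _ _ hq]
  field_simp

/-- With X = q^{2x}, Y = q^{2y} the product is X^{-1} θ(XY) θ(X/Y). The triple product makes both
factors series of nome h = √p, and `thetaSeries_mul` separates X from Y at the price of squaring the
nome. -/
theorem exists_brk_mul_brk (hp0 : 0 < p) (hp1 : p < 1) (hq0 : 0 < q) :
    ∃ f g : ℂ → ℂ, ∀ x y, brk p q (x + y) * brk p q (x - y) = f x * g y - g x * f y := by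
  have hq : (q : ℂ) ≠ 0 := by exact_mod_cast hq0.ne'
  obtain ⟨h, h0, rfl⟩ : ∃ h : ℝ, 0 < h ∧ p = h ^ 2 :=
    ⟨√p, Real.sqrt_pos.2 hp0, (Real.sq_sqrt hp0.le).symm⟩
  have h1 : h < 1 := by nlinarith
  have hh : (h : ℂ) ≠ 0 := by exact_mod_cast h0.ne'
  obtain ⟨c, hc⟩ : ∃ c, c = (qProd (h ^ 2) ((h ^ 2 : ℝ) : ℂ))⁻¹ := ⟨_, rfl⟩
  refine ⟨fun x => c * (q : ℂ) ^ (2 * x) * thetaSeries (h ^ 2) (h ^ 2 * ((q : ℂ) ^ (2 * x)) ^ 2),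
    fun x => c * thetaSeries (h ^ 2) (((q : ℂ) ^ (2 * x)) ^ 2), fun x y => ?_⟩
  have hX : (q : ℂ) ^ (2 * x) ≠ 0 := by simp [Complex.cpow_eq_zero_iff, hq]
  have hY : (q : ℂ) ^ (2 * y) ≠ 0 := by simp [Complex.cpow_eq_zero_iff, hq]
  have e1 : (q : ℂ) ^ (2 * (x + y)) = (q : ℂ) ^ (2 * x) * (q : ℂ) ^ (2 * y) := by
    rw [mul_add, Complex.cpow_add _ _ hq]
  have e2 : (q : ℂ) ^ (2 * (x - y)) = (q : ℂ) ^ (2 * x) / (q : ℂ) ^ (2 * y) := by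
    rw [mul_sub, Complex.cpow_sub _ _ hq]
  have e3 : (q : ℂ) ^ (-(x + y)) * (q : ℂ) ^ (-(x - y)) = ((q : ℂ) ^ (2 * x))⁻¹ := by
    rw [← Complex.cpow_add _ _ hq, ← Complex.cpow_neg]; congr 1; ring
  simp only [brk]
  rw [e1, e2, mul_mul_mul_comm, e3]
  generalize (q : ℂ) ^ (2 * x) = X at *
  generalize (q : ℂ) ^ (2 * y) = Y at *
  rw [theta_eq_thetaSeries h0 h1 (mul_ne_zero hX hY), theta_eq_thetaSeries h0 h1 (div_ne_zero hX hY),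
    mul_mul_mul_comm,
    thetaSeries_mul h0 h1 (div_ne_zero (neg_ne_zero.2 (mul_ne_zero hX hY)) hh)
      (div_ne_zero (neg_ne_zero.2 (div_ne_zero hX hY)) hh)]
  have e4 : -(X * Y) / h * (-(X / Y) / h) = X ^ 2 / (h : ℂ) ^ 2 := by field_simp
  have e5 : -(X * Y) / h / (-(X / Y) / h) = Y ^ 2 := by field_simp
  have e6 : (h : ℂ) ^ 2 * (X ^ 2 / (h : ℂ) ^ 2) = X ^ 2 := by field_simp
  -- Quasi-periodicity brings the argument X²/h² to h²X², after which the expression is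
  -- antisymmetric in X and Y.
  rw [← hc, e4, e5, e6, thetaSeries_shift (t := h ^ 2) (z := X ^ 2 / (h : ℂ) ^ 2) (by positivity)
    (div_ne_zero (pow_ne_zero _ hX) (pow_ne_zero _ hh))]
  have e7 : ((h ^ 2 : ℝ) : ℂ) ^ 2 * (X ^ 2 / (h : ℂ) ^ 2) = (h : ℂ) ^ 2 * X ^ 2 := by
    push_cast; field_simp
  rw [e7]
  push_cast
  field_simp
  ring

/-- The three-term relation of Weierstrass. -/
theorem brk_three_term (hp0 : 0 < p) (hp1 : p < 1) (hq0 : 0 < q) (x y s t : ℂ) :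
    brk p q (x + y) * brk p q (x - y) * (brk p q (s + t) * brk p q (s - t)) -
      brk p q (x + s) * brk p q (x - s) * (brk p q (y + t) * brk p q (y - t)) +
      brk p q (x + t) * brk p q (x - t) * (brk p q (y + s) * brk p q (y - s)) = 0 := by
  -- Each pair of brackets is now a 2×2 determinant of vectors (f, g), and the claim is the Plücker
  -- relation among the four vectors at x, y, s, t.
  obtain ⟨f, g, h⟩ := exists_brk_mul_brk (q := q) hp0 hp1 hq0
  simp only [h]
  ring

/-- The R-matrix in terms of brackets, up to a factor that depends on the spectral parameter. -/
def brkR (b : ℂ → ℂ) (l u : ℂ) (i j x y : Fin 2) : ℂ :=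
  match i, j, x, y with
  | 0, 0, 0, 0 => b (u + 1)
  | 0, 1, 0, 1 => b u * b (l + 2) / b (l + 1)
  | 1, 0, 0, 1 => b 1 * b (l + 1 - u) / b (l + 1)
  | 0, 1, 1, 0 => b 1 * b (l + 1 + u) / b (l + 1)
  | 1, 0, 1, 0 => b u * b l / b (l + 1)
  | 1, 1, 1, 1 => b (u + 1)
  | _, _, _, _ => 0

-- Conservation of weight leaves twenty of the 64 components. Six are trivial, twelve are multiples
-- of one three-term relation after clearing denominators, and two need it twice, once with
-- arguments free of u and v. The denominators that occur are exactly [l], [l+1], [l+2].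
set_option maxHeartbeats 1000000 in
theorem brkR_yangBaxter {b : ℂ → ℂ} (hb : ∀ u, b (-u) = -b u)
    (h3 : ∀ x y s t, b (x + y) * b (x - y) * (b (s + t) * b (s - t)) -
      b (x + s) * b (x - s) * (b (y + t) * b (y - t)) +
      b (x + t) * b (x - t) * (b (y + s) * b (y - s)) = 0)
    (u v l : ℂ) (h0 : b l ≠ 0) (h1 : b (l + 1) ≠ 0) (h2 : b (l + 2) ≠ 0) (i j m n r s : Fin 2) :
    ∑ x, ∑ y, ∑ k, brkR b l v x y i m * brkR b l u s j k x * brkR b (l - wt x) (u + v) k n r y =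
    ∑ x, ∑ y, ∑ k, brkR b (l - wt s) v j n x y * brkR b l (u + v) s y k m *
      brkR b (l - wt m) u k x r i := by
  -- The three-term relation, parametrised by the four arguments of one of its products. The other
  -- eight are half-sums of these; they are supplied explicitly so that they appear literally as in
  -- the entries of the R-matrix.
  have W : ∀ a₁ a₂ a₃ a₄ a₅ a₆ a₇ a₈ a₉ a₁₀ a₁₁ a₁₂ : ℂ,
      (h₅ : (a₁ + a₂ + a₃ + a₄) / 2 = a₅ := by ring) → (h₆ : (a₁ + a₂ - a₃ - a₄) / 2 = a₆ := by ring) →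
      (h₇ : (a₁ - a₂ + a₃ - a₄) / 2 = a₇ := by ring) → (h₈ : (a₁ - a₂ - a₃ + a₄) / 2 = a₈ := by ring) →
      (h₉ : (a₁ + a₂ + a₃ - a₄) / 2 = a₉ := by ring) → (h₁₀ : (a₁ + a₂ - a₃ + a₄) / 2 = a₁₀ := by ring) →
      (h₁₁ : (a₁ - a₂ + a₃ + a₄) / 2 = a₁₁ := by ring) →
      (h₁₂ : (a₁ - a₂ - a₃ - a₄) / 2 = a₁₂ := by ring) →
      b a₁ * b a₂ * (b a₃ * b a₄) - b a₅ * b a₆ * (b a₇ * b a₈) + b a₉ * b a₁₀ * (b a₁₁ * b a₁₂) = 0 := by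
    rintro a₁ a₂ a₃ a₄ _ _ _ _ _ _ _ _ rfl rfl rfl rfl rfl rfl rfl rfl
    convert h3 ((a₁ + a₂) / 2) ((a₁ - a₂) / 2) ((a₃ + a₄) / 2) ((a₃ - a₄) / 2) using 6 <;> ring
  have e1 : l - 1 + 2 = l + 1 := by ring
  have e2 : l + 1 + 1 = l + 2 := by ring
  have e3 : l + 1 + 2 = l + 3 := by ring
  simp only [Fin.sum_univ_two]
  fin_cases i <;> fin_cases j <;> fin_cases m <;> fin_cases n <;> fin_cases r <;> fin_cases s <;>
    simp only [brkR, wt, Fin.zero_eta, Fin.mk_one, Matrix.cons_val_zero, Matrix.cons_val_one,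
      mul_zero, zero_mul, add_zero, zero_add]
  all_goals try simp only [sub_neg_eq_add, sub_add_cancel, e1, e2, e3]
  · ring
  · ring
  · have h := W (v + 1) (u + 1) (l + (u + v)) l (l + 1 + (u + v)) (-(l - 1)) v (-(u)) (u + v + 1) 1 (l + v) (-(l + u))
    simp only [hb] at h
    field_simp
    linear_combination (b 1) * h
  · have h := W (v + 1) (l + 1 - (u + v)) (u + 1) (l + 1) (l + 2) (-(u)) (-(l - (u + v))) v 1 (l + 1 - u) (u + v + 1) (-(l + 1 - v))
    simp only [hb] at h
    field_simp
    linear_combination (-b 1) * h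
  · ring
  · have h := W (l + 2) l (l + 2) (l + 2) (2 * l + 3) (-1) 1 1 (l + 1) (l + 1) (l + 3) (-(l + 1))
    have h' := W (l + 1 - v) (l + 2 + (u + v)) (l + 1 - u) (l + 2) (2 * l + 3) u (-(u + v + 1))
      (-v) (l + 1) (l + 2 + u) (l + 1 - (u + v)) (-(l + 2 + v))
    simp only [hb] at h h'
    field_simp
    linear_combination (b v * b u * b (u + v + 1)) * h + b 1 ^ 3 * h'
  · have h := W (v + 1) (l + 1 + u) (u + v) l (l + 1 + (u + v)) 1 (-(l - v)) (-(u)) (u + v + 1) (l + 1) v (-(l + u))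
    simp only [hb] at h
    field_simp
    linear_combination (b 1 * b (l - 1)) * h
  · have h := W (l - v) (u + v) (u + 1) (l + 1) (l + 1 + u) (-1) (-(v)) (l - (u + v)) u l (l + 1 - v) (-(u + v + 1))
    simp only [hb] at h
    field_simp
    linear_combination (-b 1) * h
  · have h := W (l + 2 - v) (u + v + 1) u (l + 1) (l + 2 + u) 1 (-(v)) (l + 1 - (u + v)) (u + 1) (l + 2) (l + 1 - v) (-(u + v))
    simp only [hb] at h
    field_simp
    linear_combination (-b 1) * h
  · have h := W v (l + 2) (l + 1 + u) (u + v + 1) (l + 2 + (u + v)) (-(u)) (-1) (-(l + 1 - v)) (l + 1) (v + 1) (u + v) (-(l + 2 + u))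
    simp only [hb] at h
    field_simp
    linear_combination (b 1) * h
  · have h := W (v + 1) (u + v) (l - u) (l + 1) (l + 1 + v) (-(l - (u + v))) (-(u)) 1 v (u + v + 1) (l + 1 - u) (-(l))
    simp only [hb] at h
    field_simp
    linear_combination (-b 1) * h
  · have h := W (l + 1 + v) (u + 1) (u + v) l (l + 1 + (u + v)) 1 v (l - u) (u + v + 1) (l + 1) (l + v) (-(u))
    simp only [hb] at h
    field_simp
    linear_combination (b 1) * h
  · have h := W (l + 1 + v) u (u + v + 1) (l + 2) (l + 2 + (u + v)) (-1) v (l + 1 - u) (u + v) (l + 1) (l + 2 + v) (-(u + 1))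
    simp only [hb] at h
    field_simp
    linear_combination (b 1) * h
  · have h := W v (u + v + 1) (l + 2 - u) (l + 1) (l + 2 + v) (-(l + 1 - (u + v))) (-(u)) (-1) (v + 1) (u + v) (l + 1 - u) (-(l + 2))
    simp only [hb] at h
    field_simp
    linear_combination (-b (l + 3) * b 1) * h
  · have h := W (l + 2) l l l (2 * l + 1) 1 1 1 (l + 1) (l + 1) (l + 1) (-(l - 1))
    have h' := W (l + 1 + v) (l - (u + v)) (l + 1 + u) l (2 * l + 1) (-u) (u + v + 1) v (l + 1)
      (l - u) (l + 1 + (u + v)) (-(l - v))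
    simp only [hb] at h h'
    field_simp
    linear_combination (b v * b u * b (u + v + 1)) * h + b 1 ^ 3 * h'
  · ring
  · have h := W 1 (l + 1 + v) (l + 1 + u) (u + v + 1) (l + 2 + (u + v)) (-(u)) (-(v)) (-(l)) (l + 1) (v + 1) (u + 1) (-(l + 1 + (u + v)))
    simp only [hb] at h
    field_simp
    linear_combination (b 1) * h
  · have h := W 1 (l + 2 - v) (u + v + 1) (l + 2 - u) (l + 3) (-(v)) (-(l + 1 - (u + v))) (-(u)) (u + 1) (l + 2 - (u + v)) (v + 1) (-(l + 2))
    simp only [hb] at h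
    field_simp
    linear_combination (-b 1) * h
  · ring
  · ring

end Bracket

end EllipticU2

namespace EllipticU2

/-! ### Calculus in the field of meromorphic functions -/

open Filter Topology

theorem Mero.of_eq {f : ℂ → ℂ} (hf : Meromorphic f) : Mero.of f = Mero.mk ⟨f, hf⟩ := dif_pos hf

theorem Mero.mk_eq_mk {f g : meroFun} :
    Mero.mk f = Mero.mk g ↔ (f : ℂ → ℂ) =ᶠ[codiscrete ℂ] g := by
  refine (Ideal.Quotient.eq (I := meroNull)).trans ?_
  show ((f - g : meroFun) : ℂ → ℂ) =ᶠ[codiscrete ℂ] 0 ↔ _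
  rw [eventuallyEq_iff_sub (f := (f : ℂ → ℂ))]
  rfl

theorem Mero.of_congr {f g : ℂ → ℂ} (hf : Meromorphic f) (hfg : f =ᶠ[codiscrete ℂ] g) :
    Mero.of f = Mero.of g := by
  rw [Mero.of_eq hf, Mero.of_eq (hf.congr_codiscrete hfg)]
  exact Mero.mk_eq_mk.2 hfg

theorem Mero.of_add {f g : ℂ → ℂ} (hf : Meromorphic f) (hg : Meromorphic g) :
    Mero.of f + Mero.of g = Mero.of (fun l => f l + g l) := by
  rw [Mero.of_eq hf, Mero.of_eq hg, Mero.of_eq (hf.fun_add hg), ← map_add]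
  rfl

theorem Mero.of_mul {f g : ℂ → ℂ} (hf : Meromorphic f) (hg : Meromorphic g) :
    Mero.of f * Mero.of g = Mero.of (fun l => f l * g l) := by
  rw [Mero.of_eq hf, Mero.of_eq hg, Mero.of_eq (hf.fun_mul hg), ← map_mul]
  rfl

theorem Mero.of_const (c : ℂ) : Mero.of (fun _ => c) = algebraMap ℂ Mero c := by
  rw [Mero.of_eq (Meromorphic.const c)]
  rfl

theorem Mero.of_zero : Mero.of (fun _ => 0) = 0 := by
  rw [Mero.of_const, map_zero]

theorem Mero.of_sum {ι : Type*} (s : Finset ι) {f : ι → ℂ → ℂ} (hf : ∀ i, Meromorphic (f i)) :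
    ∑ i ∈ s, Mero.of (f i) = Mero.of (fun l => ∑ i ∈ s, f i l) := by
  classical
  have h : ∀ t : Finset ι, Meromorphic fun l => ∑ i ∈ t, f i l := fun t => by
    simpa [Finset.sum_fn] using Meromorphic.sum (s := t) (fun i _ => hf i)
  induction s using Finset.induction_on with
  | empty => simp [Mero.of_zero]
  | insert a s ha ih =>
    rw [Finset.sum_insert ha, ih, Mero.of_add (hf a) (h s)]
    simp [Finset.sum_insert ha]

theorem Mero.shift_of {f : ℂ → ℂ} (hf : Meromorphic f) (α : ℂ) :
    Mero.shift α (Mero.of f) = Mero.of (fun l => f (l + α)) := by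
  rw [Mero.of_eq hf, Mero.of_eq (meromorphic_shift α hf)]
  rfl

theorem Mero.bar_of {f : ℂ → ℂ} (hf : Meromorphic f) :
    Mero.bar (Mero.of f) = Mero.of (fun l => conj (f (conj l))) := by
  rw [Mero.of_eq hf, Mero.of_eq (meromorphic_conj hf)]
  rfl

theorem Mero.shift_zero (f : Mero) : Mero.shift 0 f = f := by
  obtain ⟨f, rfl⟩ := Mero.mk_surjective f
  refine congrArg Mero.mk (Subtype.ext (funext fun x => ?_))
  exact congrArg (f : ℂ → ℂ) (add_zero x)

theorem Mero.shift_shift (α β : ℂ) (f : Mero) :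
    Mero.shift α (Mero.shift β f) = Mero.shift (α + β) f := by
  obtain ⟨f, rfl⟩ := Mero.mk_surjective f
  refine congrArg Mero.mk (Subtype.ext (funext fun x => ?_))
  exact congrArg (f : ℂ → ℂ) (add_assoc x α β)

theorem Mero.bar_bar (f : Mero) : Mero.bar (Mero.bar f) = f := by
  obtain ⟨f, rfl⟩ := Mero.mk_surjective f
  refine congrArg Mero.mk (Subtype.ext (funext fun x => ?_))
  show conj (conj ((f : ℂ → ℂ) (conj (conj x)))) = _
  simp

theorem Mero.bar_shift (α : ℂ) (f : Mero) :
    Mero.bar (Mero.shift α f) = Mero.shift (conj α) (Mero.bar f) := by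
  obtain ⟨f, rfl⟩ := Mero.mk_surjective f
  refine congrArg Mero.mk (Subtype.ext (funext fun x => ?_))
  show conj ((f : ℂ → ℂ) (conj x + α)) = conj ((f : ℂ → ℂ) (conj (x + conj α)))
  simp

theorem Mero.shift_algebraMap (α c : ℂ) :
    Mero.shift α (algebraMap ℂ Mero c) = algebraMap ℂ Mero c := rfl

theorem Mero.bar_algebraMap (c : ℂ) :
    Mero.bar (algebraMap ℂ Mero c) = algebraMap ℂ Mero (conj c) := rfl

theorem Mero.shift_smul (α c : ℂ) (f : Mero) : Mero.shift α (c • f) = c • Mero.shift α f := by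
  rw [Algebra.smul_def, Algebra.smul_def, map_mul, Mero.shift_algebraMap]

theorem Mero.bar_smul (c : ℂ) (f : Mero) : Mero.bar (c • f) = conj c • Mero.bar f := by
  rw [Algebra.smul_def, Algebra.smul_def, map_mul, Mero.bar_algebraMap]

/-- Conservation of weight. All compatibilities of the relations with bidegrees rest on it. -/
theorem ellRnum_eq_zero {p q : ℝ} {l z : ℂ} {a b x y : Fin 2} (h : wt a + wt b ≠ wt x + wt y) :
    ellRnum p q l z a b x y = 0 := by
  revert h
  fin_cases a <;> fin_cases b <;> fin_cases x <;> fin_cases y <;>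
    simp [ellRnum, wt]

/-- The matrix elements of the R-matrix, with cleared spectral denominators, as meromorphic
functions of the dynamical variable. -/
def rM (p q : ℝ) (z : ℂ) (a b x y : Fin 2) : Mero := Mero.of fun l => ellRnum p q l z a b x y

theorem rM_eq_zero {p q : ℝ} {z : ℂ} {a b x y : Fin 2} (h : wt a + wt b ≠ wt x + wt y) :
    rM p q z a b x y = 0 := by
  simp only [rM, ellRnum_eq_zero (p := p) (q := q) h, Mero.of_zero]

/-- The standing assumptions on `p` and `q`. -/
class GoodParams (p q : ℝ) : Prop where
  p_pos : 0 < p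
  p_lt_one : p < 1
  q_pos : 0 < q
  q_lt_one : q < 1
  q_sq_ne : ∀ m : ℕ, q ^ 2 ≠ p ^ m

/-! ### The elliptic R-matrix in terms of brackets -/

section Elliptic

variable {p q : ℝ} [GoodParams p q]

open GoodParams

theorem q_ne_zero (p q : ℝ) [GoodParams p q] : (q : ℂ) ≠ 0 := by exact_mod_cast (q_pos (p := p) (q := q)).ne'

theorem q_cpow_ne_zero (p q : ℝ) [GoodParams p q] (u : ℂ) : (q : ℂ) ^ u ≠ 0 := by
  simp [Complex.cpow_eq_zero_iff, q_ne_zero p q]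

/-- The zeros of θ are integral powers of p. The non-negative powers are excluded by assumption, the
others by q² < 1 ≤ p^m. -/
theorem theta_q_sq_ne_zero (p q : ℝ) [GoodParams p q] : theta p ((q : ℂ) ^ 2) ≠ 0 := by
  have hp := p_pos (p := p) (q := q)
  have hp1 := p_lt_one (p := p) (q := q)
  have hq := q_pos (p := p) (q := q)
  have hq1 := q_lt_one (p := p) (q := q)
  refine theta_ne_zero hp hp1 (pow_ne_zero _ (q_ne_zero p q)) fun m => ?_
  norm_cast
  intro h
  rcases Int.le_total 0 m with hm | hm
  · obtain ⟨n, rfl⟩ := Int.eq_ofNat_of_zero_le hm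
    exact q_sq_ne (p := p) n (by simpa using h)
  · have h1 : (1 : ℝ) ≤ p ^ m := one_le_zpow_of_nonpos₀ hp hp1.le hm
    nlinarith

theorem theta_cpow (u : ℂ) : theta p ((q : ℂ) ^ (2 * u)) = (q : ℂ) ^ u * brk p q u := by
  rw [brk, Complex.cpow_neg, ← mul_assoc, mul_inv_cancel₀ (q_cpow_ne_zero p q u), one_mul]

theorem brk_neg' (u : ℂ) : brk p q (-u) = -brk p q u :=
  brk_neg (p_pos (p := p) (q := q)) (p_lt_one (p := p) (q := q)) (q_pos (p := p) (q := q)) u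

theorem brk_one_ne_zero (p q : ℝ) [GoodParams p q] : brk p q 1 ≠ 0 := by
  have := theta_q_sq_ne_zero p q
  rw [show (q : ℂ) ^ 2 = (q : ℂ) ^ (2 * (1 : ℂ)) by rw [mul_one, Complex.cpow_ofNat],
    theta_cpow] at this
  exact right_ne_zero_of_mul this

theorem exists_cpow_eq (p q : ℝ) [GoodParams p q] {z : ℂ} (hz : z ≠ 0) : ∃ u : ℂ, z = (q : ℂ) ^ (2 * u) := by
  have hq := q_pos (p := p) (q := q)
  have hl : Complex.log q ≠ 0 := by
    rw [← Complex.ofReal_log hq.le]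
    exact_mod_cast (Real.log_neg hq (q_lt_one (p := p) (q := q))).ne
  refine ⟨Complex.log z / (2 * Complex.log q), ?_⟩
  rw [Complex.cpow_def_of_ne_zero (q_ne_zero p q)]
  have : Complex.log q * (2 * (Complex.log z / (2 * Complex.log q))) = Complex.log z := by
    field_simp
  rw [this, Complex.exp_log hz]

/-- In every entry the powers of q that convert θ into brackets collect to the same factor q^{u+1}.
This uniformity transfers the Yang–Baxter equation from brackets to θ. -/
theorem ellRnum_eq_brkR (l u : ℂ) (a b x y : Fin 2) :
    ellRnum p q l ((q : ℂ) ^ (2 * u)) a b x y =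
      (q : ℂ) ^ (u + 1) * brkR (brk p q) l u a b x y := by
  have hq := q_ne_zero p q
  have t1 : theta p ((q : ℂ) ^ 2 * (q : ℂ) ^ (2 * u)) = (q : ℂ) ^ (u + 1) * brk p q (u + 1) := by
    rw [← theta_cpow, ← Complex.cpow_ofNat, ← Complex.cpow_add _ _ hq]; congr 2; ring
  have t2 : theta p ((q : ℂ) ^ 2) = (q : ℂ) ^ (1 : ℂ) * brk p q 1 := by
    rw [← theta_cpow, mul_one, Complex.cpow_ofNat]
  have t3 : theta p ((q : ℂ) ^ (-2 * (l + 1)) * (q : ℂ) ^ (2 * u)) =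
      -((q : ℂ) ^ (u - (l + 1)) * brk p q (l + 1 - u)) := by
    rw [← Complex.cpow_add _ _ hq, ← mul_neg, ← brk_neg',
      show -(l + 1 - u) = u - (l + 1) by ring, ← theta_cpow]; congr 2; ring
  have t4 : theta p ((q : ℂ) ^ (-2 * (l + 1))) = -((q : ℂ) ^ (-(l + 1)) * brk p q (l + 1)) := by
    rw [← mul_neg, ← brk_neg', ← theta_cpow]; congr 2; ring
  have t5 : theta p ((q : ℂ) ^ (-2 * l)) = -((q : ℂ) ^ (-l) * brk p q l) := by
    rw [← mul_neg, ← brk_neg', ← theta_cpow]; congr 2; ring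
  have t6 : theta p ((q : ℂ) ^ (2 * (l + 1)) * (q : ℂ) ^ (2 * u)) =
      (q : ℂ) ^ (l + 1 + u) * brk p q (l + 1 + u) := by
    rw [← theta_cpow, ← Complex.cpow_add _ _ hq]; congr 2; ring
  have n1 := q_cpow_ne_zero p q (l + 1)
  have n2 := q_cpow_ne_zero p q (-(l + 1))
  have c1 : (q : ℂ) ^ u * (q : ℂ) ^ (l + 2) = (q : ℂ) ^ (u + 1) * (q : ℂ) ^ (l + 1) := by
    rw [← Complex.cpow_add _ _ hq, ← Complex.cpow_add _ _ hq]; congr 1; ring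
  have c2 : (q : ℂ) ^ (1 : ℂ) * (q : ℂ) ^ (u - (l + 1)) = (q : ℂ) ^ (u + 1) * (q : ℂ) ^ (-(l + 1)) := by
    rw [← Complex.cpow_add _ _ hq, ← Complex.cpow_add _ _ hq]; congr 1; ring
  have c3 : (q : ℂ) ^ (1 : ℂ) * (q : ℂ) ^ (l + 1 + u) = (q : ℂ) ^ (u + 1) * (q : ℂ) ^ (l + 1) := by
    rw [← Complex.cpow_add _ _ hq, ← Complex.cpow_add _ _ hq]; congr 1; ring
  have c4 : (q : ℂ) ^ u * (q : ℂ) ^ (-l) = (q : ℂ) ^ (u + 1) * (q : ℂ) ^ (-(l + 1)) := by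
    rw [← Complex.cpow_add _ _ hq, ← Complex.cpow_add _ _ hq]; congr 1; ring
  fin_cases a <;> fin_cases b <;> fin_cases x <;> fin_cases y <;>
    simp only [ellRnum, brkR, Fin.zero_eta, Fin.mk_one, mul_zero]
  · exact t1
  · rw [theta_cpow, theta_cpow, theta_cpow]
    -- At a zero of the denominator both sides are 0 by the convention on division, so the identity
    -- holds for every l.
    rcases eq_or_ne (brk p q (l + 1)) 0 with h0 | h0
    · simp [h0]
    · rw [mul_div_assoc', div_eq_div_iff (mul_ne_zero n1 h0) h0]
      linear_combination (brk p q u * brk p q (l + 2) * brk p q (l + 1)) * c1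
  · rw [t2, t6, theta_cpow]
    rcases eq_or_ne (brk p q (l + 1)) 0 with h0 | h0
    · simp [h0]
    · rw [mul_div_assoc', div_eq_div_iff (mul_ne_zero n1 h0) h0]
      linear_combination (brk p q 1 * brk p q (l + 1 + u) * brk p q (l + 1)) * c3
  · rw [t2, t3, t4]
    rcases eq_or_ne (brk p q (l + 1)) 0 with h0 | h0
    · simp [h0]
    · rw [mul_div_assoc', div_eq_div_iff (neg_ne_zero.2 (mul_ne_zero n2 h0)) h0]
      linear_combination (-brk p q 1 * brk p q (l + 1 - u) * brk p q (l + 1)) * c2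
  · rw [theta_cpow, t5, t4]
    rcases eq_or_ne (brk p q (l + 1)) 0 with h0 | h0
    · simp [h0]
    · rw [mul_div_assoc', div_eq_div_iff (neg_ne_zero.2 (mul_ne_zero n2 h0)) h0]
      linear_combination (-brk p q u * brk p q l * brk p q (l + 1)) * c4
  · exact t1

/-- Oddness of the bracket. Thus F is, up to a constant, the common denominator of the entries of
the R-matrix. -/
theorem Ffun_eq_brk (l : ℂ) : Ffun p q l = -(q : ℂ)⁻¹ * brk p q (l + 1) := by
  have hq := q_ne_zero p q
  have t4 : theta p ((q : ℂ) ^ (-2 * (l + 1))) = -((q : ℂ) ^ (-(l + 1)) * brk p q (l + 1)) := by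
    rw [← mul_neg, ← brk_neg', ← theta_cpow]; congr 2; ring
  have : (q : ℂ) ^ l * (q : ℂ) ^ (-(l + 1)) = (q : ℂ)⁻¹ := by
    rw [← Complex.cpow_add _ _ hq, ← Complex.cpow_neg_one]; congr 1; ring
  rw [Ffun, t4]
  linear_combination (-brk p q (l + 1)) * this

theorem differentiable_brk : Differentiable ℂ (brk p q) := by
  have hq := q_ne_zero p q
  have hd := differentiable_qProd (p_pos (p := p) (q := q)) (p_lt_one (p := p) (q := q))
  have h1 : Differentiable ℂ fun u : ℂ => (q : ℂ) ^ (-u) := fun u =>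
    (differentiableAt_id.neg).const_cpow (Or.inl hq)
  have h2 : Differentiable ℂ fun u : ℂ => (q : ℂ) ^ (2 * u) := fun u =>
    (differentiableAt_id.const_mul (2 : ℂ)).const_cpow (Or.inl hq)
  have h3 : Differentiable ℂ fun u : ℂ => (p : ℂ) / (q : ℂ) ^ (2 * u) := fun u =>
    (differentiableAt_const _).div (h2 u) (q_cpow_ne_zero p q _)
  exact h1.mul ((hd.comp h2).mul (hd.comp h3))

theorem meromorphic_brk (c : ℂ) : Meromorphic fun l => brk p q (l + c) := fun x => by
  have : Differentiable ℂ fun l => brk p q (l + c) :=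
    differentiable_brk.comp (differentiable_id.add_const c)
  exact (this.analyticAt x).meromorphicAt

/-- Identity theorem for an entire function that does not vanish at l = 1 - c, where its value is
[1]. -/
theorem eventually_brk_ne_zero (c : ℂ) : ∀ᶠ l in codiscrete ℂ, brk p q (l + c) ≠ 0 := by
  have hd : Differentiable ℂ fun l => brk p q (l + c) :=
    differentiable_brk.comp (differentiable_id.add_const c)
  have ha : AnalyticOnNhd ℂ (fun l => brk p q (l + c)) Set.univ := fun x _ => hd.analyticAt x
  rcases ha.eqOn_zero_or_eventually_ne_zero_of_preconnected isPreconnected_univ with h | h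
  · exact absurd (by simpa using h (Set.mem_univ (1 - c))) (brk_one_ne_zero p q)
  · exact h

theorem meromorphic_brk' : Meromorphic (brk p q) := by
  simpa using meromorphic_brk (p := p) (q := q) 0

theorem meromorphic_Ffun : Meromorphic (Ffun p q) := by
  have : Ffun p q = fun l => -(q : ℂ)⁻¹ * brk p q (l + 1) := funext Ffun_eq_brk
  rw [this]
  exact (Meromorphic.const _).fun_mul (meromorphic_brk 1)

theorem meromorphic_ellRnum {z : ℂ} (hz : z ≠ 0) (a b x y : Fin 2) :
    Meromorphic fun l => ellRnum p q l z a b x y := by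
  obtain ⟨u, rfl⟩ := exists_cpow_eq p q hz
  simp only [ellRnum_eq_brkR]
  refine (Meromorphic.const _).fun_mul ?_
  have k := @meromorphic_brk p q _
  have k0 := @meromorphic_brk' p q _
  have k1 : Meromorphic fun l => brk p q (l + 1 - u) := by
    simpa [add_sub_assoc] using k (1 - u)
  have k2 : Meromorphic fun l => brk p q (l + 1 + u) := by
    simpa [add_assoc] using k (1 + u)
  have kc := fun c : ℂ => Meromorphic.const (𝕜 := ℂ) c
  fin_cases a <;> fin_cases b <;> fin_cases x <;> fin_cases y <;>
    simp only [brkR, Fin.zero_eta, Fin.mk_one]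
  all_goals first | exact kc _ | skip
  · exact ((kc _).fun_mul (k 2)).fun_div (k 1)
  · exact ((kc _).fun_mul k2).fun_div (k 1)
  · exact ((kc _).fun_mul k1).fun_div (k 1)
  · exact ((kc _).fun_mul k0).fun_div (k 1)

theorem rM_yangBaxter {z w : ℂ} (hz : z ≠ 0) (hw : w ≠ 0) (i j m n r s : Fin 2) :
    ∑ x, ∑ y, ∑ k, rM p q z x y i m * rM p q w s j k x *
      Mero.shift (-wt x) (rM p q (w * z) k n r y) =
    ∑ x, ∑ y, ∑ k, Mero.shift (-wt s) (rM p q z j n x y) * rM p q (w * z) s y k m *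
      Mero.shift (-wt m) (rM p q w k x r i) := by
  have hwz := mul_ne_zero hw hz
  have M := @meromorphic_ellRnum p q _
  have MS := fun (z : ℂ) (hz : z ≠ 0) (a b x y : Fin 2) (α : ℂ) =>
    meromorphic_shift α (M hz a b x y)
  simp only [rM]
  simp only [Mero.shift_of (M hz _ _ _ _), Mero.shift_of (M hw _ _ _ _),
    Mero.shift_of (M hwz _ _ _ _)]
  have e1 : ∀ x y k : Fin 2, Mero.of (fun l => ellRnum p q l z x y i m) *
      Mero.of (fun l => ellRnum p q l w s j k x) *
      Mero.of (fun l => ellRnum p q (l + -wt x) (w * z) k n r y) =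
      Mero.of (fun l => ellRnum p q l z x y i m * ellRnum p q l w s j k x *
        ellRnum p q (l + -wt x) (w * z) k n r y) := fun x y k => by
    rw [Mero.of_mul (M hz _ _ _ _) (M hw _ _ _ _),
      Mero.of_mul ((M hz _ _ _ _).fun_mul (M hw _ _ _ _)) (MS _ hwz _ _ _ _ _)]
  have e2 : ∀ x y k : Fin 2, Mero.of (fun l => ellRnum p q (l + -wt s) z j n x y) *
      Mero.of (fun l => ellRnum p q l (w * z) s y k m) *
      Mero.of (fun l => ellRnum p q (l + -wt m) w k x r i) =
      Mero.of (fun l => ellRnum p q (l + -wt s) z j n x y * ellRnum p q l (w * z) s y k m *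
        ellRnum p q (l + -wt m) w k x r i) := fun x y k => by
    rw [Mero.of_mul (MS _ hz _ _ _ _ _) (M hwz _ _ _ _),
      Mero.of_mul ((MS _ hz _ _ _ _ _).fun_mul (M hwz _ _ _ _)) (MS _ hw _ _ _ _ _)]
  have m1 : ∀ x y k : Fin 2, Meromorphic (fun l => ellRnum p q l z x y i m *
      ellRnum p q l w s j k x * ellRnum p q (l + -wt x) (w * z) k n r y) := fun x y k =>
    ((M hz _ _ _ _).fun_mul (M hw _ _ _ _)).fun_mul (MS _ hwz _ _ _ _ _)
  have m2 : ∀ x y k : Fin 2, Meromorphic (fun l => ellRnum p q (l + -wt s) z j n x y *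
      ellRnum p q l (w * z) s y k m * ellRnum p q (l + -wt m) w k x r i) := fun x y k =>
    ((MS _ hz _ _ _ _ _).fun_mul (M hwz _ _ _ _)).fun_mul (MS _ hw _ _ _ _ _)
  have mS : ∀ {f : Fin 2 → ℂ → ℂ}, (∀ x, Meromorphic (f x)) → Meromorphic fun l => ∑ x, f x l :=
    fun {f} hf => by simpa [Fin.sum_univ_two] using (hf 0).fun_add (hf 1)
  simp only [e1, e2]
  simp only [Mero.of_sum _ (m1 _ _), Mero.of_sum _ (m2 _ _)]
  simp only [Mero.of_sum _ (fun y => mS (m1 _ y)), Mero.of_sum _ (fun y => mS (m2 _ y))]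
  simp only [Mero.of_sum _ (fun x => mS (fun y => mS (m1 x y))),
    Mero.of_sum _ (fun x => mS (fun y => mS (m2 x y)))]
  refine Mero.of_congr (mS fun x => mS fun y => mS (m1 x y)) ?_
  obtain ⟨v, rfl⟩ := exists_cpow_eq p q hz
  obtain ⟨u, rfl⟩ := exists_cpow_eq p q hw
  have hq := q_ne_zero p q
  filter_upwards [eventually_brk_ne_zero (p := p) (q := q) 0, eventually_brk_ne_zero (p := p) (q := q) 1,
    eventually_brk_ne_zero (p := p) (q := q) 2] with l h0 h1 h2
  have key := brkR_yangBaxter (b := brk p q) brk_neg'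
    (brk_three_term (p_pos (p := p) (q := q)) (p_lt_one (p := p) (q := q)) (q_pos (p := p) (q := q)))
    u v l (by simpa using h0) h1 h2 i j m n r s
  rw [← Complex.cpow_add _ _ hq, ← mul_add]
  simp only [ellRnum_eq_brkR, ← sub_eq_add_neg]
  -- Each term contains one R-matrix with each of the parameters u, v, u+v, so the conversion
  -- factors agree in all terms.
  have := congrArg (fun t => (q : ℂ) ^ (u + 1) * (q : ℂ) ^ (v + 1) * (q : ℂ) ^ (u + v + 1) * t) key
  simp only [Finset.mul_sum] at this
  refine Eq.trans ?_ (this.trans ?_) <;> refine Finset.sum_congr rfl fun x _ =>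
    Finset.sum_congr rfl fun y _ => Finset.sum_congr rfl fun k _ => ?_ <;> ring

end Elliptic

end EllipticU2

namespace EllipticU2

/-! ### Symmetries of the R-matrix -/

section Symmetries

open Filter GoodParams

variable (p q : ℝ) [GoodParams p q]

/-- The function `F` as an element of the field of meromorphic functions. -/
def FM (p q : ℝ) : Mero := Mero.of (Ffun p q)

/-- The inverse of the function `F`. -/
def FMi (p q : ℝ) : Mero := Mero.of fun l => (Ffun p q l)⁻¹

/-- The theta function `[λ + c]` as an element of the field of meromorphic functions. -/
def bM (p q : ℝ) (c : ℂ) : Mero := Mero.of fun l => brk p q (l + c)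

theorem Mero.isUnit_of {f : ℂ → ℂ} (hf : Meromorphic f) (h : ∀ᶠ l in codiscrete ℂ, f l ≠ 0) :
    Mero.of f * Mero.of (fun l => (f l)⁻¹) = 1 := by
  have hi : Meromorphic fun l => (f l)⁻¹ := hf.fun_inv
  rw [Mero.of_mul hf hi, ← map_one (algebraMap ℂ Mero), ← Mero.of_const]
  refine Mero.of_congr (hf.fun_mul hi) ?_
  filter_upwards [h] with l hl
  exact mul_inv_cancel₀ hl

theorem isUnit_bM (c : ℂ) : IsUnit (bM p q c) :=
  .of_mul_eq_one _ (Mero.isUnit_of (meromorphic_brk c) (eventually_brk_ne_zero c))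

theorem FM_mul_FMi : FM p q * FMi p q = 1 := by
  refine Mero.isUnit_of meromorphic_Ffun ?_
  filter_upwards [eventually_brk_ne_zero (p := p) (q := q) 1] with l hl
  rw [Ffun_eq_brk]
  exact mul_ne_zero (neg_ne_zero.2 (inv_ne_zero (q_ne_zero p q))) hl

theorem FM_eq : FM p q = (-(q : ℂ)⁻¹) • bM p q 1 := by
  rw [Algebra.smul_def, ← Mero.of_const, bM, Mero.of_mul (Meromorphic.const _) (meromorphic_brk 1)]
  exact congrArg Mero.of (funext Ffun_eq_brk)

theorem conj_q_cpow {q : ℝ} (hq : 0 < q) (u : ℂ) : conj ((q : ℂ) ^ u) = (q : ℂ) ^ conj u := by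
  rw [Complex.cpow_conj _ _ (by rw [Complex.arg_ofReal_of_nonneg hq.le]; exact Real.pi_pos.ne),
    Complex.conj_ofReal]

theorem Ffun_conj (l : ℂ) : conj (Ffun p q (conj l)) = Ffun p q l := by
  have hc := conj_q_cpow (q_pos (p := p) (q := q))
  simp only [Ffun, map_mul, ← theta_conj (p_pos (p := p) (q := q)) (p_lt_one (p := p) (q := q)), hc]
  simp [map_ofNat]

theorem bar_FM : Mero.bar (FM p q) = FM p q := by
  rw [FM, Mero.bar_of meromorphic_Ffun]
  exact congrArg Mero.of (funext (Ffun_conj p q))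

theorem ellRnum_conj (l z : ℂ) (a b x y : Fin 2) :
    conj (ellRnum p q (conj l) z a b x y) = ellRnum p q l (conj z) a b x y := by
  have hc := conj_q_cpow (q_pos (p := p) (q := q))
  fin_cases a <;> fin_cases b <;> fin_cases x <;> fin_cases y <;>
    simp [ellRnum, ← theta_conj (p_pos (p := p) (q := q)) (p_lt_one (p := p) (q := q)), hc, map_ofNat]

theorem bar_rM {z : ℂ} (hz : z ≠ 0) (a b x y : Fin 2) :
    Mero.bar (rM p q z a b x y) = rM p q (conj z) a b x y := by
  rw [rM, Mero.bar_of (meromorphic_ellRnum hz a b x y)]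
  exact congrArg Mero.of (funext fun l => ellRnum_conj p q l z a b x y)

/-- Transposition combined with exchange of the two basis vectors is a symmetry of the R-matrix up
to the gauge factor F, as the brackets in the six entries show. This is the symmetry behind the
antipode. -/
theorem shift_FM_mul_rM {z : ℂ} (hz : z ≠ 0) (x y a c : Fin 2) :
    Mero.shift (wt y) (FM p q) * Mero.shift (wt a + wt c) (rM p q z x y a c) =
      Mero.shift (wt a) (FM p q) * rM p q z a.rev c.rev x.rev y.rev := by
  have mF := @meromorphic_Ffun p q _
  have mR := fun a b x y => meromorphic_ellRnum (p := p) (q := q) hz a b x y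
  rw [FM, rM, rM, Mero.shift_of mF, Mero.shift_of mF, Mero.shift_of (mR _ _ _ _),
    Mero.of_mul (meromorphic_shift _ mF) (meromorphic_shift _ (mR _ _ _ _)),
    Mero.of_mul (meromorphic_shift _ mF) (mR _ _ _ _)]
  refine Mero.of_congr ((meromorphic_shift _ mF).fun_mul (meromorphic_shift _ (mR _ _ _ _))) ?_
  obtain ⟨u, rfl⟩ := exists_cpow_eq p q hz
  filter_upwards [eventually_brk_ne_zero (p := p) (q := q) 0,
    eventually_brk_ne_zero (p := p) (q := q) 1,
    eventually_brk_ne_zero (p := p) (q := q) 2] with l h0 h1 h2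
  have e1 : l - 1 + 2 = l + 1 := by ring
  have e2 : l + 1 + 1 = l + 2 := by ring
  simp only [Ffun_eq_brk, ellRnum_eq_brkR]
  fin_cases a <;> fin_cases c <;> fin_cases x <;> fin_cases y <;>
    simp [brkR, wt, e2, Fin.rev]
  all_goals (field_simp; try ring)

/-- The symmetry behind the star. No gauge factor occurs, and the bracket expressions coincide entry
by entry at every point. -/
theorem shift_rM {z : ℂ} (hz : z ≠ 0) (x y a c : Fin 2) :
    Mero.shift (wt a + wt c) (rM p q z x y a c) = rM p q z y.rev x.rev c.rev a.rev := by
  have mR := fun a b x y => meromorphic_ellRnum (p := p) (q := q) hz a b x y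
  rw [rM, rM, Mero.shift_of (mR _ _ _ _)]
  refine congrArg Mero.of (funext fun l => ?_)
  obtain ⟨u, rfl⟩ := exists_cpow_eq p q hz
  simp only [ellRnum_eq_brkR]
  fin_cases a <;> fin_cases c <;> fin_cases x <;> fin_cases y <;>
    simp [brkR, wt, Fin.rev]

/-- The antisymmetric tensor that spans the image of the R-matrix at `z = q⁻²`. -/
def eps : Fin 2 → Fin 2 → ℂ := ![![0, -1], ![1, 0]]

/-- The covector, dual to `eps`, that describes the R-matrix at `z = q⁻²`. -/
def tau (p q : ℝ) : Fin 2 → Fin 2 → Mero := ![![0, bM p q 2], ![-bM p q 0, 0]]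

/-- At u = -1 the entries [u+1] vanish, and [u], [l+1-u], [l+1+u] become -[1], [l+2], [l]; the
middle 2×2 block then has proportional rows. -/
theorem bM_mul_rM (a b x y : Fin 2) :
    bM p q 1 * rM p q ((q : ℂ) ^ 2)⁻¹ a b x y = (brk p q 1 * eps a b) • tau p q x y := by
  have hz : ((q : ℂ) ^ 2)⁻¹ ≠ 0 := inv_ne_zero (pow_ne_zero _ (q_ne_zero p q))
  have mR := fun a b x y => meromorphic_ellRnum (p := p) (q := q) hz a b x y
  have mb := @meromorphic_brk p q _
  have key : ∀ (f : ℂ → ℂ) (c : ℂ), Meromorphic f → c • Mero.of f = Mero.of fun l => c * f l :=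
    fun f c hf => by
      rw [Algebra.smul_def, ← Mero.of_const, Mero.of_mul (Meromorphic.const _) hf]
  have he : ((q : ℂ) ^ 2)⁻¹ = (q : ℂ) ^ (2 * (-1 : ℂ)) := by
    rw [show 2 * (-1 : ℂ) = -2 by ring, Complex.cpow_neg, Complex.cpow_ofNat]
  have hb0 : brk p q 0 = 0 := by
    have := brk_neg' (p := p) (q := q) 0
    rw [neg_zero] at this
    exact self_eq_neg.1 this
  rw [bM, rM, Mero.of_mul (mb 1) (mR _ _ _ _)]
  have hT : ∀ f g : ℂ → ℂ, Meromorphic f → (∀ l, brk p q (l + 1) ≠ 0 → g l = f l) →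
      Mero.of g = Mero.of f := by
    intro f g hf h
    refine (Mero.of_congr hf ?_).symm
    filter_upwards [eventually_brk_ne_zero (p := p) (q := q) 1] with l h1
    exact (h l h1).symm
  have hn := brk_neg' (p := p) (q := q) 1
  have h2 : ∀ l : ℂ, l + 1 + 1 = l + 2 := fun l => by ring
  have h0 : Meromorphic fun _ : ℂ => (0 : ℂ) := Meromorphic.const 0
  have m0 := (Meromorphic.const (𝕜 := ℂ) (brk p q 1)).fun_mul (mb 0)
  have m0' := (Meromorphic.const (𝕜 := ℂ) (-brk p q 1)).fun_mul (mb 0)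
  have m2 := (Meromorphic.const (𝕜 := ℂ) (brk p q 1)).fun_mul (mb 2)
  have m2' := (Meromorphic.const (𝕜 := ℂ) (-brk p q 1)).fun_mul (mb 2)
  simp only [he, ellRnum_eq_brkR]
  fin_cases a <;> fin_cases b <;> fin_cases x <;> fin_cases y <;>
    simp [brkR, eps, tau, bM, Mero.of_zero, hb0]
  · rw [← neg_smul, key _ _ (mb 2)]
    refine hT _ _ m2' fun l h1 => ?_
    rw [hn]; field_simp
  · rw [key _ _ (by simpa using mb 0)]
    refine hT _ _ (by simpa using m0) fun l h1 => ?_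
    field_simp
  · rw [key _ _ (mb 2)]
    refine hT _ _ m2 fun l h1 => ?_
    rw [h2]; field_simp
  · rw [← neg_smul, key _ _ (by simpa using mb 0)]
    refine hT _ _ (by simpa using m0') fun l h1 => ?_
    rw [hn]; field_simp

end Symmetries

end EllipticU2

namespace EllipticU2

/-! ### Calculus of difference operators -/

namespace DiffOp

theorem term_mul_term (f g : Mero) (α β : ℂ) :
    term f α * term g β = term (f * Mero.shift α g) (α + β) :=
  SkewMonoidAlgebra.single_mul_single

theorem term_add (f g : Mero) (α : ℂ) : term (f + g) α = term f α + term g α :=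
  SkewMonoidAlgebra.single_add _ _ _

@[simp] theorem term_zero (α : ℂ) : term 0 α = 0 := SkewMonoidAlgebra.single_zero _

theorem smul_term (c : ℂ) (f : Mero) (α : ℂ) : c • term f α = term (c • f) α :=
  SkewMonoidAlgebra.smul_single _ _ _

theorem term_one_zero : term 1 0 = 1 := rfl

theorem term_injective (α : ℂ) : Function.Injective fun f => term f α :=
  SkewMonoidAlgebra.single_injective _

@[elab_as_elim]
theorem induction {motive : DiffOp → Prop} (x : DiffOp) (zero : motive 0)
    (term : ∀ f α, motive (term f α)) (add : ∀ x y, motive x → motive y → motive (x + y)) :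
    motive x :=
  SkewMonoidAlgebra.induction_on x zero (fun g f => term f g.toAdd) (fun {x y} => add x y)

/-- Multiplication operators, as an algebra homomorphism. -/
def mulHom : Mero →ₐ[ℂ] DiffOp where
  toFun := mulOp
  map_one' := rfl
  map_mul' f g := by rw [mulOp, mulOp, mulOp, term_mul_term, Mero.shift_zero, add_zero]
  map_zero' := term_zero 0
  map_add' f g := term_add f g 0
  commutes' c := rfl

theorem mulHom_apply (f : Mero) : mulHom f = mulOp f := rfl

theorem mulOp_mul_term (f g : Mero) (α : ℂ) : mulOp f * term g α = term (f * g) α := by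
  rw [mulOp, term_mul_term, Mero.shift_zero, zero_add]

theorem term_mul_mulOp (f g : Mero) (α : ℂ) :
    term g α * mulOp f = term (g * Mero.shift α f) α := by
  rw [mulOp, term_mul_term, add_zero]

theorem T_mul_term (α β : ℂ) (f : Mero) : T α * term f β = term (Mero.shift α f) (α + β) := by
  rw [T, term_mul_term, one_mul]

theorem term_mul_T (α β : ℂ) (f : Mero) : term f α * T β = term f (α + β) := by
  rw [T, term_mul_term, map_one, mul_one]

theorem T_mul_T (α β : ℂ) : T α * T β = T (α + β) := by
  rw [T, T, term_mul_term, map_one, one_mul, T]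

theorem T_zero : T 0 = 1 := rfl

theorem T_mul_mulOp (α : ℂ) (f : Mero) : T α * mulOp f = mulOp (Mero.shift α f) * T α := by
  rw [T, term_mul_mulOp, mulOp_mul_term, one_mul, mul_one]

theorem mulOp_mul_T (f : Mero) (α : ℂ) : mulOp f * T α = term f α := by
  rw [T, mulOp_mul_term, mul_one]

/-- The value at the constant function `1`, as a linear map. -/
def applyOneₗ : DiffOp →ₗ[ℂ] Mero where
  toFun := applyOne
  map_add' x y := SkewMonoidAlgebra.sum_add_index' (fun _ => rfl) fun _ _ _ => rfl
  map_smul' c x := by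
    rw [applyOne, SkewMonoidAlgebra.sum_smul_index' fun _ => rfl, applyOne, RingHom.id_apply]
    exact (SkewMonoidAlgebra.smul_sum ..).symm

@[simp] theorem applyOne_term (f : Mero) (α : ℂ) : applyOne (term f α) = f :=
  SkewMonoidAlgebra.sum_single_index rfl

@[simp] theorem applyOne_zero : applyOne 0 = 0 := map_zero applyOneₗ

@[simp] theorem applyOne_one : applyOne 1 = 1 := applyOne_term 1 0

theorem applyOne_add (x y : DiffOp) : applyOne (x + y) = applyOne x + applyOne y :=
  map_add applyOneₗ x y

theorem applyOne_term_mul (f : Mero) (α : ℂ) (x : DiffOp) :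
    applyOne (term f α * x) = f * Mero.shift α (applyOne x) := by
  induction x using DiffOp.induction with
  | zero => simp
  | term g β => rw [term_mul_term, applyOne_term, applyOne_term]
  | add x y hx hy => rw [mul_add, applyOne_add, hx, hy, applyOne_add, map_add, mul_add]

theorem applyOne_mulOp_mul (f : Mero) (x : DiffOp) :
    applyOne (mulOp f * x) = f * applyOne x := by
  rw [mulOp, applyOne_term_mul, Mero.shift_zero]

theorem applyOne_T_mul (α : ℂ) (x : DiffOp) : applyOne (T α * x) = Mero.shift α (applyOne x) := by
  rw [T, applyOne_term_mul, one_mul]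

/-- The antipode of `D` as an additive map. -/
def antipodeHom : DiffOp →+ DiffOp where
  toFun := antipode
  map_zero' := rfl
  map_add' x y := SkewMonoidAlgebra.sum_add_index'
    (fun _ => by rw [← mulHom_apply, map_zero, mul_zero])
    fun _ _ _ => by rw [← mulHom_apply, map_add, mul_add]; rfl

@[simp] theorem antipode_zero : antipode 0 = 0 := rfl

theorem antipode_add (x y : DiffOp) : antipode (x + y) = antipode x + antipode y :=
  map_add antipodeHom x y

@[simp] theorem antipode_term (f : Mero) (α : ℂ) :
    antipode (term f α) = term (Mero.shift (-α) f) (-α) := by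
  rw [antipode, term, SkewMonoidAlgebra.sum_single_index, toAdd_ofAdd, T_mul_mulOp, mulOp_mul_T]
  rw [← mulHom_apply, map_zero, mul_zero]

theorem antipode_smul (c : ℂ) (x : DiffOp) : antipode (c • x) = c • antipode x := by
  induction x using DiffOp.induction with
  | zero => simp
  | term f α => rw [smul_term, antipode_term, Mero.shift_smul, antipode_term, smul_term]
  | add x y hx hy => rw [smul_add, antipode_add, hx, hy, antipode_add, smul_add]

theorem antipode_mul (x y : DiffOp) : antipode (x * y) = antipode y * antipode x := by
  induction x using DiffOp.induction with
  | zero => simp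
  | term f α =>
    induction y using DiffOp.induction with
    | zero => simp
    | term g β =>
      simp only [term_mul_term, antipode_term, map_mul, Mero.shift_shift]
      congr 1
      · rw [mul_comm]; ring_nf
      · ring
    | add x y hx hy => rw [mul_add, antipode_add, hx, hy, antipode_add, add_mul]
  | add x y hx hy => rw [add_mul, antipode_add, hx, hy, antipode_add, mul_add]

/-- The `*`-operator of `D` as an additive map. -/
def starHom : DiffOp →+ DiffOp where
  toFun := star
  map_zero' := rfl
  map_add' x y := SkewMonoidAlgebra.sum_add_index'
    (fun _ => by rw [← mulHom_apply, map_zero, map_zero, mul_zero])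
    fun _ _ _ => by rw [← mulHom_apply, map_add, map_add, mul_add]; rfl

@[simp] theorem star_zero : star 0 = 0 := rfl

theorem star_add (x y : DiffOp) : star (x + y) = star x + star y :=
  map_add starHom x y

@[simp] theorem star_term (f : Mero) (α : ℂ) :
    star (term f α) = term (Mero.shift (-conj α) (Mero.bar f)) (-conj α) := by
  rw [star, term, SkewMonoidAlgebra.sum_single_index, toAdd_ofAdd, T_mul_mulOp, mulOp_mul_T]
  rw [← mulHom_apply, map_zero, map_zero, mul_zero]

theorem star_smul (c : ℂ) (x : DiffOp) : star (c • x) = conj c • star x := by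
  induction x using DiffOp.induction with
  | zero => simp
  | term f α => rw [smul_term, star_term, Mero.bar_smul, Mero.shift_smul, star_term, smul_term]
  | add x y hx hy => rw [smul_add, star_add, hx, hy, star_add, smul_add]

theorem star_mul (x y : DiffOp) : star (x * y) = star y * star x := by
  induction x using DiffOp.induction with
  | zero => simp
  | term f α =>
    induction y using DiffOp.induction with
    | zero => simp
    | term g β =>
      simp only [term_mul_term, star_term, map_mul, Mero.shift_shift, Mero.bar_shift, map_add]
      congr 1
      · rw [mul_comm]; ring_nf
      · ring
    | add x y hx hy => rw [mul_add, star_add, hx, hy, star_add, add_mul]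
  | add x y hx hy => rw [add_mul, star_add, hx, hy, star_add, mul_add]

theorem hasDeg_iff {α β : ℂ} {x : DiffOp} :
    HasDeg α β x ↔ x = term (applyOne x) (-α) ∧ (α ≠ β → applyOne x = 0) := by
  constructor
  · rintro ⟨f, rfl, h⟩
    simpa using h
  · exact fun h => ⟨_, h⟩

theorem HasDeg.eq_term {α β : ℂ} {x : DiffOp} (h : HasDeg α β x) : x = term (applyOne x) (-α) :=
  (hasDeg_iff.1 h).1

theorem HasDeg.applyOne_eq_zero {α β : ℂ} {x : DiffOp} (h : HasDeg α β x) (hne : α ≠ β) :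
    applyOne x = 0 :=
  (hasDeg_iff.1 h).2 hne

theorem HasDeg.zero (α β : ℂ) : HasDeg α β 0 := ⟨0, by simp, fun _ => rfl⟩

theorem HasDeg.add {α β : ℂ} {x y : DiffOp} (hx : HasDeg α β x) (hy : HasDeg α β y) :
    HasDeg α β (x + y) := by
  obtain ⟨f, rfl, hf⟩ := hx
  obtain ⟨g, rfl, hg⟩ := hy
  exact ⟨f + g, (term_add _ _ _).symm, fun h => by rw [hf h, hg h, add_zero]⟩

theorem HasDeg.smul {α β : ℂ} {x : DiffOp} (c : ℂ) (hx : HasDeg α β x) : HasDeg α β (c • x) := by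
  obtain ⟨f, rfl, hf⟩ := hx
  exact ⟨c • f, smul_term _ _ _, fun h => by rw [hf h, smul_zero]⟩

theorem HasDeg.mul {α β γ δ : ℂ} {x y : DiffOp} (hx : HasDeg α β x) (hy : HasDeg γ δ y) :
    HasDeg (α + γ) (β + δ) (x * y) := by
  obtain ⟨f, rfl, hf⟩ := hx
  obtain ⟨g, rfl, hg⟩ := hy
  refine ⟨f * Mero.shift (-α) g, by rw [term_mul_term, neg_add], fun h => ?_⟩
  by_cases h1 : α = β
  · have h2 : γ ≠ δ := fun h2 => h (by rw [h1, h2])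
    rw [hg h2, map_zero, mul_zero]
  · rw [hf h1, zero_mul]

theorem hasDeg_mulOp (f : Mero) : HasDeg 0 0 (mulOp f) := ⟨f, by rw [mulOp, neg_zero], by simp⟩

theorem hasDeg_T (α : ℂ) : HasDeg α α (T (-α)) := ⟨1, rfl, by simp⟩

end DiffOp

end EllipticU2

namespace EllipticU2

/-! ### The universal property of `ℰ` -/

/-- Operators in an algebra `B` that satisfy the defining relations of the elliptic quantum group,
except for the invertibility of the determinant. -/
structure LOps (p q : ℝ) (Z : SpectralSet q) (B : Type*) [Ring B] [Algebra ℂ B] where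
  l : Mero →ₐ[ℂ] B
  r : Mero →ₐ[ℂ] B
  L : Fin 2 → Fin 2 → Z.carrier → B
  l_r : ∀ f g, l f * r g = r g * l f
  l_L : ∀ f x y z, l f * L x y z = L x y z * l (Mero.shift (wt x) f)
  r_L : ∀ f x y z, r f * L x y z = L x y z * r (Mero.shift (wt y) f)
  RLL : ∀ a b c d (z₁ z₂ : Z.carrier),
    ∑ x, ∑ y, l (rM p q (z₁ / z₂ : ℂ) x y a c) * (L x b z₁ * L y d z₂) =
      ∑ x, ∑ y, r (rM p q (z₁ / z₂ : ℂ) b d x y) * (L c y z₂ * L a x z₁)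

namespace LOps

variable {p q : ℝ} {Z : SpectralSet q} {B : Type*} [Ring B] [Algebra ℂ B] (X : LOps p q Z B)

/-- The determinant. -/
def det (z : Z.carrier) : B :=
  X.r (FM p q) * X.l (FMi p q) *
    (X.L 0 0 z * X.L 1 1 (Z.up z) - X.L 1 0 z * X.L 0 1 (Z.up z))

end LOps

/-- Operators in an algebra `B` that satisfy the defining relations of the elliptic quantum
group. -/
structure EllRep (p q : ℝ) (Z : SpectralSet q) (B : Type*) [Ring B] [Algebra ℂ B] extends
    LOps p q Z B where
  dI : Z.carrier → B
  dI_det : ∀ z, dI z * toLOps.det z = 1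
  det_dI : ∀ z, toLOps.det z * dI z = 1
  dI_l : ∀ z f, dI z * l f = l f * dI z
  dI_r : ∀ z f, dI z * r f = r f * dI z
  dI_L : ∀ z x y w, dI z * L x y w = L x y w * dI z

namespace EllRep

variable {p q : ℝ} {Z : SpectralSet q} {B : Type*} [Ring B] [Algebra ℂ B] (X : EllRep p q Z B)

theorem dI_comm_det (z w : Z.carrier) : Commute (X.dI z) (X.det w) := by
  have h : ∀ a b v, Commute (X.dI z) (X.L a b v) := fun a b v => X.dI_L z a b v
  have hr : Commute (X.dI z) (X.r (FM p q)) := X.dI_r z _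
  have hl : Commute (X.dI z) (X.l (FMi p q)) := X.dI_l z _
  exact (hr.mul_right hl).mul_right
    (((h _ _ _).mul_right (h _ _ _)).sub_right ((h _ _ _).mul_right (h _ _ _)))

/-- An element that commutes with det(w) commutes with its inverse. Hence this relation need not be
verified for each representation. -/
theorem dI_comm (z w : Z.carrier) : X.dI z * X.dI w = X.dI w * X.dI z := by
  have h := X.dI_comm_det z w
  calc X.dI z * X.dI w = X.dI w * X.det w * X.dI z * X.dI w := by rw [X.dI_det, one_mul]
    _ = X.dI w * X.dI z * (X.det w * X.dI w) := by rw [mul_assoc (X.dI w), ← h.eq]; simp only [mul_assoc]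
    _ = X.dI w * X.dI z := by rw [X.det_dI, mul_one]

/-- The value of a representation on a generator. -/
def gen : Gen Z → B
  | .ml f => X.l f
  | .mr f => X.r f
  | .L x y z => X.L x y z
  | .detInv z => X.dI z

/-- The algebra homomorphism on the elliptic quantum group that is given by a representation. -/
def lift : Ell p q Z →ₐ[ℂ] B :=
  RingQuot.liftAlgHom ℂ ⟨FreeAlgebra.lift ℂ X.gen, by
    intro x y h
    cases h with
    | ml_add f g => simp [gen]
    | ml_mul f g => simp [gen]
    | ml_const c => simp [gen]
    | mr_add f g => simp [gen]
    | mr_mul f g => simp [gen]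
    | mr_const c => simp [gen]
    | ml_mr f g => simpa [gen] using X.l_r f g
    | ml_L f x y z => simpa [gen] using X.l_L f x y z
    | mr_L f x y z => simpa [gen] using X.r_L f x y z
    | RLL a b c d z₁ z₂ =>
      simp only [map_sum, map_mul, FreeAlgebra.lift_ι_apply]
      exact X.RLL a b c d z₁ z₂
    | detInv_mul z =>
      simp only [detFree, map_mul, map_sub, map_one, FreeAlgebra.lift_ι_apply]
      exact X.dI_det z
    | mul_detInv z =>
      simp only [detFree, map_mul, map_sub, map_one, FreeAlgebra.lift_ι_apply]
      exact X.det_dI z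
    | detInv_comm z g =>
      simp only [map_mul, FreeAlgebra.lift_ι_apply]
      cases g with
      | ml f => exact X.dI_l z f
      | mr f => exact X.dI_r z f
      | L x y w => exact X.dI_L z x y w
      | detInv w => exact X.dI_comm z w⟩

theorem lift_of (g : Gen Z) : X.lift (Ell.of p q Z g) = X.gen g :=
  (RingQuot.liftAlgHom_mkAlgHom_apply ..).trans (FreeAlgebra.lift_ι_apply _ _)

@[simp] theorem lift_muL (f : Mero) : X.lift (Ell.muL p q Z f) = X.l f := X.lift_of _

@[simp] theorem lift_muR (f : Mero) : X.lift (Ell.muR p q Z f) = X.r f := X.lift_of _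

@[simp] theorem lift_L (x y : Fin 2) (z : Z.carrier) : X.lift (Ell.L p q Z x y z) = X.L x y z :=
  X.lift_of _

@[simp] theorem lift_detInv (z : Z.carrier) : X.lift (Ell.detInv p q Z z) = X.dI z := X.lift_of _

end EllRep

namespace Ell

variable (p q : ℝ) (Z : SpectralSet q)

theorem mk_mul_rel {x y x' y' : FreeAlgebra ℂ (Gen Z)} (h : Rel p q Z (x * y) (x' * y')) :
    mk p q Z x * mk p q Z y = mk p q Z x' * mk p q Z y' := by
  rw [← map_mul, ← map_mul, mk_rel p q Z h]

/-- The tautological representation. -/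
def rep : EllRep p q Z (Ell p q Z) where
  l := muL p q Z
  r := muR p q Z
  L := L p q Z
  l_r f g := mk_mul_rel p q Z (Rel.ml_mr f g)
  l_L f x y z := mk_mul_rel p q Z (Rel.ml_L f x y z)
  r_L f x y z := mk_mul_rel p q Z (Rel.mr_L f x y z)
  RLL a b c d z₁ z₂ := by
    have h := mk_rel p q Z (Rel.RLL a b c d z₁ z₂)
    simp only [map_sum, map_mul] at h
    exact h
  dI := detInv p q Z
  dI_det z := by
    have h := mk_rel p q Z (Rel.detInv_mul z)
    simp only [detFree, map_mul, map_sub, map_one] at h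
    exact h
  det_dI z := by
    have h := mk_rel p q Z (Rel.mul_detInv z)
    simp only [detFree, map_mul, map_sub, map_one] at h
    exact h
  dI_l z f := mk_mul_rel p q Z (Rel.detInv_comm z (.ml f))
  dI_r z f := mk_mul_rel p q Z (Rel.detInv_comm z (.mr f))
  dI_L z x y w := mk_mul_rel p q Z (Rel.detInv_comm z (.L x y w))

theorem det_eq (z : Z.carrier) : det p q Z z = (rep p q Z).det z := rfl

theorem adjoin_of : Algebra.adjoin ℂ (Set.range (of p q Z)) = ⊤ := by
  have h1 : Algebra.adjoin ℂ (Set.range (FreeAlgebra.ι ℂ (X := Gen Z))) = ⊤ :=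
    FreeAlgebra.adjoin_range_ι _ _
  have h2 : Function.Surjective (mk p q Z) := RingQuot.mkAlgHom_surjective ℂ _
  rw [← (AlgHom.range_eq_top _).2 h2, ← Algebra.map_top, ← h1, AlgHom.map_adjoin, ← Set.range_comp]
  rfl

theorem span_words : Submodule.span ℂ {t | ∃ w : List (Gen Z), t = (w.map (of p q Z)).prod} = ⊤ := by
  rw [← Algebra.top_toSubmodule, ← adjoin_of p q Z, Algebra.adjoin_eq_span]
  congr 1
  ext t
  constructor
  · rintro ⟨w, rfl⟩
    exact Submonoid.list_prod_mem _ fun x hx => by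
      obtain ⟨g, _, rfl⟩ := List.mem_map.1 hx
      exact Submonoid.subset_closure ⟨g, rfl⟩
  · intro ht
    obtain ⟨l, hl, rfl⟩ := Submonoid.exists_list_of_mem_closure ht
    obtain ⟨w, rfl⟩ : ∃ w : List (Gen Z), l = w.map (of p q Z) := by
      clear ht
      induction l with
      | nil => exact ⟨[], rfl⟩
      | cons a l ih =>
        obtain ⟨g, hg⟩ := hl a (by simp)
        obtain ⟨w, rfl⟩ := ih fun y hy => hl y (by simp [hy])
        exact ⟨g :: w, by simp [hg]⟩
    exact ⟨w, rfl⟩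

variable {p q Z}

/-- Induction on the length of words, multiplying by generators on the left. -/
theorem induction_left {motive : Ell p q Z → Prop} (a : Ell p q Z)
    (add : ∀ a b, motive a → motive b → motive (a + b))
    (smul : ∀ (c : ℂ) a, motive a → motive (c • a)) (one : motive 1)
    (muL_mul : ∀ f a, motive a → motive (muL p q Z f * a))
    (muR_mul : ∀ f a, motive a → motive (muR p q Z f * a))
    (L_mul : ∀ x y z a, motive a → motive (L p q Z x y z * a))
    (detInv_mul : ∀ z a, motive a → motive (detInv p q Z z * a)) : motive a := by
  have h : a ∈ Submodule.span ℂ {t | ∃ w : List (Gen Z), t = (w.map (of p q Z)).prod} := by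
    rw [span_words]; trivial
  induction h using Submodule.span_induction with
  | mem x hx =>
    obtain ⟨w, rfl⟩ := hx
    induction w with
    | nil => exact one
    | cons g w ih =>
      rw [List.map_cons, List.prod_cons]
      cases g with
      | ml f => exact muL_mul _ _ ih
      | mr f => exact muR_mul _ _ ih
      | L x y z => exact L_mul _ _ _ _ ih
      | detInv z => exact detInv_mul _ _ ih
  | zero => simpa using smul 0 1 one
  | add x y _ _ hx hy => exact add _ _ hx hy
  | smul c x _ hx => exact smul _ _ hx

/-- Induction on the length of words, multiplying by generators on the right. -/
theorem induction_right {motive : Ell p q Z → Prop} (a : Ell p q Z)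
    (add : ∀ a b, motive a → motive b → motive (a + b))
    (smul : ∀ (c : ℂ) a, motive a → motive (c • a)) (one : motive 1)
    (mul_muL : ∀ f a, motive a → motive (a * muL p q Z f))
    (mul_muR : ∀ f a, motive a → motive (a * muR p q Z f))
    (mul_L : ∀ x y z a, motive a → motive (a * L p q Z x y z))
    (mul_detInv : ∀ z a, motive a → motive (a * detInv p q Z z)) : motive a := by
  have h : a ∈ Submodule.span ℂ {t | ∃ w : List (Gen Z), t = (w.map (of p q Z)).prod} := by
    rw [span_words]; trivial
  induction h using Submodule.span_induction with
  | mem x hx =>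
    obtain ⟨w, rfl⟩ := hx
    induction w using List.reverseRecOn with
    | nil => exact one
    | append_singleton w g ih =>
      rw [List.map_append, List.prod_append, List.map_singleton, List.prod_singleton]
      cases g with
      | ml f => exact mul_muL _ _ ih
      | mr f => exact mul_muR _ _ ih
      | L x y z => exact mul_L _ _ _ _ ih
      | detInv z => exact mul_detInv _ _ ih
  | zero => simpa using smul 0 1 one
  | add x y _ _ hx hy => exact add _ _ hx hy
  | smul c x _ hx => exact smul _ _ hx

theorem det_detInv (z : Z.carrier) : det p q Z z * detInv p q Z z = 1 := (rep p q Z).det_dI z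

theorem detInv_det (z : Z.carrier) : detInv p q Z z * det p q Z z = 1 := (rep p q Z).dI_det z

theorem detInv_mul_comm (z : Z.carrier) (a : Ell p q Z) :
    detInv p q Z z * a = a * detInv p q Z z := by
  refine induction_left (motive := fun a => Commute (detInv p q Z z) a) a
    (fun _ _ h h' => h.add_right h') (fun c _ h => h.smul_right c) (Commute.one_right _)
    (fun f a h => ?_) (fun f a h => ?_) (fun x y w a h => ?_) (fun w a h => ?_)
  · exact Commute.mul_right ((rep p q Z).dI_l z f) h
  · exact Commute.mul_right ((rep p q Z).dI_r z f) h
  · exact Commute.mul_right ((rep p q Z).dI_L z x y w) h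
  · exact Commute.mul_right ((rep p q Z).dI_comm z w) h

theorem det_mul_comm (z : Z.carrier) (a : Ell p q Z) : det p q Z z * a = a * det p q Z z := by
  calc det p q Z z * a = det p q Z z * (a * detInv p q Z z) * det p q Z z := by
        rw [mul_assoc, mul_assoc, detInv_det, mul_one]
    _ = a * det p q Z z := by rw [← detInv_mul_comm, ← mul_assoc, det_detInv, one_mul]

theorem muL_muR (f g : Mero) : muL p q Z f * muR p q Z g = muR p q Z g * muL p q Z f :=
  (rep p q Z).l_r f g

theorem muL_L (f : Mero) (x y : Fin 2) (z : Z.carrier) :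
    muL p q Z f * L p q Z x y z = L p q Z x y z * muL p q Z (Mero.shift (wt x) f) :=
  (rep p q Z).l_L f x y z

theorem muR_L (f : Mero) (x y : Fin 2) (z : Z.carrier) :
    muR p q Z f * L p q Z x y z = L p q Z x y z * muR p q Z (Mero.shift (wt y) f) :=
  (rep p q Z).r_L f x y z

/-- Homomorphisms on the elliptic quantum group are determined on the moment maps and the
generators `L`. -/
theorem algHom_ext {B : Type*} [Ring B] [Algebra ℂ B] {φ ψ : Ell p q Z →ₐ[ℂ] B}
    (hl : ∀ f, φ (muL p q Z f) = ψ (muL p q Z f)) (hr : ∀ f, φ (muR p q Z f) = ψ (muR p q Z f))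
    (hL : ∀ x y z, φ (L p q Z x y z) = ψ (L p q Z x y z)) : φ = ψ := by
  have hd : ∀ z, φ (det p q Z z) = ψ (det p q Z z) := fun z => by
    simp only [det, FF, al, be, ga, de, map_mul, map_sub, hl, hr, hL]
  -- Inverses are unique, so the image of det^{-1}(z) is determined by that of det(z).
  have hI : ∀ z, φ (detInv p q Z z) = ψ (detInv p q Z z) := fun z => by
    calc φ (detInv p q Z z) = φ (detInv p q Z z) * ψ (det p q Z z * detInv p q Z z) := by
          rw [det_detInv, map_one, mul_one]
      _ = φ (detInv p q Z z * det p q Z z) * ψ (detInv p q Z z) := by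
          rw [map_mul, map_mul, hd, mul_assoc]
      _ = ψ (detInv p q Z z) := by rw [detInv_det, map_one, one_mul]
  ext a
  refine induction_left (motive := fun a => φ a = ψ a) a (fun a b h h' => by rw [map_add, map_add, h, h'])
    (fun c a h => by rw [map_smul, map_smul, h]) (by rw [map_one, map_one])
    (fun f a h => by rw [map_mul, map_mul, h, hl]) (fun f a h => by rw [map_mul, map_mul, h, hr])
    (fun x y z a h => by rw [map_mul, map_mul, h, hL])
    (fun z a h => by rw [map_mul, map_mul, h, hI])

end Ell

end EllipticU2

namespace EllipticU2

/-! ### Quantum minors -/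

theorem SpectralSet.coe_ne_zero {q : ℝ} {Z : SpectralSet q} (z : Z.carrier) : (z : ℂ) ≠ 0 :=
  fun h => Z.zero_notMem (h ▸ z.2)

theorem SpectralSet.coe_up {q : ℝ} {Z : SpectralSet q} (z : Z.carrier) :
    (Z.up z : ℂ) = (q : ℂ) ^ 2 * z := rfl

theorem SpectralSet.div_up (p : ℝ) {q : ℝ} [GoodParams p q] {Z : SpectralSet q} (z : Z.carrier) :
    (z / Z.up z : ℂ) = ((q : ℂ) ^ 2)⁻¹ := by
  have hz := coe_ne_zero z
  have hq := q_ne_zero p q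
  rw [coe_up]
  field_simp

theorem SpectralSet.up_down (p : ℝ) {q : ℝ} [GoodParams p q] {Z : SpectralSet q} (z : Z.carrier) :
    Z.up (Z.down z) = z := by
  have hq := q_ne_zero p q
  exact Subtype.ext (by simp [up, down, hq])

theorem SpectralSet.down_up (p : ℝ) {q : ℝ} [GoodParams p q] {Z : SpectralSet q} (z : Z.carrier) :
    Z.down (Z.up z) = z := by
  have hq := q_ne_zero p q
  exact Subtype.ext (by simp [up, down, hq])

theorem SpectralSet.refl_refl {q : ℝ} {Z : SpectralSet q} (z : Z.carrier) :
    Z.refl (Z.refl z) = z := Subtype.ext (by simp [refl])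

theorem SpectralSet.refl_up {q : ℝ} {Z : SpectralSet q} (z : Z.carrier) :
    Z.refl (Z.up z) = Z.down (Z.refl z) := Subtype.ext (by simp [refl, up, down, mul_comm])

theorem SpectralSet.refl_down {q : ℝ} {Z : SpectralSet q} (z : Z.carrier) :
    Z.refl (Z.down z) = Z.up (Z.refl z) := Subtype.ext (by simp [refl, up, down, mul_comm])

section EpsTau

variable (p q : ℝ)

theorem eps_zero_zero : eps 0 0 = 0 := rfl

theorem eps_zero_one : eps 0 1 = -1 := rfl

theorem eps_one_zero : eps 1 0 = 1 := rfl

theorem eps_one_one : eps 1 1 = 0 := rfl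

theorem tau_zero_zero : tau p q 0 0 = 0 := rfl

theorem tau_zero_one : tau p q 0 1 = bM p q 2 := rfl

theorem tau_one_zero : tau p q 1 0 = -bM p q 0 := rfl

theorem tau_one_one : tau p q 1 1 = 0 := rfl

end EpsTau

namespace LOps

variable {p q : ℝ} [GoodParams p q] {Z : SpectralSet q} {B : Type*} [Ring B] [Algebra ℂ B]
  (X : LOps p q Z B) (z : Z.carrier)

/-- The row minors. -/
def rowMinor (X : LOps p q Z B) (z : Z.carrier) (b d : Fin 2) : B :=
  X.L 1 b z * X.L 0 d (Z.up z) - X.L 0 b z * X.L 1 d (Z.up z)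

/-- The column minors. -/
def colMinor (X : LOps p q Z B) (z : Z.carrier) (a c : Fin 2) : B :=
  X.r (bM p q 2) * (X.L c 1 (Z.up z) * X.L a 0 z) - X.r (bM p q 0) * (X.L c 0 (Z.up z) * X.L a 1 z)

/-- The RLL relation at ratio q^{-2}, where the R-matrix is `eps` ⊗ `tau` up to [1] over [λ+1].
Clearing the denominators on both sides separates the indices: b, d enter the right side only
through `eps`, and a, c the left side only through `tau`. -/
theorem rowMinor_colMinor (a b c d : Fin 2) :
    X.r (bM p q 1) * (X.l (tau p q a c) * X.rowMinor z b d) =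
      eps b d • (X.l (bM p q 1) * X.colMinor z a c) := by
  have h := X.RLL a b c d z (Z.up z)
  rw [SpectralSet.div_up p] at h
  have h1 := congrArg (fun t => X.r (bM p q 1) * (X.l (bM p q 1) * t)) h
  have hc : ∀ f t, X.r (bM p q 1) * (X.l (bM p q 1) * (X.r f * t)) =
      X.l (bM p q 1) * (X.r (bM p q 1 * f) * t) := fun f t => by
    rw [map_mul, ← mul_assoc, ← X.l_r, mul_assoc, mul_assoc]
  simp only [Finset.mul_sum, hc] at h1
  simp only [← mul_assoc (X.l (bM p q 1)) (X.l _), ← map_mul, bM_mul_rM, map_smul] at h1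
  simp only [Fin.sum_univ_two, eps_zero_zero, eps_zero_one, eps_one_zero, eps_one_one,
    tau_zero_zero, tau_zero_one, tau_one_zero, tau_one_one, mul_zero, zero_smul, smul_zero,
    map_zero, zero_mul, zero_add, add_zero, mul_neg, neg_smul, mul_one] at h1
  refine smul_right_injective B (brk_one_ne_zero p q) ?_
  show brk p q 1 • _ = brk p q 1 • _
  rw [← mul_smul, rowMinor, colMinor]
  simp only [mul_sub, smul_sub, smul_mul_assoc, mul_smul_comm, neg_mul, mul_neg, map_neg,
    smul_neg] at h1 ⊢
  rw [sub_eq_add_neg, add_comm, h1, sub_eq_add_neg]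

theorem bM_mul_FMi_eq : X.l (bM p q 1) * X.l (FMi p q) = algebraMap ℂ B (-(q : ℂ)) := by
  have hq := q_ne_zero p q
  have h : bM p q 1 = (-(q : ℂ)) • FM p q := by rw [FM_eq, smul_smul]; simp [hq]
  rw [h, ← map_mul, smul_mul_assoc, FM_mul_FMi, map_smul, map_one, Algebra.algebraMap_eq_smul_one]

/-- The choice a = 0, c = 1 makes the coefficient of the row minor the invertible function [λ+2]. -/
theorem rowMinor_self (b : Fin 2) : X.rowMinor z b b = 0 := by
  have h := X.rowMinor_colMinor z 0 b 1 b
  have h0 : eps b b = 0 := by fin_cases b <;> rfl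
  rw [h0, zero_smul, tau_zero_one] at h
  exact (((isUnit_bM p q 2).map X.l).mul_right_eq_zero.1
    (((isUnit_bM p q 1).map X.r).mul_right_eq_zero.1 h))

theorem rowMinor_zero_one : X.rowMinor z 0 1 = -X.rowMinor z 1 0 := by
  have h := X.rowMinor_colMinor z 0 0 1 1
  have h' := X.rowMinor_colMinor z 0 1 1 0
  rw [eps_zero_one, neg_smul, one_smul] at h
  rw [eps_one_zero, one_smul] at h'
  rw [← h', ← mul_neg, ← mul_neg] at h
  exact ((isUnit_bM p q 2).map X.l).mul_left_cancel (((isUnit_bM p q 1).map X.r).mul_left_cancel h)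

theorem rowMinor_eq (b d : Fin 2) : X.rowMinor z b d = eps b d • X.rowMinor z 1 0 := by
  fin_cases b <;> fin_cases d
  · simpa [eps] using X.rowMinor_self z 0
  · simpa [eps] using X.rowMinor_zero_one z
  · simp [eps]
  · simpa [eps] using X.rowMinor_self z 1

theorem det_eq_rowMinor : X.det z = X.r (FM p q) * X.l (FMi p q) * X.rowMinor z 1 0 := by
  rw [← neg_neg (X.rowMinor z 1 0), ← X.rowMinor_zero_one, rowMinor, neg_sub]
  rfl

/-- With b = 1, d = 0 the row minor in `rowMinor_colMinor` is the determinant up to F, and F is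
proportional to [λ+1] in each moment map. -/
theorem colMinor_eq (a c : Fin 2) : X.colMinor z a c = X.l (tau p q a c) * X.det z := by
  have h := X.rowMinor_colMinor z a 1 c 0
  rw [eps_one_zero, one_smul] at h
  refine ((isUnit_bM p q 1).map X.l).mul_left_cancel ?_
  have e : ∀ t, X.l (bM p q 1) * (X.l (tau p q a c) * (X.r (FM p q) * X.l (FMi p q) * t)) =
      X.l (bM p q 1) * X.l (FMi p q) * (X.r (FM p q) * (X.l (tau p q a c) * t)) := fun t => by
    have h1 := X.l_r (bM p q 1 * tau p q a c * FMi p q) (FM p q)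
    have h2 := X.l_r (bM p q 1 * FMi p q) (FM p q)
    calc _ = X.l (bM p q 1) * X.l (tau p q a c) * (X.r (FM p q) * X.l (FMi p q)) * t := by
          simp only [mul_assoc]
      _ = X.l (bM p q 1 * tau p q a c * FMi p q) * X.r (FM p q) * t := by
          rw [← X.l_r]; simp only [map_mul, mul_assoc]
      _ = X.r (FM p q) * (X.l (bM p q 1 * FMi p q) * X.l (tau p q a c)) * t := by
          rw [h1, ← map_mul]; congr 3; ring
      _ = _ := by rw [← mul_assoc, ← h2, map_mul]; simp only [mul_assoc]
  rw [← h, det_eq_rowMinor, e, bM_mul_FMi_eq, ← Algebra.smul_def, ← smul_mul_assoc, ← map_smul,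
    FM_eq, smul_smul]
  have hq := q_ne_zero p q
  simp [hq]

end LOps

end EllipticU2

namespace EllipticU2

/-! ### The bigrading and the counit -/

namespace Ell

variable {p q : ℝ} {Z : SpectralSet q}

theorem word_mem (w : List (Gen Z)) : (w.map (of p q Z)).prod ∈
    grading p q Z (w.map Gen.deg).sum.1 (w.map Gen.deg).sum.2 :=
  Submodule.subset_span ⟨w, rfl, rfl⟩

theorem gen_mem (g : Gen Z) : of p q Z g ∈ grading p q Z g.deg.1 g.deg.2 := by
  simpa using word_mem (p := p) [g]

theorem one_mem_grading : (1 : Ell p q Z) ∈ grading p q Z 0 0 := word_mem (p := p) []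

theorem muL_mem (f : Mero) : muL p q Z f ∈ grading p q Z 0 0 := gen_mem (.ml f)

theorem muR_mem (f : Mero) : muR p q Z f ∈ grading p q Z 0 0 := gen_mem (.mr f)

theorem L_mem (x y : Fin 2) (z : Z.carrier) : L p q Z x y z ∈ grading p q Z (wt x) (wt y) :=
  gen_mem (.L x y z)

theorem detInv_mem (z : Z.carrier) : detInv p q Z z ∈ grading p q Z 0 0 := gen_mem (.detInv z)

theorem mul_mem_grading {α β γ δ : ℂ} {a b : Ell p q Z} (ha : a ∈ grading p q Z α β)
    (hb : b ∈ grading p q Z γ δ) : a * b ∈ grading p q Z (α + γ) (β + δ) := by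
  refine Submodule.mul_le.1 ?_ a ha b hb
  rw [grading, grading, Submodule.span_mul_span]
  refine Submodule.span_le.2 ?_
  rintro _ ⟨_, ⟨w, hw, rfl⟩, _, ⟨w', hw', rfl⟩, rfl⟩
  refine Submodule.subset_span ⟨w ++ w', ?_, ?_⟩
  · rw [List.map_append, List.sum_append, hw, hw']; rfl
  · simp

theorem muL_mul_of_mem {α β : ℂ} {a : Ell p q Z} (ha : a ∈ grading p q Z α β) (f : Mero) :
    muL p q Z f * a = a * muL p q Z (Mero.shift α f) := by
  induction ha using Submodule.span_induction generalizing f with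
  | mem x hx =>
    obtain ⟨w, hw, rfl⟩ := hx
    replace hw : α = (w.map Gen.deg).sum.1 := by rw [hw]
    subst hw
    clear β
    induction w generalizing f with
    | nil => simp [Mero.shift_zero]
    | cons g w ih =>
      rw [List.map_cons, List.prod_cons, List.map_cons, List.sum_cons, Prod.fst_add, add_comm,
        ← Mero.shift_shift, mul_assoc, ← ih, ← mul_assoc, ← mul_assoc]
      congr 1
      cases g with
      | ml g =>
        show muL p q Z f * muL p q Z g = muL p q Z g * muL p q Z (Mero.shift 0 f)
        rw [Mero.shift_zero, ← map_mul, ← map_mul, mul_comm]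
      | mr g =>
        show muL p q Z f * muR p q Z g = muR p q Z g * muL p q Z (Mero.shift 0 f)
        rw [Mero.shift_zero, muL_muR]
      | L x y z => exact muL_L f x y z
      | detInv z =>
        show muL p q Z f * detInv p q Z z = detInv p q Z z * muL p q Z (Mero.shift 0 f)
        rw [Mero.shift_zero, detInv_mul_comm]
  | zero => simp
  | add x y _ _ hx hy => rw [mul_add, add_mul, hx, hy]
  | smul c x _ hx => rw [mul_smul_comm, smul_mul_assoc, hx]

theorem muR_mul_of_mem {α β : ℂ} {a : Ell p q Z} (ha : a ∈ grading p q Z α β) (f : Mero) :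
    muR p q Z f * a = a * muR p q Z (Mero.shift β f) := by
  induction ha using Submodule.span_induction generalizing f with
  | mem x hx =>
    obtain ⟨w, hw, rfl⟩ := hx
    replace hw : β = (w.map Gen.deg).sum.2 := by rw [hw]
    subst hw
    clear α
    induction w generalizing f with
    | nil => simp [Mero.shift_zero]
    | cons g w ih =>
      rw [List.map_cons, List.prod_cons, List.map_cons, List.sum_cons, Prod.snd_add, add_comm,
        ← Mero.shift_shift, mul_assoc, ← ih, ← mul_assoc, ← mul_assoc]
      congr 1
      cases g with
      | mr g =>
        show muR p q Z f * muR p q Z g = muR p q Z g * muR p q Z (Mero.shift 0 f)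
        rw [Mero.shift_zero, ← map_mul, ← map_mul, mul_comm]
      | ml g =>
        show muR p q Z f * muL p q Z g = muL p q Z g * muR p q Z (Mero.shift 0 f)
        rw [Mero.shift_zero, muL_muR]
      | L x y z => exact muR_L f x y z
      | detInv z =>
        show muR p q Z f * detInv p q Z z = detInv p q Z z * muR p q Z (Mero.shift 0 f)
        rw [Mero.shift_zero, detInv_mul_comm]
  | zero => simp
  | add x y _ _ hx hy => rw [mul_add, add_mul, hx, hy]
  | smul c x _ hx => rw [mul_smul_comm, smul_mul_assoc, hx]

open AddMonoidAlgebra in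
variable (p q Z) in
/-- The representation of `ℰ` on formal combinations of elements with bidegrees. -/
def degRep : EllRep p q Z (AddMonoidAlgebra (Ell p q Z) (ℂ × ℂ)) where
  l := singleZeroAlgHom.comp (muL p q Z)
  r := singleZeroAlgHom.comp (muR p q Z)
  L x y z := single (wt x, wt y) (L p q Z x y z)
  l_r f g := by
    simp only [AlgHom.comp_apply, singleZeroAlgHom_apply]
    rw [single_mul_single, single_mul_single, muL_muR]
  l_L f x y z := by
    simp only [AlgHom.comp_apply, singleZeroAlgHom_apply]
    rw [single_mul_single, single_mul_single, muL_L, zero_add, add_zero]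
  r_L f x y z := by
    simp only [AlgHom.comp_apply, singleZeroAlgHom_apply]
    rw [single_mul_single, single_mul_single, muR_L, zero_add, add_zero]
  RLL a b c d z₁ z₂ := by
    have h := congrArg (single (M := ℂ × ℂ) (wt a + wt c, wt b + wt d))
      ((rep p q Z).RLL a b c d z₁ z₂)
    simp only [← singleAddHom_apply, map_sum] at h
    refine Eq.trans ?_ (h.trans ?_)
    · refine Finset.sum_congr rfl fun x _ => Finset.sum_congr rfl fun y _ => ?_
      simp only [AlgHom.comp_apply, singleZeroAlgHom_apply, singleAddHom_apply]
      rw [single_mul_single, single_mul_single, zero_add]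
      -- Terms violating conservation of weight have coefficient zero; all others carry the common
      -- bidegree (ω(a)+ω(c), ω(b)+ω(d)).
      by_cases hw : wt x + wt y = wt a + wt c
      · rw [← hw]; rfl
      · rw [rM_eq_zero hw, map_zero, zero_mul, map_zero, zero_mul, single_zero, single_zero]
    · refine Finset.sum_congr rfl fun x _ => Finset.sum_congr rfl fun y _ => ?_
      simp only [AlgHom.comp_apply, singleZeroAlgHom_apply, singleAddHom_apply]
      rw [single_mul_single, single_mul_single, zero_add]
      by_cases hw : wt b + wt d = wt x + wt y
      · rw [hw, add_comm (wt a), add_comm (wt x)]; rfl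
      · rw [rM_eq_zero hw, map_zero, zero_mul, map_zero, zero_mul, single_zero, single_zero]
  dI z := single 0 (detInv p q Z z)
  dI_det z := by
    simp only [LOps.det, AlgHom.comp_apply, singleZeroAlgHom_apply, single_mul_single]
    have e1 : ((wt 0, wt 0) + (wt 1, wt 1) : ℂ × ℂ) = 0 := by simp [wt]
    have e2 : ((wt 1, wt 0) + (wt 0, wt 1) : ℂ × ℂ) = 0 := by simp [wt]
    rw [e1, e2, ← single_sub, single_mul_single, single_mul_single]
    simp only [add_zero]
    exact congrArg (single 0) (detInv_det (p := p) z)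
  det_dI z := by
    simp only [LOps.det, AlgHom.comp_apply, singleZeroAlgHom_apply, single_mul_single]
    have e1 : ((wt 0, wt 0) + (wt 1, wt 1) : ℂ × ℂ) = 0 := by simp [wt]
    have e2 : ((wt 1, wt 0) + (wt 0, wt 1) : ℂ × ℂ) = 0 := by simp [wt]
    rw [e1, e2, ← single_sub, single_mul_single, single_mul_single]
    simp only [add_zero]
    exact congrArg (single 0) (det_detInv (p := p) z)
  dI_l z f := by
    simp only [AlgHom.comp_apply, singleZeroAlgHom_apply]
    rw [single_mul_single, single_mul_single, detInv_mul_comm]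
  dI_r z f := by
    simp only [AlgHom.comp_apply, singleZeroAlgHom_apply]
    rw [single_mul_single, single_mul_single, detInv_mul_comm]
  dI_L z x y w := by
    rw [single_mul_single, single_mul_single, detInv_mul_comm, zero_add, add_zero]

/-- The homogeneous components of an element. -/
def comps : Ell p q Z →ₗ[ℂ] (ℂ × ℂ →₀ Ell p q Z) where
  toFun a := ((degRep p q Z).lift a).coeff
  map_add' a b := by simp
  map_smul' c a := by simp

theorem comps_of_mem {α β : ℂ} {a : Ell p q Z} (ha : a ∈ grading p q Z α β) :
    comps a = Finsupp.single (α, β) a := by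
  induction ha using Submodule.span_induction with
  | mem x hx =>
    obtain ⟨w, hw, rfl⟩ := hx
    rw [← hw]
    have : (degRep p q Z).lift (w.map (of p q Z)).prod =
        AddMonoidAlgebra.single (w.map Gen.deg).sum (w.map (of p q Z)).prod := by
      clear hw
      induction w with
      | nil => simp; rfl
      | cons g w ih =>
        simp only [List.map_cons, List.prod_cons, List.sum_cons, map_mul, ih, EllRep.lift_of]
        rw [← AddMonoidAlgebra.single_mul_single]
        congr 1
        cases g <;> rfl
    show ((degRep p q Z).lift _).coeff = _
    rw [this]
    rfl
  | zero => simp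
  | add x y _ _ hx hy => rw [map_add, hx, hy, Finsupp.single_add]
  | smul c x _ hx => rw [map_smul, hx, Finsupp.smul_single]

/-- Linear statements on `ℰ` may be checked on homogeneous elements. -/
theorem induction_homogeneous {motive : Ell p q Z → Prop} (a : Ell p q Z)
    (add : ∀ a b, motive a → motive b → motive (a + b))
    (mem : ∀ α β a, a ∈ grading p q Z α β → motive a) : motive a := by
  have h : a ∈ Submodule.span ℂ {t | ∃ w : List (Gen Z), t = (w.map (of p q Z)).prod} := by
    rw [span_words]; trivial
  obtain ⟨n, c, g, rfl⟩ := Submodule.mem_span_set'.1 h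
  refine Finset.sum_induction _ motive add (mem 0 0 0 (zero_mem _)) fun i _ => ?_
  obtain ⟨w, hw⟩ := (g i).2
  exact mem _ _ _ (Submodule.smul_mem _ _ (hw ▸ word_mem w))

/-- Independence holds because `comps` recovers the summands from a sum of homogeneous elements;
spanning holds because words in the generators are homogeneous. -/
theorem isInternal_grading :
    DirectSum.IsInternal fun i : ℂ × ℂ => grading p q Z i.1 i.2 := by
  classical
  constructor
  · intro x y hxy
    have key : ∀ x : DirectSum (ℂ × ℂ) fun i => grading p q Z i.1 i.2, ∀ i,
        comps (DirectSum.coeAddMonoidHom (fun i : ℂ × ℂ => grading p q Z i.1 i.2) x) i = x i := by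
      intro x i
      induction x using DirectSum.induction_on with
      | zero => simp
      | of j a =>
        rw [DirectSum.coeAddMonoidHom_of, comps_of_mem a.2, DirectSum.coe_of_apply,
          Finsupp.single_apply]
        by_cases h : j = i
        · subst h; simp
        · simp [h]
      | add x y hx hy => rw [map_add, map_add, Finsupp.add_apply, hx, hy]; rfl
    exact DFinsupp.ext fun i => Subtype.ext (by rw [← key x, ← key y, hxy])
  · intro a
    refine induction_homogeneous (motive := fun a => ∃ x, DirectSum.coeAddMonoidHom
      (fun i : ℂ × ℂ => grading p q Z i.1 i.2) x = a) a ?_ ?_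
    · rintro _ _ ⟨x, rfl⟩ ⟨y, rfl⟩
      exact ⟨x + y, map_add _ _ _⟩
    · intro α β a ha
      exact ⟨DirectSum.of (fun i : ℂ × ℂ => grading p q Z i.1 i.2) (α, β) ⟨a, ha⟩,
        DirectSum.coeAddMonoidHom_of _ _ _⟩

/-! ### Maps defined degree by degree -/

section Lift

variable {V : Type*} [AddCommGroup V] [Module ℂ V]

/-- The linear map on `ℰ` that is given by `F (α, β)` on elements of bidegree `(α, β)`. -/
def gradedLift (F : ℂ × ℂ → Ell p q Z →ₗ[ℂ] V) : Ell p q Z →ₗ[ℂ] V :=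
  Finsupp.lsum ℂ F ∘ₗ comps

theorem gradedLift_of_mem (F : ℂ × ℂ → Ell p q Z →ₗ[ℂ] V) {α β : ℂ} {a : Ell p q Z}
    (ha : a ∈ grading p q Z α β) : gradedLift F a = F (α, β) a := by
  rw [gradedLift, LinearMap.comp_apply, comps_of_mem ha, Finsupp.lsum_single]

open Classical in
/-- The bilinear map that is given by `F` on pairs of elements such that the right degree of the
first one is the left degree of the second one, and that vanishes on other pairs. -/
def matched (F : Ell p q Z →ₗ[ℂ] Ell p q Z →ₗ[ℂ] V) : Ell p q Z →ₗ[ℂ] Ell p q Z →ₗ[ℂ] V :=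
  gradedLift fun i => (gradedLift fun j => if i.2 = j.1 then F.flip else 0).flip

theorem matched_of_mem (F : Ell p q Z →ₗ[ℂ] Ell p q Z →ₗ[ℂ] V) {α β γ : ℂ} {a b : Ell p q Z}
    (ha : a ∈ grading p q Z α β) (hb : b ∈ grading p q Z β γ) : matched F a b = F a b := by
  rw [matched, gradedLift_of_mem _ ha, LinearMap.flip_apply, gradedLift_of_mem _ hb, if_pos rfl,
    LinearMap.flip_apply]

theorem matched_of_ne (F : Ell p q Z →ₗ[ℂ] Ell p q Z →ₗ[ℂ] V) {α β γ δ : ℂ} {a b : Ell p q Z}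
    (ha : a ∈ grading p q Z α β) (hb : b ∈ grading p q Z γ δ) (h : β ≠ γ) : matched F a b = 0 := by
  rw [matched, gradedLift_of_mem _ ha, LinearMap.flip_apply, gradedLift_of_mem _ hb, if_neg h,
    LinearMap.zero_apply, LinearMap.zero_apply]

end Lift

/-! ### The counit -/

section Counit

variable [GoodParams p q]

open DiffOp

variable (p q Z) in
/-- The representation that defines the counit. -/
def counitRep : EllRep p q Z DiffOp where
  l := mulHom
  r := mulHom
  L x y _ := if x = y then T (-wt x) else 0
  l_r f g := by rw [← map_mul, ← map_mul, mul_comm]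
  l_L f x y z := by
    split_ifs
    · rw [mulHom_apply, mulHom_apply, T_mul_mulOp, Mero.shift_shift, neg_add_cancel,
        Mero.shift_zero]
    · simp
  r_L f x y z := by
    split_ifs with h
    · rw [mulHom_apply, mulHom_apply, T_mul_mulOp, Mero.shift_shift, h, neg_add_cancel,
        Mero.shift_zero]
    · simp
  RLL a b c d z₁ z₂ := by
    simp only [ite_mul, mul_ite, zero_mul, mul_zero, T_mul_T, Finset.sum_ite_irrel,
      Finset.sum_ite_eq, Finset.sum_ite_eq', Finset.mem_univ, if_true, Finset.sum_const_zero]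
    -- Both sides have collapsed to the entry R^{bd}_{ac} times a shift, and the two shifts agree
    -- whenever the entry is non-zero.
    by_cases hw : wt b + wt d = wt a + wt c
    · rw [show -wt b + -wt d = -(wt b + wt d) by ring, hw]
      congr 2
      ring
    · rw [rM_eq_zero hw, map_zero, zero_mul, zero_mul]
  dI _ := 1
  dI_det z := by
    simp [LOps.det, T_mul_T, ← map_mul, FM_mul_FMi, wt, T_zero]
  det_dI z := by
    simp [LOps.det, T_mul_T, ← map_mul, FM_mul_FMi, wt, T_zero]
  dI_l z f := by simp
  dI_r z f := by simp
  dI_L z x y w := by simp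

variable (p q Z) in
/-- The counit. -/
def counit : Ell p q Z →ₐ[ℂ] DiffOp := (counitRep p q Z).lift

theorem counit_muL (f : Mero) : counit p q Z (muL p q Z f) = mulOp f := EllRep.lift_muL _ f

theorem counit_muR (f : Mero) : counit p q Z (muR p q Z f) = mulOp f := EllRep.lift_muR _ f

theorem counit_L (x y : Fin 2) (z : Z.carrier) :
    counit p q Z (L p q Z x y z) = if x = y then T (-wt x) else 0 := EllRep.lift_L _ x y z

theorem counit_detInv (z : Z.carrier) : counit p q Z (detInv p q Z z) = 1 :=
  EllRep.lift_detInv _ z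

theorem counit_mem {α β : ℂ} {a : Ell p q Z} (ha : a ∈ grading p q Z α β) :
    HasDeg α β (counit p q Z a) := by
  induction ha using Submodule.span_induction with
  | mem x hx =>
    obtain ⟨w, hw, rfl⟩ := hx
    replace hw : α = (w.map Gen.deg).sum.1 ∧ β = (w.map Gen.deg).sum.2 := by rw [hw]; simp
    obtain ⟨rfl, rfl⟩ := hw
    induction w with
    | nil => simpa [mulOp, term_one_zero] using hasDeg_mulOp 1
    | cons g w ih =>
      rw [List.map_cons, List.map_cons, List.prod_cons, map_mul, List.sum_cons]
      refine HasDeg.mul ?_ ih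
      cases g with
      | ml f => exact (counit_muL (p := p) (q := q) (Z := Z) f).symm ▸ hasDeg_mulOp f
      | mr f => exact (counit_muR (p := p) (q := q) (Z := Z) f).symm ▸ hasDeg_mulOp f
      | L x y z =>
        refine (counit_L (p := p) x y z).symm ▸ ?_
        split_ifs with h
        · subst h; exact hasDeg_T _
        · exact HasDeg.zero _ _
      | detInv z => exact (counit_detInv (p := p) z).symm ▸ hasDeg_mulOp 1
  | zero => rw [map_zero]; exact HasDeg.zero _ _
  | add x y _ _ hx hy => rw [map_add]; exact hx.add hy
  | smul c x _ hx => rw [map_smul]; exact hx.smul c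

theorem muL_injective : Function.Injective (muL p q Z) := fun f g h =>
  DiffOp.term_injective 0 (by simpa [counit_muL, mulOp] using congrArg (counit p q Z) h)

theorem muR_injective : Function.Injective (muR p q Z) := fun f g h =>
  DiffOp.term_injective 0 (by simpa [counit_muR, mulOp] using congrArg (counit p q Z) h)

variable (p q Z) in
/-- The counit, with values in the field of meromorphic functions. -/
def eps0 : Ell p q Z →ₗ[ℂ] Mero := applyOneₗ ∘ₗ (counit p q Z).toLinearMap

theorem eps0_apply (a : Ell p q Z) : eps0 p q Z a = applyOne (counit p q Z a) := rfl

@[simp] theorem eps0_one : eps0 p q Z 1 = 1 := by simp [eps0_apply]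

@[simp] theorem eps0_muL_mul (f : Mero) (a : Ell p q Z) :
    eps0 p q Z (muL p q Z f * a) = f * eps0 p q Z a := by
  rw [eps0_apply, map_mul, counit_muL, applyOne_mulOp_mul, eps0_apply]

@[simp] theorem eps0_muR_mul (f : Mero) (a : Ell p q Z) :
    eps0 p q Z (muR p q Z f * a) = f * eps0 p q Z a := by
  rw [eps0_apply, map_mul, counit_muR, applyOne_mulOp_mul, eps0_apply]

@[simp] theorem eps0_L_mul (x y : Fin 2) (z : Z.carrier) (a : Ell p q Z) :
    eps0 p q Z (L p q Z x y z * a) = if x = y then Mero.shift (-wt x) (eps0 p q Z a) else 0 := by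
  rw [eps0_apply, map_mul, counit_L]
  split_ifs
  · rw [applyOne_T_mul, eps0_apply]
  · simp

@[simp] theorem eps0_detInv_mul (z : Z.carrier) (a : Ell p q Z) :
    eps0 p q Z (detInv p q Z z * a) = eps0 p q Z a := by
  rw [eps0_apply, map_mul, counit_detInv, one_mul, eps0_apply]

end Counit

end Ell

end EllipticU2

namespace EllipticU2

/-! ### Balanced tensor products -/

section Balanced

variable {A : Type*} [Ring A] [Algebra ℂ A] {μl μr : Mero →ₐ[ℂ] A}

variable (μl μr) in
/-- The class of `a ⊗ b` as a bilinear function. -/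
def btmulₗ : A →ₗ[ℂ] A →ₗ[ℂ] BalTensor μl μr :=
  (TensorProduct.mk ℂ A A).compr₂ (balRel μl μr).mkQ

theorem btmulₗ_apply (a b : A) : btmulₗ μl μr a b = btmul μl μr a b := rfl

theorem btmul_muR (f : Mero) (a b : A) :
    btmul μl μr (μr f * a) b = btmul μl μr a (μl f * b) := by
  rw [← sub_eq_zero]
  show (balRel μl μr).mkQ _ - (balRel μl μr).mkQ _ = 0
  rw [← map_sub]
  exact (Submodule.Quotient.mk_eq_zero _).2 (Submodule.subset_span ⟨f, a, b, rfl⟩)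

variable {V : Type*} [AddCommGroup V] [Module ℂ V]

/-- The linear map on `A ⊗_M A` that is given by a balanced bilinear map. -/
def btLift (F : A →ₗ[ℂ] A →ₗ[ℂ] V) (h : ∀ f a b, F (μr f * a) b = F a (μl f * b)) :
    BalTensor μl μr →ₗ[ℂ] V :=
  (balRel μl μr).liftQ (TensorProduct.lift F) (Submodule.span_le.2 (by
    rintro _ ⟨f, a, b, rfl⟩
    simp [h]))

@[simp] theorem btLift_btmul (F : A →ₗ[ℂ] A →ₗ[ℂ] V)
    (h : ∀ f a b, F (μr f * a) b = F a (μl f * b)) (a b : A) :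
    btLift F h (btmul μl μr a b) = F a b :=
  (Submodule.liftQ_apply ..).trans (TensorProduct.lift.tmul ..)

@[elab_as_elim]
theorem bt_induction {motive : BalTensor μl μr → Prop} (t : BalTensor μl μr)
    (btmul : ∀ a b, motive (btmul μl μr a b)) (add : ∀ s t, motive s → motive t → motive (s + t)) :
    motive t := by
  obtain ⟨t, rfl⟩ := (balRel μl μr).mkQ_surjective t
  induction t using TensorProduct.induction_on with
  | zero =>
    have := btmul 0 0
    rwa [← btmulₗ_apply, map_zero, ← map_zero (balRel μl μr).mkQ] at this
  | tmul a b => exact btmul a b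
  | add x y hx hy => rw [map_add]; exact add _ _ hx hy

theorem bt_ext {φ ψ : BalTensor μl μr →ₗ[ℂ] V}
    (h : ∀ a b, φ (btmul μl μr a b) = ψ (btmul μl μr a b)) : φ = ψ :=
  LinearMap.ext fun t => by
    induction t using bt_induction with
    | btmul a b => exact h a b
    | add s t hs ht => rw [map_add, map_add, hs, ht]

variable (μl μr) in
/-- Left multiplication by `u ⊗ v` is well defined on `A ⊗_M A`. -/
def IsMatched (u v : A) : Prop := ∀ f, ∃ g, u * μr f = μr g * u ∧ v * μl f = μl g * v

/-- Left multiplication by `u ⊗ v`. -/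
def lmul {u v : A} (h : IsMatched μl μr u v) : Module.End ℂ (BalTensor μl μr) :=
  btLift (((btmulₗ μl μr).compl₂ (LinearMap.mulLeft ℂ v)).comp (LinearMap.mulLeft ℂ u)) (by
    intro f a b
    obtain ⟨g, h1, h2⟩ := h f
    simp only [LinearMap.comp_apply, LinearMap.compl₂_apply, LinearMap.mulLeft_apply, btmulₗ_apply,
      ← mul_assoc, h1, h2]
    rw [mul_assoc, btmul_muR, mul_assoc])

@[simp] theorem lmul_btmul {u v : A} (h : IsMatched μl μr u v) (a b : A) :
    lmul h (btmul μl μr a b) = btmul μl μr (u * a) (v * b) := btLift_btmul ..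

variable (μl μr) in
/-- Right multiplication by `u ⊗ v`. -/
def rmul (u v : A) : Module.End ℂ (BalTensor μl μr) :=
  btLift (((btmulₗ μl μr).compl₂ (LinearMap.mulRight ℂ v)).comp (LinearMap.mulRight ℂ u)) (by
    intro f a b
    simp only [LinearMap.comp_apply, LinearMap.compl₂_apply, LinearMap.mulRight_apply,
      btmulₗ_apply, mul_assoc]
    rw [btmul_muR])

@[simp] theorem rmul_btmul (u v a b : A) :
    rmul μl μr u v (btmul μl μr a b) = btmul μl μr (a * u) (b * v) := btLift_btmul ..

theorem btmul_add_left (a a' b : A) :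
    btmul μl μr (a + a') b = btmul μl μr a b + btmul μl μr a' b :=
  LinearMap.map_add₂ (btmulₗ μl μr) a a' b

theorem btmul_add_right (a b b' : A) :
    btmul μl μr a (b + b') = btmul μl μr a b + btmul μl μr a b' :=
  map_add (btmulₗ μl μr a) b b'

theorem btmul_smul_left (c : ℂ) (a b : A) :
    btmul μl μr (c • a) b = c • btmul μl μr a b :=
  LinearMap.map_smul₂ (btmulₗ μl μr) c a b

theorem btmul_smul_right (c : ℂ) (a b : A) :
    btmul μl μr a (c • b) = c • btmul μl μr a b :=
  map_smul (btmulₗ μl μr a) c b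

theorem btmul_neg_left (a b : A) : btmul μl μr (-a) b = -btmul μl μr a b :=
  LinearMap.map_neg₂ (btmulₗ μl μr) a b

theorem btmul_sub_left (a a' b : A) :
    btmul μl μr (a - a') b = btmul μl μr a b - btmul μl μr a' b :=
  LinearMap.map_sub₂ (btmulₗ μl μr) a a' b

theorem btmul_sub_right (a b b' : A) :
    btmul μl μr a (b - b') = btmul μl μr a b - btmul μl μr a b' :=
  map_sub (btmulₗ μl μr a) b b'

theorem btmul_sum_left {ι : Type*} (s : Finset ι) (f : ι → A) (b : A) :
    btmul μl μr (∑ i ∈ s, f i) b = ∑ i ∈ s, btmul μl μr (f i) b := by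
  rw [← btmulₗ_apply, map_sum, LinearMap.sum_apply]; rfl

theorem btmul_sum_right {ι : Type*} (s : Finset ι) (a : A) (f : ι → A) :
    btmul μl μr a (∑ i ∈ s, f i) = ∑ i ∈ s, btmul μl μr a (f i) :=
  map_sum (btmulₗ μl μr a) f s

end Balanced

theorem sum_rotate' {ι κ V : Type*} [Fintype ι] [Fintype κ] [AddCommMonoid V]
    (g : ι → ι → κ → κ → V) :
    ∑ x, ∑ y, ∑ e, ∑ f, g x y e f = ∑ e, ∑ f, ∑ x, ∑ y, g x y e f := by
  have h1 : ∀ x, ∑ y, ∑ e, ∑ f, g x y e f = ∑ e, ∑ f, ∑ y, g x y e f := fun x => by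
    rw [Finset.sum_comm]
    exact Finset.sum_congr rfl fun e _ => Finset.sum_comm
  simp only [h1]
  rw [Finset.sum_comm]
  exact Finset.sum_congr rfl fun e _ => Finset.sum_comm

theorem sum_rotate {ι κ V : Type*} [Fintype ι] [Fintype κ] [AddCommMonoid V]
    (g : ι → ι → κ → κ → V) :
    ∑ x, ∑ y, ∑ f, ∑ e, g x y e f = ∑ e, ∑ f, ∑ x, ∑ y, g x y e f :=
  (Finset.sum_congr rfl fun _ _ => Finset.sum_congr rfl fun _ _ => Finset.sum_comm).trans
    (sum_rotate' g)

/-! ### The comultiplication of `ℰ` -/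

namespace Ell

variable (p q : ℝ) (Z : SpectralSet q)

/-- The tensor product of `ℰ` with itself over the field of meromorphic functions. -/
abbrev BT : Type := BalTensor (muL p q Z) (muR p q Z)

variable {p q Z}

local notation "tm" => btmul (muL p q Z) (muR p q Z)

/-- Induction on the length of words for properties that depend on the bidegree. -/
theorem grading_induction {motive : ℂ → ℂ → Ell p q Z → Prop} {α β : ℂ} {a : Ell p q Z}
    (ha : a ∈ grading p q Z α β) (zero : ∀ α β, motive α β 0)
    (add : ∀ α β a b, motive α β a → motive α β b → motive α β (a + b))
    (smul : ∀ α β (c : ℂ) a, motive α β a → motive α β (c • a)) (one : motive 0 0 1)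
    (muL_mul : ∀ α β f a, a ∈ grading p q Z α β → motive α β a → motive α β (muL p q Z f * a))
    (muR_mul : ∀ α β f a, a ∈ grading p q Z α β → motive α β a → motive α β (muR p q Z f * a))
    (L_mul : ∀ α β x y z a, a ∈ grading p q Z α β → motive α β a →
      motive (wt x + α) (wt y + β) (L p q Z x y z * a))
    (detInv_mul : ∀ α β z a, a ∈ grading p q Z α β → motive α β a →
      motive α β (detInv p q Z z * a)) : motive α β a := by
  have key : ∀ w : List (Gen Z),
      motive (w.map Gen.deg).sum.1 (w.map Gen.deg).sum.2 (w.map (of p q Z)).prod := by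
    intro w
    induction w with
    | nil => exact one
    | cons g w ih =>
      have hw := word_mem (p := p) w
      rw [List.map_cons, List.map_cons, List.prod_cons, List.sum_cons, Prod.fst_add, Prod.snd_add]
      cases g with
      | ml f =>
        simp only [Gen.deg, Prod.fst_zero, Prod.snd_zero, zero_add]
        exact muL_mul _ _ f _ hw ih
      | mr f =>
        simp only [Gen.deg, Prod.fst_zero, Prod.snd_zero, zero_add]
        exact muR_mul _ _ f _ hw ih
      | L x y z => exact L_mul _ _ _ _ _ _ hw ih
      | detInv z =>
        simp only [Gen.deg, Prod.fst_zero, Prod.snd_zero, zero_add]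
        exact detInv_mul _ _ z _ hw ih
  induction ha using Submodule.span_induction with
  | mem x hx =>
    obtain ⟨w, hw, rfl⟩ := hx
    have := key w
    rwa [hw] at this
  | zero => exact zero α β
  | add x y _ _ hx hy => exact add _ _ _ _ hx hy
  | smul c x _ hx => exact smul _ _ _ _ hx

/-- Passing μ_r(f) through u shifts f by the right degree of u, and passing μ_l(f) through v shifts
it by the left degree of v. Left multiplication is well defined exactly because these degrees
coincide. -/
theorem isMatched_of_mem {α β γ : ℂ} {u v : Ell p q Z} (hu : u ∈ grading p q Z α β)
    (hv : v ∈ grading p q Z β γ) : IsMatched (muL p q Z) (muR p q Z) u v := fun f => by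
  refine ⟨Mero.shift (-β) f, ?_, ?_⟩
  · rw [muR_mul_of_mem hu, Mero.shift_shift, add_neg_cancel, Mero.shift_zero]
  · rw [muL_mul_of_mem hv, Mero.shift_shift, add_neg_cancel, Mero.shift_zero]

variable (p q Z) in
/-- Left multiplication by `μ_l(f) ⊗ 1`. -/
def lmulMuL : Mero →ₐ[ℂ] Module.End ℂ (BT p q Z) := AlgHom.ofLinearMap
  { toFun := fun f => lmul (isMatched_of_mem (muL_mem f) one_mem_grading)
    map_add' := fun f g => bt_ext fun a b => by simp [add_mul, btmul_add_left]
    map_smul' := fun c f => bt_ext fun a b => by simp [btmul_smul_left] }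
  (bt_ext fun a b => by simp) (fun f g => bt_ext fun a b => by simp [mul_assoc])

variable (p q Z) in
/-- Left multiplication by `1 ⊗ μ_r(f)`. -/
def lmulMuR : Mero →ₐ[ℂ] Module.End ℂ (BT p q Z) := AlgHom.ofLinearMap
  { toFun := fun f => lmul (isMatched_of_mem one_mem_grading (muR_mem f))
    map_add' := fun f g => bt_ext fun a b => by simp [add_mul, btmul_add_right]
    map_smul' := fun c f => bt_ext fun a b => by simp [btmul_smul_right] }
  (bt_ext fun a b => by simp) (fun f g => bt_ext fun a b => by simp [mul_assoc])

variable (p q Z) in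
/-- Left multiplication by `∑ L_{ax}(z) ⊗ L_{xb}(z)`. -/
def lmulL (a b : Fin 2) (z : Z.carrier) : Module.End ℂ (BT p q Z) :=
  ∑ x, lmul (isMatched_of_mem (L_mem a x z) (L_mem x b z))

theorem lmulMuL_tm (f : Mero) (u v : Ell p q Z) :
    lmulMuL p q Z f (tm u v) = tm (muL p q Z f * u) v := by
  refine (lmul_btmul (isMatched_of_mem (muL_mem f) one_mem_grading) _ _).trans ?_
  rw [one_mul]

theorem lmulMuR_tm (f : Mero) (u v : Ell p q Z) :
    lmulMuR p q Z f (tm u v) = tm u (muR p q Z f * v) := by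
  refine (lmul_btmul (isMatched_of_mem one_mem_grading (muR_mem f)) _ _).trans ?_
  rw [one_mul]

theorem lmulL_tm (a b : Fin 2) (z : Z.carrier) (u v : Ell p q Z) :
    lmulL p q Z a b z (tm u v) =
      ∑ x, tm (L p q Z a x z * u) (L p q Z x b z * v) := by
  rw [lmulL, LinearMap.sum_apply]
  exact Finset.sum_congr rfl fun x _ => lmul_btmul _ _ _

variable (p q Z) in
/-- The operators of left multiplication by the comultiplication of the generators, without
`det⁻¹`. -/
def comulOps : LOps p q Z (Module.End ℂ (BT p q Z)) where
  l := lmulMuL p q Z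
  r := lmulMuR p q Z
  L := lmulL p q Z
  l_r f g := bt_ext fun a b => by
    simp only [Module.End.mul_apply, lmulMuL_tm, lmulMuR_tm]
  l_L f x y z := bt_ext fun a b => by
    simp only [Module.End.mul_apply, lmulMuL_tm, lmulL_tm, map_sum, ← mul_assoc, muL_L]
  r_L f x y z := bt_ext fun a b => by
    simp only [Module.End.mul_apply, lmulMuR_tm, lmulL_tm, map_sum, ← mul_assoc, muR_L]
  RLL a b c d z₁ z₂ := bt_ext fun u v => by
    simp only [LinearMap.sum_apply, Module.End.mul_apply, map_sum, lmulMuL_tm, lmulMuR_tm, lmulL_tm]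
    have h1 : ∀ e f, ∑ x, ∑ y, muL p q Z (rM p q (z₁ / z₂ : ℂ) x y a c) *
        (L p q Z x e z₁ * (L p q Z y f z₂ * u)) =
        ∑ x, ∑ y, muR p q Z (rM p q (z₁ / z₂ : ℂ) e f x y) *
          (L p q Z c y z₂ * (L p q Z a x z₁ * u)) := fun e f => by
      have := congrArg (· * u) ((rep p q Z).RLL a e c f z₁ z₂)
      simp only [Finset.sum_mul, mul_assoc] at this
      exact this
    have h2 : ∀ x y, ∑ e, ∑ f, muL p q Z (rM p q (z₁ / z₂ : ℂ) e f x y) *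
        (L p q Z e b z₁ * (L p q Z f d z₂ * v)) =
        ∑ e, ∑ f, muR p q Z (rM p q (z₁ / z₂ : ℂ) b d e f) *
          (L p q Z y f z₂ * (L p q Z x e z₁ * v)) := fun e f => by
      have := congrArg (· * v) ((rep p q Z).RLL e b f d z₁ z₂)
      simp only [Finset.sum_mul, mul_assoc] at this
      exact this
    -- The RLL relation in the first leg turns the coefficient μ_l(R) into μ_r(R), which crosses the
    -- tensor sign as μ_l(R) and is absorbed by the RLL relation in the second leg.
    calc _ = ∑ e, ∑ f, tm (∑ x, ∑ y, muL p q Z (rM p q (z₁ / z₂ : ℂ) x y a c) *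
          (L p q Z x e z₁ * (L p q Z y f z₂ * u))) (L p q Z e b z₁ * (L p q Z f d z₂ * v)) := by
          simp only [btmul_sum_left]
          exact sum_rotate _
      _ = ∑ x, ∑ y, tm (L p q Z c y z₂ * (L p q Z a x z₁ * u))
          (∑ e, ∑ f, muL p q Z (rM p q (z₁ / z₂ : ℂ) e f x y) *
            (L p q Z e b z₁ * (L p q Z f d z₂ * v))) := by
          simp only [h1, btmul_sum_left, btmul_sum_right, btmul_muR]
          exact sum_rotate' _
      _ = _ := by
          simp only [h2, btmul_sum_right]
          exact sum_rotate' _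

variable (p q Z) in
/-- The component of bidegree `(α, β)` of the matrix tensor product. -/
def matchedSpan (α β : ℂ) : Submodule ℂ (BT p q Z) :=
  Submodule.span ℂ {t | ∃ (γ : ℂ) (b c : Ell p q Z),
    b ∈ grading p q Z α γ ∧ c ∈ grading p q Z γ β ∧ t = tm b c}

theorem tm_mem {α β γ : ℂ} {b c : Ell p q Z} (hb : b ∈ grading p q Z α γ)
    (hc : c ∈ grading p q Z γ β) : tm b c ∈ matchedSpan p q Z α β :=
  Submodule.subset_span ⟨γ, b, c, hb, hc, rfl⟩

theorem map_mem_matchedSpan {α β α' β' : ℂ} (φ : Module.End ℂ (BT p q Z))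
    (h : ∀ γ, ∀ b ∈ grading p q Z α γ, ∀ c ∈ grading p q Z γ β,
      φ (tm b c) ∈ matchedSpan p q Z α' β') {t : BT p q Z} (ht : t ∈ matchedSpan p q Z α β) :
    φ t ∈ matchedSpan p q Z α' β' := by
  refine (Submodule.span_le (p := (matchedSpan p q Z α' β').comap φ)).2 ?_ ht
  rintro _ ⟨γ, b, c, hb, hc, rfl⟩
  exact h γ b hb c hc

variable [GoodParams p q]

/-- After expansion the first leg contains the row minors with all pairs of column indices. They are
multiples of one minor by `eps`, and summing against `eps` reassembles the same minor in the second
leg. -/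
theorem comulOps_det (z : Z.carrier) (u v : Ell p q Z) :
    (comulOps p q Z).det z (tm u v) = tm (det p q Z z * u) (det p q Z z * v) := by
  have hd : ∀ t, det p q Z z * t = muR p q Z (FM p q) * (muL p q Z (FMi p q) *
      ((rep p q Z).rowMinor z 1 0 * t)) := fun t => by
    rw [det_eq, LOps.det_eq_rowMinor]; simp only [mul_assoc]; rfl
  have hm : ∀ b d t, L p q Z 1 b z * (L p q Z 0 d (Z.up z) * t) - L p q Z 0 b z *
      (L p q Z 1 d (Z.up z) * t) = eps b d • ((rep p q Z).rowMinor z 1 0 * t) := fun b d t => by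
    rw [← smul_mul_assoc, ← LOps.rowMinor_eq, LOps.rowMinor, sub_mul, mul_assoc, mul_assoc]; rfl
  -- For det ⊗ det: μ_r(F) of the first leg becomes μ_l(F) in the second leg and cancels μ_l(F^{-1})
  -- there.
  have hF : ∀ t, muL p q Z (FM p q) * (muR p q Z (FM p q) * (muL p q Z (FMi p q) * t)) =
      muR p q Z (FM p q) * t := fun t => by
    rw [← mul_assoc (muR _ _ _ _), ← muL_muR, mul_assoc, ← mul_assoc, ← map_mul, FM_mul_FMi,
      map_one, one_mul]
  have key : (lmulL p q Z 0 0 z * lmulL p q Z 1 1 (Z.up z) -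
      lmulL p q Z 1 0 z * lmulL p q Z 0 1 (Z.up z)) (tm u v) =
      tm ((rep p q Z).rowMinor z 1 0 * u) ((rep p q Z).rowMinor z 1 0 * v) := by
    have hr : ∀ t, (rep p q Z).rowMinor z 1 0 * t =
        L p q Z 0 0 z * (L p q Z 1 1 (Z.up z) * t) - L p q Z 1 0 z * (L p q Z 0 1 (Z.up z) * t) :=
      fun t => by
        have := hm 0 1 t
        rw [eps_zero_one, neg_smul, one_smul] at this
        rw [← neg_neg ((rep p q Z).rowMinor z 1 0 * t), ← this, neg_sub]
    simp only [LinearMap.sub_apply, Module.End.mul_apply, lmulL_tm, map_sum,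
      ← Finset.sum_sub_distrib, ← btmul_sub_left]
    simp only [← neg_sub (L p q Z 1 _ z * _), hm, btmul_neg_left, btmul_smul_left]
    rw [hr v]
    simp only [Fin.sum_univ_two, eps_zero_zero, eps_zero_one, eps_one_zero, eps_one_one, zero_smul,
      neg_smul, one_smul, neg_zero, neg_neg, add_zero, zero_add, btmul_sub_right]
    rw [neg_add_eq_sub]
  rw [hd, hd, btmul_muR, hF]
  have h : (comulOps p q Z).det z = lmulMuR p q Z (FM p q) * lmulMuL p q Z (FMi p q) *
    (lmulL p q Z 0 0 z * lmulL p q Z 1 1 (Z.up z) -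
      lmulL p q Z 1 0 z * lmulL p q Z 0 1 (Z.up z)) := rfl
  rw [h, Module.End.mul_apply, key, Module.End.mul_apply, lmulMuL_tm, lmulMuR_tm]

variable (p q Z) in
/-- The operators of left multiplication by the comultiplication of the generators. -/
def comulRep : EllRep p q Z (Module.End ℂ (BT p q Z)) where
  toLOps := comulOps p q Z
  dI z := lmul (isMatched_of_mem (detInv_mem z) (detInv_mem z))
  dI_det z := bt_ext fun a b => by
    simp only [Module.End.mul_apply, comulOps_det, lmul_btmul, ← mul_assoc, detInv_det, one_mul,
      Module.End.one_apply]
  det_dI z := bt_ext fun a b => by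
    simp only [Module.End.mul_apply, comulOps_det, lmul_btmul, ← mul_assoc, det_detInv, one_mul,
      Module.End.one_apply]
  dI_l z f := bt_ext fun a b => by
    have h := lmulMuL_tm (p := p) (q := q) (Z := Z) f
    simp only [Module.End.mul_apply, comulOps, h, lmul_btmul, ← mul_assoc, detInv_mul_comm z]
  dI_r z f := bt_ext fun a b => by
    have h := lmulMuR_tm (p := p) (q := q) (Z := Z) f
    simp only [Module.End.mul_apply, comulOps, h, lmul_btmul, ← mul_assoc, detInv_mul_comm z]
  dI_L z x y w := bt_ext fun a b => by
    have h := lmulL_tm (p := p) (q := q) (Z := Z)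
    simp only [Module.End.mul_apply, comulOps, h, lmul_btmul, ← mul_assoc, detInv_mul_comm z,
      map_sum]

variable (p q Z) in
/-- Left multiplication by `Δ(a)`. -/
def comulAct : Ell p q Z →ₐ[ℂ] Module.End ℂ (BT p q Z) := (comulRep p q Z).lift

theorem comulAct_muL (f : Mero) (u v : Ell p q Z) :
    comulAct p q Z (muL p q Z f) (tm u v) = tm (muL p q Z f * u) v := by
  rw [comulAct, EllRep.lift_muL]; exact lmulMuL_tm f u v

theorem comulAct_muR (f : Mero) (u v : Ell p q Z) :
    comulAct p q Z (muR p q Z f) (tm u v) = tm u (muR p q Z f * v) := by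
  rw [comulAct, EllRep.lift_muR]; exact lmulMuR_tm f u v

theorem comulAct_L (a b : Fin 2) (z : Z.carrier) (u v : Ell p q Z) :
    comulAct p q Z (L p q Z a b z) (tm u v) =
      ∑ x, tm (L p q Z a x z * u) (L p q Z x b z * v) := by
  rw [comulAct, EllRep.lift_L]; exact lmulL_tm a b z u v

theorem comulAct_detInv (z : Z.carrier) (u v : Ell p q Z) :
    comulAct p q Z (detInv p q Z z) (tm u v) = tm (detInv p q Z z * u) (detInv p q Z z * v) := by
  rw [comulAct, EllRep.lift_detInv]
  exact lmul_btmul (isMatched_of_mem (detInv_mem z) (detInv_mem z)) _ _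

variable (p q Z) in
/-- The comultiplication. -/
def comul : Ell p q Z →ₗ[ℂ] BT p q Z :=
  (LinearMap.applyₗ (tm 1 1)).comp (comulAct p q Z).toLinearMap

theorem comul_apply (a : Ell p q Z) : comul p q Z a = comulAct p q Z a (tm 1 1) := rfl

theorem comul_one : comul p q Z 1 = tm 1 1 := by rw [comul_apply, map_one, Module.End.one_apply]

theorem comul_mul (a b : Ell p q Z) : comul p q Z (a * b) = comulAct p q Z a (comul p q Z b) := by
  rw [comul_apply, map_mul, Module.End.mul_apply, comul_apply]

theorem comul_muL (f : Mero) : comul p q Z (muL p q Z f) = tm (muL p q Z f) 1 := by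
  rw [comul_apply, comulAct_muL, mul_one]

theorem comul_muR (f : Mero) : comul p q Z (muR p q Z f) = tm 1 (muR p q Z f) := by
  rw [comul_apply, comulAct_muR, mul_one]

theorem comul_L (a b : Fin 2) (z : Z.carrier) :
    comul p q Z (L p q Z a b z) = ∑ x, tm (L p q Z a x z) (L p q Z x b z) := by
  rw [comul_apply, comulAct_L]; simp only [mul_one]

theorem comul_detInv (z : Z.carrier) :
    comul p q Z (detInv p q Z z) = tm (detInv p q Z z) (detInv p q Z z) := by
  rw [comul_apply, comulAct_detInv, mul_one]

/-- Left multiplication by `Δ(a)` commutes with right multiplications. -/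
theorem comulAct_rmul (a u v : Ell p q Z) (t : BT p q Z) :
    comulAct p q Z a (rmul _ _ u v t) = rmul _ _ u v (comulAct p q Z a t) := by
  suffices h : Commute (comulAct p q Z a) (rmul _ _ u v) from LinearMap.congr_fun h.eq t
  refine induction_left (motive := fun a => Commute (comulAct p q Z a) (rmul _ _ u v)) a
    (fun a b ha hb => by rw [map_add]; exact ha.add_left hb)
    (fun c a ha => by rw [map_smul]; exact ha.smul_left c) (by rw [map_one]; exact .one_left _)
    (fun f a ha => ?_) (fun f a ha => ?_) (fun x y z a ha => ?_) (fun z a ha => ?_)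
  all_goals
    rw [map_mul]
    refine Commute.mul_left (bt_ext fun c d => ?_) ha
    simp only [Module.End.mul_apply, rmul_btmul, comulAct_muL, comulAct_muR, comulAct_L,
      comulAct_detInv, mul_assoc, map_sum]

/-- The balancing relations concern left multiplications only, so right multiplication by any u ⊗ v
is defined on the whole space and commutes with the action. The action of a is therefore
multiplication by Δ(a). -/
theorem comulAct_tm (a u v : Ell p q Z) :
    comulAct p q Z a (tm u v) = rmul _ _ u v (comul p q Z a) := by
  rw [comul_apply, ← comulAct_rmul, rmul_btmul, one_mul, one_mul]

theorem comul_mem {α β : ℂ} {a : Ell p q Z} (ha : a ∈ grading p q Z α β) :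
    comul p q Z a ∈ matchedSpan p q Z α β := by
  refine grading_induction (motive := fun α β a => comul p q Z a ∈ matchedSpan p q Z α β) ha
    (fun α β => by rw [map_zero]; exact zero_mem _)
    (fun α β a b ha hb => by rw [map_add]; exact add_mem ha hb)
    (fun α β c a ha => by rw [map_smul]; exact Submodule.smul_mem _ c ha)
    (by rw [comul_one]; exact tm_mem one_mem_grading one_mem_grading)
    (fun α β f a _ ha => ?_) (fun α β f a _ ha => ?_) (fun α β x y z a _ ha => ?_)
    (fun α β z a _ ha => ?_) <;> rw [comul_mul]
  · refine map_mem_matchedSpan _ (fun γ b hb c hc => ?_) ha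
    rw [comulAct_muL]
    exact tm_mem (by simpa using mul_mem_grading (muL_mem f) hb) hc
  · refine map_mem_matchedSpan _ (fun γ b hb c hc => ?_) ha
    rw [comulAct_muR]
    exact tm_mem hb (by simpa using mul_mem_grading (muR_mem f) hc)
  · refine map_mem_matchedSpan _ (fun γ b hb c hc => ?_) ha
    rw [comulAct_L]
    exact sum_mem fun i _ =>
      tm_mem (mul_mem_grading (L_mem x i z) hb) (mul_mem_grading (L_mem i y z) hc)
  · refine map_mem_matchedSpan _ (fun γ b hb c hc => ?_) ha
    rw [comulAct_detInv]
    exact tm_mem (γ := γ) (by simpa using mul_mem_grading (detInv_mem z) hb)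
      (by simpa using mul_mem_grading (detInv_mem z) hc)

end Ell

end EllipticU2

namespace EllipticU2

/-! ### Threefold balanced tensor products -/

section Balanced

variable {A : Type*} [Ring A] [Algebra ℂ A] {μl μr : Mero →ₐ[ℂ] A}

variable (μl μr) in
/-- The tensor product `A ⊗_M A ⊗_M A`. -/
abbrev BalTensor₃ : Type _ := (A ⊗[ℂ] (A ⊗[ℂ] A)) ⧸ balRel₃ μl μr

variable (μl μr) in
/-- The class of `a ⊗ b ⊗ c` as a trilinear function. -/
def btmul₃ₗ : A →ₗ[ℂ] A →ₗ[ℂ] A →ₗ[ℂ] BalTensor₃ μl μr :=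
  LinearMap.mk₂ ℂ (fun a b => (balRel₃ μl μr).mkQ ∘ₗ TensorProduct.mk ℂ A (A ⊗[ℂ] A) a ∘ₗ
    TensorProduct.mk ℂ A A b)
    (fun a a' b => by ext; simp) (fun c a b => by ext; simp)
    (fun a b b' => by ext; simp [TensorProduct.tmul_add])
    (fun c a b => by ext; simp)

theorem btmul₃ₗ_apply (a b c : A) : btmul₃ₗ μl μr a b c = btmul₃ μl μr a b c := rfl

theorem btmul₃_muR_left (f : Mero) (a b c : A) :
    btmul₃ μl μr (μr f * a) b c = btmul₃ μl μr a (μl f * b) c := by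
  rw [← sub_eq_zero]
  show (balRel₃ μl μr).mkQ _ - (balRel₃ μl μr).mkQ _ = 0
  rw [← map_sub]
  exact (Submodule.Quotient.mk_eq_zero _).2 (Submodule.subset_span ⟨f, a, b, c, Or.inl rfl⟩)

theorem btmul₃_muR_right (f : Mero) (a b c : A) :
    btmul₃ μl μr a (μr f * b) c = btmul₃ μl μr a b (μl f * c) := by
  rw [← sub_eq_zero]
  show (balRel₃ μl μr).mkQ _ - (balRel₃ μl μr).mkQ _ = 0
  rw [← map_sub]
  exact (Submodule.Quotient.mk_eq_zero _).2 (Submodule.subset_span ⟨f, a, b, c, Or.inr rfl⟩)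

variable {V : Type*} [AddCommGroup V] [Module ℂ V]

/-- The linear map on `A ⊗_M A ⊗_M A` that is given by a balanced trilinear map. -/
def btLift₃ (F : A →ₗ[ℂ] A →ₗ[ℂ] A →ₗ[ℂ] V)
    (h : ∀ f a b c, F (μr f * a) b c = F a (μl f * b) c)
    (h' : ∀ f a b c, F a (μr f * b) c = F a b (μl f * c)) : BalTensor₃ μl μr →ₗ[ℂ] V :=
  (balRel₃ μl μr).liftQ (TensorProduct.lift ((TensorProduct.uncurry (.id ℂ) A A V).comp F))
    (Submodule.span_le.2 (by
      rintro _ ⟨f, a, b, c, rfl | rfl⟩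
      · simp [h]
      · simp [h']))

@[simp] theorem btLift₃_btmul₃ (F : A →ₗ[ℂ] A →ₗ[ℂ] A →ₗ[ℂ] V)
    (h : ∀ f a b c, F (μr f * a) b c = F a (μl f * b) c)
    (h' : ∀ f a b c, F a (μr f * b) c = F a b (μl f * c)) (a b c : A) :
    btLift₃ F h h' (btmul₃ μl μr a b c) = F a b c :=
  (Submodule.liftQ_apply ..).trans (by simp)

variable (μl μr) in
/-- Right multiplication by `u ⊗ v ⊗ w`. -/
def rmul₃ (u v w : A) : Module.End ℂ (BalTensor₃ μl μr) :=
  (balRel₃ μl μr).mapQ (balRel₃ μl μr) (TensorProduct.map (LinearMap.mulRight ℂ u)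
    (TensorProduct.map (LinearMap.mulRight ℂ v) (LinearMap.mulRight ℂ w))) (Submodule.span_le.2 (by
      rintro _ ⟨f, a, b, c, rfl | rfl⟩
      · refine Submodule.subset_span ⟨f, a * u, b * v, c * w, Or.inl ?_⟩
        simp [mul_assoc]
      · refine Submodule.subset_span ⟨f, a * u, b * v, c * w, Or.inr ?_⟩
        simp [mul_assoc]))

@[simp] theorem rmul₃_btmul₃ (u v w a b c : A) :
    rmul₃ μl μr u v w (btmul₃ μl μr a b c) = btmul₃ μl μr (a * u) (b * v) (c * w) := rfl

variable (μl μr) in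
/-- `t ↦ t ⊗ c`. -/
def tensorRight (c : A) : BalTensor μl μr →ₗ[ℂ] BalTensor₃ μl μr :=
  btLift ((btmul₃ₗ μl μr).compr₂ (LinearMap.applyₗ c)) fun f a b => btmul₃_muR_left f a b c

@[simp] theorem tensorRight_btmul (c a b : A) :
    tensorRight μl μr c (btmul μl μr a b) = btmul₃ μl μr a b c := btLift_btmul ..

variable (μl μr) in
/-- `t ↦ a ⊗ t`. -/
def tensorLeft (a : A) : BalTensor μl μr →ₗ[ℂ] BalTensor₃ μl μr :=
  btLift (btmul₃ₗ μl μr a) fun f b c => btmul₃_muR_right f a b c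

@[simp] theorem tensorLeft_btmul (a b c : A) :
    tensorLeft μl μr a (btmul μl μr b c) = btmul₃ μl μr a b c := btLift_btmul ..

end Balanced

namespace Ell

variable {p q : ℝ} [GoodParams p q] {Z : SpectralSet q}

local notation "tm" => btmul (muL p q Z) (muR p q Z)

/-! ### The counit axioms -/

variable (p q Z) in
/-- The map `a ⊗ b ↦ ε(a) b`. -/
def counitLeft : BT p q Z →ₗ[ℂ] Ell p q Z :=
  btLift ((LinearMap.mul ℂ (Ell p q Z)).comp ((muL p q Z).toLinearMap.comp (eps0 p q Z)))
    fun f a b => by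
      simp only [LinearMap.comp_apply, LinearMap.mul_apply', AlgHom.toLinearMap_apply, eps0_muR_mul,
        map_mul, mul_comm f, mul_assoc]

@[simp] theorem counitLeft_tm (a b : Ell p q Z) :
    counitLeft p q Z (tm a b) = muL p q Z (eps0 p q Z a) * b := btLift_btmul ..

variable (p q Z) in
/-- The map `a ⊗ b ↦ ε(b) a`. -/
def counitRight : BT p q Z →ₗ[ℂ] Ell p q Z :=
  btLift ((LinearMap.mul ℂ (Ell p q Z)).comp ((muR p q Z).toLinearMap.comp (eps0 p q Z))).flip
    fun f a b => by
      simp only [LinearMap.flip_apply, LinearMap.comp_apply, LinearMap.mul_apply',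
        AlgHom.toLinearMap_apply, eps0_muL_mul, mul_comm f, map_mul, mul_assoc]

@[simp] theorem counitRight_tm (a b : Ell p q Z) :
    counitRight p q Z (tm a b) = muR p q Z (eps0 p q Z b) * a := btLift_btmul ..

/-- A linear map that intertwines left multiplication by `Δ(g)` and by `g` for the generators is
a retraction of the comultiplication. -/
theorem map_comul_eq_self {φ : BT p q Z →ₗ[ℂ] Ell p q Z} (h1 : φ (tm 1 1) = 1)
    (hl : ∀ f u v, φ (tm (muL p q Z f * u) v) = muL p q Z f * φ (tm u v))
    (hr : ∀ f u v, φ (tm u (muR p q Z f * v)) = muR p q Z f * φ (tm u v))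
    (hL : ∀ a b z u v, ∑ x, φ (tm (L p q Z a x z * u) (L p q Z x b z * v)) =
      L p q Z a b z * φ (tm u v))
    (hd : ∀ z u v, φ (tm (detInv p q Z z * u) (detInv p q Z z * v)) = detInv p q Z z * φ (tm u v))
    (a : Ell p q Z) : φ (comul p q Z a) = a := by
  have key : ∀ g : Ell p q Z, (∀ u v, φ (comulAct p q Z g (tm u v)) = g * φ (tm u v)) →
      ∀ t, φ (comulAct p q Z g t) = g * φ t := fun g hg t =>
    LinearMap.congr_fun (bt_ext (φ := φ.comp (comulAct p q Z g))
      (ψ := (LinearMap.mulLeft ℂ g).comp φ) hg) t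
  refine induction_left (motive := fun a => φ (comul p q Z a) = a) a
    (fun a b ha hb => by rw [map_add, map_add, ha, hb])
    (fun c a ha => by rw [map_smul, map_smul, ha]) (by rw [comul_one, h1])
    (fun f a ha => ?_) (fun f a ha => ?_) (fun x y z a ha => ?_) (fun z a ha => ?_)
  · rw [comul_mul, key _ fun u v => by rw [comulAct_muL, hl], ha]
  · rw [comul_mul, key _ fun u v => by rw [comulAct_muR, hr], ha]
  · rw [comul_mul, key _ fun u v => by rw [comulAct_L, map_sum, hL], ha]
  · rw [comul_mul, key _ fun u v => by rw [comulAct_detInv, hd], ha]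

theorem counitLeft_comul (a : Ell p q Z) : counitLeft p q Z (comul p q Z a) = a := by
  refine map_comul_eq_self ?_ (fun f u v => ?_) (fun f u v => ?_) (fun a b z u v => ?_)
    (fun z u v => ?_) a
  · simp
  · simp [mul_assoc]
  · simp only [counitLeft_tm]
    rw [← mul_assoc, muL_muR, mul_assoc]
  · simp only [counitLeft_tm, eps0_L_mul]
    -- Only x = a contributes, and the shift by -ω(a) caused by ε(L_{aa}) is undone when the
    -- function passes L_{ab}.
    rw [Finset.sum_eq_single a (fun x _ hx => by rw [if_neg (Ne.symm hx), map_zero, zero_mul])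
      (by simp), if_pos rfl, ← mul_assoc, muL_L, Mero.shift_shift, add_neg_cancel, Mero.shift_zero,
      mul_assoc]
  · simp only [counitLeft_tm, eps0_detInv_mul]
    rw [← mul_assoc, ← detInv_mul_comm, mul_assoc]

theorem counitRight_comul (a : Ell p q Z) : counitRight p q Z (comul p q Z a) = a := by
  refine map_comul_eq_self ?_ (fun f u v => ?_) (fun f u v => ?_) (fun a b z u v => ?_)
    (fun z u v => ?_) a
  · simp
  · simp only [counitRight_tm]
    rw [← mul_assoc, ← muL_muR, mul_assoc]
  · simp [mul_assoc]
  · simp only [counitRight_tm, eps0_L_mul]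
    rw [Finset.sum_eq_single b (fun x _ hx => by rw [if_neg hx, map_zero, zero_mul])
      (by simp), if_pos rfl, ← mul_assoc, muR_L, Mero.shift_shift, add_neg_cancel, Mero.shift_zero,
      mul_assoc]
  · simp only [counitRight_tm, eps0_detInv_mul]
    rw [← mul_assoc, ← detInv_mul_comm, mul_assoc]

/-! ### Coassociativity -/

variable (p q Z) in
/-- The map `Δ ⊗ id`. -/
def comulLeft : BT p q Z →ₗ[ℂ] BalTensor₃ (muL p q Z) (muR p q Z) :=
  btLift (LinearMap.mk₂ ℂ (fun a b => tensorRight _ _ b (comul p q Z a))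
    (fun a a' b => by simp) (fun c a b => by simp)
    (fun a b b' => by
      induction comul p q Z a using bt_induction with
      | btmul u v => simp [← btmul₃ₗ_apply]
      | add s t hs ht => simp only [map_add, hs, ht]; abel)
    (fun c a b => by
      induction comul p q Z a using bt_induction with
      | btmul u v => simp [← btmul₃ₗ_apply]
      | add s t hs ht => simp only [map_add, hs, ht, smul_add]))
    (fun f a b => by
      simp only [LinearMap.mk₂_apply, comul_mul]
      induction comul p q Z a using bt_induction with
      | btmul u v => rw [comulAct_muR, tensorRight_btmul, btmul₃_muR_right, tensorRight_btmul]
      | add s t hs ht => simp only [map_add, hs, ht])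

@[simp] theorem comulLeft_tm (a b : Ell p q Z) :
    comulLeft p q Z (tm a b) = tensorRight _ _ b (comul p q Z a) := btLift_btmul ..

variable (p q Z) in
/-- The map `id ⊗ Δ`. -/
def comulRight : BT p q Z →ₗ[ℂ] BalTensor₃ (muL p q Z) (muR p q Z) :=
  btLift (LinearMap.mk₂ ℂ (fun a b => tensorLeft _ _ a (comul p q Z b))
    (fun a a' b => by
      induction comul p q Z b using bt_induction with
      | btmul u v => simp [← btmul₃ₗ_apply]
      | add s t hs ht => simp only [map_add, hs, ht]; abel)
    (fun c a b => by
      induction comul p q Z b using bt_induction with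
      | btmul u v => simp [← btmul₃ₗ_apply]
      | add s t hs ht => simp only [map_add, hs, ht, smul_add])
    (fun a b b' => by simp) (fun c a b => by simp))
    (fun f a b => by
      simp only [LinearMap.mk₂_apply, comul_mul]
      induction comul p q Z b using bt_induction with
      | btmul u v => rw [comulAct_muL, tensorLeft_btmul, btmul₃_muR_left, tensorLeft_btmul]
      | add s t hs ht => simp only [map_add, hs, ht])

@[simp] theorem comulRight_tm (a b : Ell p q Z) :
    comulRight p q Z (tm a b) = tensorLeft _ _ a (comul p q Z b) := btLift_btmul ..

theorem comul_mul_of_eq {ι : Type*} [Fintype ι] {u : Ell p q Z} {u₁ u₂ : ι → Ell p q Z}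
    (hu : comul p q Z u = ∑ i, tm (u₁ i) (u₂ i)) (a : Ell p q Z) :
    comul p q Z (a * u) = ∑ i, rmul _ _ (u₁ i) (u₂ i) (comul p q Z a) := by
  rw [comul_mul, hu, map_sum]
  exact Finset.sum_congr rfl fun i _ => comulAct_tm _ _ _

theorem comulLeft_rmul {ι : Type*} [Fintype ι] {u : Ell p q Z} {u₁ u₂ : ι → Ell p q Z}
    (hu : comul p q Z u = ∑ i, tm (u₁ i) (u₂ i)) (v : Ell p q Z) (t : BT p q Z) :
    comulLeft p q Z (rmul _ _ u v t) = ∑ i, rmul₃ _ _ (u₁ i) (u₂ i) v (comulLeft p q Z t) := by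
  induction t using bt_induction with
  | btmul a b =>
    rw [rmul_btmul, comulLeft_tm, comulLeft_tm, comul_mul_of_eq hu, map_sum]
    refine Finset.sum_congr rfl fun i _ => ?_
    induction comul p q Z a using bt_induction with
    | btmul a a' => simp
    | add s t hs ht => simp only [map_add, hs, ht]
  | add s t hs ht => simp only [map_add, hs, ht, Finset.sum_add_distrib]

theorem comulRight_rmul {ι : Type*} [Fintype ι] {v : Ell p q Z} {v₁ v₂ : ι → Ell p q Z}
    (hv : comul p q Z v = ∑ i, tm (v₁ i) (v₂ i)) (u : Ell p q Z) (t : BT p q Z) :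
    comulRight p q Z (rmul _ _ u v t) = ∑ i, rmul₃ _ _ u (v₁ i) (v₂ i) (comulRight p q Z t) := by
  induction t using bt_induction with
  | btmul a b =>
    rw [rmul_btmul, comulRight_tm, comulRight_tm, comul_mul_of_eq hv, map_sum]
    refine Finset.sum_congr rfl fun i _ => ?_
    induction comul p q Z b using bt_induction with
    | btmul a a' => simp
    | add s t hs ht => simp only [map_add, hs, ht]
  | add s t hs ht => simp only [map_add, hs, ht, Finset.sum_add_distrib]

/-- Induction over generators multiplied on the right: Δ(au) arises from Δ(a) by right
multiplications, which exist without any condition on degrees and which both Δ ⊗ id and id ⊗ Δ turn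
into right multiplications on the threefold tensor product. -/
theorem comul_coassoc (a : Ell p q Z) :
    comulLeft p q Z (comul p q Z a) = comulRight p q Z (comul p q Z a) := by
  have c1 : comul p q Z 1 = ∑ _i : Fin 1, tm 1 1 := by simp [comul_one]
  have cl : ∀ f, comul p q Z (muL p q Z f) = ∑ _i : Fin 1, tm (muL p q Z f) 1 := fun f => by
    simp [comul_muL]
  have cr : ∀ f, comul p q Z (muR p q Z f) = ∑ _i : Fin 1, tm 1 (muR p q Z f) := fun f => by
    simp [comul_muR]
  have cd : ∀ z, comul p q Z (detInv p q Z z) =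
      ∑ _i : Fin 1, tm (detInv p q Z z) (detInv p q Z z) := fun f => by
    simp [comul_detInv]
  refine induction_right (motive := fun a => comulLeft p q Z (comul p q Z a) =
    comulRight p q Z (comul p q Z a)) a
    (fun a b ha hb => by simp only [map_add, ha, hb])
    (fun c a ha => by simp only [map_smul, ha])
    (by rw [comul_one, comulLeft_tm, comulRight_tm, comul_one]; simp)
    (fun f a ha => ?_) (fun f a ha => ?_) (fun x y z a ha => ?_) (fun z a ha => ?_)
  · rw [comul_mul_of_eq (cl f), map_sum, map_sum]
    simp only [comulLeft_rmul (cl f), comulRight_rmul c1, ha]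
  · rw [comul_mul_of_eq (cr f), map_sum, map_sum]
    simp only [comulLeft_rmul c1, comulRight_rmul (cr f), ha]
  · rw [comul_mul_of_eq (comul_L x y z), map_sum, map_sum]
    simp only [comulLeft_rmul (comul_L _ _ z), comulRight_rmul (comul_L _ _ z), ha]
    exact Finset.sum_comm
  · rw [comul_mul_of_eq (cd z), map_sum, map_sum]
    simp only [comulLeft_rmul (cd z), comulRight_rmul (cd z), ha]

end Ell

end EllipticU2

namespace EllipticU2

/-! ### The antipode of `ℰ` -/

/-- The sign `(-1)^i`. -/
def sg : Fin 2 → ℂ := ![1, -1]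

@[simp] theorem sg_zero : sg 0 = 1 := rfl

@[simp] theorem sg_one : sg 1 = -1 := rfl

theorem sg_mul_self (i : Fin 2) : sg i * sg i = 1 := by fin_cases i <;> simp

theorem sg_rev (i : Fin 2) : sg i.rev = -sg i := by fin_cases i <;> simp [sg, Fin.rev]

theorem wt_rev (i : Fin 2) : wt i.rev = -wt i := by fin_cases i <;> simp [wt, Fin.rev]

/-- The total weight fixes the number of indices -1. Hence the signs in the antipode and the star
are constant on the terms of an RLL relation and can be pulled out. -/
theorem sg_mul_sg {a b x y : Fin 2} (h : wt a + wt b = wt x + wt y) : sg a * sg b = sg x * sg y := by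
  revert h
  fin_cases a <;> fin_cases b <;> fin_cases x <;> fin_cases y <;> norm_num [sg, wt]

theorem sum_rev {V : Type*} [AddCommMonoid V] (g : Fin 2 → V) : ∑ x : Fin 2, g x.rev = ∑ x, g x :=
  Equiv.sum_comp Fin.revPerm g

theorem sum_sum_rev {V : Type*} [AddCommMonoid V] (g : Fin 2 → Fin 2 → V) :
    ∑ x : Fin 2, ∑ y : Fin 2, g x.rev y.rev = ∑ x, ∑ y, g x y := by
  rw [sum_rev fun x => ∑ y : Fin 2, g x y.rev]
  exact Finset.sum_congr rfl fun x _ => sum_rev _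

theorem FMi_mul_FM (p q : ℝ) [GoodParams p q] : FMi p q * FM p q = 1 := by
  rw [mul_comm, FM_mul_FMi]

theorem shift_FM (p q : ℝ) [GoodParams p q] (c : ℂ) :
    Mero.shift c (FM p q) = (-(q : ℂ)⁻¹) • bM p q (c + 1) := by
  rw [FM_eq, Mero.shift_smul, bM, bM, Mero.shift_of (meromorphic_brk 1)]
  simp only [add_assoc]

theorem shift_FMi_mul (p q : ℝ) [GoodParams p q] (c : ℂ) :
    Mero.shift c (FMi p q) * Mero.shift c (FM p q) = 1 := by
  rw [← map_mul, FMi_mul_FM, map_one]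

namespace Ell

variable {p q : ℝ} {Z : SpectralSet q}

theorem mul_muL_of_mem {α β : ℂ} {a : Ell p q Z} (ha : a ∈ grading p q Z α β) (f : Mero) :
    a * muL p q Z f = muL p q Z (Mero.shift (-α) f) * a := by
  rw [muL_mul_of_mem ha, Mero.shift_shift, add_neg_cancel, Mero.shift_zero]

theorem mul_muR_of_mem {α β : ℂ} {a : Ell p q Z} (ha : a ∈ grading p q Z α β) (f : Mero) :
    a * muR p q Z f = muR p q Z (Mero.shift (-β) f) * a := by
  rw [muR_mul_of_mem ha, Mero.shift_shift, add_neg_cancel, Mero.shift_zero]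

theorem FF_eq : FF p q Z = muR p q Z (FM p q) * muL p q Z (FMi p q) := rfl

theorem mul_FF_of_mem {α β : ℂ} {a : Ell p q Z} (ha : a ∈ grading p q Z α β) :
    a * FF p q Z =
      muR p q Z (Mero.shift (-β) (FM p q)) * muL p q Z (Mero.shift (-α) (FMi p q)) * a := by
  rw [FF_eq, ← mul_assoc, mul_muR_of_mem ha, mul_assoc, mul_muL_of_mem ha, mul_assoc]

variable [GoodParams p q]

theorem det_eq_mul_rowMinor (z : Z.carrier) :
    det p q Z z = FF p q Z * (rep p q Z).rowMinor z 1 0 := by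
  rw [det_eq, LOps.det_eq_rowMinor]; rfl

variable (p q Z) in
/-- The inverse of `μ_r(F) μ_l(F⁻¹)`. -/
def FFi : Ell p q Z := muR p q Z (FMi p q) * muL p q Z (FM p q)

theorem FF_mul_FFi : FF p q Z * FFi p q Z = 1 := by
  rw [FF_eq, FFi, mul_assoc, ← mul_assoc (muL _ _ _ _), muL_muR, mul_assoc, ← map_mul, FMi_mul_FM,
    map_one, mul_one, ← map_mul, FM_mul_FMi, map_one]

theorem FFi_mul_FF : FFi p q Z * FF p q Z = 1 := by
  rw [FF_eq, FFi, mul_assoc, ← mul_assoc (muL _ _ _ _), muL_muR, mul_assoc, ← map_mul, FM_mul_FMi,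
    map_one, mul_one, ← map_mul, FMi_mul_FM, map_one]

variable (p q Z) in
/-- The value of the antipode on `L_{ab}(z)`. -/
def antiL (a b : Fin 2) (z : Z.carrier) : Ell p q Z :=
  (sg a * sg b) • (FF p q Z * detInv p q Z (Z.down z) * L p q Z b.rev a.rev (Z.down z))

theorem FF_mem : FF p q Z ∈ grading p q Z 0 0 := by
  rw [FF_eq]
  simpa using mul_mem_grading (muR_mem (p := p) (Z := Z) (FM p q)) (muL_mem (FMi p q))

theorem antiL_mem (a b : Fin 2) (z : Z.carrier) :
    antiL p q Z a b z ∈ grading p q Z (-wt b) (-wt a) := by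
  refine Submodule.smul_mem _ _ ?_
  have := mul_mem_grading (mul_mem_grading FF_mem (detInv_mem (Z.down z)))
    (L_mem (p := p) b.rev a.rev (Z.down z))
  simpa [wt_rev] using this

/-- The determinants are central, and the second prefactor μ_r(F) μ_l(F^{-1}) passes the first L
with a shift. What remains to the right is a product of two L's, to which the RLL relation or a
minor identity applies. -/
theorem antiL_mul_antiL (a b c d : Fin 2) (z w : Z.carrier) :
    antiL p q Z a b z * antiL p q Z c d w = (sg a * sg b * (sg c * sg d)) •
      (detInv p q Z (Z.down z) * detInv p q Z (Z.down w) * FF p q Z *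
        (muR p q Z (Mero.shift (wt a) (FM p q)) * muL p q Z (Mero.shift (wt b) (FMi p q)) *
          (L p q Z b.rev a.rev (Z.down z) * L p q Z d.rev c.rev (Z.down w)))) := by
  rw [antiL, antiL, smul_mul_smul_comm]
  congr 1
  have h := mul_FF_of_mem (L_mem (p := p) b.rev a.rev (Z.down z))
  rw [wt_rev, wt_rev, neg_neg, neg_neg] at h
  calc _ = detInv p q Z (Z.down z) * (FF p q Z * (L p q Z b.rev a.rev (Z.down z) * (FF p q Z *
        (detInv p q Z (Z.down w) * L p q Z d.rev c.rev (Z.down w))))) := by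
        rw [← detInv_mul_comm (Z.down z) (FF p q Z)]
        simp only [mul_assoc]
    _ = detInv p q Z (Z.down z) * (detInv p q Z (Z.down w) * (FF p q Z *
        (L p q Z b.rev a.rev (Z.down z) * FF p q Z * L p q Z d.rev c.rev (Z.down w)))) := by
        rw [detInv_mul_comm (Z.down w) (FF p q Z * _),
          detInv_mul_comm (Z.down w) (L p q Z d.rev c.rev (Z.down w))]
        simp only [mul_assoc]
    _ = _ := by rw [h]; simp only [mul_assoc]

/-- `∑ S(L_{ix}) L_{xj} = δ_{ij}`. -/
theorem sum_antiL_mul_L (i j : Fin 2) (z : Z.carrier) :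
    ∑ x, antiL p q Z i x z * L p q Z x j z = if i = j then 1 else 0 := by
  -- The sum is a row minor for the parameters q^{-2}z, z.
  have h : ∑ x, antiL p q Z i x z * L p q Z x j z =
      sg i • (detInv p q Z (Z.down z) * (FF p q Z * (rep p q Z).rowMinor (Z.down z) i.rev j)) := by
    have hr : (rep p q Z).rowMinor (Z.down z) i.rev j =
        L p q Z 1 i.rev (Z.down z) * L p q Z 0 j z - L p q Z 0 i.rev (Z.down z) * L p q Z 1 j z := by
      rw [LOps.rowMinor, SpectralSet.up_down p]; rfl
    rw [hr, ← mul_assoc, detInv_mul_comm]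
    simp [antiL, Fin.sum_univ_two, mul_add, smul_add, mul_assoc, sub_eq_add_neg]
  rw [h, LOps.rowMinor_eq, mul_smul_comm, mul_smul_comm, smul_smul, ← det_eq_mul_rowMinor,
    detInv_det]
  fin_cases i <;> fin_cases j <;> simp [eps]

/-- `∑ L_{ix} S(L_{xj}) = δ_{ij}`. -/
theorem sum_L_mul_antiL (i j : Fin 2) (z : Z.carrier) :
    ∑ x, L p q Z i x z * antiL p q Z x j z = if i = j then 1 else 0 := by
  have h1 : ∀ x, L p q Z i x z * antiL p q Z x j z = (sg x * sg j) • (detInv p q Z (Z.down z) *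
      (muL p q Z (Mero.shift (-wt i) (FMi p q)) * (muR p q Z (Mero.shift (-wt x) (FM p q)) *
        (L p q Z i x z * L p q Z j.rev x.rev (Z.down z))))) := fun x => by
    rw [antiL, mul_smul_comm]
    congr 1
    have h := mul_FF_of_mem (L_mem (p := p) i x z)
    rw [mul_assoc, ← mul_assoc (L p q Z i x z), h, ← muL_muR, detInv_mul_comm _ (L _ _ _ _ _ _)]
    rw [← mul_assoc, ← mul_assoc, ← detInv_mul_comm]
    simp only [mul_assoc]
  have hc : (rep p q Z).colMinor (Z.down z) j.rev i =
      muR p q Z (bM p q 2) * (L p q Z i 1 z * L p q Z j.rev 0 (Z.down z)) -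
        muR p q Z (bM p q 0) * (L p q Z i 0 z * L p q Z j.rev 1 (Z.down z)) := by
    rw [LOps.colMinor, SpectralSet.up_down p]; rfl
  -- Moving μ_r(F) to the left past L_{ix} shifts F by -ω(x), which produces -q^{-1}[λ] and
  -- -q^{-1}[λ+2], the coefficients of a column minor.
  have h2 : ∑ x, L p q Z i x z * antiL p q Z x j z = (sg j * (q : ℂ)⁻¹) •
      (detInv p q Z (Z.down z) * (muL p q Z (Mero.shift (-wt i) (FMi p q)) *
        (rep p q Z).colMinor (Z.down z) j.rev i)) := by
    have e0 : (0 : Fin 2).rev = 1 := rfl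
    have e1 : (1 : Fin 2).rev = 0 := rfl
    have w0 : -wt 0 + 1 = 0 := by simp [wt]
    have w1 : -wt 1 + 1 = 2 := by norm_num [wt]
    rw [Fin.sum_univ_two, h1, h1, hc, shift_FM, shift_FM, w0, w1, e0, e1]
    simp only [map_smul, map_neg, smul_mul_assoc, mul_smul_comm, smul_smul, mul_sub, smul_sub,
      sg_zero, sg_one, neg_smul, smul_neg, neg_mul, mul_neg, neg_neg, one_mul]
    rw [neg_add_eq_sub]
  rw [h2, LOps.colMinor_eq, ← mul_assoc (muL p q Z _), ← det_eq]
  have hl : (rep p q Z).l = muL p q Z := rfl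
  rw [← mul_assoc, detInv_mul_comm, mul_assoc, detInv_det, mul_one, hl, ← map_mul]
  have hq := q_ne_zero p q
  have hF := shift_FMi_mul p q (-wt i)
  rw [shift_FM, mul_smul_comm] at hF
  -- The entry of `tau` that occurs vanishes for i ≠ j; for i = j it cancels the shifted F^{-1}.
  fin_cases i <;> fin_cases j
  · have w : -wt 0 + 1 = 0 := by simp [wt]
    simp only [Fin.zero_eta, w] at hF
    simp only [Fin.zero_eta, sg_zero, one_mul, if_true]
    rw [show (0 : Fin 2).rev = 1 from rfl, tau_one_zero, mul_neg, ← map_smul, smul_neg, ← neg_smul,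
      hF, map_one]
  · simp [show (1 : Fin 2).rev = 0 from rfl, tau_zero_zero]
  · simp [show (0 : Fin 2).rev = 1 from rfl, tau_one_one]
  · have w : -wt 1 + 1 = 2 := by norm_num [wt]
    simp only [Fin.mk_one, w] at hF
    simp only [Fin.mk_one, sg_one, if_true]
    rw [show (1 : Fin 2).rev = 0 from rfl, tau_zero_one, ← map_smul, neg_one_mul, hF, map_one]

end Ell

end EllipticU2

namespace EllipticU2

/-! ### The antipode as an anti-homomorphism -/

namespace Ell

variable {p q : ℝ} [GoodParams p q] {Z : SpectralSet q}

open MulOpposite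

theorem div_down (p : ℝ) {q : ℝ} [GoodParams p q] {Z : SpectralSet q} (z w : Z.carrier) : (Z.down z / Z.down w : ℂ) = z / w := by
  have hq := q_ne_zero p q
  show ((q : ℂ) ^ 2)⁻¹ * z / (((q : ℂ) ^ 2)⁻¹ * w) = z / w
  rw [mul_div_mul_left _ _ (inv_ne_zero (pow_ne_zero _ hq))]

theorem div_ne_zero' (z w : Z.carrier) : (z / w : ℂ) ≠ 0 :=
  div_ne_zero (SpectralSet.coe_ne_zero z) (SpectralSet.coe_ne_zero w)

theorem shift_FMi_mul_rM {z : ℂ} (hz : z ≠ 0) (b d x y : Fin 2) :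
    Mero.shift (wt x) (FMi p q) * Mero.shift (wt x + wt y) (rM p q z b d x y) =
      Mero.shift (wt d) (FMi p q) * rM p q z x.rev y.rev b.rev d.rev := by
  have h := shift_FM_mul_rM p q hz b d x y
  have h1 := shift_FMi_mul p q (wt x)
  have h2 := shift_FMi_mul p q (wt d)
  linear_combination (Mero.shift (wt d) (FMi p q) * Mero.shift (wt x) (FMi p q)) * h +
    (Mero.shift (wt d) (FMi p q) * rM p q z x.rev y.rev b.rev d.rev) * h1 -
    (Mero.shift (wt x) (FMi p q) * Mero.shift (wt x + wt y) (rM p q z b d x y)) * h2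

/-- After the coefficients are moved to the left, the symmetry `shift_FM_mul_rM` shows that both
sides are a common prefactor times the two sides of the RLL relation with reversed indices at
q^{-2}z₁, q^{-2}z₂, whose ratio is unchanged. -/
theorem antiL_RLL (a b c d : Fin 2) (z₁ z₂ : Z.carrier) :
    ∑ x, ∑ y, antiL p q Z y d z₂ * antiL p q Z x b z₁ * muR p q Z (rM p q (z₁ / z₂ : ℂ) x y a c) =
      ∑ x, ∑ y, antiL p q Z a x z₁ * antiL p q Z c y z₂ *
        muL p q Z (rM p q (z₁ / z₂ : ℂ) b d x y) := by
  set C := detInv p q Z (Z.down z₁) * detInv p q Z (Z.down z₂) * FF p q Z *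
    (muR p q Z (Mero.shift (wt a) (FM p q)) * muL p q Z (Mero.shift (wt d) (FMi p q))) with hC
  have hz := div_ne_zero' z₁ z₂
  have h1 : ∀ x y, antiL p q Z y d z₂ * antiL p q Z x b z₁ *
      muR p q Z (rM p q (z₁ / z₂ : ℂ) x y a c) = (sg a * sg b * sg c * sg d) • (C *
        (muR p q Z (rM p q (z₁ / z₂ : ℂ) a.rev c.rev x.rev y.rev) *
          (L p q Z d.rev y.rev (Z.down z₂) * L p q Z b.rev x.rev (Z.down z₁)))) := by
    intro x y
    by_cases hw : wt x + wt y = wt a + wt c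
    · have hs := sg_mul_sg hw
      rw [antiL_mul_antiL, show sg y * sg d * (sg x * sg b) = sg a * sg b * sg c * sg d by
        linear_combination (sg b * sg d) * hs, smul_mul_assoc]
      congr 1
      have hm := mul_mem_grading (L_mem (p := p) d.rev y.rev (Z.down z₂))
        (L_mem (p := p) b.rev x.rev (Z.down z₁))
      have e : -(wt y.rev + wt x.rev) = wt a + wt c := by rw [wt_rev, wt_rev, ← hw]; ring
      have key : muR p q Z (Mero.shift (wt y) (FM p q)) * muR p q Z (Mero.shift (wt a + wt c)
          (rM p q (z₁ / z₂ : ℂ) x y a c)) = muR p q Z (Mero.shift (wt a) (FM p q)) *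
          muR p q Z (rM p q (z₁ / z₂ : ℂ) a.rev c.rev x.rev y.rev) := by
        rw [← map_mul, shift_FM_mul_rM p q hz, map_mul]
      have h := mul_muR_of_mem hm (rM p q (z₁ / z₂ : ℂ) x y a c)
      rw [e] at h
      rw [hC, detInv_mul_comm (Z.down z₁) (detInv p q Z (Z.down z₂)), mul_assoc _ _ (muR _ _ _ _),
        mul_assoc _ _ (muR _ _ _ _), h, mul_assoc (_ * _ * FF p q Z) _ (_ * (_ * _))]
      congr 1
      rw [mul_assoc, ← mul_assoc (muL _ _ _ _), muL_muR, mul_assoc (muR _ _ _ _),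
        ← mul_assoc (muR p q Z (Mero.shift (wt y) (FM p q))), key, mul_assoc, mul_assoc,
        ← mul_assoc (muL _ _ _ _) (muR _ _ _ _), muL_muR, mul_assoc]
    · have hw' : wt a.rev + wt c.rev ≠ wt x.rev + wt y.rev := fun h => hw (by
        simp only [wt_rev] at h; linear_combination h)
      rw [rM_eq_zero hw, rM_eq_zero hw', map_zero, mul_zero, zero_mul, mul_zero, smul_zero]
  have h2 : ∀ x y, antiL p q Z a x z₁ * antiL p q Z c y z₂ *
      muL p q Z (rM p q (z₁ / z₂ : ℂ) b d x y) = (sg a * sg b * sg c * sg d) • (C *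
        (muL p q Z (rM p q (z₁ / z₂ : ℂ) x.rev y.rev b.rev d.rev) *
          (L p q Z x.rev a.rev (Z.down z₁) * L p q Z y.rev c.rev (Z.down z₂)))) := by
    intro x y
    by_cases hw : wt b + wt d = wt x + wt y
    · have hs := sg_mul_sg hw
      rw [antiL_mul_antiL, show sg a * sg x * (sg c * sg y) = sg a * sg b * sg c * sg d by
        linear_combination -(sg a * sg c) * hs, smul_mul_assoc]
      congr 1
      have hm := mul_mem_grading (L_mem (p := p) x.rev a.rev (Z.down z₁))
        (L_mem (p := p) y.rev c.rev (Z.down z₂))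
      have e : -(wt x.rev + wt y.rev) = wt x + wt y := by rw [wt_rev, wt_rev]; ring
      have key : muL p q Z (Mero.shift (wt x) (FMi p q)) * muL p q Z (Mero.shift (wt x + wt y)
          (rM p q (z₁ / z₂ : ℂ) b d x y)) = muL p q Z (Mero.shift (wt d) (FMi p q)) *
          muL p q Z (rM p q (z₁ / z₂ : ℂ) x.rev y.rev b.rev d.rev) := by
        rw [← map_mul, shift_FMi_mul_rM hz, map_mul]
      have h := mul_muL_of_mem hm (rM p q (z₁ / z₂ : ℂ) b d x y)
      rw [e] at h
      rw [hC, mul_assoc _ _ (muL _ _ _ _), mul_assoc _ _ (muL _ _ _ _), h,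
        mul_assoc (_ * _ * FF p q Z) _ (_ * (_ * _))]
      congr 1
      rw [mul_assoc, ← mul_assoc (muL _ _ _ _), key, mul_assoc, mul_assoc]
    · have hw' : wt x.rev + wt y.rev ≠ wt b.rev + wt d.rev := fun h => hw (by
        simp only [wt_rev] at h; linear_combination h)
      rw [rM_eq_zero hw, rM_eq_zero hw', map_zero, mul_zero, zero_mul, mul_zero, smul_zero]
  have hR := (rep p q Z).RLL b.rev a.rev d.rev c.rev (Z.down z₁) (Z.down z₂)
  rw [div_down p] at hR
  simp only [h1, h2, ← Finset.smul_sum, ← Finset.mul_sum]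
  congr 2
  rw [sum_sum_rev fun x y => muR p q Z (rM p q (z₁ / z₂ : ℂ) a.rev c.rev x y) *
          (L p q Z d.rev y (Z.down z₂) * L p q Z b.rev x (Z.down z₁)),
    sum_sum_rev fun x y => muL p q Z (rM p q (z₁ / z₂ : ℂ) x y b.rev d.rev) *
          (L p q Z x a.rev (Z.down z₁) * L p q Z y c.rev (Z.down z₂))]
  exact hR.symm

/-- The image under the antipode of the bracket in det(z). The shifted factors F make it a column
minor for q^{-2}z, z, hence a multiple of det(q^{-2}z), which cancels one of the two inverse
determinants. -/
theorem antiL_det (z : Z.carrier) :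
    antiL p q Z 1 1 (Z.up z) * antiL p q Z 0 0 z - antiL p q Z 0 1 (Z.up z) * antiL p q Z 1 0 z =
      detInv p q Z z * FF p q Z := by
  rw [antiL_mul_antiL, antiL_mul_antiL, SpectralSet.down_up p]
  simp only [sg_zero, sg_one, mul_one, mul_neg, neg_neg, one_smul]
  rw [← mul_sub]
  have w0 : wt 0 + 1 = 2 := by norm_num [wt]
  have w1 : wt 1 + 1 = 0 := by simp [wt]
  have e0 : (0 : Fin 2).rev = 1 := rfl
  have e1 : (1 : Fin 2).rev = 0 := rfl
  have hc : (rep p q Z).colMinor (Z.down z) 1 0 =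
      muR p q Z (bM p q 2) * (L p q Z 0 1 z * L p q Z 1 0 (Z.down z)) -
        muR p q Z (bM p q 0) * (L p q Z 0 0 z * L p q Z 1 1 (Z.down z)) := by
    rw [LOps.colMinor, SpectralSet.up_down p]; rfl
  have hF := shift_FMi_mul p q (wt 1)
  rw [shift_FM, w1] at hF
  have key : muR p q Z (Mero.shift (wt 1) (FM p q)) * muL p q Z (Mero.shift (wt 1) (FMi p q)) *
      (L p q Z 0 0 z * L p q Z 1 1 (Z.down z)) -
      muR p q Z (Mero.shift (wt 0) (FM p q)) * muL p q Z (Mero.shift (wt 1) (FMi p q)) *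
      (L p q Z 0 1 z * L p q Z 1 0 (Z.down z)) = det p q Z (Z.down z) := by
    rw [← muL_muR, ← muL_muR, mul_assoc, mul_assoc, ← mul_sub, shift_FM, shift_FM, w0, w1]
    have : muR p q Z (-(q : ℂ)⁻¹ • bM p q 0) * (L p q Z 0 0 z * L p q Z 1 1 (Z.down z)) -
        muR p q Z (-(q : ℂ)⁻¹ • bM p q 2) * (L p q Z 0 1 z * L p q Z 1 0 (Z.down z)) =
        (q : ℂ)⁻¹ • (rep p q Z).colMinor (Z.down z) 1 0 := by
      rw [hc]
      rw [map_smul, map_smul, smul_mul_assoc, smul_mul_assoc, neg_smul, neg_smul, smul_sub,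
        neg_sub_neg]
    rw [this, LOps.colMinor_eq, tau_one_zero, ← smul_mul_assoc, ← map_smul, smul_neg, ← neg_smul,
      ← mul_assoc]
    refine Eq.trans (congrArg (· * _) (map_mul (muL p q Z) _ _).symm) ?_
    rw [hF, map_one, one_mul]; rfl
  rw [e0, e1, key, mul_assoc, ← det_mul_comm, mul_assoc, ← mul_assoc (detInv p q Z (Z.down z)),
    detInv_det, one_mul]

variable (p q Z) in
/-- The representation that defines the antipode. -/
def antipodeRep : EllRep p q Z (Ell p q Z)ᵐᵒᵖ where
  l := (muR p q Z).toOpposite fun f g => by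
    show _ * _ = _ * _
    rw [← map_mul, ← map_mul, mul_comm]
  r := (muL p q Z).toOpposite fun f g => by
    show _ * _ = _ * _
    rw [← map_mul, ← map_mul, mul_comm]
  L a b z := op (antiL p q Z a b z)
  l_r f g := congrArg op (muL_muR g f)
  l_L f x y z := congrArg op (by
    have h := mul_muR_of_mem (antiL_mem (p := p) x y z) f
    rw [neg_neg] at h
    exact h)
  r_L f x y z := congrArg op (by
    have h := mul_muL_of_mem (antiL_mem (p := p) x y z) f
    rw [neg_neg] at h
    exact h)
  RLL a b c d z₁ z₂ := by
    refine (opAddEquiv (α := Ell p q Z)).symm.injective ?_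
    simp only [map_sum]
    exact antiL_RLL a b c d z₁ z₂
  dI z := op (det p q Z z)
  dI_det z := congrArg op (by
    show (antiL p q Z 1 1 (Z.up z) * antiL p q Z 0 0 z -
      antiL p q Z 0 1 (Z.up z) * antiL p q Z 1 0 z) * FFi p q Z * det p q Z z = 1
    rw [antiL_det, mul_assoc (detInv _ _ _ _), FF_mul_FFi, mul_one, detInv_det])
  det_dI z := congrArg op (by
    show det p q Z z * ((antiL p q Z 1 1 (Z.up z) * antiL p q Z 0 0 z -
      antiL p q Z 0 1 (Z.up z) * antiL p q Z 1 0 z) * FFi p q Z) = 1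
    rw [antiL_det, mul_assoc (detInv _ _ _ _), FF_mul_FFi, mul_one, det_detInv])
  dI_l z f := congrArg op (det_mul_comm _ _).symm
  dI_r z f := congrArg op (det_mul_comm _ _).symm
  dI_L z x y w := congrArg op (det_mul_comm _ _).symm

variable (p q Z) in
/-- The antipode. -/
def anti : Ell p q Z →ₗ[ℂ] Ell p q Z :=
  (MulOpposite.opLinearEquiv ℂ).symm.toLinearMap ∘ₗ (antipodeRep p q Z).lift.toLinearMap

theorem anti_apply (a : Ell p q Z) : anti p q Z a = unop ((antipodeRep p q Z).lift a) := rfl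

theorem anti_one : anti p q Z 1 = 1 := by simp [anti_apply]

theorem anti_mul (a b : Ell p q Z) : anti p q Z (a * b) = anti p q Z b * anti p q Z a := by
  simp [anti_apply]

theorem anti_muL (f : Mero) : anti p q Z (muL p q Z f) = muR p q Z f := by
  rw [anti_apply, EllRep.lift_muL]; rfl

theorem anti_muR (f : Mero) : anti p q Z (muR p q Z f) = muL p q Z f := by
  rw [anti_apply, EllRep.lift_muR]; rfl

theorem anti_L (a b : Fin 2) (z : Z.carrier) :
    anti p q Z (L p q Z a b z) = antiL p q Z a b z := by
  rw [anti_apply, EllRep.lift_L]; rfl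

theorem anti_detInv (z : Z.carrier) : anti p q Z (detInv p q Z z) = det p q Z z := by
  rw [anti_apply, EllRep.lift_detInv]; rfl

theorem anti_det (z : Z.carrier) : anti p q Z (det p q Z z) = detInv p q Z z := by
  have h : anti p q Z (det p q Z z) * det p q Z z = detInv p q Z z * det p q Z z := by
    have h := anti_mul (detInv p q Z z) (det p q Z z)
    rw [detInv_det, anti_one, anti_detInv] at h
    rw [detInv_det, h]
  calc _ = anti p q Z (det p q Z z) * det p q Z z * detInv p q Z z := by
        rw [mul_assoc, det_detInv, mul_one]
    _ = _ := by rw [h, detInv_det, one_mul]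

theorem det_mem (z : Z.carrier) : det p q Z z ∈ grading p q Z 0 0 := by
  have h1 := mul_mem_grading (L_mem (p := p) 0 0 z) (L_mem 1 1 (Z.up z))
  have h2 := mul_mem_grading (L_mem (p := p) 1 0 z) (L_mem 0 1 (Z.up z))
  have e : wt 0 + wt 1 = 0 := by simp [wt]
  rw [e] at h1
  rw [add_comm, e] at h2
  have h := mul_mem_grading FF_mem (sub_mem h1 h2)
  rw [add_zero] at h
  exact h

theorem anti_mem {α β : ℂ} {a : Ell p q Z} (ha : a ∈ grading p q Z α β) :
    anti p q Z a ∈ grading p q Z (-β) (-α) := by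
  refine grading_induction (motive := fun α β a => anti p q Z a ∈ grading p q Z (-β) (-α)) ha
    (fun α β => by rw [map_zero]; exact zero_mem _)
    (fun α β a b ha hb => by rw [map_add]; exact add_mem ha hb)
    (fun α β c a ha => by rw [map_smul]; exact Submodule.smul_mem _ c ha)
    (by rw [anti_one, neg_zero]; exact one_mem_grading)
    (fun α β f a _ ha => ?_) (fun α β f a _ ha => ?_) (fun α β x y z a _ ha => ?_)
    (fun α β z a _ ha => ?_) <;> rw [anti_mul]
  · rw [anti_muL]; simpa using mul_mem_grading ha (muR_mem f)
  · rw [anti_muR]; simpa using mul_mem_grading ha (muL_mem f)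
  · rw [anti_L, neg_add_rev, neg_add_rev]; exact mul_mem_grading ha (antiL_mem x y z)
  · rw [anti_detInv]; simpa using mul_mem_grading ha (det_mem z)

end Ell

end EllipticU2

namespace EllipticU2

/-! ### The `*`-operator of `ℰ` -/

/-- The opposite algebra, with complex numbers acting through complex conjugation. -/
def StarAlg (A : Type*) : Type _ := Aᵐᵒᵖ

section StarAlg

variable {A : Type*} [Ring A] [Algebra ℂ A]

instance : Ring (StarAlg A) := inferInstanceAs (Ring Aᵐᵒᵖ)

instance : Algebra ℂ (StarAlg A) :=
  RingHom.toAlgebra' ((algebraMap ℂ Aᵐᵒᵖ).comp (starRingEnd ℂ)) fun c x =>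
    Algebra.commutes (A := Aᵐᵒᵖ) (conj c) x

/-- An element of `A` as an element of `StarAlg A`. -/
def StarAlg.of : A ≃+ StarAlg A := MulOpposite.opAddEquiv

theorem StarAlg.of_mul (a b : A) : StarAlg.of (a * b) = StarAlg.of b * StarAlg.of a := rfl

theorem StarAlg.of_one : StarAlg.of (1 : A) = 1 := rfl

theorem StarAlg.algebraMap_eq (c : ℂ) :
    algebraMap ℂ (StarAlg A) c = StarAlg.of (algebraMap ℂ A (conj c)) := rfl

theorem StarAlg.smul_of (c : ℂ) (a : A) : c • StarAlg.of a = StarAlg.of (conj c • a) := by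
  rw [Algebra.smul_def, algebraMap_eq, ← of_mul, ← Algebra.commutes, ← Algebra.smul_def]

/-- A moment map composed with conjugation. -/
def StarAlg.moment (μ : Mero →ₐ[ℂ] A) : Mero →ₐ[ℂ] StarAlg A where
  toFun f := StarAlg.of (μ (Mero.bar f))
  map_one' := by rw [map_one, map_one, of_one]
  map_mul' f g := by rw [map_mul, map_mul, ← map_mul, mul_comm, map_mul, of_mul]
  map_zero' := by rw [map_zero, map_zero, map_zero]
  map_add' f g := by rw [map_add, map_add, map_add]
  commutes' c := by rw [Mero.bar_algebraMap, AlgHom.commutes, algebraMap_eq]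

end StarAlg

theorem conj_wt (i : Fin 2) : conj (wt i) = wt i := by fin_cases i <;> simp [wt]

theorem conj_sg (i : Fin 2) : conj (sg i) = sg i := by fin_cases i <;> simp [sg]

theorem bar_FMi (p q : ℝ) [GoodParams p q] : Mero.bar (FMi p q) = FMi p q := by
  have h : Mero.bar (FMi p q) * FM p q = 1 := by
    rw [← bar_FM, ← map_mul, FMi_mul_FM, map_one]
  calc _ = Mero.bar (FMi p q) * FM p q * FMi p q := by rw [mul_assoc, FM_mul_FMi, mul_one]
    _ = _ := by rw [h, one_mul]

namespace Ell

variable {p q : ℝ} [GoodParams p q] {Z : SpectralSet q}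

variable (p q Z) in
/-- The value of the `*`-operator on `L_{ab}(z)`. -/
def starL (a b : Fin 2) (z : Z.carrier) : Ell p q Z :=
  (sg a * sg b) • L p q Z a.rev b.rev (Z.refl z)

theorem starL_mem (a b : Fin 2) (z : Z.carrier) :
    starL p q Z a b z ∈ grading p q Z (-wt a) (-wt b) := by
  refine Submodule.smul_mem _ _ ?_
  rw [← wt_rev, ← wt_rev]
  exact L_mem _ _ _

theorem refl_div_refl (z w : Z.carrier) : (Z.refl w / Z.refl z : ℂ) = conj (z / w : ℂ) := by
  show (conj (w : ℂ))⁻¹ / (conj (z : ℂ))⁻¹ = _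
  rw [map_div₀, inv_div_inv]

/-- Reflection inverts and conjugates the ratio of the parameters, and the star reverses products.
The relation becomes the RLL relation for the reflected parameters in exchanged order; `shift_rM`
absorbs the shift that arises when the coefficients return to the left. -/
theorem starL_RLL (a b c d : Fin 2) (z₁ z₂ : Z.carrier) :
    ∑ x, ∑ y, starL p q Z y d z₂ * starL p q Z x b z₁ *
        muL p q Z (Mero.bar (rM p q (z₁ / z₂ : ℂ) x y a c)) =
      ∑ x, ∑ y, starL p q Z a x z₁ * starL p q Z c y z₂ *
        muR p q Z (Mero.bar (rM p q (z₁ / z₂ : ℂ) b d x y)) := by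
  have hz := div_ne_zero' z₁ z₂
  have hz' : conj (z₁ / z₂ : ℂ) ≠ 0 := (map_ne_zero _).2 hz
  have hR := (rep p q Z).RLL c.rev d.rev a.rev b.rev (Z.refl z₂) (Z.refl z₁)
  rw [refl_div_refl] at hR
  have hm : ∀ i j k l (z w : Z.carrier), starL p q Z i j z * starL p q Z k l w =
      (sg i * sg j * (sg k * sg l)) •
        (L p q Z i.rev j.rev (Z.refl z) * L p q Z k.rev l.rev (Z.refl w)) := fun i j k l z w => by
    rw [starL, starL, smul_mul_smul_comm]
  have hd : ∀ i j k l (z w : Z.carrier), L p q Z i.rev j.rev z * L p q Z k.rev l.rev w ∈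
      grading p q Z (-(wt i + wt k)) (-(wt j + wt l)) := fun i j k l z w => by
    have := mul_mem_grading (L_mem (p := p) i.rev j.rev z) (L_mem k.rev l.rev w)
    simpa only [wt_rev, ← neg_add] using this
  have h1 : ∀ x y, starL p q Z y d z₂ * starL p q Z x b z₁ *
      muL p q Z (Mero.bar (rM p q (z₁ / z₂ : ℂ) x y a c)) = (sg a * sg b * sg c * sg d) •
        (muL p q Z (rM p q (conj (z₁ / z₂ : ℂ)) y.rev x.rev c.rev a.rev) *
          (L p q Z y.rev d.rev (Z.refl z₂) * L p q Z x.rev b.rev (Z.refl z₁))) := by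
    intro x y
    by_cases hw : wt x + wt y = wt a + wt c
    · have hs := sg_mul_sg hw
      rw [hm, show sg y * sg d * (sg x * sg b) = sg a * sg b * sg c * sg d by
        linear_combination (sg b * sg d) * hs, smul_mul_assoc, mul_muL_of_mem (hd y d x b _ _),
        bar_rM p q hz, neg_neg, add_comm (wt y), hw, shift_rM p q hz']
    · have hw' : wt y.rev + wt x.rev ≠ wt c.rev + wt a.rev := fun h => hw (by
        simp only [wt_rev] at h; linear_combination -h)
      rw [rM_eq_zero hw, rM_eq_zero hw', map_zero, map_zero, mul_zero, zero_mul, smul_zero]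
  have h2 : ∀ x y, starL p q Z a x z₁ * starL p q Z c y z₂ *
      muR p q Z (Mero.bar (rM p q (z₁ / z₂ : ℂ) b d x y)) = (sg a * sg b * sg c * sg d) •
        (muR p q Z (rM p q (conj (z₁ / z₂ : ℂ)) d.rev b.rev y.rev x.rev) *
          (L p q Z a.rev x.rev (Z.refl z₁) * L p q Z c.rev y.rev (Z.refl z₂))) := by
    intro x y
    by_cases hw : wt b + wt d = wt x + wt y
    · have hs := sg_mul_sg hw
      rw [hm, show sg a * sg x * (sg c * sg y) = sg a * sg b * sg c * sg d by
        linear_combination -(sg a * sg c) * hs, smul_mul_assoc, mul_muR_of_mem (hd a x c y _ _),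
        bar_rM p q hz, neg_neg, shift_rM p q hz']
    · have hw' : wt d.rev + wt b.rev ≠ wt y.rev + wt x.rev := fun h => hw (by
        simp only [wt_rev] at h; linear_combination -h)
      rw [rM_eq_zero hw, rM_eq_zero hw', map_zero, map_zero, mul_zero, zero_mul, smul_zero]
  simp only [h1, h2, ← Finset.smul_sum]
  congr 1
  rw [sum_sum_rev fun x y => muL p q Z (rM p q (conj (z₁ / z₂ : ℂ)) y x c.rev a.rev) *
          (L p q Z y d.rev (Z.refl z₂) * L p q Z x b.rev (Z.refl z₁)),
    sum_sum_rev fun x y => muR p q Z (rM p q (conj (z₁ / z₂ : ℂ)) d.rev b.rev y x) *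
          (L p q Z a.rev x (Z.refl z₁) * L p q Z c.rev y (Z.refl z₂)), Finset.sum_comm,
    Finset.sum_comm (f := fun x y => muR p q Z _ * (L p q Z a.rev x _ * L p q Z c.rev y _))]
  exact hR

/-- The bracket has bidegree (0, 0), so it commutes with μ_r(F) μ_l(F^{-1}), and the reflection of
q²z is q^{-2} times the reflection of z. -/
theorem starL_det (z : Z.carrier) :
    (starL p q Z 1 1 (Z.up z) * starL p q Z 0 0 z - starL p q Z 0 1 (Z.up z) * starL p q Z 1 0 z) *
      (muL p q Z (FMi p q) * muR p q Z (FM p q)) = det p q Z (Z.down (Z.refl z)) := by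
  have h1 := mul_mem_grading (L_mem (p := p) 0 0 (Z.down (Z.refl z))) (L_mem 1 1 (Z.refl z))
  have h2 := mul_mem_grading (L_mem (p := p) 1 0 (Z.down (Z.refl z))) (L_mem 0 1 (Z.refl z))
  have e : wt 0 + wt 1 = 0 := by simp [wt]
  rw [e] at h1
  rw [add_comm (wt 1), e] at h2
  rw [muL_muR, ← FF_eq]
  have e0 : (0 : Fin 2).rev = 1 := rfl
  have e1 : (1 : Fin 2).rev = 0 := rfl
  simp only [starL, sg_zero, sg_one, SpectralSet.refl_up, e0, e1, mul_one, mul_neg, neg_neg,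
    one_smul, neg_smul, neg_mul]
  have h := mul_FF_of_mem (sub_mem h1 h2)
  rw [neg_zero, Mero.shift_zero, Mero.shift_zero, ← FF_eq] at h
  rw [det, SpectralSet.up_down p]
  exact h

variable (p q Z) in
/-- The representation that defines the `*`-operator. -/
def starRep : EllRep p q Z (StarAlg (Ell p q Z)) where
  l := StarAlg.moment (muL p q Z)
  r := StarAlg.moment (muR p q Z)
  L a b z := StarAlg.of (starL p q Z a b z)
  l_r f g := congrArg StarAlg.of (muL_muR _ _).symm
  l_L f x y z := congrArg StarAlg.of (by
    show starL p q Z x y z * muL p q Z (Mero.bar f) =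
      muL p q Z (Mero.bar (Mero.shift (wt x) f)) * starL p q Z x y z
    rw [mul_muL_of_mem (starL_mem x y z), neg_neg, Mero.bar_shift, conj_wt])
  r_L f x y z := congrArg StarAlg.of (by
    show starL p q Z x y z * muR p q Z (Mero.bar f) =
      muR p q Z (Mero.bar (Mero.shift (wt y) f)) * starL p q Z x y z
    rw [mul_muR_of_mem (starL_mem x y z), neg_neg, Mero.bar_shift, conj_wt])
  RLL a b c d z₁ z₂ := by
    refine (StarAlg.of (A := Ell p q Z)).symm.injective ?_
    simp only [map_sum]
    exact starL_RLL a b c d z₁ z₂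
  dI z := StarAlg.of (detInv p q Z (Z.down (Z.refl z)))
  dI_det z := congrArg StarAlg.of (by
    show (starL p q Z 1 1 (Z.up z) * starL p q Z 0 0 z -
      starL p q Z 0 1 (Z.up z) * starL p q Z 1 0 z) *
      (muL p q Z (Mero.bar (FMi p q)) * muR p q Z (Mero.bar (FM p q))) * detInv p q Z _ = 1
    rw [bar_FM, bar_FMi, starL_det, det_detInv])
  det_dI z := congrArg StarAlg.of (by
    show detInv p q Z _ * ((starL p q Z 1 1 (Z.up z) * starL p q Z 0 0 z -
      starL p q Z 0 1 (Z.up z) * starL p q Z 1 0 z) *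
      (muL p q Z (Mero.bar (FMi p q)) * muR p q Z (Mero.bar (FM p q)))) = 1
    rw [bar_FM, bar_FMi, starL_det, detInv_det])
  dI_l z f := congrArg StarAlg.of (detInv_mul_comm _ _).symm
  dI_r z f := congrArg StarAlg.of (detInv_mul_comm _ _).symm
  dI_L z x y w := congrArg StarAlg.of (detInv_mul_comm _ _).symm

variable (p q Z) in
/-- The `*`-operator. -/
def st : Ell p q Z →+ Ell p q Z :=
  StarAlg.of.symm.toAddMonoidHom.comp ((starRep p q Z).lift : Ell p q Z →+ StarAlg (Ell p q Z))

theorem of_st (a : Ell p q Z) : StarAlg.of (st p q Z a) = (starRep p q Z).lift a := rfl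

theorem st_one : st p q Z 1 = 1 := StarAlg.of.injective (by rw [of_st, map_one]; rfl)

theorem st_mul (a b : Ell p q Z) : st p q Z (a * b) = st p q Z b * st p q Z a :=
  StarAlg.of.injective (by rw [of_st, map_mul]; rfl)

theorem st_smul (c : ℂ) (a : Ell p q Z) : st p q Z (c • a) = conj c • st p q Z a :=
  StarAlg.of.injective (by rw [of_st, map_smul, ← of_st, StarAlg.smul_of])

theorem st_muL (f : Mero) : st p q Z (muL p q Z f) = muL p q Z (Mero.bar f) :=
  StarAlg.of.injective (by rw [of_st, EllRep.lift_muL]; rfl)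

theorem st_muR (f : Mero) : st p q Z (muR p q Z f) = muR p q Z (Mero.bar f) :=
  StarAlg.of.injective (by rw [of_st, EllRep.lift_muR]; rfl)

theorem st_L (a b : Fin 2) (z : Z.carrier) : st p q Z (L p q Z a b z) = starL p q Z a b z :=
  StarAlg.of.injective (by rw [of_st, EllRep.lift_L]; rfl)

theorem st_detInv (z : Z.carrier) :
    st p q Z (detInv p q Z z) = detInv p q Z (Z.down (Z.refl z)) :=
  StarAlg.of.injective (by rw [of_st, EllRep.lift_detInv]; rfl)

theorem st_mem {α β : ℂ} {a : Ell p q Z} (ha : a ∈ grading p q Z α β) :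
    st p q Z a ∈ grading p q Z (-conj α) (-conj β) := by
  refine grading_induction (motive := fun α β a =>
      st p q Z a ∈ grading p q Z (-conj α) (-conj β)) ha
    (fun α β => by rw [map_zero]; exact zero_mem _)
    (fun α β a b ha hb => by rw [map_add]; exact add_mem ha hb)
    (fun α β c a ha => by rw [st_smul]; exact Submodule.smul_mem _ _ ha)
    (by rw [st_one, map_zero, neg_zero]; exact one_mem_grading)
    (fun α β f a _ ha => ?_) (fun α β f a _ ha => ?_) (fun α β x y z a _ ha => ?_)
    (fun α β z a _ ha => ?_) <;> rw [st_mul]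
  · rw [st_muL]; simpa using mul_mem_grading ha (muL_mem (Mero.bar f))
  · rw [st_muR]; simpa using mul_mem_grading ha (muR_mem (Mero.bar f))
  · rw [st_L, map_add, map_add, neg_add_rev, neg_add_rev, conj_wt, conj_wt]
    exact mul_mem_grading ha (starL_mem x y z)
  · rw [st_detInv]; simpa using mul_mem_grading ha (detInv_mem (Z.down (Z.refl z)))

theorem st_starL (a b : Fin 2) (z : Z.carrier) : st p q Z (starL p q Z a b z) = L p q Z a b z := by
  rw [starL, st_smul, st_L, starL, smul_smul, Fin.rev_rev, Fin.rev_rev, SpectralSet.refl_refl,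
    sg_rev, sg_rev, map_mul, conj_sg, conj_sg]
  rw [show sg a * sg b * (-sg a * -sg b) = (sg a * sg a) * (sg b * sg b) by ring, sg_mul_self,
    sg_mul_self, one_mul, one_smul]

theorem st_st (a : Ell p q Z) : st p q Z (st p q Z a) = a := by
  refine induction_left (motive := fun a => st p q Z (st p q Z a) = a) a
    (fun a b ha hb => by rw [map_add, map_add, ha, hb])
    (fun c a ha => by rw [st_smul, st_smul, ha, Complex.conj_conj]) (by rw [st_one, st_one])
    (fun f a ha => ?_) (fun f a ha => ?_) (fun x y z a ha => ?_) (fun z a ha => ?_) <;>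
    rw [st_mul, st_mul, ha]
  · rw [st_muL, st_muL, Mero.bar_bar]
  · rw [st_muR, st_muR, Mero.bar_bar]
  · rw [st_L, st_starL]
  · rw [st_detInv, st_detInv, SpectralSet.refl_down, SpectralSet.refl_refl, SpectralSet.down_up p]

theorem st_det (z : Z.carrier) : st p q Z (det p q Z z) = det p q Z (Z.down (Z.refl z)) := by
  have h : st p q Z (det p q Z z) * detInv p q Z (Z.down (Z.refl z)) = 1 := by
    rw [← st_detInv, ← st_mul, detInv_det, st_one]
  calc _ = st p q Z (det p q Z z) * detInv p q Z (Z.down (Z.refl z)) *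
        det p q Z (Z.down (Z.refl z)) := by rw [mul_assoc, detInv_det, mul_one]
    _ = _ := by rw [h, one_mul]

theorem anti_FF : anti p q Z (FF p q Z) = FFi p q Z := by
  rw [FF_eq, anti_mul, anti_muL, anti_muR]; rfl

theorem st_FF : st p q Z (FF p q Z) = FF p q Z := by
  rw [FF_eq, st_mul, st_muL, st_muR, bar_FM, bar_FMi, muL_muR]

/-- The composite S∘* transposes L and moves the parameter to q^{-2}/z̄, which is an involution. In
the square the prefactors F and the determinants cancel, and every sign occurs an even number of
times. -/
theorem anti_st_anti_st_L (a b : Fin 2) (z : Z.carrier) :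
    anti p q Z (st p q Z (anti p q Z (st p q Z (L p q Z a b z)))) = L p q Z a b z := by
  have e : Z.refl (Z.down (Z.refl z)) = Z.up z := by
    rw [SpectralSet.refl_down, SpectralSet.refl_refl]
  rw [st_L, starL, map_smul, anti_L, antiL, smul_smul, Fin.rev_rev, Fin.rev_rev, st_smul, st_mul,
    st_mul, st_FF, st_L, st_detInv, starL, e, SpectralSet.down_up p, map_smul, anti_mul, anti_mul,
    anti_FF, anti_detInv, map_smul, anti_L, antiL, SpectralSet.down_up p, Fin.rev_rev,
    Fin.rev_rev, mul_smul_comm, mul_smul_comm, smul_smul, smul_smul]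
  have h : FFi p q Z * det p q Z z * (FF p q Z * detInv p q Z z * L p q Z a b z) =
      L p q Z a b z := by
    rw [← det_mul_comm, mul_assoc, ← mul_assoc (FFi p q Z), ← mul_assoc (FFi p q Z), FFi_mul_FF,
      one_mul, ← mul_assoc, det_detInv, one_mul]
  rw [h]
  simp only [map_mul, map_neg, conj_sg, sg_rev]
  have h1 := sg_mul_self a
  have h2 := sg_mul_self b
  have h3 : ∀ x y : ℂ, x * x = 1 → y * y = 1 →
      x * y * (-x * -y) * (y * x) * (-y * -x) = 1 := fun x y hx hy => by
    linear_combination (x * x * y ^ 4 + y ^ 4) * hx + (y * y + 1) * hy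
  rw [h3 _ _ h1 h2, one_smul]

/-- As a composite of four product-reversing maps, two of them conjugate-linear, the square is a
linear homomorphism, so generators suffice. It provides the inverse of the antipode. -/
theorem anti_st_anti_st (a : Ell p q Z) :
    anti p q Z (st p q Z (anti p q Z (st p q Z a))) = a := by
  refine induction_left (motive := fun a => anti p q Z (st p q Z (anti p q Z (st p q Z a))) = a) a
    (fun a b ha hb => by simp only [map_add, ha, hb])
    (fun c a ha => by rw [st_smul, map_smul, st_smul, Complex.conj_conj, map_smul, ha])
    (by simp only [anti_one, st_one])
    (fun f a ha => ?_) (fun f a ha => ?_) (fun x y z a ha => ?_) (fun z a ha => ?_) <;>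
    rw [st_mul, anti_mul, st_mul, anti_mul, ha]
  · rw [st_muL, anti_muL, st_muR, anti_muR, Mero.bar_bar]
  · rw [st_muR, anti_muR, st_muL, anti_muL, Mero.bar_bar]
  · rw [anti_st_anti_st_L]
  · rw [st_detInv, anti_detInv, st_det, anti_det, SpectralSet.refl_down, SpectralSet.refl_refl,
      SpectralSet.down_up p]

variable (p q Z) in
/-- The antipode as a linear automorphism. -/
def antiEquiv : Ell p q Z ≃ₗ[ℂ] Ell p q Z :=
  { anti p q Z with
    invFun := fun a => st p q Z (anti p q Z (st p q Z a))
    left_inv := fun a => by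
      have h := congrArg (st p q Z) (anti_st_anti_st (st p q Z a))
      rw [st_st] at h
      exact h
    right_inv := anti_st_anti_st }

theorem antiEquiv_apply (a : Ell p q Z) : antiEquiv p q Z a = anti p q Z a := rfl

theorem antiEquiv_symm_apply (a : Ell p q Z) :
    (antiEquiv p q Z).symm a = st p q Z (anti p q Z (st p q Z a)) := rfl

theorem star_diffOp_one : (1 : DiffOp).star = 1 := by
  rw [← DiffOp.term_one_zero, DiffOp.star_term]; simp

theorem antipode_diffOp_one : (1 : DiffOp).antipode = 1 := by
  rw [← DiffOp.term_one_zero, DiffOp.antipode_term]; simp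

open DiffOp in
theorem counit_st (a : Ell p q Z) : counit p q Z (st p q Z a) = (counit p q Z a).star := by
  refine induction_left (motive := fun a => counit p q Z (st p q Z a) = (counit p q Z a).star) a
    (fun a b ha hb => by simp only [map_add, ha, hb, star_add])
    (fun c a ha => by rw [st_smul, map_smul, ha, map_smul, star_smul])
    (by rw [st_one, map_one, star_diffOp_one])
    (fun f a ha => ?_) (fun f a ha => ?_) (fun x y z a ha => ?_) (fun z a ha => ?_) <;>
    rw [st_mul, map_mul, ha, map_mul, DiffOp.star_mul] <;> congr 1
  · rw [st_muL, counit_muL, counit_muL, mulOp, mulOp, star_term]; simp [Mero.shift_zero]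
  · rw [st_muR, counit_muR, counit_muR, mulOp, mulOp, star_term]; simp [Mero.shift_zero]
  · rw [st_L, starL, map_smul, counit_L, counit_L]
    by_cases h : x = y
    · subst h
      rw [if_pos rfl, if_pos rfl, sg_mul_self, one_smul, T, T, star_term]
      simp [wt_rev, conj_wt]
    · rw [if_neg h, if_neg fun h' => h (Fin.rev_injective h'), smul_zero, DiffOp.star_zero]
  · rw [st_detInv, counit_detInv, counit_detInv, star_diffOp_one]

open DiffOp in
theorem counit_anti (a : Ell p q Z) : counit p q Z (anti p q Z a) = (counit p q Z a).antipode := by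
  have hd : ∀ z, counit p q Z (det p q Z z) = 1 := fun z => by
    have h := congrArg (counit p q Z) (det_detInv (p := p) z)
    rwa [map_mul, counit_detInv, mul_one, map_one] at h
  refine induction_left (motive := fun a => counit p q Z (anti p q Z a) =
      (counit p q Z a).antipode) a
    (fun a b ha hb => by simp only [map_add, ha, hb, antipode_add])
    (fun c a ha => by rw [map_smul, map_smul, ha, map_smul, antipode_smul])
    (by rw [anti_one, map_one, antipode_diffOp_one])
    (fun f a ha => ?_) (fun f a ha => ?_) (fun x y z a ha => ?_) (fun z a ha => ?_) <;>
    rw [anti_mul, map_mul, ha, map_mul, antipode_mul] <;> congr 1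
  · rw [anti_muL, counit_muL, counit_muR, mulOp, antipode_term]; simp [Mero.shift_zero]
  · rw [anti_muR, counit_muL, counit_muR, mulOp, antipode_term]; simp [Mero.shift_zero]
  · rw [anti_L, antiL, map_smul, map_mul, map_mul, counit_detInv, counit_L, counit_L, FF_eq,
      map_mul, counit_muL, counit_muR, ← mulHom_apply, ← mulHom_apply, ← map_mul, FM_mul_FMi,
      map_one, one_mul, one_mul]
    by_cases h : x = y
    · subst h
      rw [if_pos rfl, if_pos rfl, sg_mul_self, one_smul, T, T, antipode_term]
      simp [wt_rev]
    · rw [if_neg h, if_neg fun h' => h (Fin.rev_injective h').symm, smul_zero, antipode_zero]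
  · rw [anti_detInv, counit_detInv, hd, antipode_diffOp_one]

end Ell

end EllipticU2

namespace EllipticU2

/-! ### The antipode axioms -/

/-- A complex vector space with complex numbers acting through complex conjugation. -/
def ConjMod (V : Type*) : Type _ := V

section ConjMod

variable {V : Type*} [AddCommGroup V] [Module ℂ V]

instance : AddCommGroup (ConjMod V) := inferInstanceAs (AddCommGroup V)

instance : Module ℂ (ConjMod V) := Module.compHom V (starRingEnd ℂ)

/-- An element of `V` as an element of `ConjMod V`. -/
def ConjMod.of : V ≃+ ConjMod V := AddEquiv.refl V

theorem ConjMod.smul_of (c : ℂ) (v : V) : c • ConjMod.of v = ConjMod.of (conj c • v) := rfl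

end ConjMod

namespace Ell

variable {p q : ℝ} {Z : SpectralSet q}

local notation "tm" => btmul (muL p q Z) (muR p q Z)

/-! ### Maps on the matrix tensor product -/

section MatchedLift

variable {V : Type*} [AddCommGroup V] [Module ℂ V]

/-- A bilinear map that is balanced on the matrix tensor product. -/
def IsBalanced (F : Ell p q Z →ₗ[ℂ] Ell p q Z →ₗ[ℂ] V) : Prop :=
  ∀ (α β γ : ℂ) (a b : Ell p q Z), a ∈ grading p q Z α β → b ∈ grading p q Z β γ → ∀ f,
    F (muR p q Z f * a) b = F a (muL p q Z f * b)

/-- The linear map on `ℰ ⊗_M ℰ` that is given on the matrix tensor product by a bilinear map, and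
that vanishes on the other bidegrees. -/
def matchedLift (F : Ell p q Z →ₗ[ℂ] Ell p q Z →ₗ[ℂ] V)
    (h : IsBalanced F) : BT p q Z →ₗ[ℂ] V :=
  btLift (matched F) (by
    intro f a b
    refine induction_homogeneous (motive := fun a => matched F (muR p q Z f * a) b =
      matched F a (muL p q Z f * b)) a
      (fun a a' h h' => by rw [mul_add, map_add, LinearMap.add_apply, h, h', map_add,
        LinearMap.add_apply]) fun α β a ha => ?_
    refine induction_homogeneous (motive := fun b => matched F (muR p q Z f * a) b =
      matched F a (muL p q Z f * b)) b
      (fun b b' h h' => by rw [map_add, h, h', mul_add, map_add]) fun γ δ b hb => ?_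
    have ha' : muR p q Z f * a ∈ grading p q Z α β := by
      simpa using mul_mem_grading (muR_mem f) ha
    have hb' : muL p q Z f * b ∈ grading p q Z γ δ := by
      simpa using mul_mem_grading (muL_mem f) hb
    by_cases e : β = γ
    · subst e
      rw [matched_of_mem F ha' hb, matched_of_mem F ha hb', h _ _ _ _ _ ha hb]
    · rw [matched_of_ne F ha' hb e, matched_of_ne F ha hb' e])

theorem matchedLift_tm (F : Ell p q Z →ₗ[ℂ] Ell p q Z →ₗ[ℂ] V)
    (h : IsBalanced F) {α β γ : ℂ} {a b : Ell p q Z}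
    (ha : a ∈ grading p q Z α β) (hb : b ∈ grading p q Z β γ) :
    matchedLift F h (tm a b) = F a b := by
  rw [matchedLift, btLift_btmul, matched_of_mem F ha hb]

/-- Additive maps on the matrix tensor product may be compared on homogeneous tensors. -/
theorem eq_of_mem_matchedSpan {G : Type*} [AddCommGroup G] (φ ψ : BT p q Z →+ G) {α β : ℂ}
    {t : BT p q Z} (ht : t ∈ matchedSpan p q Z α β)
    (h : ∀ γ, ∀ b ∈ grading p q Z α γ, ∀ c ∈ grading p q Z γ β, φ (tm b c) = ψ (tm b c)) :
    φ t = ψ t := by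
  refine Submodule.closure_induction (p := fun t _ => φ t = ψ t) (by simp)
    (fun x y _ _ hx hy => by rw [map_add, map_add, hx, hy]) (fun c x hx => ?_) ht
  obtain ⟨γ, b, d, hb, hd, rfl⟩ := hx
  rw [← btmul_smul_left]
  exact h γ _ (Submodule.smul_mem _ c hb) d hd

end MatchedLift

theorem muL_mul_mem {α β : ℂ} {a : Ell p q Z} (ha : a ∈ grading p q Z α β) (f : Mero) :
    muL p q Z f * a ∈ grading p q Z α β := by simpa using mul_mem_grading (muL_mem f) ha

theorem muR_mul_mem {α β : ℂ} {a : Ell p q Z} (ha : a ∈ grading p q Z α β) (f : Mero) :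
    muR p q Z f * a ∈ grading p q Z α β := by simpa using mul_mem_grading (muR_mem f) ha

theorem detInv_mul_mem {α β : ℂ} {a : Ell p q Z} (ha : a ∈ grading p q Z α β) (z : Z.carrier) :
    detInv p q Z z * a ∈ grading p q Z α β := by simpa using mul_mem_grading (detInv_mem z) ha

variable [GoodParams p q]

/-- A linear map on the image of the comultiplication is determined by the way it transforms under
left multiplication by generators. -/
theorem map_comul_eq {G : Type*} [AddCommGroup G] [Module ℂ G] (φ : BT p q Z →ₗ[ℂ] G)
    (ψ : ℂ → Ell p q Z →ₗ[ℂ] G) (h1 : φ (tm 1 1) = ψ 0 1)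
    (hl : ∀ (f : Mero) (α : ℂ), ∃ E : G →+ G,
      (∀ β γ, ∀ u ∈ grading p q Z α β, ∀ v ∈ grading p q Z β γ,
        φ (tm (muL p q Z f * u) v) = E (φ (tm u v))) ∧
      ∀ a, ψ α (muL p q Z f * a) = E (ψ α a))
    (hr : ∀ (f : Mero) (α : ℂ), ∃ E : G →+ G,
      (∀ β γ, ∀ u ∈ grading p q Z α β, ∀ v ∈ grading p q Z β γ,
        φ (tm u (muR p q Z f * v)) = E (φ (tm u v))) ∧
      ∀ a, ψ α (muR p q Z f * a) = E (ψ α a))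
    (hL : ∀ (i j : Fin 2) (z : Z.carrier) (α : ℂ), ∃ E : G →+ G,
      (∀ β γ, ∀ u ∈ grading p q Z α β, ∀ v ∈ grading p q Z β γ,
        ∑ x, φ (tm (L p q Z i x z * u) (L p q Z x j z * v)) = E (φ (tm u v))) ∧
      ∀ a, ψ (wt i + α) (L p q Z i j z * a) = E (ψ α a))
    (hd : ∀ (z : Z.carrier) (α : ℂ), ∃ E : G →+ G,
      (∀ β γ, ∀ u ∈ grading p q Z α β, ∀ v ∈ grading p q Z β γ,
        φ (tm (detInv p q Z z * u) (detInv p q Z z * v)) = E (φ (tm u v))) ∧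
      ∀ a, ψ α (detInv p q Z z * a) = E (ψ α a))
    {α β : ℂ} {a : Ell p q Z} (ha : a ∈ grading p q Z α β) : φ (comul p q Z a) = ψ α a := by
  refine grading_induction (motive := fun α β a => φ (comul p q Z a) = ψ α a) ha
    (fun α β => by simp) (fun α β a b ha hb => by simp only [map_add, ha, hb])
    (fun α β c a ha => by simp only [map_smul, ha]) (by rw [comul_one, h1])
    (fun α β f a hm ha => ?_) (fun α β f a hm ha => ?_) (fun α β x y z a hm ha => ?_)
    (fun α β z a hm ha => ?_) <;> rw [comul_mul]
  · obtain ⟨E, h, h'⟩ := hl f α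
    rw [h', ← ha]
    refine eq_of_mem_matchedSpan (φ.toAddMonoidHom.comp (comulAct p q Z (muL p q Z f)).toAddMonoidHom)
      (E.comp φ.toAddMonoidHom) (comul_mem hm) fun γ b hb c hc => ?_
    exact (congrArg φ (comulAct_muL f b c)).trans (h _ _ b hb c hc)
  · obtain ⟨E, h, h'⟩ := hr f α
    rw [h', ← ha]
    refine eq_of_mem_matchedSpan (φ.toAddMonoidHom.comp (comulAct p q Z (muR p q Z f)).toAddMonoidHom)
      (E.comp φ.toAddMonoidHom) (comul_mem hm) fun γ b hb c hc => ?_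
    exact (congrArg φ (comulAct_muR f b c)).trans (h _ _ b hb c hc)
  · obtain ⟨E, h, h'⟩ := hL x y z α
    rw [h', ← ha]
    refine eq_of_mem_matchedSpan (φ.toAddMonoidHom.comp (comulAct p q Z (L p q Z x y z)).toAddMonoidHom)
      (E.comp φ.toAddMonoidHom) (comul_mem hm) fun γ b hb c hc => ?_
    exact ((congrArg φ (comulAct_L x y z b c)).trans (map_sum φ _ _)).trans (h _ _ b hb c hc)
  · obtain ⟨E, h, h'⟩ := hd z α
    rw [h', ← ha]
    refine eq_of_mem_matchedSpan (φ.toAddMonoidHom.comp (comulAct p q Z (detInv p q Z z)).toAddMonoidHom)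
      (E.comp φ.toAddMonoidHom) (comul_mem hm) fun γ b hb c hc => ?_
    exact (congrArg φ (comulAct_detInv z b c)).trans (h _ _ b hb c hc)

variable (p q Z) in
/-- The map `a ⊗ b ↦ S(a) b`. -/
def antiLeft : BT p q Z →ₗ[ℂ] Ell p q Z :=
  btLift ((LinearMap.mul ℂ (Ell p q Z)).comp (anti p q Z)) fun f a b => by
    simp only [LinearMap.comp_apply, LinearMap.mul_apply', anti_mul, anti_muR, mul_assoc]

@[simp] theorem antiLeft_tm (a b : Ell p q Z) : antiLeft p q Z (tm a b) = anti p q Z a * b :=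
  btLift_btmul ..

/-- Under left multiplication of a by L_{ij} the sum ∑ S(L_{ix})L_{xj} = δ_{ij} appears in the
middle of S(u)·v; a function multiplied on the left passes S(u) with a shift by the left degree of
u, whence the shift by α. -/
theorem antiLeft_comul {α β : ℂ} {a : Ell p q Z} (ha : a ∈ grading p q Z α β) :
    antiLeft p q Z (comul p q Z a) = muR p q Z (Mero.shift α (eps0 p q Z a)) := by
  refine map_comul_eq (antiLeft p q Z) (fun α => (muR p q Z).toLinearMap.comp
    ({ Mero.shift α with map_smul' := fun c f => Mero.shift_smul α c f } ∘ₗ eps0 p q Z)) ?_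
    (fun f α => ⟨AddMonoidHom.mulLeft (muR p q Z (Mero.shift α f)), fun β γ u hu v hv => ?_,
      fun a => ?_⟩) (fun f α => ⟨AddMonoidHom.mulLeft (muR p q Z (Mero.shift α f)),
        fun β γ u hu v hv => ?_, fun a => ?_⟩)
    (fun i j z α => ⟨if i = j then .id _ else 0, fun β γ u hu v hv => ?_, fun a => ?_⟩)
    (fun z α => ⟨.id _, fun β γ u hu v hv => ?_, fun a => ?_⟩) ha
  · simp [anti_one]
  · have h := mul_muR_of_mem (anti_mem hu) f
    rw [neg_neg] at h
    simp only [antiLeft_tm, anti_mul, anti_muL, h, AddMonoidHom.coe_mulLeft, mul_assoc]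
  · simp
  · have h := mul_muR_of_mem (anti_mem hu) f
    rw [neg_neg] at h
    simp only [antiLeft_tm, ← mul_assoc, h, AddMonoidHom.coe_mulLeft]
  · simp
  · simp only [antiLeft_tm, anti_mul, anti_L, mul_assoc]
    have h := congrArg (fun t => anti p q Z u * (t * v)) (sum_antiL_mul_L (p := p) i j z)
    simp only [Finset.sum_mul, Finset.mul_sum, mul_assoc] at h
    rw [h]
    split_ifs <;> simp
  · by_cases e : i = j
    · simp [e, Mero.shift_shift, add_comm]
    · simp [e]
  · simp only [antiLeft_tm, anti_mul, anti_detInv, AddMonoidHom.id_apply]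
    rw [mul_assoc, ← mul_assoc (det _ _ _ _), det_detInv, one_mul]
  · simp

/-- For matched degrees aS(b) has right degree 0, so μ_r(f) commutes with it. Without matching this
fails, which is why this map, unlike a ⊗ b ↦ S(a)b, lives on the matrix tensor product only. -/
theorem isBalanced_mul_anti :
    IsBalanced ((LinearMap.mul ℂ (Ell p q Z)).compl₂ (anti p q Z)) := fun α β γ a b ha hb f => by
  have h := mul_muR_of_mem (mul_mem_grading ha (anti_mem hb)) f
  rw [add_neg_cancel, neg_zero, Mero.shift_zero] at h
  simp only [LinearMap.compl₂_apply, LinearMap.mul_apply', anti_mul, anti_muL]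
  rw [← mul_assoc, h, mul_assoc]

variable (p q Z) in
/-- The map `a ⊗ b ↦ a S(b)` on the matrix tensor product. -/
def antiRight : BT p q Z →ₗ[ℂ] Ell p q Z := matchedLift _ isBalanced_mul_anti

theorem antiRight_tm {α β γ : ℂ} {a b : Ell p q Z} (ha : a ∈ grading p q Z α β)
    (hb : b ∈ grading p q Z β γ) : antiRight p q Z (tm a b) = a * anti p q Z b :=
  matchedLift_tm _ _ ha hb

theorem antiRight_comul (a : Ell p q Z) :
    antiRight p q Z (comul p q Z a) = muL p q Z (eps0 p q Z a) := by
  refine induction_homogeneous (motive := fun a => antiRight p q Z (comul p q Z a) =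
    muL p q Z (eps0 p q Z a)) a (fun a b ha hb => by simp only [map_add, ha, hb])
    fun α β a ha => ?_
  refine map_comul_eq (antiRight p q Z) (fun α => (muL p q Z).toLinearMap.comp (eps0 p q Z)) ?_
    (fun f α => ⟨AddMonoidHom.mulLeft (muL p q Z f), fun β γ u hu v hv => ?_, fun a => ?_⟩)
    (fun f α => ⟨AddMonoidHom.mulRight (muL p q Z f), fun β γ u hu v hv => ?_, fun a => ?_⟩)
    (fun i j z α => ⟨∑ x, (AddMonoidHom.mulLeft (L p q Z i x z)).comp
      (AddMonoidHom.mulRight (antiL p q Z x j z)), fun β γ u hu v hv => ?_, fun a => ?_⟩)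
    (fun z α => ⟨.id _, fun β γ u hu v hv => ?_, fun a => ?_⟩) ha
  · rw [antiRight_tm one_mem_grading one_mem_grading]; simp [anti_one]
  · rw [antiRight_tm (muL_mul_mem hu f) hv, antiRight_tm hu hv, mul_assoc]; rfl
  · simp
  · rw [antiRight_tm hu (muR_mul_mem hv f), antiRight_tm hu hv, anti_mul, anti_muR, ← mul_assoc]; rfl
  · simp [mul_comm f]
  · rw [AddMonoidHom.finsetSum_apply]
    refine Finset.sum_congr rfl fun x _ => ?_
    rw [antiRight_tm (mul_mem_grading (L_mem i x z) hu) (mul_mem_grading (L_mem x j z) hv),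
      antiRight_tm hu hv, anti_mul, anti_L]
    simp [mul_assoc]
  · have h : ∀ x, L p q Z i x z * (muL p q Z (eps0 p q Z a) * antiL p q Z x j z) =
        muL p q Z (Mero.shift (-wt i) (eps0 p q Z a)) * (L p q Z i x z * antiL p q Z x j z) :=
      fun x => by rw [← mul_assoc, mul_muL_of_mem (L_mem i x z), mul_assoc]
    rw [AddMonoidHom.finsetSum_apply]
    simp only [AddMonoidHom.comp_apply, AddMonoidHom.coe_mulLeft, AddMonoidHom.coe_mulRight,
      LinearMap.comp_apply, AlgHom.toLinearMap_apply, h]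
    rw [← Finset.mul_sum, sum_L_mul_antiL, eps0_L_mul]
    split_ifs <;> simp
  · rw [antiRight_tm (detInv_mul_mem hu z) (detInv_mul_mem hv z), antiRight_tm hu hv, anti_mul,
      anti_detInv, ← mul_assoc, mul_assoc (detInv _ _ _ _), detInv_mul_comm, mul_assoc, detInv_det,
      mul_one]; rfl
  · simp

end Ell

end EllipticU2

namespace EllipticU2

namespace Ell

variable {p q : ℝ} [GoodParams p q] {Z : SpectralSet q}

local notation "tm" => btmul (muL p q Z) (muR p q Z)

/-! ### Comultiplication, antipode and `*` -/

theorem comul_starL (i j : Fin 2) (z : Z.carrier) : comul p q Z (starL p q Z i j z) =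
    ∑ x, tm (starL p q Z i x z) (starL p q Z x j z) := by
  rw [starL, map_smul, comul_L, ← sum_rev, Finset.smul_sum]
  refine Finset.sum_congr rfl fun x _ => ?_
  rw [starL, starL, btmul_smul_left, btmul_smul_right, smul_smul]
  congr 1
  linear_combination -(sg i * sg j) * sg_mul_self x

/-- The transposition of L in the formula for S exchanges the legs, det^{-1} is group-like, and of
the two factors μ_r(F) μ_l(F^{-1}) the inner halves cancel across the tensor sign. -/
theorem comul_antiL (i j : Fin 2) (z : Z.carrier) : comul p q Z (antiL p q Z i j z) =
    ∑ x, tm (antiL p q Z x j z) (antiL p q Z i x z) := by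
  have hF : ∀ t, muL p q Z (FM p q) * (muR p q Z (FM p q) * (muL p q Z (FMi p q) * t)) =
      muR p q Z (FM p q) * t := fun t => by
    rw [← mul_assoc (muR _ _ _ _), ← muL_muR, mul_assoc, ← mul_assoc, ← map_mul, FM_mul_FMi,
      map_one, one_mul]
  rw [antiL, map_smul, FF_eq]
  simp only [mul_assoc, comul_mul, comul_L, map_sum, comulAct_muL, comulAct_muR, comulAct_detInv]
  rw [← sum_rev, Finset.smul_sum]
  refine Finset.sum_congr rfl fun x _ => ?_
  rw [antiL, antiL, btmul_smul_left, btmul_smul_right, smul_smul, FF_eq]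
  simp only [mul_assoc, btmul_muR, hF]
  congr 1
  linear_combination -(sg i * sg j) * sg_mul_self x

/-- Both sides are carried to 1 ⊗ 1 by the invertible action of det^{-1}(z). -/
theorem comul_det (z : Z.carrier) : comul p q Z (det p q Z z) = tm (det p q Z z) (det p q Z z) := by
  have h1 : comulAct p q Z (detInv p q Z z) (comul p q Z (det p q Z z)) = tm 1 1 := by
    rw [← comul_mul, detInv_det, comul_one]
  have h2 := congrArg (comulAct p q Z (det p q Z z)) h1
  rw [← Module.End.mul_apply, ← map_mul, det_detInv, map_one, Module.End.one_apply] at h2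
  rw [h2]
  have h3 : comulAct p q Z (detInv p q Z z) (tm (det p q Z z) (det p q Z z)) = tm 1 1 := by
    rw [comulAct_detInv, detInv_det]
  rw [← h3, ← Module.End.mul_apply, ← map_mul, det_detInv, map_one, Module.End.one_apply]

theorem comul_mul_tm {a u : Ell p q Z} {u₁ u₂ : Ell p q Z} (hu : comul p q Z u = tm u₁ u₂) :
    comul p q Z (a * u) = rmul _ _ u₁ u₂ (comul p q Z a) := by
  rw [comul_mul, hu, comulAct_tm]

variable (p q Z) in
/-- The bilinear map `(a, b) ↦ S(b) ⊗ S(a)`. -/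
def antiTensor : Ell p q Z →ₗ[ℂ] Ell p q Z →ₗ[ℂ] BT p q Z :=
  ((btmulₗ (muL p q Z) (muR p q Z)).compl₁₂ (anti p q Z) (anti p q Z)).flip

theorem antiTensor_apply (a b : Ell p q Z) :
    antiTensor p q Z a b = tm (anti p q Z b) (anti p q Z a) := rfl

theorem isBalanced_antiTensor : IsBalanced (antiTensor p q Z) := fun α β γ a b ha hb f => by
  have h1 := mul_muL_of_mem (anti_mem ha) f
  have h2 := mul_muR_of_mem (anti_mem hb) f
  rw [antiTensor_apply, antiTensor_apply, anti_mul, anti_mul, anti_muL, anti_muR, h1, h2,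
    btmul_muR]

variable (p q Z) in
/-- The map `a ⊗ b ↦ S(b) ⊗ S(a)` on the matrix tensor product. -/
def antiFlip : BT p q Z →ₗ[ℂ] BT p q Z := matchedLift _ isBalanced_antiTensor

theorem antiFlip_tm {α β γ : ℂ} {a b : Ell p q Z} (ha : a ∈ grading p q Z α β)
    (hb : b ∈ grading p q Z β γ) :
    antiFlip p q Z (tm a b) = tm (anti p q Z b) (anti p q Z a) := matchedLift_tm _ _ ha hb

/-- Both sides respond to left multiplication of a by a generator g through right multiplication by
∑ S(g_{(2)}) ⊗ S(g_{(1)}), so they agree once they agree at 1. -/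
theorem antiFlip_comul (a : Ell p q Z) :
    antiFlip p q Z (comul p q Z a) = comul p q Z (anti p q Z a) := by
  refine induction_homogeneous (motive := fun a => antiFlip p q Z (comul p q Z a) =
    comul p q Z (anti p q Z a)) a (fun a b ha hb => by simp only [map_add, ha, hb])
    fun α β a ha => ?_
  refine map_comul_eq (antiFlip p q Z) (fun α => comul p q Z ∘ₗ anti p q Z) ?_
    (fun f α => ⟨(rmul _ _ 1 (muR p q Z f)).toAddMonoidHom, fun β γ u hu v hv => ?_, fun a => ?_⟩)
    (fun f α => ⟨(rmul _ _ (muL p q Z f) 1).toAddMonoidHom, fun β γ u hu v hv => ?_, fun a => ?_⟩)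
    (fun i j z α => ⟨(∑ x, rmul _ _ (antiL p q Z x j z) (antiL p q Z i x z)).toAddMonoidHom,
      fun β γ u hu v hv => ?_, fun a => ?_⟩)
    (fun z α => ⟨(rmul _ _ (det p q Z z) (det p q Z z)).toAddMonoidHom,
      fun β γ u hu v hv => ?_, fun a => ?_⟩) ha
  · rw [antiFlip_tm one_mem_grading one_mem_grading]; simp [anti_one, comul_one]
  · rw [antiFlip_tm (muL_mul_mem hu f) hv, antiFlip_tm hu hv, anti_mul, anti_muL]
    refine Eq.trans ?_ (rmul_btmul _ _ _ _).symm
    rw [mul_one]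
  · simp only [LinearMap.comp_apply, anti_mul, anti_muL]
    exact comul_mul_tm (comul_muR f)
  · rw [antiFlip_tm hu (muR_mul_mem hv f), antiFlip_tm hu hv, anti_mul, anti_muR]
    refine Eq.trans ?_ (rmul_btmul _ _ _ _).symm
    rw [mul_one]
  · simp only [LinearMap.comp_apply, anti_mul, anti_muR]
    exact comul_mul_tm (comul_muL f)
  · rw [LinearMap.toAddMonoidHom_coe, LinearMap.sum_apply]
    refine Finset.sum_congr rfl fun x _ => ?_
    rw [antiFlip_tm (mul_mem_grading (L_mem i x z) hu) (mul_mem_grading (L_mem x j z) hv),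
      antiFlip_tm hu hv, anti_mul, anti_L, anti_mul, anti_L, rmul_btmul]
  · simp only [LinearMap.comp_apply, anti_mul, anti_L]
    exact (comul_mul_of_eq (comul_antiL i j z) _).trans (LinearMap.sum_apply ..).symm
  · rw [antiFlip_tm (detInv_mul_mem hu z) (detInv_mul_mem hv z), antiFlip_tm hu hv, anti_mul,
      anti_mul, anti_detInv]
    exact (rmul_btmul _ _ _ _).symm
  · simp only [LinearMap.comp_apply, anti_mul, anti_detInv]
    exact comul_mul_tm (comul_det z)

variable (p q Z) in
/-- The map `(a, b) ↦ a^* ⊗ b^*`. -/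
def stTensor : Ell p q Z →ₗ[ℂ] Ell p q Z →ₗ[ℂ] ConjMod (BT p q Z) :=
  LinearMap.mk₂ ℂ (fun a b => ConjMod.of (tm (st p q Z a) (st p q Z b)))
    (fun a a' b => by rw [map_add, btmul_add_left, map_add])
    (fun c a b => by rw [st_smul, btmul_smul_left, ConjMod.smul_of])
    (fun a b b' => by rw [map_add, btmul_add_right, map_add])
    (fun c a b => by rw [st_smul, btmul_smul_right, ConjMod.smul_of])

theorem isBalanced_stTensor : IsBalanced (stTensor p q Z) := fun α β γ a b ha hb f => by
  have h1 := mul_muR_of_mem (st_mem ha) (Mero.bar f)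
  have h2 := mul_muL_of_mem (st_mem hb) (Mero.bar f)
  simp only [stTensor, LinearMap.mk₂_apply]
  rw [st_mul, st_mul, st_muL, st_muR, h1, h2, btmul_muR]

variable (p q Z) in
/-- The map `a ⊗ b ↦ a^* ⊗ b^*` on the matrix tensor product. -/
def stMap : BT p q Z →ₗ[ℂ] ConjMod (BT p q Z) := matchedLift _ isBalanced_stTensor

theorem stMap_tm {α β γ : ℂ} {a b : Ell p q Z} (ha : a ∈ grading p q Z α β)
    (hb : b ∈ grading p q Z β γ) :
    stMap p q Z (tm a b) = ConjMod.of (tm (st p q Z a) (st p q Z b)) := matchedLift_tm _ _ ha hb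

/-- An additive endomorphism as an additive endomorphism of the conjugate space. -/
def ConjMod.map {V : Type*} [AddCommGroup V] [Module ℂ V] (φ : V →ₗ[ℂ] V) :
    ConjMod V →+ ConjMod V := φ.toAddMonoidHom

theorem ConjMod.map_of {V : Type*} [AddCommGroup V] [Module ℂ V] (φ : V →ₗ[ℂ] V) (v : V) :
    ConjMod.map φ (ConjMod.of v) = ConjMod.of (φ v) := rfl

/-- The same comparison on generators, with right multiplication by ∑ g_{(1)}^* ⊗ g_{(2)}^*. The
target carries conjugated scalars, which makes the two maps linear. -/
theorem stMap_comul (a : Ell p q Z) :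
    stMap p q Z (comul p q Z a) = ConjMod.of (comul p q Z (st p q Z a)) := by
  refine induction_homogeneous (motive := fun a => stMap p q Z (comul p q Z a) =
    ConjMod.of (comul p q Z (st p q Z a))) a (fun a b ha hb => by simp only [map_add, ha, hb])
    fun α β a ha => ?_
  refine map_comul_eq (stMap p q Z) (fun α =>
    { toFun := fun a => ConjMod.of (comul p q Z (st p q Z a))
      map_add' := fun a b => by simp only [map_add]
      map_smul' := fun c a => by
        rw [st_smul, map_smul, RingHom.id_apply, ConjMod.smul_of] }) ?_
    (fun f α => ⟨ConjMod.map (rmul _ _ (muL p q Z (Mero.bar f)) 1),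
      fun β γ u hu v hv => ?_, fun a => ?_⟩)
    (fun f α => ⟨ConjMod.map (rmul _ _ 1 (muR p q Z (Mero.bar f))),
      fun β γ u hu v hv => ?_, fun a => ?_⟩)
    (fun i j z α => ⟨ConjMod.map (∑ x, rmul _ _ (starL p q Z i x z) (starL p q Z x j z)),
      fun β γ u hu v hv => ?_, fun a => ?_⟩)
    (fun z α => ⟨ConjMod.map (rmul _ _ (detInv p q Z (Z.down (Z.refl z)))
      (detInv p q Z (Z.down (Z.refl z)))), fun β γ u hu v hv => ?_, fun a => ?_⟩) ha
  · rw [stMap_tm one_mem_grading one_mem_grading]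
    exact congrArg ConjMod.of (by rw [st_one, comul_one])
  · rw [stMap_tm (muL_mul_mem hu f) hv, stMap_tm hu hv, st_mul, st_muL, ConjMod.map_of, rmul_btmul,
      mul_one]
  · refine congrArg ConjMod.of ?_
    rw [st_mul, st_muL]
    exact comul_mul_tm (comul_muL _)
  · rw [stMap_tm hu (muR_mul_mem hv f), stMap_tm hu hv, st_mul, st_muR, ConjMod.map_of, rmul_btmul,
      mul_one]
  · refine congrArg ConjMod.of ?_
    rw [st_mul, st_muR]
    exact comul_mul_tm (comul_muR _)
  · rw [stMap_tm hu hv, ConjMod.map_of, LinearMap.sum_apply, map_sum]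
    refine Finset.sum_congr rfl fun x _ => ?_
    rw [stMap_tm (mul_mem_grading (L_mem i x z) hu) (mul_mem_grading (L_mem x j z) hv),
      st_mul, st_L, st_mul, st_L, rmul_btmul]
  · refine congrArg ConjMod.of ?_
    rw [st_mul, st_L]
    exact (comul_mul_of_eq (comul_starL i j z) _).trans (LinearMap.sum_apply ..).symm
  · rw [stMap_tm (detInv_mul_mem hu z) (detInv_mul_mem hv z), stMap_tm hu hv, st_mul, st_mul,
      st_detInv, ConjMod.map_of, rmul_btmul]
  · refine congrArg ConjMod.of ?_
    rw [st_mul, st_detInv]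
    exact comul_mul_tm (comul_detInv _)

end Ell

end EllipticU2

namespace EllipticU2

/-! ### The co-opposite bialgebroid -/

theorem DiffOp.HasDeg.symm {α β : ℂ} {x : DiffOp} (h : DiffOp.HasDeg α β x) :
    DiffOp.HasDeg β α x := by
  obtain ⟨f, rfl, hf⟩ := h
  by_cases e : α = β
  · exact ⟨f, by rw [e], fun h => absurd e.symm h⟩
  · exact ⟨0, by rw [hf e, term_zero, term_zero], fun _ => rfl⟩

theorem list_sum_comm {α β G : Type*} [AddCommMonoid G] (s : List α) (t : List β) (g : α → β → G) :
    (s.map fun x => (t.map fun y => g x y).sum).sum =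
      (t.map fun y => (s.map fun x => g x y).sum).sum := by
  induction s with
  | nil => simp
  | cons a s ih => simp only [List.map_cons, List.sum_cons, ih, List.sum_map_add]

section Flip

variable {A : Type*} [Ring A] [Algebra ℂ A] {μl μr : Mero →ₐ[ℂ] A}

theorem flipTensor_flipTensor (t : BalTensor μl μr) :
    flipTensor μr μl (flipTensor μl μr t) = t := by
  induction t using bt_induction with
  | btmul a b => rfl
  | add s t hs ht => rw [map_add, map_add, hs, ht]

variable (μl μr) in
/-- The map `a ⊗ b ⊗ c ↦ c ⊗ b ⊗ a`. -/
def flipTensor₃ : BalTensor₃ μl μr →ₗ[ℂ] BalTensor₃ μr μl :=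
  btLift₃ (LinearMap.mk₂ ℂ (fun a b => ((btmul₃ₗ μr μl).flip b).flip a)
    (fun a a' b => by ext; simp) (fun c a b => by ext; simp) (fun a b b' => by ext; simp)
    (fun c a b => by ext; simp))
    (fun f a b c => (btmul₃_muR_right (μl := μr) (μr := μl) f c b a).symm)
    (fun f a b c => (btmul₃_muR_left (μl := μr) (μr := μl) f c b a).symm)

@[simp] theorem flipTensor₃_btmul₃ (a b c : A) :
    flipTensor₃ μl μr (btmul₃ μl μr a b c) = btmul₃ μr μl c b a := btLift₃_btmul₃ ..

end Flip

namespace HopfStarData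

variable {A : Type*} [Ring A] [Algebra ℂ A] {H : HopfStarData A}

/-- Interchange of the legs of a Sweedler term. -/
def swapLegs (t : ℂ × A × A) : ℂ × A × A := (t.1, t.2.2, t.2.1)

/-- A Sweedler sum is the value of one additive map at Δ(a), independent of the presentation. The
map need be known only on the terms that occur, whose degrees are matched. -/
theorem IsSweedler.map_sum {a : A} {s : List (ℂ × A × A)} (h : H.IsSweedler a s) {G : Type*}
    [AddCommGroup G] (φ : BalTensor H.μl H.μr →+ G) (g : ℂ × A × A → G)
    (hg : ∀ t ∈ s, φ (btmul H.μl H.μr t.2.1 t.2.2) = g t) : (s.map g).sum = φ (H.Δ a) := by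
  rw [h.2, map_list_sum, List.map_map]
  exact congrArg List.sum (List.map_congr_left fun t ht => (hg t ht).symm)

theorem IsSweedler.of_cop {a : A} {s : List (ℂ × A × A)} (h : H.cop.IsSweedler a s) :
    H.IsSweedler a (s.map swapLegs) := by
  refine ⟨fun t ht => ?_, ?_⟩
  · obtain ⟨t, hs, rfl⟩ := List.mem_map.1 ht
    exact ⟨(h.1 t hs).2, (h.1 t hs).1⟩
  · have h2 : flipTensor H.μl H.μr (H.Δ a) =
        (s.map fun t => btmul H.μr H.μl t.2.1 t.2.2).sum := h.2
    rw [← flipTensor_flipTensor (H.Δ a), h2, map_list_sum, List.map_map, List.map_map]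
    rfl

theorem IsHAlgebra.cop (h : H.IsHAlgebra) : H.cop.IsHAlgebra where
  decomp := by
    have h1 := (DirectSum.isInternal_submodule_iff_iSupIndep_and_iSup_eq_top _).1 h.decomp
    refine (DirectSum.isInternal_submodule_iff_iSupIndep_and_iSup_eq_top _).2
      ⟨h1.1.comp (Equiv.prodComm ℂ ℂ).injective, ?_⟩
    rw [← h1.2]
    exact (Equiv.prodComm ℂ ℂ).iSup_comp (g := fun i : ℂ × ℂ => H.gr i.1 i.2)
  one_mem := h.one_mem
  mul_mem ha hb := h.mul_mem ha hb
  μl_mem := h.μr_mem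
  μr_mem := h.μl_mem
  μl_inj := h.μr_inj
  μr_inj := h.μl_inj
  μl_μr f g := (h.μl_μr g f).symm
  μl_mul ha f := h.μr_mul ha f
  μr_mul ha f := h.μl_mul ha f

theorem IsBialgebroid.cop (h : H.IsBialgebroid) : H.cop.IsBialgebroid where
  toIsHAlgebra := h.toIsHAlgebra.cop
  Δ_mem {α β a} ha := by
    have e := Submodule.mem_map_of_mem (f := flipTensor H.μl H.μr) (h.Δ_mem ha)
    rw [Submodule.map_span] at e
    refine Submodule.span_mono ?_ e
    rintro _ ⟨_, ⟨γ, b, c, hb, hc, rfl⟩, rfl⟩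
    exact ⟨γ, c, b, hc, hb, rfl⟩
  Δ_μl f := congrArg (flipTensor H.μl H.μr) (h.Δ_μr f)
  Δ_μr f := congrArg (flipTensor H.μl H.μr) (h.Δ_μl f)
  Δ_one := congrArg (flipTensor H.μl H.μr) h.Δ_one
  Δ_mul a b s t hs ht := by
    have e := congrArg (flipTensor H.μl H.μr) (h.Δ_mul a b _ _ hs.of_cop ht.of_cop)
    simp only [map_list_sum, List.map_map, Function.comp_def] at e
    exact e
  ε_mem ha := (h.ε_mem ha).symm
  ε_μl := h.ε_μr
  ε_μr := h.ε_μl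
  ε_one := h.ε_one
  ε_mul := h.ε_mul
  coassoc a s u v hs hu hv := by
    have e := congrArg (flipTensor₃ H.μl H.μr) (h.coassoc a (s.map swapLegs)
      (fun x => (v (swapLegs x)).map swapLegs) (fun x => (u (swapLegs x)).map swapLegs) hs.of_cop
      (fun x hx => by
        obtain ⟨y, hy, rfl⟩ := List.mem_map.1 hx
        exact (hv y hy).of_cop)
      (fun x hx => by
        obtain ⟨y, hy, rfl⟩ := List.mem_map.1 hx
        exact (hu y hy).of_cop))
    simp only [map_list_sum, List.map_map, Function.comp_def, flipTensor₃_btmul₃] at e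
    exact e.symm
  counit_left a s hs := by
    have e := h.counit_right a _ hs.of_cop
    rwa [List.map_map] at e
  counit_right a s hs := by
    have e := h.counit_left a _ hs.of_cop
    rwa [List.map_map] at e

end HopfStarData

/-! ### The `𝔥`-Hopf `*`-algebroid `ℰ` -/

namespace Ell

variable {p q : ℝ} [GoodParams p q] {Z : SpectralSet q}

local notation "tm" => btmul (muL p q Z) (muR p q Z)

variable (p q Z) in
/-- The structure of `ℰ`. -/
def hopf : HopfStarData (Ell p q Z) where
  gr := grading p q Z
  μl := muL p q Z
  μr := muR p q Z
  Δ := comul p q Z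
  ε := (counit p q Z).toLinearMap
  S := antiEquiv p q Z
  st := st p q Z

theorem hopf_isStandard : IsStandard p q Z (hopf p q Z) where
  gr_eq := rfl
  μl_eq := rfl
  μr_eq := rfl
  Δ_L := comul_L
  Δ_detInv := comul_detInv
  ε_L := counit_L
  ε_detInv := counit_detInv
  S_al z := (anti_L 0 0 z).trans (by rw [antiL, sg_zero, mul_one, one_smul]; rfl)
  S_be z := (anti_L 0 1 z).trans (by rw [antiL, sg_zero, sg_one, one_mul, neg_one_smul]; rfl)
  S_ga z := (anti_L 1 0 z).trans (by rw [antiL, sg_zero, sg_one, mul_one, neg_one_smul]; rfl)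
  S_de z := (anti_L 1 1 z).trans (by
    rw [antiL, sg_one, neg_mul_neg, one_mul, one_smul]; rfl)
  S_detInv := anti_detInv
  st_al z := (st_L 0 0 z).trans (by rw [starL, sg_zero, mul_one, one_smul]; rfl)
  st_be z := (st_L 0 1 z).trans (by rw [starL, sg_zero, sg_one, one_mul, neg_one_smul]; rfl)
  st_ga z := (st_L 1 0 z).trans (by rw [starL, sg_zero, sg_one, mul_one, neg_one_smul]; rfl)
  st_de z := (st_L 1 1 z).trans (by rw [starL, sg_one, neg_mul_neg, one_mul, one_smul]; rfl)
  st_detInv := st_detInv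

theorem hopf_isHAlgebra : (hopf p q Z).IsHAlgebra where
  decomp := isInternal_grading
  one_mem := one_mem_grading
  mul_mem := mul_mem_grading
  μl_mem := muL_mem
  μr_mem := muR_mem
  μl_inj := muL_injective
  μr_inj := muR_injective
  μl_μr := muL_muR
  μl_mul := muL_mul_of_mem
  μr_mul := muR_mul_of_mem

theorem hopf_isBialgebroid : (hopf p q Z).IsBialgebroid where
  toIsHAlgebra := hopf_isHAlgebra
  Δ_mem := comul_mem
  Δ_μl := comul_muL
  Δ_μr := comul_muR
  Δ_one := comul_one
  Δ_mul a b s t hs ht := by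
    -- Expanding Δ(b) turns the action of a into right multiplications of Δ(a), to which the
    -- expansion of Δ(a) applies.
    have h : comul p q Z (a * b) = (t.map fun y => rmul _ _ y.2.1 y.2.2 (comul p q Z a)).sum := by
      refine Eq.symm ((ht.map_sum (comulAct p q Z a).toAddMonoidHom _ fun y _ => ?_).trans
        (comul_mul a b).symm)
      exact comulAct_tm a y.2.1 y.2.2
    have h' : (t.map fun y => rmul _ _ y.2.1 y.2.2 (comul p q Z a)) =
        t.map fun y => (s.map fun x => tm (x.2.1 * y.2.1) (x.2.2 * y.2.2)).sum :=
      List.map_congr_left fun y _ =>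
        (hs.map_sum (rmul (muL p q Z) (muR p q Z) y.2.1 y.2.2).toAddMonoidHom _
          fun x _ => rmul_btmul y.2.1 y.2.2 x.2.1 x.2.2).symm
    refine h.trans ?_
    rw [h']
    exact list_sum_comm t s (fun y x => tm (x.2.1 * y.2.1) (x.2.2 * y.2.2))
  ε_mem := counit_mem
  ε_μl := counit_muL
  ε_μr := counit_muR
  ε_one := map_one (counit p q Z)
  ε_mul := map_mul (counit p q Z)
  coassoc a s u v hs hu hv := by
    refine Eq.trans (hs.map_sum (comulLeft p q Z).toAddMonoidHom _ fun x hx => ?_)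
      ((comul_coassoc a).trans
        (hs.map_sum (comulRight p q Z).toAddMonoidHom _ fun x hx => ?_).symm)
    · exact (comulLeft_tm x.2.1 x.2.2).trans ((hu x hx).map_sum
        (tensorRight (muL p q Z) (muR p q Z) x.2.2).toAddMonoidHom _ fun y _ => rfl).symm
    · exact (comulRight_tm x.2.1 x.2.2).trans ((hv x hx).map_sum
        (tensorLeft (muL p q Z) (muR p q Z) x.2.1).toAddMonoidHom _ fun y _ => rfl).symm
  counit_left a s hs := (hs.map_sum (counitLeft p q Z).toAddMonoidHom _
    fun x _ => counitLeft_tm x.2.1 x.2.2).trans (counitLeft_comul a)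
  counit_right a s hs := (hs.map_sum (counitRight p q Z).toAddMonoidHom _
    fun x _ => counitRight_tm x.2.1 x.2.2).trans (counitRight_comul a)

theorem hopf_isHopfAlgebroid : (hopf p q Z).IsHopfAlgebroid where
  toIsBialgebroid := hopf_isBialgebroid
  S_μr f a := (anti_mul _ _).trans (congrArg (anti p q Z a * ·) (anti_muR f))
  S_μl f a := (anti_mul _ _).trans (congrArg (· * anti p q Z a) (anti_muL f))
  S_right a s hs := (hs.map_sum (antiRight p q Z).toAddMonoidHom _ fun x hx => by
    obtain ⟨⟨γ, h1⟩, δ, h2⟩ := hs.1 x hx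
    exact antiRight_tm h1 h2).trans (antiRight_comul a)
  S_left ha s hs := (hs.map_sum (antiLeft p q Z).toAddMonoidHom _
    fun x _ => antiLeft_tm x.2.1 x.2.2).trans (antiLeft_comul ha)

theorem hopf_isHopfStarAlgebroid : (hopf p q Z).IsHopfStarAlgebroid where
  toIsHopfAlgebroid := hopf_isHopfAlgebroid
  st_add := map_add (st p q Z)
  st_smul := st_smul
  st_mul := st_mul
  st_st := st_st
  st_μl := st_muL
  st_μr := st_muR
  Δ_st a s hs := ((hs.map_sum (stMap p q Z).toAddMonoidHom _ fun x hx => by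
    obtain ⟨⟨γ, h1⟩, δ, h2⟩ := hs.1 x hx
    exact stMap_tm h1 h2).trans (stMap_comul a)).symm
  ε_st := counit_st

theorem antipode_symm_mul (a b : Ell p q Z) :
    (antiEquiv p q Z).symm (a * b) = (antiEquiv p q Z).symm b * (antiEquiv p q Z).symm a := by
  simp only [antiEquiv_symm_apply, st_mul, anti_mul]

theorem antipode_symm_muL (f : Mero) :
    (antiEquiv p q Z).symm (muL p q Z f) = muR p q Z f := by
  rw [antiEquiv_symm_apply, st_muL, anti_muL, st_muR, Mero.bar_bar]

theorem antipode_symm_muR (f : Mero) :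
    (antiEquiv p q Z).symm (muR p q Z f) = muL p q Z f := by
  rw [antiEquiv_symm_apply, st_muR, anti_muR, st_muL, Mero.bar_bar]

theorem eps0_st {α β : ℂ} {a : Ell p q Z} (ha : a ∈ grading p q Z α β) :
    eps0 p q Z (st p q Z a) = Mero.shift (conj α) (Mero.bar (eps0 p q Z a)) := by
  rw [eps0_apply, counit_st, (counit_mem ha).eq_term, DiffOp.star_term, DiffOp.applyOne_term,
    map_neg, neg_neg, ← eps0_apply]

theorem st_antiLeft_comul_st (a : Ell p q Z) :
    st p q Z (antiLeft p q Z (comul p q Z (st p q Z a))) = muR p q Z (eps0 p q Z a) := by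
  refine induction_homogeneous (motive := fun a => st p q Z (antiLeft p q Z (comul p q Z
    (st p q Z a))) = muR p q Z (eps0 p q Z a)) a
    (fun a b ha hb => by simp only [map_add, ha, hb]) fun α β a ha => ?_
  rw [antiLeft_comul (st_mem ha), st_muR, eps0_st ha, Mero.shift_shift]
  simp [Mero.shift_zero, Mero.bar_bar]

theorem st_antiRight_comul_st {α β : ℂ} {a : Ell p q Z} (ha : a ∈ grading p q Z α β) :
    st p q Z (antiRight p q Z (comul p q Z (st p q Z a))) =
      muL p q Z (Mero.shift β (eps0 p q Z a)) := by
  rw [antiRight_comul, st_muL, eps0_st ha, Mero.bar_shift, Complex.conj_conj, Mero.bar_bar]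
  -- The computation gives a shift by the left degree α, while the co-opposite requires β; for α ≠ β
  -- the counit vanishes.
  by_cases h : α = β
  · rw [h]
  · rw [eps0_apply, (counit_mem ha).applyOne_eq_zero h, map_zero, map_zero, map_zero, map_zero]

/-- Because S^{-1} = *∘S∘*, the sum ∑ a_{(2)} S^{-1}(a_{(1)}) is the star of ∑ S(a_{(1)}^*)
a_{(2)}^*, which the antipode axiom for a^* evaluates; likewise for the other axiom. -/
theorem hopf_cop_isHopfAlgebroid : (hopf p q Z).cop.IsHopfAlgebroid where
  toIsBialgebroid := hopf_isBialgebroid.cop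
  S_μr f a := (antipode_symm_mul _ _).trans
    (congrArg ((antiEquiv p q Z).symm a * ·) (antipode_symm_muL f))
  S_μl f a := (antipode_symm_mul _ _).trans
    (congrArg (· * (antiEquiv p q Z).symm a) (antipode_symm_muR f))
  S_right a s hs := by
    have hs' := hs.of_cop
    have h := hs'.map_sum ((st p q Z).comp ((antiLeft p q Z).toAddMonoidHom.comp
      (ConjMod.of.symm.toAddMonoidHom.comp (stMap p q Z).toAddMonoidHom)))
      (fun t => t.2.2 * (antiEquiv p q Z).symm t.2.1) (fun t ht => by
        obtain ⟨⟨γ, h1⟩, δ, h2⟩ := hs'.1 t ht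
        show st p q Z (antiLeft p q Z (ConjMod.of.symm (stMap p q Z (tm t.2.1 t.2.2)))) = _
        rw [stMap_tm h1 h2, AddEquiv.symm_apply_apply, antiLeft_tm, st_mul, st_st,
          antiEquiv_symm_apply])
    rw [List.map_map] at h
    refine h.trans ?_
    show st p q Z (antiLeft p q Z (ConjMod.of.symm (stMap p q Z (comul p q Z a)))) = _
    rw [stMap_comul, AddEquiv.symm_apply_apply, st_antiLeft_comul_st]
    rfl
  S_left {α β a} ha s hs := by
    have hs' := hs.of_cop
    have h := hs'.map_sum ((st p q Z).comp ((antiRight p q Z).toAddMonoidHom.comp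
      (ConjMod.of.symm.toAddMonoidHom.comp (stMap p q Z).toAddMonoidHom)))
      (fun t => (antiEquiv p q Z).symm t.2.2 * t.2.1) (fun t ht => by
        obtain ⟨⟨γ, h1⟩, δ, h2⟩ := hs'.1 t ht
        show st p q Z (antiRight p q Z (ConjMod.of.symm (stMap p q Z (tm t.2.1 t.2.2)))) = _
        rw [stMap_tm h1 h2, AddEquiv.symm_apply_apply, antiRight_tm (st_mem h1) (st_mem h2),
          st_mul, st_st, antiEquiv_symm_apply])
    rw [List.map_map] at h
    refine h.trans ?_
    show st p q Z (antiRight p q Z (ConjMod.of.symm (stMap p q Z (comul p q Z a)))) = _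
    rw [stMap_comul, AddEquiv.symm_apply_apply, st_antiRight_comul_st (α := β) (β := α) ha]
    rfl

theorem hopf_cop_isHopfStarAlgebroid : (hopf p q Z).cop.IsHopfStarAlgebroid where
  toIsHopfAlgebroid := hopf_cop_isHopfAlgebroid
  st_add := map_add (st p q Z)
  st_smul := st_smul
  st_mul := st_mul
  st_st := st_st
  st_μl := st_muR
  st_μr := st_muL
  Δ_st a s hs := by
    have h := congrArg (flipTensor (hopf p q Z).μl (hopf p q Z).μr)
      (hopf_isHopfStarAlgebroid.Δ_st a _ hs.of_cop)
    refine h.trans ((map_list_sum _ _).trans ?_)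
    rw [List.map_map, List.map_map]
    rfl
  ε_st := counit_st

end Ell

end EllipticU2

namespace EllipticU2

/-! ### The vector representations of `ℰ` -/

section Diagonal

open Filter

variable (p q : ℝ) [GoodParams p q]

theorem bM_mul_rM_zero_one {x : ℂ} (hx : x ≠ 0) :
    bM p q 1 * rM p q x 0 1 0 1 = ((q : ℂ) * theta p x) • bM p q 2 := by
  have hq := q_ne_zero p q
  rw [bM, rM, Mero.of_mul (meromorphic_brk 1) (meromorphic_ellRnum hx 0 1 0 1), Algebra.smul_def,
    ← Mero.of_const, bM, Mero.of_mul (Meromorphic.const _) (meromorphic_brk 2)]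
  refine Mero.of_congr ((meromorphic_brk 1).fun_mul (meromorphic_ellRnum hx 0 1 0 1)) ?_
  filter_upwards [eventually_brk_ne_zero (p := p) (q := q) 1] with l hl
  have h1 := q_cpow_ne_zero p q (l + 1)
  show brk p q (l + 1) * (theta p x * theta p ((q : ℂ) ^ (2 * (l + 2))) /
    theta p ((q : ℂ) ^ (2 * (l + 1)))) = _
  rw [theta_cpow, theta_cpow, show l + 2 = l + 1 + 1 by ring, Complex.cpow_add _ _ hq,
    Complex.cpow_one]
  field_simp

theorem bM_mul_rM_one_zero {x : ℂ} (hx : x ≠ 0) :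
    bM p q 1 * rM p q x 1 0 1 0 = ((q : ℂ) * theta p x) • bM p q 0 := by
  have hq := q_ne_zero p q
  rw [bM, rM, Mero.of_mul (meromorphic_brk 1) (meromorphic_ellRnum hx 1 0 1 0), Algebra.smul_def,
    ← Mero.of_const, bM, Mero.of_mul (Meromorphic.const _) (meromorphic_brk 0)]
  refine Mero.of_congr ((meromorphic_brk 1).fun_mul (meromorphic_ellRnum hx 1 0 1 0)) ?_
  filter_upwards [eventually_brk_ne_zero (p := p) (q := q) 1] with l hl
  have h1 := q_cpow_ne_zero p q (-(l + 1))
  show brk p q (l + 1) * (theta p x * theta p ((q : ℂ) ^ (-2 * l)) /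
    theta p ((q : ℂ) ^ (-2 * (l + 1)))) = _
  rw [show -2 * l = 2 * -l by ring, show -2 * (l + 1) = 2 * -(l + 1) by ring, theta_cpow, theta_cpow,
    brk_neg', brk_neg', show -l = -(l + 1) + 1 by ring, Complex.cpow_add _ _ hq, Complex.cpow_one,
    add_zero]
  field_simp

/-- This diagonal entry is a scalar times the ratio of F at λ + 1 and λ. Gauging by F thus reduces
the action of determinants to scalars. -/
theorem FM_mul_rM_zero_one {x : ℂ} (hx : x ≠ 0) :
    FM p q * rM p q x 0 1 0 1 = ((q : ℂ) * theta p x) • Mero.shift 1 (FM p q) := by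
  rw [FM_eq, smul_mul_assoc, bM_mul_rM_zero_one p q hx, ← FM_eq, shift_FM, smul_comm]
  norm_num

theorem FM_mul_rM_one_zero {x : ℂ} (hx : x ≠ 0) :
    FM p q * rM p q x 1 0 1 0 = ((q : ℂ) * theta p x) • Mero.shift (-1) (FM p q) := by
  rw [FM_eq, smul_mul_assoc, bM_mul_rM_one_zero p q hx, ← FM_eq, shift_FM, smul_comm]
  norm_num

theorem rM_zero_zero (x : ℂ) : rM p q x 0 0 0 0 = algebraMap ℂ Mero (theta p ((q : ℂ) ^ 2 * x)) :=
  Mero.of_const _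

theorem rM_one_one (x : ℂ) : rM p q x 1 1 1 1 = algebraMap ℂ Mero (theta p ((q : ℂ) ^ 2 * x)) :=
  Mero.of_const _

/-- The matrix elements of the R-matrix as meromorphic functions of the dynamical variable. -/
def RM (p q : ℝ) (x : ℂ) (a b i j : Fin 2) : Mero :=
  (theta p ((q : ℂ) ^ 2 * x))⁻¹ • rM p q x a b i j

theorem RM_eq_zero {p q : ℝ} {x : ℂ} {a b i j : Fin 2} (h : wt a + wt b ≠ wt i + wt j) :
    RM p q x a b i j = 0 := by rw [RM, rM_eq_zero h, smul_zero]

theorem of_ellR {x : ℂ} (hx : x ≠ 0) (a b i j : Fin 2) :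
    (Mero.of fun t => ellR p q t x a b i j) = RM p q x a b i j := by
  rw [RM, rM, Algebra.smul_def, ← Mero.of_const,
    Mero.of_mul (Meromorphic.const _) (meromorphic_ellRnum hx a b i j)]
  exact congrArg Mero.of (funext fun t => by rw [ellR, div_eq_inv_mul])

/-- The Yang–Baxter equation for the normalized R-matrix. -/
theorem RM_yangBaxter {z w : ℂ} (hz : z ≠ 0) (hw : w ≠ 0) (i j m n r s : Fin 2) :
    ∑ x, ∑ y, ∑ k, rM p q z x y i m * (RM p q w s j k x *
      Mero.shift (-wt x) (RM p q (w * z) k n r y)) =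
    ∑ x, ∑ y, ∑ k, Mero.shift (-wt s) (rM p q z j n x y) * (RM p q (w * z) s y k m *
      Mero.shift (-wt m) (RM p q w k x r i)) := by
  have h := congrArg (((theta p ((q : ℂ) ^ 2 * w))⁻¹ * (theta p ((q : ℂ) ^ 2 * (w * z)))⁻¹) • ·)
    (rM_yangBaxter (p := p) (q := q) hz hw i j m n r s)
  simp only [Finset.smul_sum] at h
  refine Eq.trans ?_ (h.trans ?_) <;>
  · refine Finset.sum_congr rfl fun x _ => Finset.sum_congr rfl fun y _ =>
      Finset.sum_congr rfl fun k _ => ?_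
    simp only [RM, Mero.shift_smul, smul_mul_assoc, mul_smul_comm, smul_smul, mul_assoc]
    try rw [mul_comm (theta p ((q : ℂ) ^ 2 * w))⁻¹]

/-- A variant of the Yang–Baxter equation. -/
theorem RM_yangBaxter' {z w : ℂ} (hz : z ≠ 0) (hw : w ≠ 0) (i j m n r s : Fin 2) :
    ∑ x, ∑ y, ∑ k, rM p q w s j k x * (RM p q z x y i m *
      Mero.shift (-wt x) (RM p q (w * z) k n r y)) =
    ∑ x, ∑ y, ∑ k, Mero.shift (-wt m) (rM p q w k x r i) * (RM p q (w * z) s y k m *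
      Mero.shift (-wt s) (RM p q z j n x y)) := by
  have h := congrArg (((theta p ((q : ℂ) ^ 2 * z))⁻¹ * (theta p ((q : ℂ) ^ 2 * (w * z)))⁻¹) • ·)
    (rM_yangBaxter (p := p) (q := q) hz hw i j m n r s)
  simp only [Finset.smul_sum] at h
  refine Eq.trans ?_ (h.trans ?_)
  · refine Finset.sum_congr rfl fun x _ => Finset.sum_congr rfl fun y _ =>
      Finset.sum_congr rfl fun k _ => ?_
    simp only [RM, Mero.shift_smul, smul_mul_assoc, mul_smul_comm, smul_smul]
    rw [mul_comm (theta p ((q : ℂ) ^ 2 * (w * z)))⁻¹]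
    congr 1; ring
  · refine Finset.sum_congr rfl fun x _ => Finset.sum_congr rfl fun y _ =>
      Finset.sum_congr rfl fun k _ => ?_
    simp only [RM, Mero.shift_smul, smul_mul_assoc, mul_smul_comm, smul_smul]
    congr 1
    ring

end Diagonal

/-- The assumption on the spectral parameters under which the pairing exists. -/
class Separated (p : ℝ) {q : ℝ} (W Z : SpectralSet q) : Prop where
  ne : ∀ w ∈ W.carrier, ∀ z ∈ Z.carrier, ∀ k m : ℤ, w ≠ (q : ℂ) ^ (2 * k) * (p : ℂ) ^ m * z

section Separated

variable (p : ℝ) {q : ℝ} [GoodParams p q] {W Z : SpectralSet q} [Separated p W Z]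

theorem spectral_div_ne_zero (w : W.carrier) (z : Z.carrier) : (w / z : ℂ) ≠ 0 :=
  div_ne_zero (SpectralSet.coe_ne_zero w) (SpectralSet.coe_ne_zero z)

theorem theta_div_ne_zero (w : W.carrier) (z : Z.carrier) : theta p (w / z : ℂ) ≠ 0 := by
  refine theta_ne_zero (GoodParams.p_pos (p := p) (q := q)) (GoodParams.p_lt_one (p := p) (q := q))
    (spectral_div_ne_zero w z) fun m h => Separated.ne (p := p) w.1 w.2 z.1 z.2 0 m ?_
  rw [mul_zero, zpow_zero, one_mul, ← h, div_mul_cancel₀ _ (SpectralSet.coe_ne_zero z)]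

theorem up_div (w : W.carrier) (z : Z.carrier) : (W.up w / z : ℂ) = (q : ℂ) ^ 2 * (w / z) :=
  mul_div_assoc _ _ _

theorem div_up' (w : W.carrier) (z : Z.carrier) :
    (w / Z.up z : ℂ) = ((q : ℂ) ^ 2)⁻¹ * (w / z) := by
  show (w : ℂ) / ((q : ℂ) ^ 2 * z) = _
  rw [div_mul_eq_div_div_swap, div_eq_inv_mul]

theorem theta_up_div_ne_zero (w : W.carrier) (z : Z.carrier) :
    theta p ((q : ℂ) ^ 2 * (w / z)) ≠ 0 := by
  rw [← up_div]; exact theta_div_ne_zero p _ _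

end Separated

/-- The automorphism `T_α` as an algebra homomorphism. -/
def Mero.shiftₐ (α : ℂ) : Mero →ₐ[ℂ] Mero :=
  { Mero.shift α with commutes' := fun c => Mero.shift_algebraMap α c }

theorem Mero.shiftₐ_apply (α : ℂ) (f : Mero) : Mero.shiftₐ α f = Mero.shift α f := rfl

namespace Ell

variable {p q : ℝ} [GoodParams p q] {W Z : SpectralSet q}

theorem L_mul_muR (k u : Fin 2) (z : Z.carrier) (f : Mero) :
    L p q Z k u z * muR p q Z f = muR p q Z (Mero.shift (-wt u) f) * L p q Z k u z := by
  rw [muR_L, Mero.shift_shift, add_neg_cancel, Mero.shift_zero]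

theorem sum_muR_L_mul (k m : Fin 2) (z z' : Z.carrier) (f g : Fin 2 → Mero) :
    (∑ u, muR p q Z (f u) * L p q Z k u z) * ∑ v, muR p q Z (g v) * L p q Z m v z' =
      ∑ u, ∑ v, muR p q Z (f u * Mero.shift (-wt u) (g v)) * (L p q Z k u z * L p q Z m v z') := by
  rw [Finset.sum_mul_sum]
  refine Finset.sum_congr rfl fun u _ => Finset.sum_congr rfl fun v _ => ?_
  rw [mul_assoc, ← mul_assoc (L p q Z k u z), L_mul_muR, map_mul]
  simp only [mul_assoc]

/-- The matrix elements of the coaction on a generator `L`. -/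
def coactL (w : W.carrier) (k l : Fin 2) (z : Z.carrier) (j i : Fin 2) : Ell p q Z :=
  ∑ x, muR p q Z (RM p q (w / z : ℂ) j l i x) * L p q Z k x z

variable (p Z) in
/-- The coaction of `ℰ` on the vector representation, without `det⁻¹`. -/
def coactOps (w : W.carrier) : LOps p q Z (Matrix (Fin 2) (Fin 2) (Ell p q Z)) where
  l := (Matrix.diagonalAlgHom ℂ).comp (AlgHom.pi fun _ => muL p q Z)
  r := (Matrix.diagonalAlgHom ℂ).comp (AlgHom.pi fun j => (muR p q Z).comp (Mero.shiftₐ (-wt j)))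
  L k l z := Matrix.of (coactL w k l z)
  l_r f g := by
    show Matrix.diagonal _ * Matrix.diagonal _ = Matrix.diagonal _ * Matrix.diagonal _
    rw [Matrix.diagonal_mul_diagonal, Matrix.diagonal_mul_diagonal]
    exact congrArg Matrix.diagonal (funext fun j => muL_muR f _)
  l_L f x y z := by
    ext j i
    show (Matrix.diagonal _ * _ : Matrix _ _ _) j i = (_ * Matrix.diagonal _ : Matrix _ _ _) j i
    rw [Matrix.diagonal_mul, Matrix.mul_diagonal]
    show muL p q Z f * coactL w x y z j i = coactL w x y z j i * muL p q Z (Mero.shift (wt x) f)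
    rw [coactL, Finset.mul_sum, Finset.sum_mul]
    refine Finset.sum_congr rfl fun u _ => ?_
    rw [← mul_assoc, muL_muR, mul_assoc, muL_L, mul_assoc]
  r_L f x y z := by
    ext j i
    show (Matrix.diagonal _ * _ : Matrix _ _ _) j i = (_ * Matrix.diagonal _ : Matrix _ _ _) j i
    rw [Matrix.diagonal_mul, Matrix.mul_diagonal]
    show muR p q Z (Mero.shift (-wt j) f) * coactL w x y z j i =
      coactL w x y z j i * muR p q Z (Mero.shift (-wt i) (Mero.shift (wt y) f))
    rw [coactL, Finset.mul_sum, Finset.sum_mul]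
    refine Finset.sum_congr rfl fun u _ => ?_
    rw [mul_assoc, L_mul_muR, Mero.shift_shift, Mero.shift_shift, ← mul_assoc, ← mul_assoc,
      ← map_mul, ← map_mul]
    -- The twist of μ_r by -ω(j) in the diagonal matrices is chosen so that conservation of weight
    -- matches the two shifts.
    by_cases h : wt j + wt y = wt i + wt u
    · rw [mul_comm, show -wt u + -wt i + wt y = -wt j by linear_combination h]
    · rw [RM_eq_zero h, zero_mul, mul_zero]
  RLL a b c d z₁ z₂ := by
    ext j i
    simp only [Matrix.sum_apply]
    have h1 : ∀ f x y, (((Matrix.diagonalAlgHom ℂ).comp (AlgHom.pi fun _ => muL p q Z)) f *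
        (Matrix.of (coactL w x b z₁) * Matrix.of (coactL w y d z₂)) :
          Matrix (Fin 2) (Fin 2) (Ell p q Z)) j i = ∑ s, ∑ u, ∑ v,
        muR p q Z (RM p q (w / z₁ : ℂ) j b s u * Mero.shift (-wt u) (RM p q (w / z₂ : ℂ) s d i v)) *
          (muL p q Z f * (L p q Z x u z₁ * L p q Z y v z₂)) := fun f x y => by
      show (Matrix.diagonal _ * _ : Matrix _ _ _) j i = _
      rw [Matrix.diagonal_mul, Matrix.mul_apply, Finset.mul_sum]
      refine Finset.sum_congr rfl fun s _ => ?_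
      show muL p q Z f * (coactL w x b z₁ j s * coactL w y d z₂ s i) = _
      rw [coactL, coactL, sum_muR_L_mul, Finset.mul_sum]
      refine Finset.sum_congr rfl fun u _ => ?_
      rw [Finset.mul_sum]
      exact Finset.sum_congr rfl fun v _ => by rw [← mul_assoc, muL_muR, mul_assoc]
    have h2 : ∀ f x y, (((Matrix.diagonalAlgHom ℂ).comp (AlgHom.pi fun j =>
        (muR p q Z).comp (Mero.shiftₐ (-wt j)))) f *
        (Matrix.of (coactL w c y z₂) * Matrix.of (coactL w a x z₁)) :
          Matrix (Fin 2) (Fin 2) (Ell p q Z)) j i = ∑ s, ∑ v, ∑ u,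
        muR p q Z (Mero.shift (-wt j) f * (RM p q (w / z₂ : ℂ) j y s v *
          Mero.shift (-wt v) (RM p q (w / z₁ : ℂ) s x i u))) *
          (L p q Z c v z₂ * L p q Z a u z₁) := fun f x y => by
      show (Matrix.diagonal _ * _ : Matrix _ _ _) j i = _
      rw [Matrix.diagonal_mul, Matrix.mul_apply, Finset.mul_sum]
      refine Finset.sum_congr rfl fun s _ => ?_
      show muR p q Z (Mero.shift (-wt j) f) * (coactL w c y z₂ j s * coactL w a x z₁ s i) = _
      rw [coactL, coactL, sum_muR_L_mul, Finset.mul_sum]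
      refine Finset.sum_congr rfl fun u _ => ?_
      rw [Finset.mul_sum]
      exact Finset.sum_congr rfl fun v _ => by rw [← mul_assoc, ← map_mul]
    simp only [h1, h2]
    have h3 := fun u v => (rep p q Z).RLL a u c v z₁ z₂
    change ∀ u v, ∑ x, ∑ y, muL p q Z (rM p q (z₁ / z₂ : ℂ) x y a c) *
      (L p q Z x u z₁ * L p q Z y v z₂) = ∑ x, ∑ y, muR p q Z (rM p q (z₁ / z₂ : ℂ) u v x y) *
      (L p q Z c y z₂ * L p q Z a x z₁) at h3
    have hz : (z₁ / z₂ : ℂ) ≠ 0 := spectral_div_ne_zero z₁ z₂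
    have hw : (w / z₁ : ℂ) ≠ 0 := spectral_div_ne_zero w z₁
    have hwz : (w / z₁ : ℂ) * (z₁ / z₂ : ℂ) = w / z₂ :=
      div_mul_div_cancel₀ (SpectralSet.coe_ne_zero z₁)
    have h4 := fun u v => RM_yangBaxter p q hz hw u b v d i j
    rw [hwz] at h4
    -- The RLL relation of ℰ exchanges the L's, and the Yang–Baxter equation exchanges the resulting
    -- triple products of R-matrix entries.
    calc _ = ∑ s, ∑ u, ∑ v, muR p q Z (RM p q (w / z₁ : ℂ) j b s u *
          Mero.shift (-wt u) (RM p q (w / z₂ : ℂ) s d i v)) *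
          ∑ x, ∑ y, muL p q Z (rM p q (z₁ / z₂ : ℂ) x y a c) *
            (L p q Z x u z₁ * L p q Z y v z₂) := by
          simp only [Fin.sum_univ_two, mul_add]; abel
      _ = ∑ x, ∑ y, muR p q Z (∑ u, ∑ v, ∑ s, rM p q (z₁ / z₂ : ℂ) u v x y *
          (RM p q (w / z₁ : ℂ) j b s u * Mero.shift (-wt u) (RM p q (w / z₂ : ℂ) s d i v))) *
            (L p q Z c y z₂ * L p q Z a x z₁) := by
          simp only [h3, Finset.mul_sum, ← mul_assoc (muR p q Z _) (muR p q Z _), ← map_mul]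
          simp only [Fin.sum_univ_two, map_add, add_mul, mul_comm (rM _ _ _ _ _ _ _)]
          abel
      _ = _ := by
          simp only [h4]
          simp only [Fin.sum_univ_two, map_add, add_mul]
          abel

/-- Multiplying out leaves row minors of ℰ with column indices u, v, and these are multiples of a
single minor by `eps`. -/
theorem coactOps_rowMinor (w : W.carrier) (z : Z.carrier) (b d j i : Fin 2) :
    (coactOps p Z w).rowMinor z b d j i = muR p q Z (∑ s, ∑ u, ∑ v, eps u v •
      (RM p q (w / z : ℂ) j b s u * Mero.shift (-wt u) (RM p q (w / Z.up z : ℂ) s d i v))) *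
        (rep p q Z).rowMinor z 1 0 := by
  have h : ∀ k m, ((coactOps p Z w).L k b z * (coactOps p Z w).L m d (Z.up z)) j i =
      ∑ s, ∑ u, ∑ v, muR p q Z (RM p q (w / z : ℂ) j b s u *
        Mero.shift (-wt u) (RM p q (w / Z.up z : ℂ) s d i v)) *
          (L p q Z k u z * L p q Z m v (Z.up z)) := fun k m => by
    rw [Matrix.mul_apply]
    exact Finset.sum_congr rfl fun s _ => sum_muR_L_mul ..
  rw [LOps.rowMinor, Matrix.sub_apply, h, h]
  simp only [← Finset.sum_sub_distrib, ← mul_sub, map_sum, Finset.sum_mul]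
  refine Finset.sum_congr rfl fun s _ => Finset.sum_congr rfl fun u _ =>
    Finset.sum_congr rfl fun v _ => ?_
  rw [map_smul, smul_mul_assoc, ← mul_smul_comm, ← LOps.rowMinor_eq]
  rfl

variable (p q) in
/-- The factor by which `det⁻¹` acts. -/
def kap (x : ℂ) : ℂ := (q : ℂ)⁻¹ * theta p ((q : ℂ) ^ 2 * x) / theta p x

variable [Separated p W Z]

theorem kap_ne_zero (w : W.carrier) (z : Z.carrier) : kap p q (w / z) ≠ 0 :=
  div_ne_zero (mul_ne_zero (inv_ne_zero (q_ne_zero p q)) (theta_up_div_ne_zero p w z))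
    (theta_div_ne_zero p w z)

theorem RM_zero_zero (w : W.carrier) (z : Z.carrier) : RM p q (w / z) 0 0 0 0 = 1 := by
  rw [RM, rM_zero_zero, Algebra.smul_def, ← map_mul, inv_mul_cancel₀ (theta_up_div_ne_zero p w z),
    map_one]

theorem RM_one_one (w : W.carrier) (z : Z.carrier) : RM p q (w / z) 1 1 1 1 = 1 := by
  rw [RM, rM_one_one, Algebra.smul_def, ← map_mul, inv_mul_cancel₀ (theta_up_div_ne_zero p w z),
    map_one]

theorem FM_mul_RM_zero_one (w : W.carrier) (z : Z.carrier) :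
    FM p q * RM p q (w / z) 0 1 0 1 = (kap p q (w / z))⁻¹ • Mero.shift 1 (FM p q) := by
  rw [RM, mul_smul_comm, FM_mul_rM_zero_one p q (spectral_div_ne_zero w z), smul_smul, kap]
  congr 1
  field_simp

theorem FM_mul_RM_one_zero (w : W.carrier) (z : Z.carrier) :
    FM p q * RM p q (w / z) 1 0 1 0 = (kap p q (w / z))⁻¹ • Mero.shift (-1) (FM p q) := by
  rw [RM, mul_smul_comm, FM_mul_rM_one_zero p q (spectral_div_ne_zero w z), smul_smul, kap]
  congr 1
  field_simp

/-- The determinant may be computed from the (0,1) or the (1,0) minor. Choosing the former in row 0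
and the latter in row 1 brings in the entry R^{00}_{00} = 1 or R^{11}_{11} = 1; conservation of
weight leaves one diagonal entry of the second R-matrix, and F makes it scalar. -/
theorem coactOps_det (w : W.carrier) (z : Z.carrier) : (coactOps p Z w).det z =
    Matrix.diagonal fun _ => (kap p q (w / Z.up z : ℂ))⁻¹ • det p q Z z := by
  have e : ∀ M : Matrix (Fin 2) (Fin 2) (Ell p q Z), ∀ j i,
      ((coactOps p Z w).r (FM p q) * (coactOps p Z w).l (FMi p q) * M) j i =
      muR p q Z (Mero.shift (-wt j) (FM p q)) * (muL p q Z (FMi p q) * M j i) := fun M j i => by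
    show (Matrix.diagonal _ * Matrix.diagonal _ * M : Matrix _ _ _) j i = _
    rw [mul_assoc, Matrix.diagonal_mul, Matrix.diagonal_mul]
    rfl
  have n : ∀ x : ℂ, RM p q x 0 0 0 1 = 0 ∧ RM p q x 0 0 1 0 = 0 ∧ RM p q x 0 0 1 1 = 0 ∧
      RM p q x 1 1 0 0 = 0 ∧ RM p q x 1 1 0 1 = 0 ∧ RM p q x 1 1 1 0 = 0 ∧
      RM p q x 0 1 1 1 = 0 ∧ RM p q x 1 0 0 0 = 0 := fun x => by
    refine ⟨?_, ?_, ?_, ?_, ?_, ?_, ?_, ?_⟩ <;> exact RM_eq_zero (by norm_num [wt])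
  have hr := RM_zero_zero (p := p) w z
  have hr' := RM_one_one (p := p) w z
  obtain ⟨n1, n2, n3, n4, n5, n6, -, -⟩ := n (w / z)
  obtain ⟨-, -, -, -, -, -, m7, m8⟩ := n (w / Z.up z)
  have hd : det p q Z z = muR p q Z (FM p q) * (muL p q Z (FMi p q) *
    (rep p q Z).rowMinor z 1 0) := by
    rw [det_eq, LOps.det_eq_rowMinor, mul_assoc]; rfl
  have k0 := congrArg (Mero.shift (-1)) (FM_mul_RM_zero_one (p := p) w (Z.up z))
  have k1 := congrArg (Mero.shift 1) (FM_mul_RM_one_zero (p := p) w (Z.up z))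
  rw [map_mul, Mero.shift_smul, Mero.shift_shift] at k0 k1
  norm_num [Mero.shift_zero] at k0 k1
  ext j i
  fin_cases j
  · rw [LOps.det_eq_rowMinor, ← neg_neg ((coactOps p Z w).rowMinor z 1 0),
      ← LOps.rowMinor_zero_one]
    show _ = Matrix.diagonal _ 0 i
    refine (e _ 0 i).trans ?_
    rw [Matrix.neg_apply, coactOps_rowMinor]
    simp only [Fin.sum_univ_two, n1, n2, n3, hr, eps_zero_zero, eps_zero_one, zero_mul, zero_smul,
      smul_zero, add_zero, zero_add, one_mul, neg_smul, one_smul, neg_zero]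
    rw [map_neg, neg_mul, neg_neg]
    rw [← mul_assoc (muL p q Z _), muL_muR, mul_assoc, ← mul_assoc, ← map_mul]
    fin_cases i
    · refine (congrArg (muR p q Z · * _) k0).trans ?_
      rw [map_smul, smul_mul_assoc, ← hd]; rfl
    · simp [m7]
  · rw [LOps.det_eq_rowMinor]
    show _ = Matrix.diagonal _ 1 i
    refine (e _ 1 i).trans ?_
    rw [coactOps_rowMinor]
    simp only [Fin.sum_univ_two, n4, n5, n6, hr', eps_one_zero, eps_one_one, zero_mul, zero_smul,
      smul_zero, add_zero, zero_add, one_mul, one_smul]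
    rw [← mul_assoc (muL p q Z _), muL_muR, mul_assoc, ← mul_assoc, ← map_mul]
    fin_cases i
    · simp [m8]
    · refine (congrArg (muR p q Z · * _) (Eq.trans ?_ k1)).trans ?_
      · norm_num [wt]
      rw [map_smul, smul_mul_assoc, ← hd]; rfl

variable (p Z) in
/-- The coaction of `ℰ` on the vector representation. -/
def coactRep (w : W.carrier) : EllRep p q Z (Matrix (Fin 2) (Fin 2) (Ell p q Z)) where
  __ := coactOps p Z w
  dI z := Matrix.diagonal fun _ => kap p q (w / Z.up z : ℂ) • detInv p q Z z
  dI_det z := by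
    rw [coactOps_det, Matrix.diagonal_mul_diagonal, ← Matrix.diagonal_one]
    refine congrArg Matrix.diagonal (funext fun _ => ?_)
    rw [smul_mul_smul_comm, mul_inv_cancel₀ (kap_ne_zero w (Z.up z)), one_smul, detInv_det]
  det_dI z := by
    rw [coactOps_det, Matrix.diagonal_mul_diagonal, ← Matrix.diagonal_one]
    refine congrArg Matrix.diagonal (funext fun _ => ?_)
    rw [smul_mul_smul_comm, inv_mul_cancel₀ (kap_ne_zero w (Z.up z)), one_smul, det_detInv]
  dI_l z f := by
    show _ * Matrix.diagonal _ = Matrix.diagonal _ * _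
    rw [Matrix.diagonal_mul_diagonal, Matrix.diagonal_mul_diagonal]
    exact congrArg Matrix.diagonal (funext fun _ => by
      rw [smul_mul_assoc, mul_smul_comm, detInv_mul_comm])
  dI_r z f := by
    show _ * Matrix.diagonal _ = Matrix.diagonal _ * _
    rw [Matrix.diagonal_mul_diagonal, Matrix.diagonal_mul_diagonal]
    exact congrArg Matrix.diagonal (funext fun _ => by
      rw [smul_mul_assoc, mul_smul_comm, detInv_mul_comm])
  dI_L z x y z' := by
    ext j i
    rw [Matrix.diagonal_mul, Matrix.mul_diagonal, smul_mul_assoc, mul_smul_comm, detInv_mul_comm]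

variable (p Z) in
/-- The coaction of `ℰ` on the vector representation. -/
def coact (w : W.carrier) : Ell p q Z →ₐ[ℂ] Matrix (Fin 2) (Fin 2) (Ell p q Z) :=
  (coactRep p Z w).lift

variable (p Z) in
/-- The action of `L_{ij}(w)` on `ℰ`. -/
def actL (i j : Fin 2) (w : W.carrier) : Module.End ℂ (Ell p q Z) where
  toFun a := coact p Z w a j i
  map_add' a b := by rw [map_add]; rfl
  map_smul' c a := by rw [map_smul]; rfl

theorem actL_apply (i j : Fin 2) (w : W.carrier) (a : Ell p q Z) :
    actL p Z i j w a = coact p Z w a j i := rfl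

theorem actL_mul (i j : Fin 2) (w : W.carrier) (a b : Ell p q Z) :
    actL p Z i j w (a * b) = ∑ s, actL p Z s j w a * actL p Z i s w b := by
  rw [actL_apply, map_mul, Matrix.mul_apply]; rfl

theorem actL_one (i j : Fin 2) (w : W.carrier) :
    actL p Z i j w 1 = if i = j then 1 else 0 := by
  rw [actL_apply, map_one, Matrix.one_apply]; simp only [eq_comm]

theorem actL_muL (i j : Fin 2) (w : W.carrier) (f : Mero) :
    actL p Z i j w (muL p q Z f) = if i = j then muL p q Z f else 0 := by
  rw [actL_apply, coact, EllRep.lift_muL]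
  refine (Matrix.diagonal_apply ..).trans ?_
  simp only [eq_comm]; rfl

theorem actL_muR (i j : Fin 2) (w : W.carrier) (f : Mero) :
    actL p Z i j w (muR p q Z f) = if i = j then muR p q Z (Mero.shift (-wt j) f) else 0 := by
  rw [actL_apply, coact, EllRep.lift_muR]
  refine (Matrix.diagonal_apply ..).trans ?_
  simp only [eq_comm]; rfl

theorem actL_L (i j : Fin 2) (w : W.carrier) (k l : Fin 2) (z : Z.carrier) :
    actL p Z i j w (L p q Z k l z) =
      ∑ x, muR p q Z (RM p q (w / z : ℂ) j l i x) * L p q Z k x z := by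
  rw [actL_apply, coact, EllRep.lift_L]; rfl

theorem actL_detInv (i j : Fin 2) (w : W.carrier) (z : Z.carrier) :
    actL p Z i j w (detInv p q Z z) =
      if i = j then kap p q (w / Z.up z : ℂ) • detInv p q Z z else 0 := by
  rw [actL_apply, coact, EllRep.lift_detInv]
  refine (Matrix.diagonal_apply ..).trans ?_
  simp only [eq_comm]

theorem actL_muL_mul (i j : Fin 2) (w : W.carrier) (f : Mero) (a : Ell p q Z) :
    actL p Z i j w (muL p q Z f * a) = muL p q Z f * actL p Z i j w a := by
  simp [actL_mul, actL_muL]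

theorem actL_muR_mul (i j : Fin 2) (w : W.carrier) (f : Mero) (a : Ell p q Z) :
    actL p Z i j w (muR p q Z f * a) = muR p q Z (Mero.shift (-wt j) f) * actL p Z i j w a := by
  simp [actL_mul, actL_muR]

theorem actL_mul_muR (i j : Fin 2) (w : W.carrier) (f : Mero) (a : Ell p q Z) :
    actL p Z i j w (a * muR p q Z f) = actL p Z i j w a * muR p q Z (Mero.shift (-wt i) f) := by
  simp [actL_mul, actL_muR]

end Ell

end EllipticU2

namespace EllipticU2

/-! ### The action of one elliptic quantum group on another one -/

theorem sum_comm_right {ι κ ν V : Type*} [Fintype ι] [Fintype κ] [Fintype ν] [AddCommMonoid V]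
    (g : ι → κ → ν → V) : ∑ x, ∑ y, ∑ v, g x y v = ∑ v, ∑ x, ∑ y, g x y v := by
  rw [Finset.sum_comm]
  exact (Finset.sum_congr rfl fun _ _ => Finset.sum_comm).trans
    (Finset.sum_comm.trans (Finset.sum_congr rfl fun _ _ => Finset.sum_comm))

namespace Ell

/-! ### Rescaling of the generators -/

section Scale

variable {p q : ℝ} {Z : SpectralSet q}

variable (p) in
/-- The representation that defines the scaling homomorphisms. -/
def scaleRep (κ : Z.carrier → ℂˣ) : EllRep p q Z (Ell p q Z) where
  l := muL p q Z
  r := muR p q Z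
  L x y z := (κ z : ℂ) • L p q Z x y z
  l_r f g := muL_muR f g
  l_L f x y z := by rw [mul_smul_comm, muL_L, smul_mul_assoc]
  r_L f x y z := by rw [mul_smul_comm, muR_L, smul_mul_assoc]
  RLL a b c d z₁ z₂ := by
    have h := congrArg (((κ z₁ : ℂ) * κ z₂) • ·) ((rep p q Z).RLL a b c d z₁ z₂)
    simp only [Finset.smul_sum] at h
    refine Eq.trans ?_ (h.trans ?_) <;>
    · refine Finset.sum_congr rfl fun x _ => Finset.sum_congr rfl fun y _ => ?_
      simp only [smul_mul_assoc, mul_smul_comm, smul_smul]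
      try rw [mul_comm (κ z₂ : ℂ)]
      rfl
  dI z := ((κ z : ℂ) * κ (Z.up z))⁻¹ • detInv p q Z z
  dI_det z := by
    have h := detInv_det (p := p) z
    simp only [LOps.det, smul_mul_assoc, mul_smul_comm, smul_smul, ← smul_sub]
    rw [show (κ (Z.up z) : ℂ) * κ z * ((κ z : ℂ) * κ (Z.up z))⁻¹ = 1 by field_simp, one_smul]
    exact h
  det_dI z := by
    have h := det_detInv (p := p) z
    simp only [LOps.det, smul_mul_assoc, mul_smul_comm, smul_smul, ← smul_sub]
    rw [show ((κ z : ℂ) * κ (Z.up z))⁻¹ * (κ (Z.up z) * κ z) = 1 by field_simp, one_smul]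
    exact h
  dI_l z f := by rw [smul_mul_assoc, mul_smul_comm, detInv_mul_comm]
  dI_r z f := by rw [smul_mul_assoc, mul_smul_comm, detInv_mul_comm]
  dI_L z x y w := by
    rw [smul_mul_smul_comm, smul_mul_smul_comm, detInv_mul_comm, mul_comm]

variable (p) in
/-- The endomorphism of `ℰ` that multiplies `L(z)` by `κ(z)`. -/
def scale (κ : Z.carrier → ℂˣ) : Ell p q Z →ₐ[ℂ] Ell p q Z := (scaleRep p κ).lift

variable (κ : Z.carrier → ℂˣ)

@[simp] theorem scale_muL (f : Mero) : scale p κ (muL p q Z f) = muL p q Z f := EllRep.lift_muL ..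

@[simp] theorem scale_muR (f : Mero) : scale p κ (muR p q Z f) = muR p q Z f := EllRep.lift_muR ..

@[simp] theorem scale_L (x y : Fin 2) (z : Z.carrier) :
    scale p κ (L p q Z x y z) = (κ z : ℂ) • L p q Z x y z := EllRep.lift_L ..

@[simp] theorem scale_detInv (z : Z.carrier) :
    scale p κ (detInv p q Z z) = ((κ z : ℂ) * κ (Z.up z))⁻¹ • detInv p q Z z :=
  EllRep.lift_detInv ..

theorem scale_scale (κ κ' : Z.carrier → ℂˣ) (h : ∀ z, κ z * κ' z = 1) (a : Ell p q Z) :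
    scale p κ (scale p κ' a) = a := by
  have : (scale p κ).comp (scale p κ') = AlgHom.id ℂ (Ell p q Z) :=
    algHom_ext (by simp) (by simp) fun x y z => by
      have := congrArg Units.val (h z)
      rw [Units.val_mul, Units.val_one] at this
      simp [smul_smul, mul_comm, this]
  exact DFunLike.congr_fun this a

end Scale

variable {p q : ℝ} [GoodParams p q] {W Z : SpectralSet q} [Separated p W Z]

theorem actL_actL_mul (x b y d : Fin 2) (w₁ w₂ : W.carrier) (g h : Ell p q Z) :
    actL p Z x b w₁ (actL p Z y d w₂ (g * h)) = ∑ t, ∑ s,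
      actL p Z t b w₁ (actL p Z s d w₂ g) * actL p Z x t w₁ (actL p Z y s w₂ h) := by
  simp only [actL_mul, map_sum]
  exact Finset.sum_comm

theorem actL_actL_L (x b y d : Fin 2) (w₁ w₂ : W.carrier) (k l : Fin 2) (z : Z.carrier) :
    actL p Z x b w₁ (actL p Z y d w₂ (L p q Z k l z)) = ∑ v, muR p q Z (∑ u,
      Mero.shift (-wt b) (RM p q (w₂ / z : ℂ) d l y u) * RM p q (w₁ / z : ℂ) b u x v) *
        L p q Z k v z := by
  simp only [actL_L, map_sum, actL_muR_mul, Finset.mul_sum, Finset.sum_mul, ← mul_assoc, ← map_mul]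
  exact Finset.sum_comm

/-- The exchange relation of the operators `actL`, on one element. -/
def Exchange (w₁ w₂ : W.carrier) (g : Ell p q Z) : Prop := ∀ a b c d : Fin 2,
  ∑ x, ∑ y, actL p Z x b w₁ (actL p Z y d w₂ g) * muR p q Z (rM p q (w₁ / w₂ : ℂ) x y a c) =
    ∑ x, ∑ y, muR p q Z (rM p q (w₁ / w₂ : ℂ) b d x y) *
      actL p Z c y w₂ (actL p Z a x w₁ g)

/-- The relation for h carries the R-matrix from the right end to the middle of the product, where
it stands to the right of the operators on g; the relation for g carries it to the left end. -/
theorem Exchange.mul {w₁ w₂ : W.carrier} {g h : Ell p q Z} (hg : Exchange w₁ w₂ g)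
    (hh : Exchange w₁ w₂ h) : Exchange w₁ w₂ (g * h) := fun a b c d => by
  simp only [actL_actL_mul]
  calc _ = ∑ t, ∑ s, actL p Z t b w₁ (actL p Z s d w₂ g) * ∑ x, ∑ y,
        actL p Z x t w₁ (actL p Z y s w₂ h) * muR p q Z (rM p q (w₁ / w₂ : ℂ) x y a c) := by
        simp only [Fin.sum_univ_two, mul_add, add_mul, mul_assoc]; abel
    _ = ∑ x, ∑ y, (∑ t, ∑ s, actL p Z t b w₁ (actL p Z s d w₂ g) *
        muR p q Z (rM p q (w₁ / w₂ : ℂ) t s x y)) * actL p Z c y w₂ (actL p Z a x w₁ h) := by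
        simp only [hh a _ c _]
        simp only [Fin.sum_univ_two, mul_add, add_mul, mul_assoc]; abel
    _ = _ := by
        simp only [hg _ b _ d]
        simp only [Fin.sum_univ_two, mul_add, add_mul, mul_assoc]; abel

/-- By multiplicativity only generators matter. On 1, μ_l(f) and det^{-1} the operators are scalar
and the elements commute with μ_r; on μ_r(f) the claim is conservation of weight; on L it is the
Yang–Baxter equation. -/
theorem exchange (w₁ w₂ : W.carrier) (g : Ell p q Z) : Exchange w₁ w₂ g := by
  have hd : ∀ (u : Ell p q Z) (k : W.carrier → ℂ),
      (∀ i j w, actL p Z i j w u = if i = j then k w • u else 0) →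
      (∀ f, muR p q Z f * u = u * muR p q Z f) → Exchange w₁ w₂ u := fun u k hu hc a b c d => by
    have h1 : ∀ x b y d (w w' : W.carrier), actL p Z x b w (actL p Z y d w' u) =
        if x = b ∧ y = d then (k w * k w') • u else 0 := fun x b y d w w' => by
      rw [hu]
      split_ifs with h h' h'
      · rw [map_smul, hu, if_pos h'.1, smul_smul, mul_comm]
      · rw [map_smul, hu, if_neg fun hh => h' ⟨hh, h⟩, smul_zero]
      · exact absurd h'.2 h
      · rw [map_zero]
    simp only [h1, ite_and, ite_mul, mul_ite, zero_mul, mul_zero, Finset.sum_ite_irrel,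
      Finset.sum_ite_eq, Finset.sum_ite_eq', Finset.mem_univ, if_true, Finset.sum_const_zero]
    rw [smul_mul_assoc, mul_smul_comm, hc, mul_comm (k w₁)]
  refine induction_left (motive := fun g => Exchange w₁ w₂ g) g
    (fun g h hg hh a b c d => ?_) (fun k g hg a b c d => ?_) ?_ (fun f a ha => .mul ?_ ha)
    (fun f a ha => .mul ?_ ha) (fun k l z a ha => .mul ?_ ha) (fun z a ha => .mul ?_ ha)
  · simp only [map_add, add_mul, mul_add, Finset.sum_add_distrib, hg a b c d, hh a b c d]
  · simp only [map_smul, smul_mul_assoc, mul_smul_comm, ← Finset.smul_sum, hg a b c d]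
  · exact hd 1 (fun _ => 1) (fun i j w => by rw [actL_one, one_smul]) fun f => by simp
  · exact hd _ (fun _ => 1) (fun i j w => by rw [actL_muL, one_smul]) fun g => (muL_muR _ _).symm
  · intro a b c d
    have h1 : ∀ x b y d (w w' : W.carrier), actL p Z x b w (actL p Z y d w' (muR p q Z f)) =
        if x = b ∧ y = d then muR p q Z (Mero.shift (-wt b + -wt d) f) else 0 :=
      fun x b y d w w' => by
        rw [actL_muR]
        split_ifs with h h' h'
        · rw [actL_muR, if_pos h'.1, Mero.shift_shift]
        · rw [actL_muR, if_neg fun hh => h' ⟨hh, h⟩]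
        · exact absurd h'.2 h
        · rw [map_zero]
    simp only [h1, ite_and, ite_mul, mul_ite, zero_mul, mul_zero, Finset.sum_ite_irrel,
      Finset.sum_ite_eq, Finset.sum_ite_eq', Finset.mem_univ, if_true, Finset.sum_const_zero]
    rw [← map_mul, ← map_mul]
    by_cases h : wt b + wt d = wt a + wt c
    · rw [mul_comm, show -wt c + -wt a = -wt b + -wt d by linear_combination h]
    · rw [rM_eq_zero h, zero_mul, mul_zero]
  · intro a b c d
    have hz : (w₂ / z : ℂ) ≠ 0 := spectral_div_ne_zero w₂ z
    have hw : (w₁ / w₂ : ℂ) ≠ 0 := spectral_div_ne_zero w₁ w₂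
    have hwz : (w₁ / w₂ : ℂ) * (w₂ / z : ℂ) = w₁ / z :=
      div_mul_div_cancel₀ (SpectralSet.coe_ne_zero w₂)
    have h4 := fun v => RM_yangBaxter' p q hz hw c d v l a b
    rw [hwz] at h4
    simp only [actL_actL_L]
    calc _ = ∑ v, muR p q Z (∑ x, ∑ t, ∑ s, Mero.shift (-wt v) (rM p q (w₁ / w₂ : ℂ) s x a c) *
        (RM p q (w₁ / z : ℂ) b t s v * Mero.shift (-wt b) (RM p q (w₂ / z : ℂ) d l x t))) *
          L p q Z k v z := by
          have e : ∀ (g : Fin 2 → Mero) f, (∑ v, muR p q Z (g v) * L p q Z k v z) * muR p q Z f =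
              ∑ v, muR p q Z (g v * Mero.shift (-wt v) f) * L p q Z k v z := fun g f => by
            rw [Finset.sum_mul]
            exact Finset.sum_congr rfl fun v _ => by rw [mul_assoc, L_mul_muR, ← mul_assoc, map_mul]
          simp only [e]
          rw [sum_comm_right]
          refine Finset.sum_congr rfl fun v _ => ?_
          simp only [← Finset.sum_mul, ← map_sum]
          refine congrArg (fun t => muR p q Z t * L p q Z k v z) ?_
          simp only [Fin.sum_univ_two]
          ring
      _ = _ := by
          simp only [← h4, Finset.mul_sum, ← mul_assoc (muR p q Z _) (muR p q Z _), ← map_mul]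
          rw [sum_comm_right]
          refine Finset.sum_congr rfl fun v _ => ?_
          simp only [← Finset.sum_mul, ← map_sum]
          refine congrArg (fun t => muR p q Z t * L p q Z k v z) ?_
          simp only [Fin.sum_univ_two]
          ring
  · exact hd _ (fun w => kap p q (w / Z.up z : ℂ)) (fun i j w => actL_detInv i j w z)
      fun f => (detInv_mul_comm _ _).symm

variable (p W Z) in
/-- The action on `ℰ` of the generators, without `det⁻¹`, of another elliptic quantum group. -/
def actOps : LOps p q W (Module.End ℂ (Ell p q Z)) where
  -- Both moment maps act through μ_r of ℰ_Z: the left one multiplies from the right and the right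
  -- one from the left, as the positions of the R-matrix in `Exchange` require.
  l := AlgHom.ofLinearMap ((LinearMap.mul ℂ (Ell p q Z)).flip ∘ₗ (muR p q Z).toLinearMap)
    (by ext; simp) fun f g => by ext a; simp [mul_assoc, ← map_mul, mul_comm]
  r := (Algebra.lmul ℂ (Ell p q Z)).comp (muR p q Z)
  L i j w := actL p Z i j w
  l_r f g := LinearMap.ext fun a => mul_assoc ..
  l_L f i j w := LinearMap.ext fun a => by
    show actL p Z i j w a * muR p q Z f = actL p Z i j w (a * muR p q Z (Mero.shift (wt i) f))
    rw [actL_mul_muR, Mero.shift_shift, neg_add_cancel, Mero.shift_zero]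
  r_L f i j w := LinearMap.ext fun a => by
    show muR p q Z f * actL p Z i j w a = actL p Z i j w (muR p q Z (Mero.shift (wt j) f) * a)
    rw [actL_muR_mul, Mero.shift_shift, neg_add_cancel, Mero.shift_zero]
  RLL a b c d w₁ w₂ := LinearMap.ext fun g => by
    simp only [LinearMap.sum_apply]
    exact exchange w₁ w₂ g a b c d

theorem actOps_rowMinor_apply (w : W.carrier) (b d : Fin 2) (a : Ell p q Z) :
    (actOps p W Z).rowMinor w b d a = actL p Z 1 b w (actL p Z 0 d (W.up w) a) -
      actL p Z 0 b w (actL p Z 1 d (W.up w) a) := rfl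

/-- The minors applied to h are multiples of one of them by `eps`, and the sum against `eps` is the
minor applied to g. For (b, d) = (1, 0) this makes the minor multiplicative. -/
theorem actOps_rowMinor_mul (w : W.carrier) (b d : Fin 2) (g h : Ell p q Z) :
    (actOps p W Z).rowMinor w b d (g * h) =
      (actOps p W Z).rowMinor w b d g * (actOps p W Z).rowMinor w 1 0 h := by
  have hr : ∀ t s, actL p Z 1 t w (actL p Z 0 s (W.up w) h) -
      actL p Z 0 t w (actL p Z 1 s (W.up w) h) = eps t s • (actOps p W Z).rowMinor w 1 0 h :=
    fun t s => by rw [← LinearMap.smul_apply, ← LOps.rowMinor_eq]; rfl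
  rw [actOps_rowMinor_apply, actL_actL_mul, actL_actL_mul]
  simp only [← Finset.sum_sub_distrib, ← mul_sub, hr]
  simp only [Fin.sum_univ_two, eps_zero_zero, eps_zero_one, eps_one_zero, eps_one_one, zero_smul,
    mul_zero, zero_add, add_zero, neg_smul, one_smul, mul_neg]
  rw [actOps_rowMinor_apply w b d, sub_mul]
  abel

variable (p W) in
/-- The quantum minor acts by an algebra homomorphism. -/
def actMinor (w : W.carrier) : Ell p q Z →ₐ[ℂ] Ell p q Z :=
  AlgHom.ofLinearMap ((actOps p W Z).rowMinor w 1 0)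
    (by simp [actOps_rowMinor_apply, actL_one]) (actOps_rowMinor_mul w 1 0)

/-- With the (1,0) minor for l = 0 and the negative of the (0,1) minor for l = 1, the R-matrix at
q²w contributes only an entry 1, and conservation of weight leaves a diagonal entry of the R-matrix
at w. -/
theorem actMinor_L (w : W.carrier) (k l : Fin 2) (z : Z.carrier) :
    actMinor p W w (L p q Z k l z) =
      muR p q Z (RM p q (w / z : ℂ) l.rev l l.rev l) * L p q Z k l z := by
  show (actOps p W Z).rowMinor w 1 0 (L p q Z k l z) = _
  have n : ∀ x : ℂ, RM p q x 0 0 0 1 = 0 ∧ RM p q x 0 0 1 0 = 0 ∧ RM p q x 0 0 1 1 = 0 ∧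
      RM p q x 1 1 0 0 = 0 ∧ RM p q x 1 1 0 1 = 0 ∧ RM p q x 1 1 1 0 = 0 ∧
      RM p q x 0 1 0 0 = 0 ∧ RM p q x 1 0 1 1 = 0 := fun x => by
    refine ⟨?_, ?_, ?_, ?_, ?_, ?_, ?_, ?_⟩ <;> exact RM_eq_zero (by norm_num [wt])
  obtain ⟨n1, n2, n3, n4, n5, n6, -, -⟩ := n (W.up w / z)
  obtain ⟨-, -, -, -, -, -, m7, m8⟩ := n (w / z)
  have hr := RM_zero_zero (p := p) (W.up w) z
  have hr' := RM_one_one (p := p) (W.up w) z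
  fin_cases l
  · rw [actOps_rowMinor_apply]
    simp [actL_actL_L, n1, n2, n3, m8, hr]
  · rw [← neg_neg ((actOps p W Z).rowMinor w 1 0), ← LOps.rowMinor_zero_one, LinearMap.neg_apply,
      actOps_rowMinor_apply]
    simp [actL_actL_L, n4, n5, n6, m7, hr']

theorem actMinor_muL (w : W.carrier) (f : Mero) :
    actMinor p W w (muL p q Z f) = muL p q Z f := by
  show (actOps p W Z).rowMinor w 1 0 _ = _
  simp [actOps_rowMinor_apply, actL_muL]

theorem actMinor_muR (w : W.carrier) (f : Mero) :
    actMinor p W w (muR p q Z f) = muR p q Z f := by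
  show (actOps p W Z).rowMinor w 1 0 _ = _
  simp [actOps_rowMinor_apply, actL_muR, Mero.shift_shift, wt, Mero.shift_zero]

variable (p Z) in
/-- The factors by which `det⁻¹(w)` scales the generators. -/
def kapUnit (w : W.carrier) (z : Z.carrier) : ℂˣ := Units.mk0 _ (kap_ne_zero (p := p) w z)

/-- Up to conjugation by μ_r(F) the determinant acts as the multiplicative minor, so it is an
algebra endomorphism and can be compared with a rescaling on generators. Conjugation by F turns the
remaining diagonal entry of the R-matrix into a scalar. -/
theorem actOps_det (w : W.carrier) (a : Ell p q Z) :
    (actOps p W Z).det w a = scale p (fun z => (kapUnit p Z w z)⁻¹) a := by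
  have hu : muR p q Z (FMi p q) * muR p q Z (FM p q) = 1 := by
    rw [← map_mul, FMi_mul_FM, map_one]
  have hu' : muR p q Z (FM p q) * muR p q Z (FMi p q) = 1 := by
    rw [← map_mul, FM_mul_FMi, map_one]
  have e : ∀ a, (actOps p W Z).det w a =
      muR p q Z (FM p q) * (actMinor p W w a * muR p q Z (FMi p q)) := fun a => by
    rw [LOps.det_eq_rowMinor]; rfl
  let φ : Ell p q Z →ₐ[ℂ] Ell p q Z := AlgHom.ofLinearMap ((actOps p W Z).det w)
    (by rw [e, map_one, one_mul, hu']) fun a b => by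
      rw [e, e, e, map_mul]
      simp only [mul_assoc]
      rw [← mul_assoc (muR p q Z (FMi p q)), hu, one_mul]
  have key : φ = scale p fun z => (kapUnit p Z w z)⁻¹ := by
    refine algHom_ext (fun f => ?_) (fun f => ?_) fun k l z => ?_
    · refine (e _).trans ?_
      rw [actMinor_muL, muL_muR, ← mul_assoc, hu', one_mul, scale_muL]
    · refine (e _).trans ?_
      rw [actMinor_muR, scale_muR, ← map_mul, ← map_mul, mul_left_comm, FM_mul_FMi, mul_one]
    · refine (e _).trans ?_
      rw [actMinor_L, scale_L, mul_assoc, L_mul_muR, ← mul_assoc, ← mul_assoc, ← map_mul,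
        ← map_mul]
      have hs : ∀ c, Mero.shift c (FM p q) * Mero.shift c (FMi p q) = 1 := fun c => by
        rw [← map_mul, FM_mul_FMi, map_one]
      have : FM p q * RM p q (w / z : ℂ) l.rev l l.rev l * Mero.shift (-wt l) (FMi p q) =
          algebraMap ℂ Mero (kap p q (w / z))⁻¹ := by
        fin_cases l
        · show FM p q * RM p q (w / z : ℂ) 1 0 1 0 * Mero.shift (-1) (FMi p q) = _
          rw [FM_mul_RM_one_zero, smul_mul_assoc, hs, Algebra.algebraMap_eq_smul_one]
        · show FM p q * RM p q (w / z : ℂ) 0 1 0 1 * Mero.shift (-(-1)) (FMi p q) = _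
          rw [FM_mul_RM_zero_one, neg_neg, smul_mul_assoc, hs, Algebra.algebraMap_eq_smul_one]
      rw [this, AlgHom.commutes, ← Algebra.smul_def]
      simp [kapUnit]
  exact DFunLike.congr_fun key a

theorem scale_actL (κ : Z.carrier → ℂˣ) (i j : Fin 2) (w : W.carrier) (a : Ell p q Z) :
    scale p κ (actL p Z i j w a) = actL p Z i j w (scale p κ a) := by
  have : (scale p κ).mapMatrix.comp (coact p Z w) = (coact p Z w).comp (scale p κ) := by
    refine algHom_ext (fun f => ?_) (fun f => ?_) fun k l z => ?_ <;> ext j i <;>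
      simp only [AlgHom.comp_apply, AlgHom.mapMatrix_apply, Matrix.map_apply, ← actL_apply]
    · simp [actL_muL, apply_ite (scale p κ)]
    · simp [actL_muR, apply_ite (scale p κ)]
    · simp [actL_L]
  have h := congrFun (congrFun (DFunLike.congr_fun this a) j) i
  exact h

variable (p W Z) in
/-- The action on `ℰ` of another elliptic quantum group. -/
def actRep : EllRep p q W (Module.End ℂ (Ell p q Z)) where
  __ := actOps p W Z
  dI w := (scale p (kapUnit p Z w)).toLinearMap
  dI_det w := LinearMap.ext fun a => by
    show scale p (kapUnit p Z w) ((actOps p W Z).det w a) = a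
    rw [actOps_det, scale_scale _ _ fun z => mul_inv_cancel _]
  det_dI w := LinearMap.ext fun a => by
    show (actOps p W Z).det w (scale p (kapUnit p Z w) a) = a
    rw [actOps_det, scale_scale _ _ fun z => inv_mul_cancel _]
  dI_l w f := LinearMap.ext fun a => by
    show scale p (kapUnit p Z w) (a * muR p q Z f) = scale p (kapUnit p Z w) a * muR p q Z f
    rw [map_mul, scale_muR]
  dI_r w f := LinearMap.ext fun a => by
    show scale p (kapUnit p Z w) (muR p q Z f * a) = muR p q Z f * scale p (kapUnit p Z w) a
    rw [map_mul, scale_muR]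
  dI_L w i j w' := LinearMap.ext fun a => scale_actL ..

variable (p W Z) in
/-- The action on `ℰ` of another elliptic quantum group. -/
def act : Ell p q W →ₐ[ℂ] Module.End ℂ (Ell p q Z) := (actRep p W Z).lift

@[simp] theorem act_muL (f : Mero) (a : Ell p q Z) :
    act p W Z (muL p q W f) a = a * muR p q Z f := by rw [act, EllRep.lift_muL]; rfl

@[simp] theorem act_muR (f : Mero) (a : Ell p q Z) :
    act p W Z (muR p q W f) a = muR p q Z f * a := by rw [act, EllRep.lift_muR]; rfl

@[simp] theorem act_L (i j : Fin 2) (w : W.carrier) (a : Ell p q Z) :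
    act p W Z (L p q W i j w) a = actL p Z i j w a := by rw [act, EllRep.lift_L]; rfl

@[simp] theorem act_detInv (w : W.carrier) (a : Ell p q Z) :
    act p W Z (detInv p q W w) a = scale p (kapUnit p Z w) a := by
  rw [act, EllRep.lift_detInv]; rfl

end Ell

end EllipticU2

namespace EllipticU2

/-! ### Properties of the action -/

namespace Ell

section RightMap

variable {p q : ℝ} {Z : SpectralSet q} [GoodParams p q]

local notation "tm" => btmul (muL p q Z) (muR p q Z)

/-- The map `a ⊗ b ↦ a ⊗ φ(b)`. -/
def rightMap (φ : Module.End ℂ (Ell p q Z))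
    (h : ∀ f a, φ (muL p q Z f * a) = muL p q Z f * φ a) : BT p q Z →ₗ[ℂ] BT p q Z :=
  btLift ((btmulₗ (muL p q Z) (muR p q Z)).compl₂ φ) fun f a b => by
    simp only [LinearMap.compl₂_apply, btmulₗ_apply, h, btmul_muR]

@[simp] theorem rightMap_tm (φ : Module.End ℂ (Ell p q Z))
    (h : ∀ f a, φ (muL p q Z f * a) = muL p q Z f * φ a) (a b : Ell p q Z) :
    rightMap φ h (tm a b) = tm a (φ b) := btLift_btmul ..

theorem comul_mul_muR (a : Ell p q Z) (f : Mero) :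
    comul p q Z (a * muR p q Z f) = rmul _ _ 1 (muR p q Z f) (comul p q Z a) := by
  rw [comul_mul, comul_muR, comulAct_tm]

theorem scale_muL_mul (κ : Z.carrier → ℂˣ) (f : Mero) (a : Ell p q Z) :
    (scale p κ).toLinearMap (muL p q Z f * a) = muL p q Z f * (scale p κ).toLinearMap a := by
  simp

theorem comul_scale (κ : Z.carrier → ℂˣ) (a : Ell p q Z) : comul p q Z (scale p κ a) =
    rightMap (scale p κ).toLinearMap (scale_muL_mul κ) (comul p q Z a) := by
  have key : ∀ (g g' : Ell p q Z), scale p κ g = g' → (∀ t, comulAct p q Z g'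
      (rightMap (scale p κ).toLinearMap (scale_muL_mul κ) t) =
        rightMap (scale p κ).toLinearMap (scale_muL_mul κ) (comulAct p q Z g t)) → ∀ a,
      comul p q Z (scale p κ a) =
        rightMap (scale p κ).toLinearMap (scale_muL_mul κ) (comul p q Z a) →
      comul p q Z (scale p κ (g * a)) =
        rightMap (scale p κ).toLinearMap (scale_muL_mul κ) (comul p q Z (g * a)) := by
    intro g g' hg hgg a ha
    rw [map_mul, hg, comul_mul, ha, hgg, comul_mul]
  refine induction_left (motive := fun a => comul p q Z (scale p κ a) =
    rightMap (scale p κ).toLinearMap (scale_muL_mul κ) (comul p q Z a)) a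
    (fun a b ha hb => by simp only [map_add, ha, hb]) (fun c a ha => by simp only [map_smul, ha])
    (by simp [comul_one]) (fun f => key _ _ (scale_muL ..) fun t => ?_)
    (fun f => key _ _ (scale_muR ..) fun t => ?_)
    (fun x y z => key _ _ (scale_L ..) fun t => ?_)
    (fun z => key _ _ (scale_detInv ..) fun t => ?_)
  all_goals
    induction t using bt_induction with
    | add s t hs ht => simp only [map_add, hs, ht]
    | btmul u v => simp [comulAct_muL, comulAct_muR, comulAct_L, comulAct_detInv,
        btmul_smul_right]

theorem scale_mem (κ : Z.carrier → ℂˣ) {α β : ℂ} {a : Ell p q Z} (ha : a ∈ grading p q Z α β) :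
    scale p κ a ∈ grading p q Z α β := by
  refine grading_induction (motive := fun α β a => scale p κ a ∈ grading p q Z α β) ha
    (fun _ _ => by rw [map_zero]; exact zero_mem _)
    (fun _ _ a b ha hb => by rw [map_add]; exact add_mem ha hb)
    (fun _ _ c a ha => by rw [map_smul]; exact Submodule.smul_mem _ c ha)
    (by rw [map_one]; exact one_mem_grading) (fun _ _ f a _ ha => ?_) (fun _ _ f a _ ha => ?_)
    (fun _ _ x y z a _ ha => ?_) (fun _ _ z a _ ha => ?_)
  · rw [map_mul, scale_muL]; exact muL_mul_mem ha f
  · rw [map_mul, scale_muR]; exact muR_mul_mem ha f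
  · rw [map_mul, scale_L, smul_mul_assoc]
    exact Submodule.smul_mem _ _ (mul_mem_grading (L_mem x y z) ha)
  · rw [map_mul, scale_detInv, smul_mul_assoc]
    exact Submodule.smul_mem _ _ (detInv_mul_mem ha z)

end RightMap

variable {p q : ℝ} [GoodParams p q] {W Z : SpectralSet q} [Separated p W Z]

local notation "tm" => btmul (muL p q Z) (muR p q Z)

theorem actL_mem (i j : Fin 2) (w : W.carrier) {α β : ℂ} {a : Ell p q Z}
    (ha : a ∈ grading p q Z α β) : actL p Z i j w a ∈ grading p q Z α (β + wt j - wt i) := by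
  refine grading_induction (motive := fun α β a => ∀ i j, actL p Z i j w a ∈
    grading p q Z α (β + wt j - wt i)) ha
    (fun _ _ i j => by rw [map_zero]; exact zero_mem _)
    (fun _ _ a b ha hb i j => by rw [map_add]; exact add_mem (ha i j) (hb i j))
    (fun _ _ c a ha i j => by rw [map_smul]; exact Submodule.smul_mem _ c (ha i j))
    (fun i j => ?_) (fun _ _ f a _ ha i j => ?_) (fun _ _ f a _ ha i j => ?_)
    (fun α β k l z a _ ha i j => ?_) (fun _ _ z a _ ha i j => ?_) i j
  · rw [actL_one]
    split_ifs with h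
    · rw [h, zero_add, sub_self]; exact one_mem_grading
    · exact zero_mem _
  · rw [actL_muL_mul]; exact muL_mul_mem (ha i j) f
  · rw [actL_muR_mul]; exact muR_mul_mem (ha i j) _
  · rw [actL_mul]
    refine Submodule.sum_mem _ fun s _ => ?_
    rw [actL_L, Finset.sum_mul]
    refine Submodule.sum_mem _ fun x _ => ?_
    by_cases h : wt j + wt l = wt s + wt x
    · rw [mul_assoc]
      refine muR_mul_mem ?_ _
      have := mul_mem_grading (L_mem (p := p) k x z) (ha i s)
      rwa [show wt x + (β + wt s - wt i) = wt l + β + wt j - wt i by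
        linear_combination -h] at this
    · rw [RM_eq_zero h, map_zero, zero_mul, zero_mul]; exact zero_mem _
  · rw [actL_mul]
    refine Submodule.sum_mem _ fun s _ => ?_
    rw [actL_detInv]
    split_ifs with h
    · rw [h, smul_mul_assoc]; exact Submodule.smul_mem _ _ (detInv_mul_mem (ha i j) z)
    · rw [zero_mul]; exact zero_mem _

theorem act_mem {α β γ δ : ℂ} {X : Ell p q W} {a : Ell p q Z} (hX : X ∈ grading p q W α β)
    (ha : a ∈ grading p q Z γ δ) : act p W Z X a ∈ grading p q Z γ (δ + β - α) := by
  refine grading_induction (motive := fun α β X => act p W Z X a ∈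
    grading p q Z γ (δ + β - α)) hX
    (fun _ _ => by rw [map_zero]; exact zero_mem _)
    (fun _ _ X Y hX hY => by rw [map_add]; exact add_mem hX hY)
    (fun _ _ c X hX => by rw [map_smul]; exact Submodule.smul_mem _ c hX)
    (by rw [map_one, add_zero, sub_zero]; exact ha) (fun _ _ f X _ hX => ?_)
    (fun _ _ f X _ hX => ?_) (fun α β i j w X _ hX => ?_) (fun _ _ w X _ hX => ?_)
  · rw [map_mul, Module.End.mul_apply, act_muL, mul_muR_of_mem hX]
    exact muR_mul_mem hX _
  · rw [map_mul, Module.End.mul_apply, act_muR]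
    exact muR_mul_mem hX _
  · rw [map_mul, Module.End.mul_apply, act_L]
    have := actL_mem i j w hX
    rwa [show δ + β - α + wt j - wt i = δ + (wt j + β) - (wt i + α) by ring] at this
  · rw [map_mul, Module.End.mul_apply, act_detInv]
    exact scale_mem _ hX

theorem act_one (X : Ell p q W) : act p W Z X 1 = muR p q Z (eps0 p q W X) := by
  refine induction_left (motive := fun X => act p W Z X 1 = muR p q Z (eps0 p q W X)) X
    (fun X Y hX hY => by rw [map_add, LinearMap.add_apply, hX, hY, map_add, map_add])
    (fun c X hX => by rw [map_smul, LinearMap.smul_apply, hX, map_smul, map_smul])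
    (by simp) (fun f X hX => ?_) (fun f X hX => ?_) (fun i j w X hX => ?_) (fun w X hX => ?_) <;>
    rw [map_mul, Module.End.mul_apply, hX]
  · rw [act_muL, eps0_muL_mul, ← map_mul, mul_comm]
  · rw [act_muR, eps0_muR_mul, ← map_mul]
  · rw [act_L, eps0_L_mul, actL_muR]
    split_ifs with h
    · rw [h]
    · rw [map_zero]
  · rw [act_detInv, eps0_detInv_mul, scale_muR]

/-- The action touches only the right side of ℰ_Z. This is what makes id ⊗ X well defined on the
balanced tensor product. -/
theorem act_muL_mul (X : Ell p q W) (f : Mero) (a : Ell p q Z) :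
    act p W Z X (muL p q Z f * a) = muL p q Z f * act p W Z X a := by
  refine induction_left (motive := fun X => act p W Z X (muL p q Z f * a) =
    muL p q Z f * act p W Z X a) X
    (fun X Y hX hY => by rw [map_add, LinearMap.add_apply, LinearMap.add_apply, hX, hY, mul_add])
    (fun c X hX => by rw [map_smul, LinearMap.smul_apply, LinearMap.smul_apply, hX, mul_smul_comm])
    (by simp) (fun g X hX => ?_) (fun g X hX => ?_) (fun i j w X hX => ?_) (fun w X hX => ?_) <;>
    rw [map_mul (act p W Z), Module.End.mul_apply, hX, Module.End.mul_apply]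
  · rw [act_muL, act_muL, mul_assoc]
  · rw [act_muR, act_muR, ← mul_assoc, ← muL_muR, mul_assoc]
  · rw [act_L, act_L, actL_muL_mul]
  · rw [act_detInv, act_detInv, map_mul, scale_muL]

/-- Left multiplication by μ_r(f) is itself the action of an element of ℰ_W, so the claim is the
commutation rule between moment map and X there. -/
theorem act_muR_mul {α β : ℂ} {X : Ell p q W} (hX : X ∈ grading p q W α β) (f : Mero)
    (a : Ell p q Z) :
    act p W Z X (muR p q Z f * a) = muR p q Z (Mero.shift (-β) f) * act p W Z X a := by
  rw [← act_muR (W := W), ← act_muR (W := W), ← Module.End.mul_apply, ← Module.End.mul_apply,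
    ← map_mul, ← map_mul, mul_muR_of_mem hX]

theorem act_mul_muR {α β : ℂ} {X : Ell p q W} (hX : X ∈ grading p q W α β) (f : Mero)
    (a : Ell p q Z) :
    act p W Z X (a * muR p q Z f) = act p W Z X a * muR p q Z (Mero.shift (-α) f) := by
  rw [← act_muL (W := W), ← act_muL (W := W), ← Module.End.mul_apply, ← Module.End.mul_apply,
    ← map_mul, ← map_mul, mul_muL_of_mem hX]

/-- The map `X ⊗ Y ↦ (Y a) (X b)`. -/
def actMul (a b : Ell p q Z) : BT p q W →ₗ[ℂ] Ell p q Z :=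
  btLift (LinearMap.mk₂ ℂ (fun X Y => act p W Z Y a * act p W Z X b)
    (fun X X' Y => by rw [map_add, LinearMap.add_apply, mul_add])
    (fun c X Y => by rw [map_smul, LinearMap.smul_apply, mul_smul_comm])
    (fun X Y Y' => by rw [map_add, LinearMap.add_apply, add_mul])
    (fun c X Y => by rw [map_smul, LinearMap.smul_apply, smul_mul_assoc])) fun f X Y => by
      simp only [LinearMap.mk₂_apply, map_mul, Module.End.mul_apply, act_muR, act_muL, mul_assoc]

@[simp] theorem actMul_tm (a b : Ell p q Z) (X Y : Ell p q W) :
    actMul a b (btmul (muL p q W) (muR p q W) X Y) = act p W Z Y a * act p W Z X b :=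
  btLift_btmul ..

/-- The module algebra property, with the legs of Δ(X) exchanged; this exchange is why the
co-opposite of ℰ_W enters the pairing. It holds for generators by the product rule of `coact` and
propagates through products in ℰ_W. -/
theorem act_mul (X : Ell p q W) (a b : Ell p q Z) :
    act p W Z X (a * b) = actMul a b (comul p q W X) := by
  have key : ∀ g : Ell p q W, (∀ t : BT p q W, act p W Z g (actMul a b t) =
      actMul a b (comulAct p q W g t)) → ∀ X, act p W Z X (a * b) = actMul a b (comul p q W X) →
      act p W Z (g * X) (a * b) = actMul a b (comul p q W (g * X)) := fun g hg X hX => by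
    rw [map_mul (act p W Z), Module.End.mul_apply, hX, hg, comul_mul]
  refine induction_left (motive := fun X => act p W Z X (a * b) = actMul a b (comul p q W X)) X
    (fun X Y hX hY => by rw [map_add, LinearMap.add_apply, hX, hY, map_add, map_add])
    (fun c X hX => by rw [map_smul, LinearMap.smul_apply, hX, map_smul, map_smul])
    (by simp [comul_one]) (fun f => key _ fun t => ?_) (fun f => key _ fun t => ?_)
    (fun i j w => key _ fun t => ?_) (fun w => key _ fun t => ?_)
  all_goals
    induction t using bt_induction with
    | add s t hs ht => simp only [map_add, hs, ht]
    | btmul u v => simp [comulAct_muL, comulAct_muR, comulAct_L, comulAct_detInv, actL_mul,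
        mul_assoc]

theorem comul_actL (i j : Fin 2) (w : W.carrier) (a : Ell p q Z) : comul p q Z (actL p Z i j w a) =
    rightMap (actL p Z i j w) (actL_muL_mul i j w) (comul p q Z a) := by
  have key : ∀ g : Ell p q Z, (∀ i j, ∀ t, ∑ s, comulAct p q Z (actL p Z s j w g)
      (rightMap (actL p Z i s w) (actL_muL_mul i s w) t) =
        rightMap (actL p Z i j w) (actL_muL_mul i j w) (comulAct p q Z g t)) → ∀ a,
      (∀ i j, comul p q Z (actL p Z i j w a) =
        rightMap (actL p Z i j w) (actL_muL_mul i j w) (comul p q Z a)) →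
      ∀ i j, comul p q Z (actL p Z i j w (g * a)) =
        rightMap (actL p Z i j w) (actL_muL_mul i j w) (comul p q Z (g * a)) := by
    intro g hg a ha i j
    rw [actL_mul, map_sum, comul_mul g, ← hg]
    exact Finset.sum_congr rfl fun s _ => by rw [comul_mul, ha]
  refine induction_left (motive := fun a => ∀ i j, comul p q Z (actL p Z i j w a) =
    rightMap (actL p Z i j w) (actL_muL_mul i j w) (comul p q Z a)) a
    (fun a b ha hb i j => by simp only [map_add, ha i j, hb i j])
    (fun c a ha i j => by simp only [map_smul, ha i j])
    (fun i j => ?_) (fun f => key _ fun i j t => ?_)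
    (fun f => key _ fun i j t => ?_)
    (fun x y z => key _ fun i j t => ?_)
    (fun z => key _ fun i j t => ?_) i j
  · rw [comul_one, rightMap_tm, actL_one]
    split_ifs
    · rw [comul_one]
    · rw [map_zero, ← btmulₗ_apply, map_zero]
  · induction t using bt_induction with
    | add s t hs ht => simp only [map_add, Finset.sum_add_distrib, hs, ht]
    | btmul u v =>
      rw [comulAct_muL, rightMap_tm, Finset.sum_eq_single j]
      · rw [actL_muL, if_pos rfl, rightMap_tm, comulAct_muL]
      · intro s _ hs
        rw [actL_muL, if_neg hs, map_zero, LinearMap.zero_apply]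
      · simp
  · induction t using bt_induction with
    | add s t hs ht => simp only [map_add, Finset.sum_add_distrib, hs, ht]
    | btmul u v =>
      rw [comulAct_muR, rightMap_tm, Finset.sum_eq_single j]
      · rw [actL_muR, if_pos rfl, rightMap_tm, comulAct_muR, actL_muR_mul]
      · intro s _ hs
        rw [actL_muR, if_neg hs, map_zero, LinearMap.zero_apply]
      · simp
  · induction t using bt_induction with
    | add s t hs ht => simp only [map_add, Finset.sum_add_distrib, hs, ht]
    | btmul u v =>
      simp only [comulAct_L, rightMap_tm, actL_L, actL_mul, map_sum, map_mul, LinearMap.sum_apply,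
        Module.End.mul_apply, comulAct_muR, Finset.sum_mul, btmul_sum_right, mul_assoc]
      exact sum_comm_right _
  · induction t using bt_induction with
    | add s t hs ht => simp only [map_add, Finset.sum_add_distrib, hs, ht]
    | btmul u v =>
      rw [comulAct_detInv, rightMap_tm, Finset.sum_eq_single j]
      · rw [actL_mul, Finset.sum_eq_single j]
        · rw [actL_detInv, if_pos rfl, rightMap_tm, map_smul, LinearMap.smul_apply, comulAct_detInv,
            smul_mul_assoc, btmul_smul_right]
        · intro s _ hs
          rw [actL_detInv, if_neg hs, zero_mul]
        · simp
      · intro s _ hs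
        rw [actL_detInv, if_neg hs, map_zero, LinearMap.zero_apply]
      · simp

/-- The action commutes with the left coaction. It is checked for the generators of ℰ_W, and
composition of operators then gives all X. -/
theorem comul_act (X : Ell p q W) (a : Ell p q Z) : comul p q Z (act p W Z X a) =
    rightMap (act p W Z X) (act_muL_mul X) (comul p q Z a) := by
  have key : ∀ g : Ell p q W, (∀ a, comul p q Z (act p W Z g a) =
      rightMap (act p W Z g) (act_muL_mul g) (comul p q Z a)) → ∀ X,
      (∀ a, comul p q Z (act p W Z X a) =
        rightMap (act p W Z X) (act_muL_mul X) (comul p q Z a)) →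
      ∀ a, comul p q Z (act p W Z (g * X) a) =
        rightMap (act p W Z (g * X)) (act_muL_mul (g * X)) (comul p q Z a) := by
    intro g hg X hX a
    rw [show act p W Z (g * X) a = act p W Z g (act p W Z X a) by rw [map_mul]; rfl, hg, hX]
    generalize comul p q Z a = t
    induction t using bt_induction with
    | add s t hs ht => simp only [map_add, hs, ht]
    | btmul u v => simp
  refine induction_left (motive := fun X => ∀ a, comul p q Z (act p W Z X a) =
    rightMap (act p W Z X) (act_muL_mul X) (comul p q Z a)) X
    (fun X Y hX hY a => ?_) (fun c X hX a => ?_) (fun a => ?_) (fun f => key _ fun a => ?_)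
    (fun f => key _ fun a => ?_) (fun i j w => key _ fun a => ?_) (fun w => key _ fun a => ?_) a
  · rw [show act p W Z (X + Y) a = act p W Z X a + act p W Z Y a by rw [map_add]; rfl, map_add, hX,
      hY]
    generalize comul p q Z a = t
    induction t using bt_induction with
    | add s t hs ht =>
      rw [LinearMap.map_add, LinearMap.map_add, LinearMap.map_add, ← hs, ← ht]
      abel
    | btmul u v => simp [btmul_add_right]
  · rw [show act p W Z (c • X) a = c • act p W Z X a by rw [map_smul]; rfl, map_smul, hX]
    generalize comul p q Z a = t
    induction t using bt_induction with
    | add s t hs ht => simp only [map_add, ← hs, ← ht, smul_add]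
    | btmul u v => simp [btmul_smul_right]
  · rw [show act p W Z 1 a = a by rw [map_one]; rfl]
    generalize comul p q Z a = t
    induction t using bt_induction with
    | add s t hs ht => simp only [map_add, ← hs, ← ht]
    | btmul u v => simp
  · rw [act_muL, comul_mul_muR]
    generalize comul p q Z a = t
    induction t using bt_induction with
    | add s t hs ht => simp only [map_add, hs, ht]
    | btmul u v => simp
  · rw [act_muR, comul_mul]
    generalize comul p q Z a = t
    induction t using bt_induction with
    | add s t hs ht => simp only [map_add, hs, ht]
    | btmul u v => simp [comulAct_muR]
  · rw [act_L, comul_actL]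
    generalize comul p q Z a = t
    induction t using bt_induction with
    | add s t hs ht => simp only [map_add, hs, ht]
    | btmul u v => simp
  · rw [act_detInv, comul_scale]
    generalize comul p q Z a = t
    induction t using bt_induction with
    | add s t hs ht => simp only [map_add, hs, ht]
    | btmul u v => simp

end Ell

end EllipticU2

namespace EllipticU2

/-! ### The pairing -/

namespace Ell

open DiffOp

variable {p q : ℝ} [GoodParams p q] {W Z : SpectralSet q} [Separated p W Z]

local notation "tm" => btmul (muL p q Z) (muR p q Z)

variable (p W Z) in
/-- The pairing `⟨X, a⟩ = ε(X a) T_{-α}` for `X` of left degree `α`. -/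
def pair : Ell p q W →ₗ[ℂ] Ell p q Z →ₗ[ℂ] DiffOp :=
  gradedLift fun i =>
    { toFun := fun X => (LinearMap.mulRight ℂ (T (-i.1))).comp
        ((counit p q Z).toLinearMap.comp (act p W Z X))
      map_add' := fun X Y => by
        rw [map_add, LinearMap.comp_add, LinearMap.comp_add]
      map_smul' := fun c X => by
        rw [map_smul, LinearMap.comp_smul, LinearMap.comp_smul]; rfl }

theorem pair_of_mem {α β : ℂ} {X : Ell p q W} (hX : X ∈ grading p q W α β) (a : Ell p q Z) :
    pair p W Z X a = counit p q Z (act p W Z X a) * T (-α) := by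
  rw [pair, gradedLift_of_mem _ hX]; rfl

theorem pair_eq_term {α β γ δ : ℂ} {X : Ell p q W} {a : Ell p q Z} (hX : X ∈ grading p q W α β)
    (ha : a ∈ grading p q Z γ δ) :
    pair p W Z X a = term (eps0 p q Z (act p W Z X a)) (-(α + γ)) := by
  rw [pair_of_mem hX, (counit_mem (act_mem hX ha)).eq_term, term_mul_T, ← eps0_apply,
    neg_add_rev]

theorem pair_target {α β γ δ : ℂ} {X : Ell p q W} {a : Ell p q Z} (hX : X ∈ grading p q W α β)
    (ha : a ∈ grading p q Z γ δ) : HasDeg (β + δ) (α + γ) (pair p W Z X a) := by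
  refine HasDeg.symm ⟨_, pair_eq_term hX ha, fun h => ?_⟩
  exact (counit_mem (act_mem hX ha)).applyOne_eq_zero fun h' => h (by linear_combination h')

theorem pair_muR_mul_fst (f : Mero) (X : Ell p q W) (a : Ell p q Z) :
    pair p W Z (muR p q W f * X) a = mulOp f * pair p W Z X a := by
  refine induction_homogeneous (motive := fun X => pair p W Z (muR p q W f * X) a =
    mulOp f * pair p W Z X a) X (fun X Y hX hY => ?_) fun α β X hX => ?_
  · rw [mul_add, map_add, LinearMap.add_apply, hX, hY, map_add, LinearMap.add_apply, mul_add]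
  · rw [pair_of_mem hX, pair_of_mem (muR_mul_mem hX f), map_mul (act p W Z), Module.End.mul_apply,
      act_muR, map_mul, counit_muR, mul_assoc]

theorem pair_muL_mul_snd (f : Mero) (X : Ell p q W) (a : Ell p q Z) :
    pair p W Z X (muL p q Z f * a) = mulOp f * pair p W Z X a := by
  refine induction_homogeneous (motive := fun X => pair p W Z X (muL p q Z f * a) =
    mulOp f * pair p W Z X a) X (fun X Y hX hY => ?_) fun α β X hX => ?_
  · rw [map_add, LinearMap.add_apply, hX, hY, LinearMap.add_apply, mul_add]
  · rw [pair_of_mem hX, pair_of_mem hX, act_muL_mul, map_mul, counit_muL, mul_assoc]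

theorem pair_mul_muR_snd (f : Mero) (X : Ell p q W) (a : Ell p q Z) :
    pair p W Z X (a * muR p q Z f) = pair p W Z X a * mulOp f := by
  refine induction_homogeneous (motive := fun X => pair p W Z X (a * muR p q Z f) =
    pair p W Z X a * mulOp f) X (fun X Y hX hY => ?_) fun α β X hX => ?_
  · rw [map_add, LinearMap.add_apply, hX, hY, LinearMap.add_apply, add_mul]
  · rw [pair_of_mem hX, pair_of_mem hX, act_mul_muR hX, map_mul, counit_muR, mul_assoc, mul_assoc,
      T_mul_mulOp]

theorem pair_mul_muL_fst (f : Mero) (X : Ell p q W) (a : Ell p q Z) :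
    pair p W Z (X * muL p q W f) a = pair p W Z X a * mulOp f := by
  refine induction_homogeneous (motive := fun X => pair p W Z (X * muL p q W f) a =
    pair p W Z X a * mulOp f) X (fun X Y hX hY => ?_) fun α β X hX => ?_
  · rw [add_mul, map_add, LinearMap.add_apply, hX, hY, map_add, LinearMap.add_apply, add_mul]
  · rw [mul_muL_of_mem hX, pair_of_mem (muL_mul_mem hX _), ← mul_muL_of_mem hX,
      map_mul (act p W Z), Module.End.mul_apply, act_muL, ← pair_of_mem hX, pair_mul_muR_snd]

theorem pair_one_fst (a : Ell p q Z) : pair p W Z 1 a = counit p q Z a := by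
  rw [pair_of_mem one_mem_grading, map_one, Module.End.one_apply, neg_zero, T_zero, mul_one]

theorem pair_one_snd (X : Ell p q W) : pair p W Z X 1 = counit p q W X := by
  refine induction_homogeneous (motive := fun X => pair p W Z X 1 = counit p q W X) X
    (fun X Y hX hY => ?_) fun α β X hX => ?_
  · rw [map_add, LinearMap.add_apply, hX, hY, map_add]
  · rw [pair_of_mem hX, act_one, counit_muR, mulOp_mul_T, eps0_apply, ← (counit_mem hX).eq_term]

/-- The element Y·a is recovered from its coproduct by the right counit axiom, and that coproduct is
Δ(a) with Y applied to the second leg. -/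
theorem counit_act_mul (X : Ell p q W) (Y : Ell p q W) (a : Ell p q Z) :
    counit p q Z (act p W Z (X * Y) a) = counit p q Z (act p W Z X (counitRight p q Z
      (rightMap (act p W Z Y) (act_muL_mul Y) (comul p q Z a)))) := by
  rw [← comul_act, counitRight_comul, map_mul, Module.End.mul_apply]

theorem pair_mul_T_mul {α β α' β' γ ρ δ : ℂ} {X Y : Ell p q W} {a b : Ell p q Z}
    (hX : X ∈ grading p q W α β) (hY : Y ∈ grading p q W α' β') (ha : a ∈ grading p q Z γ ρ)
    (hb : b ∈ grading p q Z ρ δ) : pair p W Z X a * T ρ * pair p W Z Y b =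
      counit p q Z (act p W Z X (counitRight p q Z (rightMap (act p W Z Y) (act_muL_mul Y)
        (tm a b)))) * T (-(α + α')) := by
  have h := act_mem hX ha
  rw [rightMap_tm, counitRight_tm, act_muR_mul hX, map_mul, counit_muR, pair_of_mem hX,
    pair_eq_term hY hb, (counit_mem h).eq_term]
  -- When the bidegree of X·a is not diagonal its counit is zero and both sides vanish; otherwise
  -- the shifts match and the coefficients commute.
  by_cases e : γ = ρ + β - α
  · rw [mulOp_mul_term, term_mul_T, term_mul_T, term_mul_T, term_mul_term, mul_comm,
      show -γ + -α + ρ = -β by linear_combination -e,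
      show -β + -(α' + ρ) = -γ + -(α + α') by linear_combination e]
  · rw [(counit_mem h).applyOne_eq_zero e]
    simp

theorem pair_mul_fst (X Y : Ell p q W) (a : Ell p q Z) (s : List (ℂ × Ell p q Z × Ell p q Z))
    (hs : (hopf p q Z).IsSweedler a s) : pair p W Z (X * Y) a =
      (s.map fun t => pair p W Z X t.2.1 * T t.1 * pair p W Z Y t.2.2).sum := by
  refine induction_homogeneous (motive := fun X => pair p W Z (X * Y) a =
    (s.map fun t => pair p W Z X t.2.1 * T t.1 * pair p W Z Y t.2.2).sum) X
    (fun X X' h h' => ?_) fun α β X hX => ?_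
  · simp only [add_mul, map_add, LinearMap.add_apply, h, h', List.sum_map_add]
  refine induction_homogeneous (motive := fun Y => pair p W Z (X * Y) a =
    (s.map fun t => pair p W Z X t.2.1 * T t.1 * pair p W Z Y t.2.2).sum) Y
    (fun Y Y' h h' => ?_) fun α' β' Y hY => ?_
  · simp only [mul_add, map_add, LinearMap.add_apply, h, h', List.sum_map_add]
  rw [pair_of_mem (mul_mem_grading hX hY), counit_act_mul]
  refine Eq.symm (hs.map_sum ((LinearMap.mulRight ℂ (T (-(α + α')))).comp
    ((counit p q Z).toLinearMap.comp ((act p W Z X).comp ((counitRight p q Z).comp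
      (rightMap (act p W Z Y) (act_muL_mul Y)))))).toAddMonoidHom _ fun t ht => ?_)
  obtain ⟨⟨γ, h1⟩, δ, h2⟩ := hs.1 t ht
  exact (pair_mul_T_mul hX hY h1 h2).symm

variable (W) in
/-- The map `X ⊗ Y ↦ ε(Y a) ⟨X, b⟩`. -/
def pairMul (a b : Ell p q Z) : BT p q W →ₗ[ℂ] DiffOp :=
  btLift (LinearMap.mk₂ ℂ (fun X Y => counit p q Z (act p W Z Y a) * pair p W Z X b)
    (fun X X' Y => by rw [map_add, LinearMap.add_apply, mul_add])
    (fun c X Y => by rw [map_smul, LinearMap.smul_apply, mul_smul_comm])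
    (fun X Y Y' => by rw [map_add, LinearMap.add_apply, map_add, add_mul])
    (fun c X Y => by rw [map_smul, LinearMap.smul_apply, map_smul, smul_mul_assoc]))
    fun f X Y => by
      simp only [LinearMap.mk₂_apply]
      rw [pair_muR_mul_fst, map_mul (act p W Z), Module.End.mul_apply, act_muL, map_mul,
        counit_muR, mul_assoc]

@[simp] theorem pairMul_tm (a b : Ell p q Z) (X Y : Ell p q W) :
    pairMul W a b (btmul (muL p q W) (muR p q W) X Y) =
      counit p q Z (act p W Z Y a) * pair p W Z X b := btLift_btmul ..

theorem pairMul_comul (X : Ell p q W) (a b : Ell p q Z) :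
    pairMul W a b (comul p q W X) = pair p W Z X (a * b) := by
  refine induction_homogeneous (motive := fun X => pairMul W a b (comul p q W X) =
    pair p W Z X (a * b)) X (fun X Y hX hY => ?_) fun α β X hX => ?_
  · rw [map_add, map_add, hX, hY, map_add, LinearMap.add_apply]
  · rw [pair_of_mem hX, act_mul]
    refine eq_of_mem_matchedSpan (pairMul W a b).toAddMonoidHom ((LinearMap.mulRight ℂ
      (T (-α))).comp ((counit p q Z).toLinearMap.comp (actMul a b))).toAddMonoidHom (comul_mem hX)
      fun γ X' hX' Y hY => ?_
    refine (pairMul_tm a b X' Y).trans ?_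
    show _ = counit p q Z (actMul a b (btmul _ _ X' Y)) * T (-α)
    rw [actMul_tm, pair_of_mem hX', map_mul, mul_assoc]

theorem pair_mul_snd (X : Ell p q W) (a b : Ell p q Z) (s : List (ℂ × Ell p q W × Ell p q W))
    (hs : (hopf p q W).cop.IsSweedler X s) : pair p W Z X (a * b) =
      (s.map fun t => pair p W Z t.2.1 a * T t.1 * pair p W Z t.2.2 b).sum := by
  have hs' := hs.of_cop
  have h := hs'.map_sum (pairMul W a b).toAddMonoidHom
    (fun t => pair p W Z t.2.2 a * T t.1 * pair p W Z t.2.1 b) fun t ht => by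
      obtain ⟨⟨γ, h1⟩, δ, h2⟩ := hs'.1 t ht
      refine (pairMul_tm a b t.2.1 t.2.2).trans ?_
      -- The inserted shift cancels the one in the definition of the pairing, since the second leg
      -- has left degree ρ.
      rw [pair_of_mem h2, mul_assoc (counit p q Z _), T_mul_T, neg_add_cancel, T_zero, mul_one]
  rw [List.map_map] at h
  exact ((pairMul_comul X a b).symm.trans h.symm)

theorem pair_isPairing : IsPairing (hopf p q W).cop (hopf p q Z) (pair p W Z) where
  target hX ha := pair_target hX ha
  μl_fst := pair_muR_mul_fst
  μl_snd := pair_muL_mul_snd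
  μr_fst := pair_mul_muL_fst
  μr_snd := pair_mul_muR_snd
  mul_fst := pair_mul_fst
  mul_snd := pair_mul_snd
  one_snd := pair_one_snd
  one_fst := pair_one_fst

theorem pair_L_L (i j k l : Fin 2) (w : W.carrier) (z : Z.carrier) :
    pair p W Z (L p q W i j w) (L p q Z k l z) =
      term (RM p q (w / z : ℂ) j l i k) (-wt i - wt k) := by
  rw [pair_eq_term (L_mem i j w) (L_mem k l z), act_L, actL_L, map_sum, neg_add']
  congr 1
  simp only [eps0_muR_mul]
  rw [Finset.sum_eq_single k]
  · have h := eps0_L_mul (p := p) k k z 1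
    rw [mul_one, if_pos rfl, eps0_one, map_one] at h
    rw [h, mul_one]
  · intro x _ hx
    have h := eps0_L_mul (p := p) k x z 1
    rw [mul_one, if_neg (Ne.symm hx)] at h
    rw [h, mul_zero]
  · simp

theorem pair_L_detInv (i j : Fin 2) (w : W.carrier) (z : Z.carrier) :
    pair p W Z (L p q W i j w) (detInv p q Z z) =
      if i = j then kap p q (w / Z.up z : ℂ) • T (-wt i) else 0 := by
  rw [pair_of_mem (L_mem i j w), act_L, actL_detInv]
  split_ifs
  · rw [map_smul, counit_detInv, smul_mul_assoc, one_mul]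
  · rw [map_zero, zero_mul]

theorem pair_detInv (w : W.carrier) (a : Ell p q Z) :
    pair p W Z (detInv p q W w) a = counit p q Z (scale p (kapUnit p Z w) a) := by
  rw [pair_of_mem (detInv_mem w), act_detInv, neg_zero, T_zero, mul_one]

theorem pair_detInv_L (i j : Fin 2) (w : W.carrier) (z : Z.carrier) :
    pair p W Z (detInv p q W w) (L p q Z i j z) =
      if i = j then kap p q (w / z : ℂ) • T (-wt i) else 0 := by
  rw [pair_detInv, scale_L, map_smul, counit_L]
  split_ifs
  · rfl
  · rw [smul_zero]

theorem pair_hasGeneratorValues : HasGeneratorValues p q W Z (pair p W Z) where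
  L_L i j k l w z := by rw [pair_L_L, of_ellR p q (spectral_div_ne_zero w z)]
  L_detInv i j w z := by
    rw [pair_L_detInv, Mero.of_const, T, smul_term, Algebra.algebraMap_eq_smul_one, kap, div_up',
      mul_inv_cancel_left₀ (pow_ne_zero 2 (q_ne_zero p q))]
  detInv_L i j w z := by
    rw [pair_detInv_L, Mero.of_const, T, smul_term, Algebra.algebraMap_eq_smul_one, kap]

end Ell

end EllipticU2

namespace EllipticU2

/-! ### Uniqueness of the pairing -/

theorem HopfStarData.IsSweedler.cop {A : Type*} [Ring A] [Algebra ℂ A] {H : HopfStarData A} {a : A}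
    {s : List (ℂ × A × A)} (h : H.IsSweedler a s) :
    H.cop.IsSweedler a (s.map HopfStarData.swapLegs) := by
  refine ⟨fun t ht => ?_, ?_⟩
  · obtain ⟨t, hs, rfl⟩ := List.mem_map.1 ht
    exact ⟨(h.1 t hs).2, (h.1 t hs).1⟩
  · refine (congrArg (flipTensor H.μl H.μr) h.2).trans ?_
    rw [map_list_sum, List.map_map, List.map_map]
    rfl

namespace Ell

open DiffOp

section Sweedler

variable {p q : ℝ} [GoodParams p q] {Z : SpectralSet q}

local notation "tm" => btmul (muL p q Z) (muR p q Z)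

/-- A presentation of `Δ(a)` by homogeneous elements, for `a` of bidegree `(γ, δ)`. -/
structure HomSweedler (γ δ : ℂ) (a : Ell p q Z) (s : List (ℂ × Ell p q Z × Ell p q Z)) : Prop where
  mem : a ∈ grading p q Z γ δ
  mem_fst : ∀ t ∈ s, t.2.1 ∈ grading p q Z γ t.1
  mem_snd : ∀ t ∈ s, t.2.2 ∈ grading p q Z t.1 δ
  eq : comul p q Z a = (s.map fun t => tm t.2.1 t.2.2).sum

theorem HomSweedler.isSweedler {γ δ : ℂ} {a : Ell p q Z} {s : List (ℂ × Ell p q Z × Ell p q Z)}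
    (h : HomSweedler γ δ a s) : (hopf p q Z).IsSweedler a s :=
  ⟨fun t ht => ⟨⟨γ, h.mem_fst t ht⟩, δ, h.mem_snd t ht⟩, h.eq⟩

theorem exists_homSweedler {γ δ : ℂ} {a : Ell p q Z} (ha : a ∈ grading p q Z γ δ) :
    ∃ s, HomSweedler γ δ a s := by
  suffices h : ∃ s : List (ℂ × Ell p q Z × Ell p q Z), (∀ t ∈ s, t.2.1 ∈ grading p q Z γ t.1) ∧
      (∀ t ∈ s, t.2.2 ∈ grading p q Z t.1 δ) ∧
      comul p q Z a = (s.map fun t => tm t.2.1 t.2.2).sum by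
    obtain ⟨s, h1, h2, h3⟩ := h
    exact ⟨s, ha, h1, h2, h3⟩
  refine Submodule.closure_induction (p := fun u _ => ∃ s : List (ℂ × Ell p q Z × Ell p q Z),
    (∀ t ∈ s, t.2.1 ∈ grading p q Z γ t.1) ∧ (∀ t ∈ s, t.2.2 ∈ grading p q Z t.1 δ) ∧
      u = (s.map fun t => tm t.2.1 t.2.2).sum) ⟨[], by simp⟩ ?_ ?_ (comul_mem ha)
  · rintro x y _ _ ⟨s, h1, h2, h3⟩ ⟨s', h1', h2', h3'⟩
    refine ⟨s ++ s', fun t ht => ?_, fun t ht => ?_, by simp [h3, h3']⟩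
    · exact (List.mem_append.1 ht).elim (h1 t) (h1' t)
    · exact (List.mem_append.1 ht).elim (h2 t) (h2' t)
  · rintro c _ ⟨ρ, b, d, hb, hd, rfl⟩
    refine ⟨[(ρ, c • b, d)], ?_, ?_, ?_⟩
    · simpa using Submodule.smul_mem _ c hb
    · simpa using hd
    · simp [btmul_smul_left]

theorem L_homSweedler (k l : Fin 2) (z : Z.carrier) :
    HomSweedler (wt k) (wt l) (L p q Z k l z) ((List.finRange 2).map fun x =>
      (wt x, L p q Z k x z, L p q Z x l z)) where
  mem := L_mem k l z
  mem_fst t ht := by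
    obtain ⟨x, -, rfl⟩ := List.mem_map.1 ht
    exact L_mem k x z
  mem_snd t ht := by
    obtain ⟨x, -, rfl⟩ := List.mem_map.1 ht
    exact L_mem x l z
  eq := by
    rw [comul_L, List.map_map, ← List.ofFn_eq_map, List.sum_ofFn]
    rfl

theorem detInv_homSweedler (z : Z.carrier) : HomSweedler 0 0 (detInv p q Z z)
    [(0, detInv p q Z z, detInv p q Z z)] where
  mem := detInv_mem z
  mem_fst t ht := by rw [List.mem_singleton.1 ht]; exact detInv_mem z
  mem_snd t ht := by rw [List.mem_singleton.1 ht]; exact detInv_mem z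
  eq := by simp [comul_detInv]

end Sweedler

variable {p q : ℝ} [GoodParams p q] {W Z : SpectralSet q}

/-- The properties that determine a pairing by its values on the generators. -/
structure IsMulPairing (P : Ell p q W →ₗ[ℂ] Ell p q Z →ₗ[ℂ] DiffOp) : Prop where
  muR_fst : ∀ f a, P (muR p q W f) a = mulOp f * counit p q Z a
  muL_fst : ∀ f a, P (muL p q W f) a = counit p q Z a * mulOp f
  muL_snd : ∀ f X, P X (muL p q Z f) = mulOp f * counit p q W X
  muR_snd : ∀ f X, P X (muR p q Z f) = counit p q W X * mulOp f
  mul_fst : ∀ X Y γ δ a s, HomSweedler γ δ a s →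
    P (X * Y) a = (s.map fun t => P X t.2.1 * T t.1 * P Y t.2.2).sum
  mul_snd : ∀ α β X s, HomSweedler α β X s → ∀ a b,
    P X (a * b) = (s.map fun t => P t.2.2 a * T t.1 * P t.2.1 b).sum

theorem isMulPairing_of_isPairing {P : Ell p q W →ₗ[ℂ] Ell p q Z →ₗ[ℂ] DiffOp}
    (h : IsPairing (hopf p q W).cop (hopf p q Z) P) : IsMulPairing P where
  muR_fst f a := by
    have := h.μl_fst f 1 a
    rw [mul_one, h.one_fst] at this
    exact this
  muL_fst f a := by
    have := h.μr_fst f 1 a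
    rw [one_mul, h.one_fst] at this
    exact this
  muL_snd f X := by
    have := h.μl_snd f X 1
    rw [mul_one, h.one_snd] at this
    exact this
  muR_snd f X := by
    have := h.μr_snd f X 1
    rw [one_mul, h.one_snd] at this
    exact this
  mul_fst X Y γ δ a s hs := h.mul_fst X Y a s hs.isSweedler
  mul_snd α β X s hs a b := by
    have := h.mul_snd X a b _ hs.isSweedler.cop
    rw [List.map_map] at this
    exact this

namespace IsMulPairing

variable {P P' : Ell p q W →ₗ[ℂ] Ell p q Z →ₗ[ℂ] DiffOp}

theorem one_fst (h : IsMulPairing P) (a : Ell p q Z) : P 1 a = counit p q Z a := by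
  have := h.muL_fst 1 a
  rwa [map_one (muL p q W), ← mulHom_apply, map_one mulHom, mul_one] at this

theorem one_snd (h : IsMulPairing P) (X : Ell p q W) : P X 1 = counit p q W X := by
  have := h.muL_snd 1 X
  rwa [map_one (muL p q Z), ← mulHom_apply, map_one mulHom, one_mul] at this

theorem sum_finRange {V : Type*} [AddCommMonoid V] (g : Fin 2 → V) :
    ((List.finRange 2).map g).sum = ∑ x, g x := by
  rw [← List.ofFn_eq_map, List.sum_ofFn]

/-- The representation of `ℰ` that is given by the pairing with `L(w)`. -/
def evalL (h : IsMulPairing P) (w : W.carrier) : Ell p q Z →ₐ[ℂ] Matrix (Fin 2) (Fin 2) DiffOp :=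
  AlgHom.ofLinearMap
    { toFun := fun a => Matrix.of fun j i => P (L p q W i j w) a * T (wt i)
      map_add' := fun a b => by ext j i; simp [add_mul]
      map_smul' := fun c a => by ext j i; simp }
    (by
      refine Matrix.ext fun j i => ?_
      show P (L p q W i j w) 1 * T (wt i) = _
      rw [h.one_snd, counit_L, Matrix.one_apply]
      by_cases e : i = j
      · rw [if_pos e, if_pos e.symm, T_mul_T, neg_add_cancel, T_zero]
      · rw [if_neg e, if_neg (Ne.symm e), zero_mul])
    (fun a b => by
      refine Matrix.ext fun j i => ?_
      show P (L p q W i j w) (a * b) * T (wt i) = _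
      rw [h.mul_snd _ _ _ _ (L_homSweedler i j w), List.map_map, sum_finRange, Matrix.mul_apply,
        Finset.sum_mul]
      exact Finset.sum_congr rfl fun s _ => mul_assoc ..)

theorem evalL_apply (h : IsMulPairing P) (w : W.carrier) (a : Ell p q Z) (i j : Fin 2) :
    h.evalL w a j i = P (L p q W i j w) a * T (wt i) := rfl

/-- The one-dimensional representation of `ℰ` that is given by the pairing with `det⁻¹(w)`. -/
def evalDetInv (h : IsMulPairing P) (w : W.carrier) : Ell p q Z →ₐ[ℂ] DiffOp :=
  AlgHom.ofLinearMap (P (detInv p q W w)) (by rw [h.one_snd, counit_detInv]) fun a b => by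
    rw [h.mul_snd _ _ _ _ (detInv_homSweedler w)]
    simp [T_zero]

/-- Two homomorphisms from ℰ_Z to 2×2 matrices over D agree as soon as they agree on the moment maps
and on L(z). -/
theorem eq_L (h : IsMulPairing P) (h' : IsMulPairing P')
    (hL : ∀ i j k l w z, P (L p q W i j w) (L p q Z k l z) = P' (L p q W i j w) (L p q Z k l z))
    (i j : Fin 2) (w : W.carrier) (a : Ell p q Z) : P (L p q W i j w) a = P' (L p q W i j w) a := by
  have e : h.evalL w = h'.evalL w := by
    refine algHom_ext (fun f => ?_) (fun f => ?_) fun k l z => ?_ <;> refine Matrix.ext fun j i => ?_ <;>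
      rw [evalL_apply, evalL_apply]
    · rw [h.muL_snd, h'.muL_snd]
    · rw [h.muR_snd, h'.muR_snd]
    · rw [hL]
  have e' := congrFun (congrFun (DFunLike.congr_fun e a) j) i
  rw [evalL_apply, evalL_apply] at e'
  have e'' := congrArg (· * T (-wt i)) e'
  simpa only [mul_assoc, T_mul_T, add_neg_cancel, T_zero, mul_one] using e''

theorem eq_mul (h : IsMulPairing P) (h' : IsMulPairing P') {X Y : Ell p q W}
    (hX : ∀ a, P X a = P' X a) (hY : ∀ a, P Y a = P' Y a) (a : Ell p q Z) :
    P (X * Y) a = P' (X * Y) a := by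
  refine induction_homogeneous (motive := fun a => P (X * Y) a = P' (X * Y) a) a
    (fun a b ha hb => by rw [map_add, map_add, ha, hb]) fun γ δ a ha => ?_
  obtain ⟨s, hs⟩ := exists_homSweedler ha
  rw [h.mul_fst _ _ _ _ _ _ hs, h'.mul_fst _ _ _ _ _ _ hs]
  simp only [hX, hY]

/-- The matrix of the values of `P X` on `L(z)`. -/
def matrixL (P : Ell p q W →ₗ[ℂ] Ell p q Z →ₗ[ℂ] DiffOp) (X : Ell p q W) (z : Z.carrier) :
    Matrix (Fin 2) (Fin 2) DiffOp :=
  Matrix.of fun k l => P X (L p q Z k l z) * T (wt l)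

/-- Because Δ(L) is matrix multiplication, pairing with L(z) turns products in ℰ_W into products of
matrices. Inverse elements give inverse matrices. -/
theorem matrixL_mul (h : IsMulPairing P) {X Y : Ell p q W} (hXY : X * Y = 1) (z : Z.carrier) :
    matrixL P X z * matrixL P Y z = 1 := by
  refine Matrix.ext fun k l => ?_
  rw [Matrix.mul_apply, Matrix.one_apply]
  have e := h.mul_fst X Y _ _ _ _ (L_homSweedler k l z)
  rw [hXY, h.one_fst, counit_L, List.map_map, sum_finRange] at e
  have e' := congrArg (· * T (wt l)) e
  simp only [Finset.sum_mul] at e'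
  refine Eq.trans ?_ (e'.symm.trans ?_)
  · exact Finset.sum_congr rfl fun s _ => (mul_assoc ..).symm
  · split_ifs with e
    · rw [e, T_mul_T, neg_add_cancel, T_zero]
    · rw [zero_mul]

/-- A pairing is determined by its values on the generators `L`. -/
theorem unique (h : IsMulPairing P) (h' : IsMulPairing P')
    (hL : ∀ i j k l w z, P (L p q W i j w) (L p q Z k l z) = P' (L p q W i j w) (L p q Z k l z)) :
    P = P' := by
  have eL := eq_L h h' hL
  have el : ∀ f a, P (muL p q W f) a = P' (muL p q W f) a := fun f a => by
    rw [h.muL_fst, h'.muL_fst]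
  have er : ∀ f a, P (muR p q W f) a = P' (muR p q W f) a := fun f a => by
    rw [h.muR_fst, h'.muR_fst]
  have ed : ∀ w a, P (det p q W w) a = P' (det p q W w) a := fun w =>
    eq_mul h h' (eq_mul h h' (er _) (el _)) fun a => by
      rw [map_sub, map_sub, LinearMap.sub_apply, LinearMap.sub_apply]
      exact congrArg₂ _ (eq_mul h h' (eL _ _ _) (eL _ _ _) a) (eq_mul h h' (eL _ _ _) (eL _ _ _) a)
  -- The pairing with the group-like det^{-1}(w) is a homomorphism on ℰ_Z; on L(z) its matrix is
  -- inverse to that of det(w), on which both pairings already agree.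
  have eI : ∀ w a, P (detInv p q W w) a = P' (detInv p q W w) a := fun w a => by
    have e : h.evalDetInv w = h'.evalDetInv w := by
      refine algHom_ext (fun f => ?_) (fun f => ?_) fun k l z => ?_
      · show P _ _ = P' _ _
        rw [h.muL_snd, h'.muL_snd]
      · show P _ _ = P' _ _
        rw [h.muR_snd, h'.muR_snd]
      · show P _ _ = P' _ _
        have hd : matrixL P (det p q W w) z = matrixL P' (det p q W w) z := by
          refine Matrix.ext fun k l => ?_
          show P _ _ * _ = P' _ _ * _
          rw [ed]
        have hm := left_inv_eq_right_inv (matrixL_mul h (detInv_det w) z)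
          (hd ▸ matrixL_mul h' (det_detInv w) z)
        have hm' : P (detInv p q W w) (L p q Z k l z) * T (wt l) =
            P' (detInv p q W w) (L p q Z k l z) * T (wt l) := congrFun (congrFun hm k) l
        have e'' := congrArg (· * T (-wt l)) hm'
        simpa only [mul_assoc, T_mul_T, add_neg_cancel, T_zero, mul_one] using e''
    exact DFunLike.congr_fun e a
  refine LinearMap.ext fun X => LinearMap.ext fun a => ?_
  refine induction_left (motive := fun X => ∀ a, P X a = P' X a) X
    (fun X Y hX hY a => by rw [map_add, map_add, LinearMap.add_apply, LinearMap.add_apply, hX, hY])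
    (fun c X hX a => by
      rw [map_smul, map_smul, LinearMap.smul_apply, LinearMap.smul_apply, hX])
    (fun a => by rw [h.one_fst, h'.one_fst]) (fun f X hX => eq_mul h h' (el f) hX)
    (fun f X hX => eq_mul h h' (er f) hX) (fun i j w X hX => eq_mul h h' (eL i j w) hX)
    (fun w X hX => eq_mul h h' (eI w) hX) a

end IsMulPairing

end Ell

end EllipticU2

namespace EllipticU2

/-! ### Compatibility of the pairing with the antipodes -/

theorem DiffOp.antipode_mulOp (f : Mero) : (DiffOp.mulOp f).antipode = DiffOp.mulOp f := by
  rw [DiffOp.mulOp, DiffOp.antipode_term, neg_zero, Mero.shift_zero]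

theorem DiffOp.antipode_T (α : ℂ) : (DiffOp.T α).antipode = DiffOp.T (-α) := by
  rw [DiffOp.T, DiffOp.antipode_term, map_one, DiffOp.T]

theorem DiffOp.antipode_antipode (x : DiffOp) : x.antipode.antipode = x := by
  induction x using DiffOp.induction with
  | zero => rfl
  | term f α =>
    rw [antipode_term, antipode_term, Mero.shift_shift, neg_neg, add_neg_cancel, Mero.shift_zero]
  | add x y hx hy => rw [antipode_add, antipode_add, hx, hy]

theorem DiffOp.antipode_list_sum {ι : Type*} (s : List ι) (g : ι → DiffOp) :
    (s.map g).sum.antipode = (s.map fun t => (g t).antipode).sum := by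
  have h := map_list_sum antipodeHom (s.map g)
  rw [List.map_map] at h
  exact h

namespace Ell

open DiffOp

section Sweedler

variable {p q : ℝ} [GoodParams p q] {Z : SpectralSet q}

local notation "tm" => btmul (muL p q Z) (muR p q Z)

theorem HomSweedler.anti {γ δ : ℂ} {a : Ell p q Z} {s : List (ℂ × Ell p q Z × Ell p q Z)}
    (h : HomSweedler γ δ a s) : HomSweedler (-δ) (-γ) (anti p q Z a)
      (s.map fun t => (-t.1, Ell.anti p q Z t.2.2, Ell.anti p q Z t.2.1)) where
  mem := anti_mem h.mem
  mem_fst t ht := by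
    obtain ⟨t, hs, rfl⟩ := List.mem_map.1 ht
    exact anti_mem (h.mem_snd t hs)
  mem_snd t ht := by
    obtain ⟨t, hs, rfl⟩ := List.mem_map.1 ht
    exact anti_mem (h.mem_fst t hs)
  eq := by
    rw [← antiFlip_comul, h.eq, map_list_sum, List.map_map, List.map_map]
    exact congrArg List.sum (List.map_congr_left fun t ht =>
      antiFlip_tm (h.mem_fst t ht) (h.mem_snd t ht))

end Sweedler

variable {p q : ℝ} [GoodParams p q] {W Z : SpectralSet q} [Separated p W Z]

variable (p W Z) in
/-- The pairing twisted by the antipodes. -/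
def antiPair : Ell p q W →ₗ[ℂ] Ell p q Z →ₗ[ℂ] DiffOp :=
  LinearMap.mk₂ ℂ (fun X a => (pair p W Z (anti p q W X) (anti p q Z a)).antipode)
    (fun X Y a => by rw [map_add, map_add, LinearMap.add_apply, antipode_add])
    (fun c X a => by rw [map_smul, map_smul, LinearMap.smul_apply, antipode_smul])
    (fun X a b => by rw [map_add, map_add, antipode_add])
    (fun c X a => by rw [map_smul, map_smul, antipode_smul])

theorem antiPair_apply (X : Ell p q W) (a : Ell p q Z) :
    antiPair p W Z X a = (pair p W Z (anti p q W X) (anti p q Z a)).antipode := rfl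

theorem pair_isMulPairing : IsMulPairing (pair p W Z) := isMulPairing_of_isPairing pair_isPairing

/-- On each side S reverses products and coproducts, so the factors stay correctly paired but occur
in opposite order, and the antipode of D restores the order. -/
theorem antiPair_isMulPairing : IsMulPairing (antiPair p W Z) where
  muR_fst f a := by
    rw [antiPair_apply, anti_muR, pair_isMulPairing.muL_fst, antipode_mul, antipode_mulOp,
      counit_anti, antipode_antipode]
  muL_fst f a := by
    rw [antiPair_apply, anti_muL, pair_isMulPairing.muR_fst, antipode_mul, antipode_mulOp,
      counit_anti, antipode_antipode]
  muL_snd f X := by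
    rw [antiPair_apply, anti_muL, pair_isMulPairing.muR_snd, antipode_mul, antipode_mulOp,
      counit_anti, antipode_antipode]
  muR_snd f X := by
    rw [antiPair_apply, anti_muR, pair_isMulPairing.muL_snd, antipode_mul, antipode_mulOp,
      counit_anti, antipode_antipode]
  mul_fst X Y γ δ a s hs := by
    rw [antiPair_apply, anti_mul, pair_isMulPairing.mul_fst _ _ _ _ _ _ hs.anti, List.map_map,
      antipode_list_sum]
    refine congrArg List.sum (List.map_congr_left fun t _ => ?_)
    simp only [Function.comp_apply, antipode_mul, antipode_T, neg_neg, mul_assoc, antiPair_apply]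
  mul_snd α β X s hs a b := by
    rw [antiPair_apply, anti_mul, pair_isMulPairing.mul_snd _ _ _ _ hs.anti, List.map_map,
      antipode_list_sum]
    refine congrArg List.sum (List.map_congr_left fun t _ => ?_)
    simp only [Function.comp_apply, antipode_mul, antipode_T, neg_neg, mul_assoc, antiPair_apply]

theorem eps0_L (k x : Fin 2) (z : Z.carrier) :
    eps0 p q Z (L p q Z k x z) = if k = x then 1 else 0 := by
  have h := eps0_L_mul (p := p) k x z 1
  rwa [mul_one, eps0_one, map_one] at h

theorem act_antiL_antiL (i j k l : Fin 2) (w : W.carrier) (z : Z.carrier) :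
    act p W Z (antiL p q W i j w) (antiL p q Z k l z) = (sg i * sg j * (sg k * sg l)) •
      (muR p q Z (FM p q * Mero.shift (wt i) (FM p q)) * (muL p q Z (FMi p q) *
        (detInv p q Z (Z.down z) * ∑ x, muR p q Z (RM p q (w / z : ℂ) i.rev k.rev j.rev x *
          Mero.shift (-wt x) (FMi p q)) * L p q Z l.rev x (Z.down z)))) := by
  have e1 : (W.down w / Z.down z : ℂ) = w / z := by
    show ((q : ℂ) ^ 2)⁻¹ * w / (((q : ℂ) ^ 2)⁻¹ * z) = _
    exact mul_div_mul_left _ _ (inv_ne_zero (pow_ne_zero 2 (q_ne_zero p q)))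
  have hk := kap_ne_zero (p := p) (W.down w) (Z.up (Z.down z))
  have hk' := kap_ne_zero (p := p) (W.down w) (Z.down z)
  rw [antiL, antiL, map_smul (act p W Z), LinearMap.smul_apply, map_smul, smul_smul, FF_eq, FF_eq]
  congr 1
  simp only [map_mul (act p W Z), Module.End.mul_apply, act_muR, act_muL, act_L, act_detInv,
    mul_assoc, actL_muR_mul, actL_muL_mul]
  rw [actL_mul, Finset.sum_eq_single i.rev, actL_detInv, if_pos rfl, actL_L, e1]
  · simp only [map_mul, map_smul, map_sum, scale_muR, scale_muL, scale_detInv, scale_L,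
      smul_mul_assoc, mul_smul_comm, smul_smul, ← Finset.smul_sum]
    -- The scalars from L(q^{-2}w) acting on det^{-1}(q^{-2}z), and from det^{-1}(q^{-2}w) rescaling
    -- L(q^{-2}z) and det^{-1}(q^{-2}z), cancel.
    rw [show kap p q (W.down w / Z.up (Z.down z) : ℂ) * (kapUnit p Z (W.down w) (Z.down z) *
      ((kapUnit p Z (W.down w) (Z.down z) : ℂ) * kapUnit p Z (W.down w) (Z.up (Z.down z)))⁻¹) = 1 by
        simp only [kapUnit, Units.val_mk0]
        field_simp, one_smul, wt_rev, neg_neg]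
    simp only [mul_assoc, Finset.sum_mul, L_mul_muR]
  · intro s _ hs
    rw [actL_detInv, if_neg hs, zero_mul]
  · simp

/-- The factors F from the two antipodes are those of `shift_FM_mul_rM`, and the remaining shift is
undone by the antipode of D. -/
theorem antiPair_L_L (i j k l : Fin 2) (w : W.carrier) (z : Z.carrier) :
    antiPair p W Z (L p q W i j w) (L p q Z k l z) =
      pair p W Z (L p q W i j w) (L p q Z k l z) := by
  rw [antiPair_apply, anti_L, anti_L, pair_eq_term (antiL_mem i j w) (antiL_mem k l z),
    act_antiL_antiL, pair_L_L, antipode_term, map_smul]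
  simp only [eps0_muR_mul, eps0_muL_mul, eps0_detInv_mul, map_sum, eps0_L]
  rw [Finset.sum_eq_single l.rev (fun x _ hx => by rw [if_neg (Ne.symm hx), mul_zero]) (by simp),
    if_pos rfl, mul_one, wt_rev, neg_neg (wt l)]
  by_cases h : wt j + wt l = wt i + wt k
  · have e := shift_FM_mul_rM p q (spectral_div_ne_zero w z) j l i k
    have e1 : FM p q * FMi p q = 1 := FM_mul_FMi ..
    have e2 := shift_FMi_mul p q (wt l)
    have e3 : sg i * sg j * (sg k * sg l) = 1 := by
      rw [mul_mul_mul_comm, ← sg_mul_sg h, mul_mul_mul_comm, sg_mul_self, sg_mul_self, one_mul]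
    rw [e3, one_smul, show FM p q * Mero.shift (wt i) (FM p q) * (FMi p q *
      (RM p q (w / z : ℂ) i.rev k.rev j.rev l.rev * Mero.shift (wt l) (FMi p q))) =
      Mero.shift (wt i + wt k) (RM p q (w / z : ℂ) j l i k) by
        rw [RM, RM, ← Mero.shiftₐ_apply (wt i + wt k), map_smul, Mero.shiftₐ_apply,
          smul_mul_assoc, mul_smul_comm, mul_smul_comm]
        congr 1
        linear_combination (Mero.shift (wt i) (FM p q) * rM p q (w / z : ℂ) i.rev k.rev j.rev l.rev *
          Mero.shift (wt l) (FMi p q)) * e1 - Mero.shift (wt l) (FMi p q) * e +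
          Mero.shift (wt i + wt k) (rM p q (w / z : ℂ) j l i k) * e2,
      Mero.shift_shift, ← h]
    congr 1
    · rw [show _ + _ = (0 : ℂ) by ring, Mero.shift_zero]
    · linear_combination -h
  · rw [RM_eq_zero h, RM_eq_zero (by
      rw [wt_rev, wt_rev, wt_rev, wt_rev]
      exact fun h' => h (by linear_combination h'))]
    simp [term]

theorem antiPair_eq_pair : antiPair p W Z = pair p W Z :=
  antiPair_isMulPairing.unique pair_isMulPairing antiPair_L_L

theorem pair_antiEquiv_symm (X : Ell p q W) (a : Ell p q Z) :
    pair p W Z ((antiEquiv p q W).symm X) a = (pair p W Z X (anti p q Z a)).antipode := by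
  rw [← antiPair_eq_pair, antiPair_apply, ← antiEquiv_apply, LinearEquiv.apply_symm_apply,
    antiPair_eq_pair]

end Ell

end EllipticU2

namespace EllipticU2

/-! ### The crossing symmetry of the R-matrix -/

section Crossing

open Filter GoodParams

variable (p q : ℝ) [GoodParams p q]

/-- Because q²xu = 1, the arguments q^{2(l+2)}u and q^{-2(l+1)}x of the two theta factors are
inverse to each other, and `theta_inv` compares them. -/
theorem shift_FM_mul_rM_one_zero {x u : ℂ} (hx : x ≠ 0) (hu : (q : ℂ) ^ 2 * (x * u) = 1) :
    ((q : ℂ) * x) • Mero.shift 1 (FM p q * rM p q u 0 1 1 0) = FM p q * rM p q x 1 0 0 1 := by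
  have hq := q_ne_zero p q
  have hu0 : u ≠ 0 := by rintro rfl; simp at hu
  have mF := @meromorphic_Ffun p q _
  have m1 := meromorphic_ellRnum (p := p) (q := q) hu0 0 1 1 0
  have m2 := meromorphic_ellRnum (p := p) (q := q) hx 1 0 0 1
  rw [FM, rM, rM, Mero.of_mul mF m1, Mero.of_mul mF m2, Mero.shift_of (mF.fun_mul m1),
    Algebra.smul_def, ← Mero.of_const,
    Mero.of_mul (Meromorphic.const _) (meromorphic_shift 1 (mF.fun_mul m1))]
  refine Mero.of_congr ((Meromorphic.const _).fun_mul (meromorphic_shift 1 (mF.fun_mul m1))) ?_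
  filter_upwards [eventually_brk_ne_zero (p := p) (q := q) 1,
    eventually_brk_ne_zero (p := p) (q := q) 2] with l h1 h2
  have c1 := q_cpow_ne_zero p q (l + 1)
  have c2 := q_cpow_ne_zero p q (-(l + 1))
  show (q : ℂ) * x * (Ffun p q (l + 1) * (theta p ((q : ℂ) ^ 2) *
      theta p ((q : ℂ) ^ (2 * (l + 1 + 1)) * u) / theta p ((q : ℂ) ^ (2 * (l + 1 + 1))))) =
    Ffun p q l * (theta p ((q : ℂ) ^ 2) * theta p ((q : ℂ) ^ (-2 * (l + 1)) * x) /
      theta p ((q : ℂ) ^ (-2 * (l + 1))))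
  have e1 : (q : ℂ) ^ (2 * (l + 1 + 1)) = (q : ℂ) ^ (l + 1) * (q : ℂ) ^ (l + 1) * (q : ℂ) ^ 2 := by
    rw [← Complex.cpow_add _ _ hq, ← Complex.cpow_natCast, ← Complex.cpow_add _ _ hq]
    congr 1; push_cast; ring
  have e2 : (q : ℂ) ^ (-2 * (l + 1)) = ((q : ℂ) ^ (l + 1) * (q : ℂ) ^ (l + 1))⁻¹ := by
    rw [← Complex.cpow_add _ _ hq, ← Complex.cpow_neg]
    congr 1; ring
  have e3 : (q : ℂ) ^ (2 * (l + 1 + 1)) * u = ((q : ℂ) ^ (-2 * (l + 1)) * x)⁻¹ := by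
    rw [e1, e2, mul_inv, inv_inv]
    field_simp
    linear_combination hu
  have h3 : (q : ℂ) ^ (-2 * (l + 1)) * x ≠ 0 := by
    rw [e2]; exact mul_ne_zero (inv_ne_zero (mul_ne_zero c1 c1)) hx
  rw [e3, theta_inv (p_pos q) (p_lt_one q) h3, Ffun_eq_brk, Ffun_eq_brk, theta_cpow,
    show theta p ((q : ℂ) ^ (-2 * (l + 1))) = -((q : ℂ) ^ (-(l + 1)) * brk p q (l + 1)) by
      rw [← mul_neg, ← brk_neg', ← theta_cpow]; congr 2; ring,
    Complex.cpow_add (l + 1) 1 hq, Complex.cpow_one, Complex.cpow_neg]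
  rw [show l + 2 = l + 1 + 1 by ring] at h2
  generalize theta p ((q : ℂ) ^ (-2 * (l + 1)) * x) = t
  rw [e2]
  field_simp

/-- The crossing symmetry of the R-matrix. -/
theorem crossing_rM {x u : ℂ} (hx : x ≠ 0) (hu : (q : ℂ) ^ 2 * (x * u) = 1) (i j k l : Fin 2) :
    (sg k * sg l * -(q * x)) • Mero.shift (-wt k) (FM p q * rM p q u i l.rev j k.rev) =
      FM p q * rM p q x j l i k := by
  have hq := q_ne_zero p q
  have hu0 : u ≠ 0 := by rintro rfl; simp at hu
  have e1 : (q : ℂ) ^ 2 * x = u⁻¹ := eq_inv_of_mul_eq_one_left (by linear_combination hu)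
  have e2 : theta p ((q : ℂ) ^ 2 * x) = -((q : ℂ) ^ 2 * x) * theta p u := by
    rw [e1, theta_inv (p_pos q) (p_lt_one q) hu0]
  have e3 : theta p ((q : ℂ) ^ 2 * u) = -x⁻¹ * theta p x := by
    rw [← theta_inv (p_pos q) (p_lt_one q) hx]
    congr 1
    exact eq_inv_of_mul_eq_one_left (by linear_combination hu)
  have h01 := FM_mul_rM_zero_one p q hu0
  have h10 := FM_mul_rM_one_zero p q hu0
  by_cases h : wt j + wt l = wt i + wt k
  · have s0 : ∀ (c : ℂ) f, c • Mero.shift (-1) (Mero.shift 1 f) = c • f := fun c f => by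
      rw [Mero.shift_shift, neg_add_cancel, Mero.shift_zero]
    have s1 : ∀ (c : ℂ) f, c • Mero.shift 1 (Mero.shift (-1) f) = c • f := fun c f => by
      rw [Mero.shift_shift, add_neg_cancel, Mero.shift_zero]
    have w0 : -wt 0 = -1 := rfl
    have w1 : -wt 1 = 1 := neg_neg 1
    have s00 : sg 0 * sg 0 * -(q * x) = -(q * x) := by rw [sg_mul_self, one_mul]
    have s11 : sg 1 * sg 1 * -(q * x) = -(q * x) := by rw [sg_mul_self, one_mul]
    have s10 : sg 1 * sg 0 * -(q * x) = q * x := by rw [sg_zero, sg_one]; ring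
    have s01 : sg 0 * sg 1 * -(q * x) = q * x := by rw [sg_zero, sg_one]; ring
    -- Crossing exchanges the constant entries with the other diagonal ones, and the two
    -- off-diagonal entries with each other.
    have a0 : (sg 0 * sg 0 * -(q * x)) • Mero.shift (-wt 0) (FM p q * rM p q u 0 1 0 1) =
        FM p q * rM p q x 0 0 0 0 := by
      rw [s00, w0, h01, Mero.shift_smul, s0, rM_zero_zero, e2, mul_comm (FM p q), ← Algebra.smul_def,
        smul_smul]
      congr 1; ring
    have a1 : (sg 1 * sg 1 * -(q * x)) • Mero.shift (-wt 1) (FM p q * rM p q u 1 0 1 0) =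
        FM p q * rM p q x 1 1 1 1 := by
      rw [s11, w1, h10, Mero.shift_smul, s1, rM_one_one, e2, mul_comm (FM p q), ← Algebra.smul_def,
        smul_smul]
      congr 1; ring
    have b1 : (sg 1 * sg 1 * -(q * x)) • Mero.shift (-wt 1) (FM p q * rM p q u 0 0 0 0) =
        FM p q * rM p q x 0 1 0 1 := by
      rw [s11, w1, FM_mul_rM_zero_one p q hx, rM_zero_zero, mul_comm (FM p q), ← Algebra.smul_def,
        Mero.shift_smul, smul_smul, e3]
      congr 1; field_simp
    have b0 : (sg 0 * sg 0 * -(q * x)) • Mero.shift (-wt 0) (FM p q * rM p q u 1 1 1 1) =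
        FM p q * rM p q x 1 0 1 0 := by
      rw [s00, w0, FM_mul_rM_one_zero p q hx, rM_one_one, mul_comm (FM p q), ← Algebra.smul_def,
        Mero.shift_smul, smul_smul, e3]
      congr 1; field_simp
    have c1 : (sg 1 * sg 0 * -(q * x)) • Mero.shift (-wt 1) (FM p q * rM p q u 0 1 1 0) =
        FM p q * rM p q x 1 0 0 1 := by
      rw [s10, w1, shift_FM_mul_rM_one_zero p q hx hu]
    have c0 : (sg 0 * sg 1 * -(q * x)) • Mero.shift (-wt 0) (FM p q * rM p q u 1 0 0 1) =
        FM p q * rM p q x 0 1 1 0 := by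
      rw [s01, w0, ← shift_FM_mul_rM_one_zero p q hu0 (by rw [mul_comm u, hu]), Mero.shift_smul, s0,
        smul_smul, show (q : ℂ) * x * (q * u) = 1 by linear_combination hu, one_smul]
    revert h
    fin_cases i <;> fin_cases j <;> fin_cases k <;> fin_cases l <;> intro h <;>
      first
      | (exfalso; norm_num [wt] at h; done)
      | exact a0
      | exact a1
      | exact b0
      | exact b1
      | exact c0
      | exact c1
  · rw [rM_eq_zero h, rM_eq_zero fun h' => h (by
      rw [wt_rev, wt_rev] at h'; linear_combination -h'), mul_zero, map_zero, smul_zero]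

end Crossing

end EllipticU2

namespace EllipticU2

/-! ### Compatibility of the pairing with the `*`-operators -/

namespace DiffOp

/-- The conjugation `f T_α ↦ f̄ T_ᾱ`. -/
def bar (x : DiffOp) : DiffOp := x.antipode.star

@[simp] theorem bar_term (f : Mero) (α : ℂ) : bar (term f α) = term (Mero.bar f) (conj α) := by
  rw [bar, antipode_term, star_term, map_neg, neg_neg, Mero.bar_shift, Mero.shift_shift, map_neg,
    add_neg_cancel, Mero.shift_zero]

theorem bar_add (x y : DiffOp) : bar (x + y) = bar x + bar y := by
  rw [bar, antipode_add, star_add, bar, bar]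

theorem bar_mul (x y : DiffOp) : bar (x * y) = bar x * bar y := by
  rw [bar, antipode_mul, star_mul, bar, bar]

theorem bar_smul (c : ℂ) (x : DiffOp) : bar (c • x) = conj c • bar x := by
  rw [bar, antipode_smul, star_smul, bar]

theorem bar_T (α : ℂ) : bar (T α) = T (conj α) := by rw [T, bar_term, map_one, T]

theorem bar_mulOp (f : Mero) : bar (mulOp f) = mulOp (Mero.bar f) := by
  rw [mulOp, bar_term, map_zero, mulOp]

theorem star_star (x : DiffOp) : x.star.star = x := by
  induction x using DiffOp.induction with
  | zero => rfl
  | term f α =>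
    rw [star_term, star_term, Mero.bar_shift, Mero.bar_bar, Mero.shift_shift, map_neg, neg_neg,
      Complex.conj_conj, add_neg_cancel, Mero.shift_zero]
  | add x y hx hy => rw [star_add, star_add, hx, hy]

theorem bar_list_sum {ι : Type*} (s : List ι) (g : ι → DiffOp) :
    bar (s.map g).sum = (s.map fun t => bar (g t)).sum := by
  induction s with
  | nil => rfl
  | cons t s ih => rw [List.map_cons, List.sum_cons, bar_add, ih, List.map_cons, List.sum_cons]

end DiffOp

namespace Ell

open DiffOp

section Sweedler

variable {p q : ℝ} [GoodParams p q] {Z : SpectralSet q}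

theorem HomSweedler.st {γ δ : ℂ} {a : Ell p q Z} {s : List (ℂ × Ell p q Z × Ell p q Z)}
    (h : HomSweedler γ δ a s) : HomSweedler (-conj γ) (-conj δ) (st p q Z a)
      (s.map fun t => (-conj t.1, Ell.st p q Z t.2.1, Ell.st p q Z t.2.2)) where
  mem := st_mem h.mem
  mem_fst t ht := by
    obtain ⟨t, hs, rfl⟩ := List.mem_map.1 ht
    exact st_mem (h.mem_fst t hs)
  mem_snd t ht := by
    obtain ⟨t, hs, rfl⟩ := List.mem_map.1 ht
    exact st_mem (h.mem_snd t hs)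
  eq := by
    apply ConjMod.of.injective
    rw [← stMap_comul, h.eq, map_list_sum, List.map_map, List.map_map, map_list_sum, List.map_map]
    exact congrArg List.sum (List.map_congr_left fun t ht =>
      stMap_tm (h.mem_fst t ht) (h.mem_snd t ht))

theorem counit_eq_bar {γ δ : ℂ} {a : Ell p q Z} (ha : a ∈ grading p q Z γ δ) :
    T (-γ) * bar (counit p q Z (st p q Z a)) * T (-δ) = counit p q Z a := by
  obtain ⟨f, h1, h2⟩ := counit_mem ha
  rw [counit_st, h1, star_term, bar_term, map_neg, neg_neg, Mero.bar_shift, Mero.bar_bar,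
    Complex.conj_conj]
  by_cases h : γ = δ
  · subst h
    simp only [T, term_mul_term, one_mul, map_one, mul_one, Mero.shift_shift, neg_add_cancel,
      Mero.shift_zero, zero_add]
  · rw [h2 h]; simp [term]

end Sweedler

variable {p q : ℝ} [GoodParams p q] {W Z : SpectralSet q} [Separated p W Z]

variable (p W Z) in
/-- The pairing twisted by the `*`-operators. -/
def starPair : Ell p q W →ₗ[ℂ] Ell p q Z →ₗ[ℂ] DiffOp :=
  (gradedLift fun i => LinearMap.mk₂ ℂ (fun a X =>
      T (-i.1) * bar (pair p W Z (anti p q W (st p q W X)) (st p q Z a)) * T (-i.2))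
    (fun a b X => by rw [map_add, map_add, bar_add, mul_add, add_mul])
    (fun c a X => by
      rw [st_smul, map_smul, bar_smul, Complex.conj_conj, mul_smul_comm, smul_mul_assoc])
    (fun a X Y => by rw [map_add, map_add, map_add, LinearMap.add_apply, bar_add, mul_add, add_mul])
    (fun c a X => by rw [st_smul, map_smul, map_smul, LinearMap.smul_apply, bar_smul,
      Complex.conj_conj, mul_smul_comm, smul_mul_assoc])).flip

theorem starPair_of_mem {γ δ : ℂ} {a : Ell p q Z} (ha : a ∈ grading p q Z γ δ) (X : Ell p q W) :
    starPair p W Z X a =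
      T (-γ) * bar (pair p W Z (anti p q W (st p q W X)) (st p q Z a)) * T (-δ) := by
  rw [starPair, LinearMap.flip_apply, gradedLift_of_mem _ ha, LinearMap.mk₂_apply]

/-- Each pairing is a single term fT, so interchanging the two factors only requires the shifts of
their coefficients to agree. They do by the degree condition, unless a factor is zero. -/
theorem starPair_mul_T_mul {α β ρ γ δ γ' δ' : ℂ} {X Y : Ell p q W} {a b : Ell p q Z}
    (hX : X ∈ grading p q W α ρ) (hY : Y ∈ grading p q W ρ β) (ha : a ∈ grading p q Z γ δ)
    (hb : b ∈ grading p q Z γ' δ') :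
    T (-(γ + γ')) * (bar (pair p W Z (anti p q W (st p q W X)) (st p q Z b)) * T ρ *
        bar (pair p W Z (anti p q W (st p q W Y)) (st p q Z a))) * T (-(δ + δ')) =
      starPair p W Z Y a * T ρ * starPair p W Z X b := by
  have hX' := anti_mem (st_mem hX)
  have hY' := anti_mem (st_mem hY)
  rw [starPair_of_mem ha, starPair_of_mem hb, pair_eq_term hX' (st_mem hb)]
  obtain ⟨f, h1, h2⟩ := (pair_target hY' (st_mem ha)).symm
  rw [h1]
  by_cases h : conj β - conj γ = conj ρ - conj δ
  · have h' : β - γ = ρ - δ := by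
      have := congrArg conj h
      simpa using this
    simp only [bar_term, T, term_mul_term, map_mul, map_one, mul_one, one_mul, Mero.shift_shift]
    simp only [map_neg, map_add, neg_neg, Complex.conj_conj]
    rw [mul_comm, show ρ = β - γ + δ by rw [h']; ring]
    ring_nf
  · rw [h2 (by intro h'; exact h (by linear_combination h'))]
    rw [show term (0 : Mero) _ = 0 from SkewMonoidAlgebra.single_zero _, show bar 0 = 0 from rfl]
    simp only [mul_zero, zero_mul]

/-- On the first argument S∘* preserves products and reverses coproducts; on the second one *
reverses products and preserves coproducts; `bar` is multiplicative. Hence the first product rule is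
immediate, and the second holds after the interchange `starPair_mul_T_mul`. -/
theorem starPair_isMulPairing : IsMulPairing (starPair p W Z) where
  muR_fst f a := by
    refine induction_homogeneous (motive := fun a => starPair p W Z (muR p q W f) a =
      mulOp f * counit p q Z a) a (fun a b ha hb => by rw [map_add, ha, hb, map_add, mul_add])
      fun γ δ a ha => ?_
    rw [starPair_of_mem ha, st_muR, anti_muR, pair_isMulPairing.muL_fst, bar_mul, bar_mulOp,
      Mero.bar_bar, ← counit_eq_bar ha, (counit_mem (st_mem ha)).eq_term, bar_term, mulOp]
    simp only [T, term_mul_term, map_one, mul_one, one_mul, map_mul, Mero.shift_shift,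
      Complex.conj_conj, neg_neg, add_zero, zero_add, Mero.shift_zero, neg_add_cancel]
    rw [mul_comm]
  muL_fst f a := by
    refine induction_homogeneous (motive := fun a => starPair p W Z (muL p q W f) a =
      counit p q Z a * mulOp f) a (fun a b ha hb => by rw [map_add, ha, hb, map_add, add_mul])
      fun γ δ a ha => ?_
    rw [starPair_of_mem ha, st_muL, anti_muL, pair_isMulPairing.muR_fst, bar_mul, bar_mulOp,
      Mero.bar_bar, ← counit_eq_bar ha]
    obtain ⟨g, h1, h2⟩ := counit_mem (st_mem ha)
    rw [h1]
    by_cases h : γ = δ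
    · subst h
      rw [bar_term, mulOp]
      simp only [T, term_mul_term, map_one, mul_one, one_mul, map_mul, Mero.shift_shift,
        Complex.conj_conj, neg_neg, add_zero, zero_add, neg_add_cancel]
      rw [mul_comm]
    · rw [h2 fun h' => h ((starRingEnd ℂ).injective (neg_injective h')),
        show term (0 : Mero) _ = 0 from SkewMonoidAlgebra.single_zero _, show bar 0 = 0 from rfl]
      simp only [mul_zero, zero_mul]
  muL_snd f X := by
    rw [starPair_of_mem (muL_mem f), st_muL, pair_isMulPairing.muL_snd, bar_mul, bar_mulOp,
      Mero.bar_bar, counit_anti, counit_st, bar, antipode_antipode, star_star, neg_zero, T,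
      term_one_zero, one_mul, mul_one]
  muR_snd f X := by
    rw [starPair_of_mem (muR_mem f), st_muR, pair_isMulPairing.muR_snd, bar_mul, bar_mulOp,
      Mero.bar_bar, counit_anti, counit_st, bar, antipode_antipode, star_star, neg_zero, T,
      term_one_zero, one_mul, mul_one]
  mul_fst X Y γ δ a s hs := by
    rw [starPair_of_mem hs.mem, st_mul, anti_mul, pair_isMulPairing.mul_fst _ _ _ _ _ _ hs.st,
      List.map_map, bar_list_sum, ← List.sum_map_mul_left, ← List.sum_map_mul_right]
    refine congrArg List.sum (List.map_congr_left fun t ht => ?_)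
    rw [starPair_of_mem (hs.mem_fst t ht), starPair_of_mem (hs.mem_snd t ht)]
    simp only [Function.comp_apply, bar_mul, bar_T, map_neg, Complex.conj_conj, mul_assoc]
    rw [← mul_assoc (T t.1) (T (-t.1)), T_mul_T, add_neg_cancel, show T 0 = 1 from term_one_zero,
      one_mul]
  mul_snd α β X s hs a b := by
    refine induction_homogeneous (motive := fun a => starPair p W Z X (a * b) =
      (s.map fun t => starPair p W Z t.2.2 a * T t.1 * starPair p W Z t.2.1 b).sum) a
      (fun a a' ha ha' => by simp only [add_mul, map_add, ha, ha', List.sum_map_add])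
      fun γ δ a ha => ?_
    refine induction_homogeneous (motive := fun b => starPair p W Z X (a * b) =
      (s.map fun t => starPair p W Z t.2.2 a * T t.1 * starPair p W Z t.2.1 b).sum) b
      (fun b b' hb hb' => by simp only [mul_add, map_add, hb, hb', List.sum_map_add])
      fun γ' δ' b hb => ?_
    rw [starPair_of_mem (mul_mem_grading ha hb), st_mul,
      pair_isMulPairing.mul_snd _ _ _ _ hs.st.anti, List.map_map, List.map_map, bar_list_sum,
      ← List.sum_map_mul_left, ← List.sum_map_mul_right]
    refine congrArg List.sum (List.map_congr_left fun t ht => ?_)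
    rw [← starPair_mul_T_mul (hs.mem_fst t ht) (hs.mem_snd t ht) ha hb]
    simp only [Function.comp_apply, bar_mul, bar_T, neg_neg, Complex.conj_conj]

theorem anti_st_L (i j : Fin 2) (w : W.carrier) : anti p q W (st p q W (L p q W i j w)) =
    FF p q W * detInv p q W (W.down (W.refl w)) * L p q W j i (W.down (W.refl w)) := by
  rw [st_L, starL, map_smul, anti_L, antiL, smul_smul, Fin.rev_rev, Fin.rev_rev, sg_rev, sg_rev,
    neg_mul_neg, mul_mul_mul_comm, sg_mul_self, sg_mul_self, one_mul, one_smul]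

theorem act_anti_st_L (i j k l : Fin 2) (w : W.carrier) (z : Z.carrier) :
    act p W Z (anti p q W (st p q W (L p q W i j w))) (st p q Z (L p q Z k l z)) =
      (sg k * sg l * kap p q (W.down (W.refl w) / Z.refl z : ℂ)) • ∑ x, muR p q Z (FM p q *
        RM p q (W.down (W.refl w) / Z.refl z : ℂ) i l.rev j x * Mero.shift (-wt x) (FMi p q)) *
          L p q Z k.rev x (Z.refl z) := by
  rw [anti_st_L, st_L, starL, map_smul, mul_smul (sg k * sg l), FF_eq]
  congr 1
  simp only [map_mul (act p W Z), Module.End.mul_apply, act_muR, act_muL, act_L, act_detInv, actL_L,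
    map_sum, map_mul, scale_muR, scale_L, Finset.smul_sum]
  refine Finset.sum_congr rfl fun x _ => ?_
  simp only [mul_smul_comm, smul_mul_assoc, mul_assoc, L_mul_muR]
  rfl

/-- The twisted value contains the R-matrix at y = q^{-2} z̄/w̄. For x = w/z this means q² x ȳ = 1,
so crossing applies; the factor `kap` adjusts the spectral denominator. -/
theorem starPair_L_L (i j k l : Fin 2) (w : W.carrier) (z : Z.carrier) :
    starPair p W Z (L p q W i j w) (L p q Z k l z) =
      pair p W Z (L p q W i j w) (L p q Z k l z) := by
  rw [starPair_of_mem (L_mem k l z), pair_eq_term (anti_mem (st_mem (L_mem i j w)))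
    (st_mem (L_mem k l z)), act_anti_st_L, pair_L_L, map_smul]
  simp only [eps0_muR_mul, map_sum, eps0_L]
  rw [Finset.sum_eq_single k.rev (fun x _ hx => by rw [if_neg (Ne.symm hx), mul_zero]) (by simp),
    if_pos rfl, mul_one, wt_rev, neg_neg (wt k), bar_term]
  have hy := spectral_div_ne_zero (W.down (W.refl w)) (Z.refl z)
  have hty := theta_div_ne_zero p (W.down (W.refl w)) (Z.refl z)
  have hx := spectral_div_ne_zero w z
  have hqy := theta_up_div_ne_zero p (W.down (W.refl w)) (Z.refl z)
  have hu : (q : ℂ) ^ 2 * ((w / z : ℂ) * conj (W.down (W.refl w) / Z.refl z : ℂ)) = 1 := by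
    have hq := q_ne_zero p q
    have h1 := div_ne_zero_iff.1 hx
    show (q : ℂ) ^ 2 * ((w / z : ℂ) * conj (((q : ℂ) ^ 2)⁻¹ * (conj (w : ℂ))⁻¹ /
      (conj (z : ℂ))⁻¹)) = 1
    simp only [map_div₀, map_mul, map_inv₀, map_pow, Complex.conj_ofReal, Complex.conj_conj]
    field_simp [h1.1, h1.2]
  generalize (W.down (W.refl w) / Z.refl z : ℂ) = y at *
  generalize (w / z : ℂ) = x at *
  have hux := crossing_rM p q hx hu i j k l
  have htx : theta p ((q : ℂ) ^ 2 * x) = -((q : ℂ) ^ 2 * x) * theta p (conj y) := by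
    have hy' : conj y ≠ 0 := fun h => hy ((map_eq_zero _).1 h)
    rw [show (q : ℂ) ^ 2 * x = (conj y)⁻¹ from eq_inv_of_mul_eq_one_left (by linear_combination hu),
      theta_inv (GoodParams.p_pos q) (GoodParams.p_lt_one q) hy']
  have hty' : theta p (conj y) ≠ 0 := by
    rw [theta_conj (GoodParams.p_pos q) (GoodParams.p_lt_one q)]
    exact fun h => hty ((map_eq_zero _).1 h)
  have hc : (sg k * sg l * kap p q y) • (FM p q * RM p q y i l.rev j k.rev *
      Mero.shift (wt k) (FMi p q)) = (sg k * sg l * ((q : ℂ)⁻¹ * (theta p y)⁻¹)) •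
        (FM p q * rM p q y i l.rev j k.rev * Mero.shift (wt k) (FMi p q)) := by
    rw [RM, mul_smul_comm, smul_mul_assoc, smul_smul, kap]
    congr 1
    field_simp
  have hR : RM p q x j l i k = (sg k * sg l * ((q : ℂ)⁻¹ * (theta p (conj y))⁻¹)) •
      (Mero.shift (-wt k) (FM p q * rM p q (conj y) i l.rev j k.rev) * FMi p q) := by
    have e : RM p q x j l i k =
        (theta p ((q : ℂ) ^ 2 * x))⁻¹ • (FM p q * rM p q x j l i k * FMi p q) := by
      rw [mul_right_comm, FM_mul_FMi, one_mul, RM]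
    rw [e, ← hux, smul_mul_assoc, smul_smul, htx]
    congr 1
    have hq := q_ne_zero p q
    field_simp
  rw [hc, Mero.bar_smul, T_mul_term, term_mul_T, show Mero.shift (-wt k) (_ • _) =
      RM p q x j l i k by
    rw [hR, Mero.shift_smul]
    simp only [map_mul, map_inv₀, conj_sg, Complex.conj_ofReal, bar_FM, bar_rM p q hy,
      Mero.bar_shift, conj_wt, bar_FMi, Mero.shift_shift, neg_add_cancel, Mero.shift_zero,
      theta_conj (GoodParams.p_pos q) (GoodParams.p_lt_one q)]]
  by_cases h : wt j + wt l = wt i + wt k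
  · congr 1
    simp only [map_neg, map_add, neg_neg, conj_wt]
    linear_combination -h
  · rw [RM_eq_zero h, show term (0 : Mero) _ = 0 from SkewMonoidAlgebra.single_zero _,
      show term (0 : Mero) _ = 0 from SkewMonoidAlgebra.single_zero _]

theorem starPair_eq_pair : starPair p W Z = pair p W Z :=
  starPair_isMulPairing.unique pair_isMulPairing starPair_L_L

/-- Invariance under the star twist, applied to X^*, gives ⟨S(X), a^*⟩. Since a^* = S(S(a)^*),
invariance under the antipode twist reduces this to ⟨X, S(a)^*⟩. -/
theorem pair_st {γ δ : ℂ} {a : Ell p q Z} (ha : a ∈ grading p q Z γ δ) (X : Ell p q W) :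
    pair p W Z (st p q W X) a =
      T (-γ) * (pair p W Z X (st p q Z (anti p q Z a))).star * T (-δ) := by
  have h : antiPair p W Z X (st p q Z (anti p q Z a)) = pair p W Z X (st p q Z (anti p q Z a)) := by
    rw [antiPair_eq_pair]
  have e := anti_st_anti_st (st p q Z a)
  rw [st_st] at e
  rw [antiPair_apply, e] at h
  have h' : starPair p W Z (st p q W X) a = pair p W Z (st p q W X) a := by rw [starPair_eq_pair]
  rw [← h', starPair_of_mem ha, st_st, bar, h]

theorem pair_isHopfStarPairing :
    IsHopfStarPairing (hopf p q W).cop (hopf p q Z) (pair p W Z) where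
  toIsPairing := pair_isPairing
  antipode := pair_antiEquiv_symm
  isHopfStar_fst := hopf_cop_isHopfStarAlgebroid
  isHopfStar_snd := hopf_isHopfStarAlgebroid
  star_compat := pair_st

end Ell

end EllipticU2

end

/-! ### The theorem -/

open EllipticU2 in
theorem mainTheorem4 (p q : ℝ) (hp0 : 0 < p) (hp1 : p < 1) (hq0 : 0 < q) (hq1 : q < 1)
    (hpq : ∀ m : ℕ, q ^ 2 ≠ p ^ m) (W Z : SpectralSet q)
    (hWZ : ∀ w ∈ W.carrier, ∀ z ∈ Z.carrier, ∀ k m : ℤ,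
      w ≠ (q : ℂ) ^ (2 * k) * (p : ℂ) ^ m * z) :
    ∃ (K : HopfStarData (Ell p q W)) (H : HopfStarData (Ell p q Z)),
      Ell.IsStandard p q W K ∧ Ell.IsStandard p q Z H ∧
      K.IsHopfStarAlgebroid ∧ H.IsHopfStarAlgebroid ∧
      ∃ P : Ell p q W →ₗ[ℂ] Ell p q Z →ₗ[ℂ] DiffOp,
        HasGeneratorValues p q W Z P ∧ IsHopfStarPairing K.cop H P ∧
        ∀ P' : Ell p q W →ₗ[ℂ] Ell p q Z →ₗ[ℂ] DiffOp,
          HasGeneratorValues p q W Z P' → IsPairing K.cop H P' → P' = P := by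
  have : GoodParams p q := ⟨hp0, hp1, hq0, hq1, hpq⟩
  have : Separated p W Z := ⟨hWZ⟩
  refine ⟨Ell.hopf p q W, Ell.hopf p q Z, Ell.hopf_isStandard, Ell.hopf_isStandard,
    Ell.hopf_isHopfStarAlgebroid, Ell.hopf_isHopfStarAlgebroid, Ell.pair p W Z,
    Ell.pair_hasGeneratorValues, Ell.pair_isHopfStarPairing, fun P' hv hP => ?_⟩
  -- Only the values on pairs of L's are compared; those involving det^{-1} are consequences.
  refine (Ell.isMulPairing_of_isPairing hP).unique Ell.pair_isMulPairing fun i j k l w z => ?_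
  rw [hv.L_L, Ell.pair_hasGeneratorValues.L_L]
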